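/- Let $p$ be an odd prime and let $\pi\in\mathbb{C}_p$ satisfy $\pi^{p-1}=-p$. **Functions.** Let $B$ be a parameter domain in finitely many parameters $\lambda=(\lambda_k)$ (possibly none, in which case $B$ is a point). It is given by a non-empty set $R$ of polyradii $\rho=(\rho_k)$ with all $\rho_k>0$ and by a set of parameters that are allowed non-negative exponents only. A series $\sum_{K,I} a_{K,I}\lambda^K z^I$ is overconvergent over $B$ if the exponents of the parameters in that set and of the $\mathbb{A}^1$-coordinates among the $z_i$ are non-negative (the exponents of the other parameters and of the $\mathbb{A}^\times$-coordinates being arbitrary integers), and if for every $\rho\in R$ there are $C$ and $0<r<1$ with $|a_{K,I}|\rho^K\le C\,r^{|K|+|I|}$ for all $K,I$. Here $|K|$, $|I|$ are the sums of the absolute values of the exponents. **Cohomology.** Forms are taken relative to the parameters and have overconvergent coefficients. $H^k((\mathbb{A}^\times)^2)$ is the cohomology of the forms in $u^{\pm1},v^{\pm1}$ with differential $d$. For a hypersurface $X=\{f=0\}$ in a product $Y$ of copies of $\mathbb{A}$ and $\mathbb{A}^\times$ with coordinates $z_i$, $H^k(X)$ is Dwork cohomology: the cohomology in degree $k+2$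 of the overconvergent forms in the $z_i$ and a further $\mathbb{A}^1$-coordinate $t$, with differential $\omega\mapsto d\omega+\pi\,d(tf)\wedge\omega$. A form $\eta$ on $Y$, or one with poles such that $df\wedge\eta$ has none, is represented in it by $\pi\,dt\wedge df\wedge\eta$. The Frobenius on forms on the torus is $g(\lambda,z)\,dz_{i_1}\cdots dz_{i_s}\mapsto g(\lambda^p,z^p)\,d(z_{i_1}^p)\cdots d(z_{i_s}^p)$. On $H^k(X)$, $Fr$ is induced by $\frac1p$ times the map $$g(\lambda,z,t)\,dz_{i_1}\cdots\,dt\mapsto e^{\pi(f(\lambda^p,z^p)t^p-f(\lambda,z)t)}\,g(\lambda^p,z^p,t^p)\,d(z_{i_1}^p)\cdots\,d(t^p)$$ (and likewise for forms without $dt$). The Gauss–Manin connection $\nabla_{\lambda_k}$ acts on coefficients as $\partial_{\lambda_k}$ for the torus and as $\partial_{\lambda_k}+\pi t\,\partial_{\lambda_k}f$ for $X$. **Statement.** Let $P=\sum_{K,I} a_{K,I}\lambda^K(u,v)^I$ be a Laurent polynomial over $\mathbb{C}_p$ in $\lambda,u,v$, with non-negative exponents in the parameters of which $B$ requires it, normalized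 so that $|a_{K,I}|\rho^K\le1$ for all $\rho\in R$ and all $K,I$. Let $C=\{P=0\}\subset(\mathbb{A}^\times)^2$ and $CY=\{xy+P(u,v)=0\}\subset\mathbb{A}^2\times(\mathbb{A}^\times)^2$. (Smoothness is not needed.) There is an exact sequence $$H^1((\mathbb{A}^\times)^2)\xrightarrow{i^*}H^1(C)\xrightarrow{\alpha}H^3(CY)\xrightarrow{\int}H^2((\mathbb{A}^\times)^2)\to0$$ of $\mathbb{C}_p$-linear maps such that: 1. $i^*$ is the restriction, $[\eta]\mapsto[\pi\,dt\wedge dP\wedge\eta]$; $\alpha$ is induced by $\omega\mapsto t\,dx\wedge dy\wedge\omega$; and $\int$ sends the class of $\frac{dx\,du\,dv}{x\,u\,v}$ to the class of $\frac{du\,dv}{u\,v}$. 2. Multiplication by any overconvergent function of the parameters is well defined on the four groups, and the three maps commute with it. 3. For each parameter $\lambda_k$, $\nabla_{\lambda_k}$ is well defined on the four groups, and the three maps commute with it. 4. Suppose that $(\rho_k^p)_k\in R$ for all $\rho\in R$, and that $|a_{K,I}^p-a_{K,I}|\,\rho^{pK}<1$ for all $\rho\in R$ and all $K,I$. Then the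 Frobenius maps are well defined on the four groups, and the three maps commute with $Fr$ on $H^3(CY)$ and $p\cdot Fr$ on the other three groups. -/

import Mathlib

namespace Dwork

noncomputable section

open scoped Classical

variable (p : ℕ) [Fact p.Prime] (κ : Type*) [Fintype κ] (n : ℕ)

/-! ### Exponents, Laurent polynomials, formal series

The variables are parameters `λ_k` (`k : κ`) and coordinates `z_i` (`i : Fin n`). -/

/-- Exponent vectors of Laurent monomials in the parameters and the coordinates. -/
abbrev Expo : Type _ := κ ⊕ Fin n → ℤ

/-- Laurent polynomials over `ℂ_p` in the parameters and the coordinates. -/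
abbrev Poly : Type _ := AddMonoidAlgebra ℂ_[p] (Expo κ n)

/-- Arbitrary families of coefficients `∑ a_I λ^{I_κ} z^{I_z}`, without any growth condition. -/
abbrev Series : Type _ := Expo κ n → ℂ_[p]

/-- Families of coefficients of differential forms relative to the parameters: `ω S` is the
coefficient of `dz_{i_1} ∧ … ∧ dz_{i_k}`, where `S = {i_1 < … < i_k}`. -/
abbrev Form : Type _ := Finset (Fin n) → Series p κ n

/-- A domain for the parameters, given by the polyradii it contains. Functions on it are the
series that converge in a neighbourhood of each polycircle `|λ_k| = ρ_k`, `ρ ∈ radii`, and in which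
the parameters in `nonneg` occur with nonnegative exponents only. For instance (one parameter):
the closed unit disc (`radii = {1}`, `nonneg = univ`), the annulus `|λ| = 1` (`radii = {1}`,
`nonneg = ∅`), or the punctured disc `0 < |λ| < ε` (`radii = (0, ε)`, `nonneg = ∅`). If `κ` is
empty there is no parameter and the domain is a point. -/
structure ParamDomain (κ : Type*) where
  nonneg : Set κ
  radii : Set (κ → ℝ)
  radii_nonempty : radii.Nonempty
  radii_pos : ∀ ρ ∈ radii, ∀ k, 0 < ρ k

variable {p κ n}

/-- The absolute value of the monomial with exponent `I` on the polycircle of radius `ρ` in the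
parameters and radius `1` in the coordinates. -/
def weight (ρ : κ → ℝ) (I : Expo κ n) : ℝ := ∏ k, ρ k ^ I (Sum.inl k)

lemma weight_pos {ρ : κ → ℝ} (hρ : ∀ k, 0 < ρ k) (I : Expo κ n) : 0 < weight ρ I :=
  Finset.prod_pos fun k _ => zpow_pos (hρ k) _

/-- The total size `|I|` of an exponent. -/
def size (I : Expo κ n) : ℕ := ∑ i, (I i).natAbs

variable (p) in
/-- The overconvergent functions on the product of the parameter domain `B` with the closed unit
polydisc in the coordinates `z_i`, `i ∈ A`, and the unit annuli `|z_i| = 1`, `i ∉ A`. -/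
def overconvergent (B : ParamDomain κ) (A : Set (Fin n)) : Submodule ℂ_[p] (Series p κ n) where
  carrier := {a | (∀ I, a I ≠ 0 → (∀ k ∈ B.nonneg, 0 ≤ I (Sum.inl k)) ∧
      ∀ i ∈ A, 0 ≤ I (Sum.inr i)) ∧
    ∀ ρ ∈ B.radii, ∃ C r : ℝ, 0 < r ∧ r < 1 ∧ ∀ I, ‖a I‖ * weight ρ I ≤ C * r ^ size I}
  zero_mem' := by
    refine ⟨fun I h => absurd rfl h, fun ρ _ => ⟨0, 1 / 2, by norm_num, by norm_num, ?_⟩⟩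
    intro I
    simp
  add_mem' := by
    rintro a b ⟨ha, ha'⟩ ⟨hb, hb'⟩
    refine ⟨fun I h => ?_, fun ρ hρ => ?_⟩
    · by_cases h0 : a I = 0
      · exact hb I fun h1 => h (by simp [h0, h1])
      · exact ha I h0
    · obtain ⟨C, r, hr, hr1, hC⟩ := ha' ρ hρ
      obtain ⟨C', r', hr', hr1', hC'⟩ := hb' ρ hρ
      refine ⟨|C| + |C'|, max r r', lt_max_of_lt_left hr, max_lt hr1 hr1', fun I => ?_⟩
      have hw := (weight_pos (B.radii_pos ρ hρ) I).le
      have h1 : C * r ^ size I ≤ |C| * max r r' ^ size I :=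
        mul_le_mul (le_abs_self C) (pow_le_pow_left₀ hr.le (le_max_left _ _) _) (by positivity)
          (abs_nonneg C)
      have h2 : C' * r' ^ size I ≤ |C'| * max r r' ^ size I :=
        mul_le_mul (le_abs_self C') (pow_le_pow_left₀ hr'.le (le_max_right _ _) _) (by positivity)
          (abs_nonneg C')
      have h3 : ‖(a + b) I‖ * weight ρ I ≤ (‖a I‖ + ‖b I‖) * weight ρ I :=
        mul_le_mul_of_nonneg_right (norm_add_le _ _) hw
      have h4 := hC I
      have h5 := hC' I
      calc _ ≤ _ := h3
        _ ≤ _ := by rw [add_mul, add_mul]; linarith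
  smul_mem' := by
    rintro c a ⟨ha, ha'⟩
    refine ⟨fun I h => ha I fun h0 => h (by simp [h0]), fun ρ hρ => ?_⟩
    obtain ⟨C, r, hr, hr1, hC⟩ := ha' ρ hρ
    refine ⟨‖c‖ * C, r, hr, hr1, fun I => ?_⟩
    have h := mul_le_mul_of_nonneg_left (hC I) (norm_nonneg c)
    calc ‖(c • a) I‖ * weight ρ I = ‖c‖ * (‖a I‖ * weight ρ I) := by
          simp [mul_assoc]
      _ ≤ ‖c‖ * (C * r ^ size I) := h
      _ = _ := by ring

/-! ### Operators on series and forms -/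

/-- The exponent of a single variable. -/
def unitExpo (i : κ ⊕ Fin n) : Expo κ n := Pi.single i 1

/-- The partial derivative of a Laurent polynomial. -/
def polyDeriv (i : κ ⊕ Fin n) (f : Poly p κ n) : Poly p κ n :=
  f.coeff.sum fun J c => AddMonoidAlgebra.single (J - unitExpo i) ((J i : ℂ_[p]) * c)

/-- Multiplication of series by a Laurent polynomial. -/
def mulPoly (f : Poly p κ n) : Series p κ n →ₗ[ℂ_[p]] Series p κ n :=
  f.coeff.sum fun J c => c • LinearMap.funLeft ℂ_[p] ℂ_[p] fun I => I - J

/-- The partial derivative of a series. -/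
def deriv (i : κ ⊕ Fin n) : Series p κ n →ₗ[ℂ_[p]] Series p κ n where
  toFun a I := ((I i : ℂ_[p]) + 1) * a (I + unitExpo i)
  map_add' a b := by ext I; simp [mul_add]
  map_smul' c a := by ext I; simp [mul_left_comm]

/-- The product of two series, of which one at least is overconvergent (or finite). -/
def mulSeries (a b : Series p κ n) : Series p κ n := fun I => ∑' J, a J * b (I - J)

/-- The exterior multiplication `ω ↦ dz_i ∧ ω`. -/
def wedge (i : Fin n) : Form p κ n →ₗ[ℂ_[p]] Form p κ n where
  toFun ω S := if i ∈ S then (-1 : ℂ_[p]) ^ (S.filter (· < i)).card • ω (S.erase i) else 0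
  map_add' ω η := by ext S I; by_cases h : i ∈ S <;> simp [h, mul_add]
  map_smul' c ω := by ext S I; by_cases h : i ∈ S <;> simp [h, mul_left_comm]

/-- `∂_i + ∂_i F`, that is, the action of `∂_i` on the `D`-module `e^F`. -/
def twistedDeriv (F : Poly p κ n) (i : κ ⊕ Fin n) : Series p κ n →ₗ[ℂ_[p]] Series p κ n :=
  deriv i + mulPoly (polyDeriv i F)

/-- The differential `ω ↦ dω + dF ∧ ω` of the de Rham complex, relative to the parameters, of the
`D`-module `e^F`. -/
def twistedD (F : Poly p κ n) : Form p κ n →ₗ[ℂ_[p]] Form p κ n :=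
  ∑ i, wedge i ∘ₗ (twistedDeriv F (Sum.inr i)).compLeft (Finset (Fin n))

/-- The exterior multiplication `ω ↦ df ∧ ω` with the relative differential of `f`. -/
def wedgeD (f : Poly p κ n) : Form p κ n →ₗ[ℂ_[p]] Form p κ n :=
  ∑ i, wedge i ∘ₗ (mulPoly (polyDeriv (Sum.inr i) f)).compLeft (Finset (Fin n))

/-- The Gauss–Manin connection along the parameter `λ_k` on forms with values in `e^F`: the operator
`∂_{λ_k} + ∂_{λ_k} F` on coefficients. -/
def gaussManin (F : Poly p κ n) (k : κ) : Form p κ n →ₗ[ℂ_[p]] Form p κ n :=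
  (twistedDeriv F (Sum.inl k)).compLeft (Finset (Fin n))

/-! ### Pullback along coordinate projections -/

/-- Regard an exponent in the first set of coordinates as one in the second. -/
def expoMap {m : ℕ} (e : Fin m ↪o Fin n) (J : Expo κ m) : Expo κ n :=
  Function.extend (Sum.map id e) J 0

/-- Pullback of Laurent polynomials. -/
def polyMap {m : ℕ} (e : Fin m ↪o Fin n) (f : Poly p κ m) : Poly p κ n :=
  AddMonoidAlgebra.mapDomain (expoMap e) f

/-- Pullback of series. -/
def seriesMap {m : ℕ} (e : Fin m ↪o Fin n) (a : Series p κ m) : Series p κ n :=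
  Function.extend (expoMap e) a 0

/-- Pullback of forms. -/
def formMap {m : ℕ} (e : Fin m ↪o Fin n) (ω : Form p κ m) : Form p κ n :=
  Function.extend (Finset.map e.toEmbedding) (fun S => seriesMap e (ω S)) 0

/-- Multiplication of forms by a function `b` of the parameters. -/
def mulParam (b : Series p κ 0) (ω : Form p κ n) : Form p κ n := fun S =>
  mulSeries (seriesMap (Fin.castLEOrderEmb (Nat.zero_le n)) b) (ω S)

/-! ### Cohomology -/

/-- The overconvergent forms. -/
def forms (B : ParamDomain κ) (A : Set (Fin n)) : Submodule ℂ_[p] (Form p κ n) :=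
  Submodule.pi Set.univ fun _ => overconvergent p B A

/-- Overconvergent `k`-forms closed under `d + dF ∧ ·`. -/
def cocycles (B : ParamDomain κ) (A : Set (Fin n)) (F : Poly p κ n) (k : ℕ) :
    Submodule ℂ_[p] (Form p κ n) :=
  forms B A ⊓ (⨅ S : {S : Finset (Fin n) // S.card ≠ k}, LinearMap.ker (LinearMap.proj S.1)) ⊓
    LinearMap.ker (twistedD F)

/-- The `k`-th relative de Rham cohomology of the overconvergent `D`-module `e^F`. -/
abbrev DeRham (B : ParamDomain κ) (A : Set (Fin n)) (F : Poly p κ n) (k : ℕ) : Type _ :=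
  cocycles B A F k ⧸ ((forms B A).map (twistedD F)).submoduleOf (cocycles B A F k)

/-- `ω` is a cocycle with cohomology class `c`. -/
def IsClass {B : ParamDomain κ} {A : Set (Fin n)} {F : Poly p κ n} {k : ℕ} (ω : Form p κ n)
    (c : DeRham B A F k) : Prop :=
  ∃ h : ω ∈ cocycles B A F k, Submodule.Quotient.mk ⟨ω, h⟩ = c

/-- The map `G` on cohomology is induced by the map `Φ` on forms: `Φ` sends cocycles to cocycles
and `G [ω] = [Φ ω]`. -/
def Induces {m : ℕ} {B : ParamDomain κ} {A : Set (Fin n)} {F : Poly p κ n} {k : ℕ}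
    {A' : Set (Fin m)} {F' : Poly p κ m} {k' : ℕ} (Φ : Form p κ n → Form p κ m)
    (G : DeRham B A F k →ₗ[ℂ_[p]] DeRham B A' F' k') : Prop :=
  ∀ ω c, IsClass ω c → IsClass (Φ ω) (G c)

/-! ### Dwork cohomology of a hypersurface

For the hypersurface `f = 0` in the space with coordinates `z_i`, the new variable `t` is
the coordinate `0` and `z_i` becomes the coordinate `i + 1`. -/

/-- The phase `π t f(z)`. -/
def phase (π : ℂ_[p]) (f : Poly p κ n) : Poly p κ (n + 1) :=
  AddMonoidAlgebra.single (unitExpo (Sum.inr 0)) π * polyMap (Fin.succOrderEmb n) f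

/-- The cohomology `H^k` of the hypersurface `f = 0`: the de Rham cohomology of the overconvergent
`D`-module `e^{π t f}`, with the degree shifted by two. -/
abbrev HypersurfaceCohomology (B : ParamDomain κ) (A : Set (Fin n)) (π : ℂ_[p]) (f : Poly p κ n)
    (k : ℕ) : Type _ :=
  DeRham B (insert 0 (Fin.succ '' A)) (phase π f) (k + 2)

/-- The Dwork representative `π dt ∧ df ∧ ω` of the restriction of `ω` to the hypersurface
`f = 0`. (It also makes sense when `ω` has poles, as long as `df ∧ ω` has none.) -/
def restrict (π : ℂ_[p]) (f : Poly p κ n) (ω : Form p κ n) : Form p κ (n + 1) :=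
  π • wedge 0 (wedgeD (polyMap (Fin.succOrderEmb n) f) (formMap (Fin.succOrderEmb n) ω))

/-! ### Frobenius -/

/-- The substitution `λ ↦ λ^p`, `z ↦ z^p` in Laurent polynomials. -/
def polyFrob (f : Poly p κ n) : Poly p κ n := AddMonoidAlgebra.mapDomain (fun J => p • J) f

/-- The substitution `λ ↦ λ^p`, `z ↦ z^p` in series. -/
def seriesFrob (a : Series p κ n) : Series p κ n := Function.extend (fun J => p • J) a 0

/-- The series `exp (F(λ^p, z^p) - F(λ, z))`, expanded as the sum over `i, j` of
`F(λ^p, z^p)^i (-F(λ, z))^j / (i! j!)`. In the cases of interest `F` is homogeneous of positive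
degree in one of the variables, or zero, and each coefficient is a finite sum. -/
def frobFactor (F : Poly p κ n) : Series p κ n := fun I =>
  ∑ᶠ ij : ℕ × ℕ, (polyFrob F ^ ij.1 * (-F) ^ ij.2).coeff I /
    ((ij.1.factorial : ℂ_[p]) * (ij.2.factorial : ℂ_[p]))

/-- The Frobenius map on forms with values in `e^F`: it sends `g(λ, z) dz_{i_1} ∧ … ∧ dz_{i_k}` to
`exp (F(λ^p, z^p) - F(λ, z)) g(λ^p, z^p) d(z_{i_1}^p) ∧ … ∧ d(z_{i_k}^p)`. -/
def frobenius (F : Poly p κ n) (ω : Form p κ n) : Form p κ n := fun S =>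
  mulSeries (frobFactor F) fun I =>
    (p : ℂ_[p]) ^ S.card *
      seriesFrob (ω S) (I - (p - 1) • ∑ i ∈ S, unitExpo (Sum.inr i))

/-- The Frobenius map on forms that represent the cohomology of the hypersurface `f = 0`, in the
usual normalization: the Frobenius map of `e^{π t f}` divided by `p`. -/
def hypersurfaceFrobenius (π : ℂ_[p]) (f : Poly p κ n) (ω : Form p κ (n + 1)) :
    Form p κ (n + 1) :=
  (p : ℂ_[p])⁻¹ • frobenius (phase π f) ω

/-! ### The torus, the curve and the threefold -/

/-- The form `z^a`, of degree zero. -/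
def monomialForm (a : Fin n → ℤ) : Form p κ n := Pi.single ∅ (Pi.single (Sum.elim 0 a) 1)

variable (p) in
/-- `H^k` of the torus with coordinates `u = z_0`, `v = z_1`. -/
abbrev TorusCohomology (B : ParamDomain κ) (k : ℕ) : Type _ :=
  DeRham B (∅ : Set (Fin 2)) (0 : Poly p κ 2) k

/-- `H^k` of the curve `P(u, v) = 0` in the torus. -/
abbrev CurveCohomology (B : ParamDomain κ) (π : ℂ_[p]) (P : Poly p κ 2) (k : ℕ) : Type _ :=
  HypersurfaceCohomology B ∅ π P k

/-- The Laurent polynomial `x y + P(u, v)`; the coordinates are `u, v, x, y`, in this order. -/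
def threefoldEq (P : Poly p κ 2) : Poly p κ 4 :=
  AddMonoidAlgebra.single (unitExpo (Sum.inr 2) + unitExpo (Sum.inr 3)) 1 +
    polyMap (Fin.castLEOrderEmb (by norm_num)) P

/-- `H^k` of the threefold `x y + P(u, v) = 0`; here `x`, `y` are affine coordinates. -/
abbrev ThreefoldCohomology (B : ParamDomain κ) (π : ℂ_[p]) (P : Poly p κ 2) (k : ℕ) : Type _ :=
  HypersurfaceCohomology B {2, 3} π (threefoldEq P) k

/-- The map `ω ↦ t dx ∧ dy ∧ ω` from forms in `t, u, v` to forms in `t, u, v, x, y`. -/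
def curveToThreefold (ω : Form p κ 3) : Form p κ 5 :=
  (mulPoly (AddMonoidAlgebra.single (unitExpo (Sum.inr 0)) 1)).compLeft (Finset (Fin 5))
    (wedge 3 (wedge 4 (formMap (Fin.castLEOrderEmb (by norm_num)) ω)))

/-- The form `du ∧ dv / (u v)`. -/
def torusForm : Form p κ 2 := wedge 0 (wedge 1 (monomialForm ![-1, -1]))

/-- The form `dx ∧ du ∧ dv / (x u v)`. -/
def threefoldForm : Form p κ 4 := wedge 2 (wedge 0 (wedge 1 (monomialForm ![-1, -1, -1, 0])))

/-- The operators `ΦT`, `ΦC`, `ΦX` on forms induce operators on `H^1` and `H^2` of the torus, on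
`H^1` of the curve and on `H^3` of the threefold, and the three maps commute with them. -/
def Commutes {B : ParamDomain κ} {π : ℂ_[p]} {P : Poly p κ 2}
    (iStar : TorusCohomology p B 1 →ₗ[ℂ_[p]] CurveCohomology B π P 1)
    (α : CurveCohomology B π P 1 →ₗ[ℂ_[p]] ThreefoldCohomology B π P 3)
    (integral : ThreefoldCohomology B π P 3 →ₗ[ℂ_[p]] TorusCohomology p B 2)
    (ΦT : Form p κ 2 → Form p κ 2) (ΦC : Form p κ 3 → Form p κ 3)
    (ΦX : Form p κ 5 → Form p κ 5) : Prop :=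
  ∃ (T₁ : TorusCohomology p B 1 →ₗ[ℂ_[p]] TorusCohomology p B 1)
    (C₁ : CurveCohomology B π P 1 →ₗ[ℂ_[p]] CurveCohomology B π P 1)
    (X₃ : ThreefoldCohomology B π P 3 →ₗ[ℂ_[p]] ThreefoldCohomology B π P 3)
    (T₂ : TorusCohomology p B 2 →ₗ[ℂ_[p]] TorusCohomology p B 2),
    Induces ΦT T₁ ∧ Induces ΦC C₁ ∧ Induces ΦX X₃ ∧ Induces ΦT T₂ ∧
      iStar ∘ₗ T₁ = C₁ ∘ₗ iStar ∧ α ∘ₗ C₁ = X₃ ∘ₗ α ∧ integral ∘ₗ X₃ = T₂ ∘ₗ integral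

end

end Dwork

/-! In top degree the cohomology is the cokernel of the commuting operators `D_i = ∂_i + ∂_i F` on
overconvergent functions (`mem_coboundaries_top`). Every group in the sequence except `H^1` of the
torus is of this kind, so nearly everything is a computation with functions. On the threefold, with
`F = π t (x y + P(u, v))`, the quotient by the fibre directions `D_t`, `D_x`, `D_y` is taken first.

Fibre computation. The operator `D_x x - D_y y` multiplies each coefficient by the difference of the
exponents of `x` and `y`, so all monomials off the diagonal are exact (`exists_offDiagonal`). The
operator `D_x x = x ∂_x + 1 + π t x y` removes the monomials divisible by `t x y` (`exists_radial`);
the series that inverts it converges because `l! / π ^ l` grows at most linearly. What remains is a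
`t`-free function of `u, v, x y` plus `t h(t, u, v)` (`exists_normalForm`). On `t`-free functions
`D_t` is multiplication by `π (x y + P)`. Since `P` has norm at most one on each polycircle while
the functions overconverge in `x y`, division with remainder by `x y + P` is possible
(`exists_division`) and leaves a function `r(u, v)`. Hence each function is `r + t h` modulo the
three images, with `r` unique and `h` unique modulo the operator `D_t` of the curve
(`exists_sub_mem_resKernel`, `eq_zero_of_mem_fibreExact`). The function `r` is the residue: relative
to the torus, the fibre cohomology of the threefold is an extension of the functions on the torus by
the fibre cohomology of the curve.

Exactness. The sequence is the long exact sequence of this extension for the remaining directions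
`u, v`. On the threefold `D_u r = ∂_u r + t π (∂_u P) r`, and similarly for `v`; so the connecting
map is `η ↦ π dt ∧ dP ∧ η`, which is the restriction to the curve (`exact_iStar_alpha`,
`exact_alpha_integral`). The integral is `-π⁻¹` times the residue.

Compatibilities. Modulo the image of `α`, the group `H^3` consists of classes of functions on the
torus, so operators need to be compared only on these and on the sources of the two other maps
(`commutes_of`). Functions of the parameters commute on the nose; for the Gauss–Manin connection,
restriction commutes up to an explicit exact form.

For Frobenius, the factor `exp (F(λ^p, z^p) - F(λ, z))` is a product over the monomials `c S` of `t
f` of series `exp (π c (S^p - S))`. These overconverge by the theorem of Dwork on `exp (π (X^p -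
X))`, deduced here from the integrality of the Artin–Hasse exponential
(`exists_norm_coeff_dwork_le`, `norm_coeff_artinHasse_le_one`). On the threefold the factor is `θ(t
x y) Θ`, where `θ(X) = exp (π (X^p - X))` and `Θ` is the factor of the curve. Along the fibre, `p (t
x y)^(p-1) θ(t x y)` differs from `1` by an element of the image of `D_x` (`mon_fibreSeries_sub`),
which explains the factor `p` between the Frobenius maps. Finally `Θ = 1 + t Ω`, and `Ω` yields the
homotopy for the restriction map (`curveBracket_sub_frobenius`) and shows that the residue is
respected. -/

namespace Dwork
noncomputable section
open scoped Classical
set_option linter.unusedSectionVars false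
variable {p : ℕ} [Fact p.Prime] {κ : Type*} [Fintype κ] {n : ℕ}
open Filter Topology

/-! ### Laurent polynomials acting on series -/

@[simp] lemma unitExpo_same (i : κ ⊕ Fin n) : unitExpo i i = 1 := by simp [unitExpo]

lemma unitExpo_ne {i j : κ ⊕ Fin n} (h : j ≠ i) : unitExpo i j = 0 := by simp [unitExpo, h]

lemma mulPoly_apply (f : Poly p κ n) (a : Series p κ n) (I : Expo κ n) :
    mulPoly f a I = f.coeff.sum fun J c => c * a (I - J) := by
  simp [mulPoly, Finsupp.sum, LinearMap.sum_apply, Finset.sum_apply, LinearMap.funLeft_apply]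

@[simp] lemma mulPoly_zero : mulPoly (0 : Poly p κ n) = 0 := by simp [mulPoly]

lemma mulPoly_add (f g : Poly p κ n) : mulPoly (f + g) = mulPoly f + mulPoly g := by
  unfold mulPoly
  rw [AddMonoidAlgebra.coeff_add, Finsupp.sum_add_index']
  · simp
  · intro J b c; rw [add_smul]

lemma mulPoly_single (J : Expo κ n) (c : ℂ_[p]) :
    mulPoly (AddMonoidAlgebra.single J c) = c • LinearMap.funLeft ℂ_[p] ℂ_[p] fun I => I - J := by
  simp [mulPoly]

lemma mulPoly_single_apply (J : Expo κ n) (c : ℂ_[p]) (a : Series p κ n) (I : Expo κ n) :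
    mulPoly (AddMonoidAlgebra.single J c) a I = c * a (I - J) := by
  simp [mulPoly_single, LinearMap.funLeft_apply]

lemma mulPoly_mul (f g : Poly p κ n) : mulPoly (f * g) = mulPoly f ∘ₗ mulPoly g := by
  induction f using AddMonoidAlgebra.induction_linear with
  | zero => simp
  | add f f' hf hf' => rw [add_mul, mulPoly_add, hf, hf', mulPoly_add, LinearMap.add_comp]
  | single J c =>
    induction g using AddMonoidAlgebra.induction_linear with
    | zero => simp
    | add g g' hg hg' => rw [mul_add, mulPoly_add, hg, hg', mulPoly_add, LinearMap.comp_add]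
    | single K d =>
      rw [AddMonoidAlgebra.single_mul_single]
      ext a I
      simp [mulPoly_single_apply, mul_assoc, sub_sub]

lemma mulPoly_mul_apply (f g : Poly p κ n) (a : Series p κ n) :
    mulPoly (f * g) a = mulPoly f (mulPoly g a) := by rw [mulPoly_mul]; rfl

lemma mulPoly_comm (f g : Poly p κ n) (a : Series p κ n) :
    mulPoly f (mulPoly g a) = mulPoly g (mulPoly f a) := by
  rw [← mulPoly_mul_apply, mul_comm, mulPoly_mul_apply]

lemma mulPoly_smul (c : ℂ_[p]) (f : Poly p κ n) : mulPoly (c • f) = c • mulPoly f := by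
  induction f using AddMonoidAlgebra.induction_linear with
  | zero => simp
  | add f f' hf hf' => rw [smul_add, mulPoly_add, hf, hf', mulPoly_add, smul_add]
  | single J d => rw [AddMonoidAlgebra.smul_single, mulPoly_single, mulPoly_single, smul_eq_mul,
      mul_smul]

lemma mulPoly_neg (f : Poly p κ n) : mulPoly (-f) = -mulPoly f := by
  rw [eq_neg_iff_add_eq_zero, ← mulPoly_add, neg_add_cancel, mulPoly_zero]

lemma mulPoly_single_injective (J : Expo κ n) {c : ℂ_[p]} (hc : c ≠ 0) :
    Function.Injective (mulPoly (AddMonoidAlgebra.single J c)) := by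
  intro a b h
  ext I
  have := congrFun h (I + J)
  simpa [mulPoly_single_apply, hc] using this

/-- Multiplication by the monomial with exponent `J`. -/
abbrev mon (J : Expo κ n) : Series p κ n →ₗ[ℂ_[p]] Series p κ n :=
  mulPoly (AddMonoidAlgebra.single J 1)

lemma mon_apply (J : Expo κ n) (a : Series p κ n) (I : Expo κ n) : mon J a I = a (I - J) := by
  rw [mulPoly_single_apply, one_mul]

lemma mon_injective (J : Expo κ n) : Function.Injective (mon (p := p) J) :=
  mulPoly_single_injective J one_ne_zero

lemma mon_mon (J K : Expo κ n) (a : Series p κ n) : mon J (mon K a) = mon (J + K) a := by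
  ext I; simp only [mon_apply]; rw [sub_sub]

/-! ### Derivations -/

lemma deriv_apply (i : κ ⊕ Fin n) (a : Series p κ n) (I : Expo κ n) :
    deriv i a I = ((I i : ℂ_[p]) + 1) * a (I + unitExpo i) := rfl

@[simp] lemma polyDeriv_zero (i : κ ⊕ Fin n) : polyDeriv i (0 : Poly p κ n) = 0 := by
  simp [polyDeriv]

lemma polyDeriv_add (i : κ ⊕ Fin n) (f g : Poly p κ n) :
    polyDeriv i (f + g) = polyDeriv i f + polyDeriv i g := by
  unfold polyDeriv
  rw [AddMonoidAlgebra.coeff_add, Finsupp.sum_add_index']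
  · simp
  · intro J b c; rw [mul_add, AddMonoidAlgebra.single_add]

lemma polyDeriv_single (i : κ ⊕ Fin n) (J : Expo κ n) (c : ℂ_[p]) :
    polyDeriv i (AddMonoidAlgebra.single J c) =
      AddMonoidAlgebra.single (J - unitExpo i) ((J i : ℂ_[p]) * c) := by
  simp [polyDeriv]

lemma polyDeriv_mul (i : κ ⊕ Fin n) (f g : Poly p κ n) :
    polyDeriv i (f * g) = polyDeriv i f * g + f * polyDeriv i g := by
  induction f using AddMonoidAlgebra.induction_linear with
  | zero => simp
  | add f f' hf hf' => rw [add_mul, polyDeriv_add, hf, hf', polyDeriv_add]; ring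
  | single J c =>
    induction g using AddMonoidAlgebra.induction_linear with
    | zero => simp
    | add g g' hg hg' => rw [mul_add, polyDeriv_add, hg, hg', polyDeriv_add]; ring
    | single K d =>
      simp only [AddMonoidAlgebra.single_mul_single, polyDeriv_single]
      rw [show J - unitExpo i + K = J + K - unitExpo i by abel,
        show J + (K - unitExpo i) = J + K - unitExpo i by abel, ← AddMonoidAlgebra.single_add]
      congr 1
      push_cast [Pi.add_apply]; ring

lemma polyDeriv_comm (i j : κ ⊕ Fin n) (f : Poly p κ n) :
    polyDeriv i (polyDeriv j f) = polyDeriv j (polyDeriv i f) := by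
  induction f using AddMonoidAlgebra.induction_linear with
  | zero => simp
  | add f f' hf hf' => simp only [polyDeriv_add, hf, hf']
  | single J c =>
    simp only [polyDeriv_single]
    rw [sub_right_comm]
    congr 1
    by_cases h : i = j
    · subst h; rfl
    · simp [unitExpo_ne h, unitExpo_ne (Ne.symm h)]; ring

lemma deriv_comm (i j : κ ⊕ Fin n) (a : Series p κ n) :
    deriv i (deriv j a) = deriv j (deriv i a) := by
  ext I
  simp only [deriv_apply]
  rw [add_right_comm]
  by_cases h : i = j
  · subst h; rfl
  · simp [unitExpo_ne h, unitExpo_ne (Ne.symm h)]; ring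

lemma deriv_mulPoly (i : κ ⊕ Fin n) (f : Poly p κ n) (a : Series p κ n) :
    deriv i (mulPoly f a) = mulPoly f (deriv i a) + mulPoly (polyDeriv i f) a := by
  induction f using AddMonoidAlgebra.induction_linear with
  | zero => simp
  | add f f' hf hf' =>
    simp only [mulPoly_add, LinearMap.add_apply, map_add, hf, hf', polyDeriv_add]; abel
  | single J c =>
    ext I
    simp only [polyDeriv_single, deriv_apply, mulPoly_single_apply, Pi.add_apply]
    rw [show I - (J - unitExpo i) = I + unitExpo i - J by abel,
      show I - J + unitExpo i = I + unitExpo i - J by abel]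
    push_cast [Pi.sub_apply]; ring

lemma twistedDeriv_apply (F : Poly p κ n) (i : κ ⊕ Fin n) (a : Series p κ n) :
    twistedDeriv F i a = deriv i a + mulPoly (polyDeriv i F) a := rfl

lemma twistedDeriv_mulPoly (F : Poly p κ n) (i : κ ⊕ Fin n) (f : Poly p κ n) (a : Series p κ n) :
    twistedDeriv F i (mulPoly f a) =
      mulPoly f (twistedDeriv F i a) + mulPoly (polyDeriv i f) a := by
  simp only [twistedDeriv_apply, deriv_mulPoly, map_add, mulPoly_comm f (polyDeriv i F)]; abel

/-- These operators are the conjugates of partial derivatives by `e^F`, hence commute. This allows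
reductions modulo the image of one operator to be carried through another, and makes the Gauss–Manin
connection compatible with the differential. -/
lemma twistedDeriv_comm (F : Poly p κ n) (i j : κ ⊕ Fin n) (a : Series p κ n) :
    twistedDeriv F i (twistedDeriv F j a) = twistedDeriv F j (twistedDeriv F i a) := by
  simp only [twistedDeriv_apply, map_add, deriv_mulPoly, deriv_comm i j,
    polyDeriv_comm i j F, mulPoly_comm (polyDeriv i F) (polyDeriv j F)]
  abel

lemma twistedDeriv_zero (i : κ ⊕ Fin n) (a : Series p κ n) :
    twistedDeriv (0 : Poly p κ n) i a = deriv i a := by simp [twistedDeriv_apply]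

/-! ### Exterior algebra -/

lemma wedge_apply (i : Fin n) (ω : Form p κ n) (S : Finset (Fin n)) :
    wedge i ω S = if i ∈ S then (-1 : ℂ_[p]) ^ (S.filter (· < i)).card • ω (S.erase i) else 0 := rfl

/-- The form `ω` has components in degree `k` only. -/
def HasDegree (k : ℕ) (ω : Form p κ n) : Prop := ∀ S, S.card ≠ k → ω S = 0

lemma HasDegree.wedge {k : ℕ} {ω : Form p κ n} (h : HasDegree k ω) (i : Fin n) :
    HasDegree (k + 1) (wedge i ω) := by
  intro S hS
  rw [wedge_apply]
  split_ifs with hi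
  · rw [h, smul_zero]
    have := Finset.card_erase_add_one hi
    omega
  · rfl

lemma HasDegree.sum {ι : Type*} {s : Finset ι} {k : ℕ} {ω : ι → Form p κ n}
    (h : ∀ i ∈ s, HasDegree k (ω i)) : HasDegree k (∑ i ∈ s, ω i) := by
  intro S hS
  rw [Finset.sum_apply]
  exact Finset.sum_eq_zero fun i hi => h i hi S hS

lemma HasDegree.smul {k : ℕ} {ω : Form p κ n} (h : HasDegree k ω) (c : ℂ_[p]) :
    HasDegree k (c • ω) := fun S hS => by rw [Pi.smul_apply, h S hS, smul_zero]

lemma HasDegree.compLeft {k : ℕ} {ω : Form p κ n} (h : HasDegree k ω)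
    (T : Series p κ n →ₗ[ℂ_[p]] Series p κ n) : HasDegree k (T.compLeft _ ω) := fun S hS => by
  rw [LinearMap.compLeft_apply, Function.comp_apply, h S hS, map_zero]

lemma wedgeD_eq (f : Poly p κ n) (ω : Form p κ n) : wedgeD f ω =
    ∑ i, wedge i ((mulPoly (polyDeriv (Sum.inr i) f)).compLeft (Finset (Fin n)) ω) := by
  simp [wedgeD]

lemma twistedD_eq (F : Poly p κ n) (ω : Form p κ n) : twistedD F ω =
    ∑ i, wedge i ((twistedDeriv F (Sum.inr i)).compLeft (Finset (Fin n)) ω) := by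
  simp [twistedD]

lemma HasDegree.wedgeD {k : ℕ} {ω : Form p κ n} (h : HasDegree k ω) (f : Poly p κ n) :
    HasDegree (k + 1) (wedgeD f ω) := by
  rw [wedgeD_eq]; exact HasDegree.sum fun i _ => (h.compLeft _).wedge i

lemma HasDegree.twistedD {k : ℕ} {ω : Form p κ n} (h : HasDegree k ω) (f : Poly p κ n) :
    HasDegree (k + 1) (twistedD f ω) := by
  rw [twistedD_eq]; exact HasDegree.sum fun i _ => (h.compLeft _).wedge i

lemma twistedD_apply (F : Poly p κ n) (ω : Form p κ n) (S : Finset (Fin n)) :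
    twistedD F ω S = ∑ i, if i ∈ S then (-1 : ℂ_[p]) ^ (S.filter (· < i)).card •
      twistedDeriv F (Sum.inr i) (ω (S.erase i)) else 0 := by
  rw [twistedD_eq, Finset.sum_apply]
  rfl

lemma wedgeD_apply (f : Poly p κ n) (ω : Form p κ n) (S : Finset (Fin n)) :
    wedgeD f ω S = ∑ i, if i ∈ S then (-1 : ℂ_[p]) ^ (S.filter (· < i)).card •
      mulPoly (polyDeriv (Sum.inr i) f) (ω (S.erase i)) else 0 := by
  rw [wedgeD_eq, Finset.sum_apply]
  rfl

lemma HasDegree.eq_zero {k : ℕ} {ω : Form p κ n} (h : HasDegree k ω) (hk : n < k) : ω = 0 := by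
  ext1 S
  apply h
  have := Finset.card_le_univ S
  rw [Fintype.card_fin] at this
  omega

/-- Forms of top degree are determined by their last component. -/
lemma HasDegree.ext_top {ω η : Form p κ n} (h : HasDegree n ω) (h' : HasDegree n η)
    (hu : ω Finset.univ = η Finset.univ) : ω = η := by
  ext1 S
  by_cases hS : S.card = n
  · have : S = Finset.univ := by
      rw [← Finset.card_eq_iff_eq_univ, hS, Fintype.card_fin]
    rw [this, hu]
  · rw [h S hS, h' S hS]

lemma mem_cocycles {B : ParamDomain κ} {A : Set (Fin n)} {F : Poly p κ n} {k : ℕ}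
    {ω : Form p κ n} : ω ∈ cocycles B A F k ↔
      (∀ S, ω S ∈ overconvergent p B A) ∧ HasDegree k ω ∧ twistedD F ω = 0 := by
  simp [cocycles, forms, HasDegree, Submodule.mem_pi, and_assoc]

lemma mem_forms {B : ParamDomain κ} {A : Set (Fin n)} {ω : Form p κ n} :
    ω ∈ forms B A ↔ ∀ S, ω S ∈ overconvergent p B A := by
  simp [forms, Submodule.mem_pi]

/-! ### Sizes and weights of exponents -/

lemma natAbs_le_size (I : Expo κ n) (i : κ ⊕ Fin n) : (I i).natAbs ≤ size I :=
  Finset.single_le_sum (f := fun i => (I i).natAbs) (fun _ _ => Nat.zero_le _) (Finset.mem_univ i)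

lemma size_add_le (I J : Expo κ n) : size (I + J) ≤ size I + size J := by
  unfold size
  rw [← Finset.sum_add_distrib]
  exact Finset.sum_le_sum fun i _ => Int.natAbs_add_le _ _

lemma size_le_sub_add (I J : Expo κ n) : size I ≤ size (I - J) + size J := by
  simpa using size_add_le (I - J) J

lemma size_nsmul (m : ℕ) (I : Expo κ n) : size (m • I) = m * size I := by
  simp only [size, Finset.mul_sum, Pi.smul_apply, nsmul_eq_mul, Int.natAbs_mul, Int.natAbs_natCast]

@[simp] lemma size_zero : size (0 : Expo κ n) = 0 := by simp [size]

lemma weight_add {ρ : κ → ℝ} (hρ : ∀ k, 0 < ρ k) (I J : Expo κ n) :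
    weight ρ (I + J) = weight ρ I * weight ρ J := by
  unfold weight
  rw [← Finset.prod_mul_distrib]
  exact Finset.prod_congr rfl fun k _ => zpow_add₀ (hρ k).ne' _ _

@[simp] lemma weight_zero (ρ : κ → ℝ) : weight ρ (0 : Expo κ n) = 1 := by simp [weight]

lemma weight_sub_mul {ρ : κ → ℝ} (hρ : ∀ k, 0 < ρ k) (I J : Expo κ n) :
    weight ρ (I - J) * weight ρ J = weight ρ I := by
  rw [← weight_add hρ, sub_add_cancel]

lemma weight_nsmul {ρ : κ → ℝ} (hρ : ∀ k, 0 < ρ k) (m : ℕ) (I : Expo κ n) :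
    weight ρ (m • I) = weight ρ I ^ m := by
  induction m with
  | zero => simp
  | succ m ih => rw [succ_nsmul, weight_add hρ, ih, pow_succ]

lemma weight_nsmul' (ρ : κ → ℝ) (m : ℕ) (I : Expo κ n) :
    weight ρ (m • I) = weight (fun k => ρ k ^ m) I := by
  unfold weight
  refine Finset.prod_congr rfl fun k _ => ?_
  rw [Pi.smul_apply, nsmul_eq_mul, zpow_mul, zpow_natCast]

lemma tendsto_size : Tendsto (size (κ := κ) (n := n)) cofinite atTop := by
  rw [tendsto_atTop]
  intro b
  rw [eventually_cofinite]
  refine (Set.finite_Icc (fun _ => -(b : ℤ)) (fun _ => (b : ℤ))).subset fun I hI => ?_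
  rw [Set.mem_ofPred_eq, not_le] at hI
  constructor <;> intro i <;> have := natAbs_le_size I i <;> simp only <;> omega

/-! ### Decay -/

/-- Over a complete nonarchimedean field, tending to zero along the cofinite filter already implies
summability. -/
lemma summable_of_le_pow {ι : Type*} {f : ι → ℂ_[p]} {s : ι → ℕ} (hs : Tendsto s cofinite atTop)
    {C r : ℝ} (hr : 0 < r) (hr1 : r < 1) (h : ∀ i, ‖f i‖ ≤ C * r ^ s i) : Summable f := by
  have : NonarchimedeanAddGroup ℂ_[p] := IsUltrametricDist.nonarchimedeanAddGroup
  apply NonarchimedeanAddGroup.summable_of_tendsto_cofinite_zero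
  apply squeeze_zero_norm h
  simpa using ((tendsto_pow_atTop_nhds_zero_of_lt_one hr.le hr1).comp hs).const_mul C

lemma norm_int_le_one (m : ℤ) : ‖(m : ℂ_[p])‖ ≤ 1 := IsUltrametricDist.norm_intCast_le_one _ m

/-- The coefficients decay exponentially on the polycircle of radius `ρ`. -/
def Decays (ρ : κ → ℝ) (a : Series p κ n) : Prop :=
  ∃ C r : ℝ, 0 < r ∧ r < 1 ∧ ∀ I, ‖a I‖ * weight ρ I ≤ C * r ^ size I

/-- The exponents of the parameters in `B.nonneg` and of the coordinates in `A` are nonnegative. -/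
def Admissible (B : ParamDomain κ) (A : Set (Fin n)) (I : Expo κ n) : Prop :=
  (∀ k ∈ B.nonneg, 0 ≤ I (Sum.inl k)) ∧ ∀ i ∈ A, 0 ≤ I (Sum.inr i)

lemma decays_of_mem {B : ParamDomain κ} {A : Set (Fin n)} {a : Series p κ n}
    (ha : a ∈ overconvergent p B A) {ρ : κ → ℝ} (hρ : ρ ∈ B.radii) : Decays ρ a := ha.2 ρ hρ

lemma admissible_of_mem {B : ParamDomain κ} {A : Set (Fin n)} {a : Series p κ n}
    (ha : a ∈ overconvergent p B A) {I : Expo κ n} (hI : a I ≠ 0) : Admissible B A I := ha.1 I hI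

lemma Admissible.add {B : ParamDomain κ} {A : Set (Fin n)} {I J : Expo κ n}
    (hI : Admissible B A I) (hJ : Admissible B A J) : Admissible B A (I + J) :=
  ⟨fun k hk => add_nonneg (hI.1 k hk) (hJ.1 k hk), fun i hi => add_nonneg (hI.2 i hi) (hJ.2 i hi)⟩

lemma Admissible.nsmul {B : ParamDomain κ} {A : Set (Fin n)} {I : Expo κ n}
    (hI : Admissible B A I) (m : ℕ) : Admissible B A (m • I) :=
  ⟨fun k hk => nsmul_nonneg (hI.1 k hk) m, fun i hi => nsmul_nonneg (hI.2 i hi) m⟩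

lemma Decays.nonneg {ρ : κ → ℝ} (hρ : ∀ k, 0 < ρ k) {a : Series p κ n} {C r : ℝ}
    (h : ∀ I, ‖a I‖ * weight ρ I ≤ C * r ^ size I) : 0 ≤ C := by
  have h0 := h 0
  have : 0 ≤ ‖a 0‖ * weight ρ (0 : Expo κ n) := mul_nonneg (norm_nonneg _) (weight_pos hρ _).le
  simp only [size_zero, pow_zero, mul_one] at h0
  linarith

/-- Linear factors are absorbed by an exponential decay. -/
lemma exists_succ_mul_pow_le {r : ℝ} (hr : 0 < r) (hr1 : r < 1) :
    ∃ K q : ℝ, 0 < q ∧ q < 1 ∧ 0 ≤ K ∧ ∀ s : ℕ, ((s : ℝ) + 1) * r ^ s ≤ K * q ^ s := by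
  have hq : 0 < √r := Real.sqrt_pos.2 hr
  have hq1 : √r < 1 := by rw [Real.sqrt_lt' one_pos]; simpa using hr1
  have h1 : Tendsto (fun s : ℕ => (s : ℝ) * √r ^ s + √r ^ s) atTop (𝓝 (0 + 0)) :=
    (tendsto_self_mul_const_pow_of_lt_one hq.le hq1).add
      (tendsto_pow_atTop_nhds_zero_of_lt_one hq.le hq1)
  obtain ⟨K, hK⟩ := h1.bddAbove_range
  refine ⟨K, √r, hq, hq1, ?_, fun s => ?_⟩
  · have := hK (Set.mem_range_self 0)
    simp at this; linarith
  · have := hK (Set.mem_range_self s)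
    have h2 : r ^ s = √r ^ s * √r ^ s := by rw [← mul_pow, Real.mul_self_sqrt hr.le]
    rw [h2]
    nlinarith [pow_pos hq s]

/-- A comparison criterion for exponential decay. -/
lemma Decays.of_le {m : ℕ} {ρ ρ' : κ → ℝ} (hρ' : ∀ k, 0 < ρ' k) {a : Series p κ m}
    (ha : Decays ρ' a) {b : Series p κ n} (C : ℝ) (N : ℕ)
    (h : ∀ I, b I ≠ 0 → ∃ J, ‖b I‖ * weight ρ I ≤ C * (size J + 1) * (‖a J‖ * weight ρ' J) ∧
      size I ≤ N * (size J + 1)) : Decays ρ b := by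
  obtain ⟨C₀, r₀, hr, hr1, h0⟩ := ha
  have hC₀ := Decays.nonneg hρ' h0
  obtain ⟨K, q, hq, hq1, hK0, hK⟩ := exists_succ_mul_pow_le hr hr1
  -- The rate `q` has absorbed the linear factor. Its `(N + 1)`-st root turns decay in `size J` into
  -- decay in `size I`, because `size I ≤ (N + 1) (size J + 1)`; the `+ 1` costs the constant factor
  -- `1 / q`.
  set s : ℝ := q ^ (1 / ((N : ℝ) + 1)) with hs
  have hs0 : 0 < s := Real.rpow_pos_of_pos hq _
  have hs1 : s < 1 := Real.rpow_lt_one hq.le hq1 (by positivity)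
  have hsq : s ^ (N + 1) = q := by
    rw [hs, ← Real.rpow_natCast, ← Real.rpow_mul hq.le]
    push_cast
    rw [one_div_mul_cancel (by positivity), Real.rpow_one]
  refine ⟨|C| * (C₀ * K) / q, s, hs0, hs1, fun I => ?_⟩
  by_cases hb : b I = 0
  · rw [hb, norm_zero, zero_mul]; positivity
  obtain ⟨J, hJ, hJ'⟩ := h I hb
  have h1 : q ^ (size J + 1) ≤ s ^ size I := by
    rw [← hsq, ← pow_mul]
    apply pow_le_pow_of_le_one hs0.le hs1.le
    nlinarith
  calc ‖b I‖ * weight ρ I ≤ C * (size J + 1) * (‖a J‖ * weight ρ' J) := hJ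
    _ ≤ |C| * (size J + 1) * (C₀ * r₀ ^ size J) :=
        mul_le_mul (mul_le_mul_of_nonneg_right (le_abs_self C) (by positivity)) (h0 J)
          (mul_nonneg (norm_nonneg _) (weight_pos hρ' _).le) (by positivity)
    _ = |C| * C₀ * (((size J : ℝ) + 1) * r₀ ^ size J) := by ring
    _ ≤ |C| * C₀ * (K * q ^ size J) :=
        mul_le_mul_of_nonneg_left (hK _) (by positivity)
    _ = |C| * (C₀ * K) / q * q ^ (size J + 1) := by rw [pow_succ]; field_simp
    _ ≤ _ := by gcongr

/-- A comparison criterion for overconvergence. -/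
lemma overconvergent_of_le {m : ℕ} {B : ParamDomain κ} {A : Set (Fin m)} {A' : Set (Fin n)}
    {a : Series p κ m} (ha : a ∈ overconvergent p B A) {b : Series p κ n}
    (hb : ∀ I, b I ≠ 0 → Admissible B A' I)
    (h : ∀ ρ ∈ B.radii, ∃ ρ' ∈ B.radii, ∃ (C : ℝ) (N : ℕ), ∀ I, b I ≠ 0 → ∃ J,
      ‖b I‖ * weight ρ I ≤ C * (size J + 1) * (‖a J‖ * weight ρ' J) ∧
      size I ≤ N * (size J + 1)) : b ∈ overconvergent p B A' := by
  refine ⟨hb, fun ρ hρ => ?_⟩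
  obtain ⟨ρ', hρ', C, N, h'⟩ := h ρ hρ
  exact Decays.of_le (B.radii_pos ρ' hρ') (ha.2 ρ' hρ') C N h'

/-- The special case where each coefficient is bounded by a translated one. -/
lemma Decays.of_translate {ρ : κ → ℝ} (hρ : ∀ k, 0 < ρ k) {a b : Series p κ n} (ha : Decays ρ a)
    (K : Expo κ n) (C : ℝ) (h : ∀ I, ‖b I‖ ≤ C * (size I + 1) * ‖a (I - K)‖) : Decays ρ b := by
  refine Decays.of_le hρ ha (|C| * (size K + 1) * weight ρ K) (size K + 1) fun I _ =>
    ⟨I - K, ?_, ?_⟩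
  · have hw := weight_pos hρ (I - K)
    have h1 : (size I : ℝ) + 1 ≤ ((size K : ℝ) + 1) * (size (I - K) + 1) := by
      have : (size I : ℝ) ≤ size (I - K) + size K := by exact_mod_cast size_le_sub_add I K
      nlinarith [(size K).cast_nonneg (α := ℝ), (size (I - K)).cast_nonneg (α := ℝ),
        mul_nonneg ((size K).cast_nonneg (α := ℝ)) ((size (I - K)).cast_nonneg (α := ℝ))]
    calc ‖b I‖ * weight ρ I ≤ |C| * (size I + 1) * ‖a (I - K)‖ * weight ρ I := by
          gcongr
          · exact (weight_pos hρ I).le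
          · exact (h I).trans (by gcongr; exact le_abs_self C)
      _ ≤ |C| * (((size K : ℝ) + 1) * (size (I - K) + 1)) * ‖a (I - K)‖ * weight ρ I := by
          gcongr; exact (weight_pos hρ I).le
      _ = _ := by rw [← weight_sub_mul hρ I K]; ring
  · have := size_le_sub_add I K
    nlinarith

lemma overconvergent_of_translate {B : ParamDomain κ} {A A' : Set (Fin n)} {a b : Series p κ n}
    (ha : a ∈ overconvergent p B A) (K : Expo κ n) (C : ℝ)
    (hb : ∀ I, b I ≠ 0 → Admissible B A' I)
    (h : ∀ I, ‖b I‖ ≤ C * (size I + 1) * ‖a (I - K)‖) : b ∈ overconvergent p B A' :=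
  ⟨hb, fun ρ hρ => Decays.of_translate (B.radii_pos ρ hρ) (ha.2 ρ hρ) K C h⟩

lemma overconvergent_of_norm_le {B : ParamDomain κ} {A A' : Set (Fin n)} {a b : Series p κ n}
    (ha : a ∈ overconvergent p B A) (hb : ∀ I, b I ≠ 0 → Admissible B A' I)
    (h : ∀ I, ‖b I‖ ≤ ‖a I‖) : b ∈ overconvergent p B A' := by
  refine overconvergent_of_translate ha 0 1 hb fun I => ?_
  rw [sub_zero]
  refine (h I).trans (le_mul_of_one_le_left (norm_nonneg _) ?_)
  have : (0 : ℝ) ≤ size I := Nat.cast_nonneg _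
  linarith

/-- The polycircle of radius `ρ`. -/
def ParamDomain.polycircle (ρ : κ → ℝ) (hρ : ∀ k, 0 < ρ k) : ParamDomain κ where
  nonneg := ∅
  radii := {ρ}
  radii_nonempty := ⟨ρ, rfl⟩
  radii_pos := fun _ h k => (Set.mem_singleton_iff.1 h) ▸ hρ k

/-- Decay at a single radius becomes an instance of overconvergence, so that closure under addition
is inherited from the submodule. -/
lemma decays_iff_mem {ρ : κ → ℝ} (hρ : ∀ k, 0 < ρ k) (a : Series p κ n) :
    Decays ρ a ↔ a ∈ overconvergent p (ParamDomain.polycircle ρ hρ) ∅ := by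
  refine ⟨fun h => ⟨fun I _ => ⟨fun k hk => absurd hk (Set.notMem_empty k),
    fun i hi => absurd hi (Set.notMem_empty i)⟩, ?_⟩, fun h => h.2 ρ rfl⟩
  intro ρ' h'
  rw [Set.mem_singleton_iff.1 h']
  exact h

lemma Decays.add {ρ : κ → ℝ} (hρ : ∀ k, 0 < ρ k) {a b : Series p κ n} (ha : Decays ρ a)
    (hb : Decays ρ b) : Decays ρ (a + b) := by
  rw [decays_iff_mem hρ] at *
  exact add_mem ha hb

lemma Decays.zero (ρ : κ → ℝ) : Decays ρ (0 : Series p κ n) :=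
  ⟨0, 1 / 2, by norm_num, by norm_num, fun I => by simp⟩

lemma Decays.mulPoly {ρ : κ → ℝ} (hρ : ∀ k, 0 < ρ k) {a : Series p κ n} (ha : Decays ρ a)
    (f : Poly p κ n) : Decays ρ (mulPoly f a) := by
  induction f using AddMonoidAlgebra.induction_linear with
  | zero => simpa using Decays.zero ρ
  | add f g hf hg => rw [mulPoly_add]; exact hf.add hρ hg
  | single J c =>
    refine ha.of_translate hρ J ‖c‖ fun I => ?_
    rw [mulPoly_single_apply, norm_mul]
    gcongr
    refine le_mul_of_one_le_right (norm_nonneg c) ?_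
    have : (0 : ℝ) ≤ size I := Nat.cast_nonneg _
    linarith

lemma Decays.deriv {ρ : κ → ℝ} (hρ : ∀ k, 0 < ρ k) {a : Series p κ n} (ha : Decays ρ a)
    (i : κ ⊕ Fin n) : Decays ρ (deriv i a) := by
  refine ha.of_translate hρ (-unitExpo i) 1 fun I => ?_
  rw [deriv_apply, norm_mul, sub_neg_eq_add, one_mul]
  gcongr
  have := norm_int_le_one (p := p) (I i + 1)
  push_cast at this
  have h2 : (0 : ℝ) ≤ size I := Nat.cast_nonneg _
  linarith

/-- The exponents of `f` are admissible. -/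
def AdmissiblePoly (B : ParamDomain κ) (A : Set (Fin n)) (f : Poly p κ n) : Prop :=
  ∀ J, f.coeff J ≠ 0 → Admissible B A J

lemma mulPoly_ne_zero {f : Poly p κ n} {a : Series p κ n} {I : Expo κ n}
    (h : mulPoly f a I ≠ 0) : ∃ J, f.coeff J ≠ 0 ∧ a (I - J) ≠ 0 := by
  rw [mulPoly_apply, Finsupp.sum] at h
  obtain ⟨J, hJ, hJ'⟩ := Finset.exists_ne_zero_of_sum_ne_zero h
  exact ⟨J, left_ne_zero_of_mul hJ', right_ne_zero_of_mul hJ'⟩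

lemma mulPoly_mem {B : ParamDomain κ} {A : Set (Fin n)} {f : Poly p κ n}
    (hf : AdmissiblePoly B A f) {a : Series p κ n} (ha : a ∈ overconvergent p B A) :
    mulPoly f a ∈ overconvergent p B A := by
  refine ⟨fun I hI => ?_, fun ρ hρ => (decays_of_mem ha hρ).mulPoly (B.radii_pos ρ hρ) f⟩
  obtain ⟨J, hJ, hJ'⟩ := mulPoly_ne_zero hI
  have := (hf J hJ).add (ha.1 _ hJ')
  rwa [add_sub_cancel] at this

lemma admissiblePoly_single {B : ParamDomain κ} {A : Set (Fin n)} {J : Expo κ n}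
    (hJ : Admissible B A J) (c : ℂ_[p]) :
    AdmissiblePoly B A (AddMonoidAlgebra.single J c) := by
  intro K hK
  rw [AddMonoidAlgebra.coeff_single, Finsupp.single_apply] at hK
  split_ifs at hK with h
  · exact h ▸ hJ
  · exact absurd rfl hK

lemma AdmissiblePoly.add {B : ParamDomain κ} {A : Set (Fin n)} {f g : Poly p κ n}
    (hf : AdmissiblePoly B A f) (hg : AdmissiblePoly B A g) : AdmissiblePoly B A (f + g) := by
  intro J hJ
  by_cases h : f.coeff J = 0
  · refine hg J fun h' => hJ ?_
    rw [AddMonoidAlgebra.coeff_add, Finsupp.add_apply, h, h', add_zero]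
  · exact hf J h

lemma AdmissiblePoly.sum {B : ParamDomain κ} {A : Set (Fin n)} {ι : Type*} {s : Finset ι}
    {f : ι → Poly p κ n} (hf : ∀ i ∈ s, AdmissiblePoly B A (f i)) :
    AdmissiblePoly B A (∑ i ∈ s, f i) := by
  induction s using Finset.induction_on with
  | empty => intro J hJ; simp at hJ
  | insert i s hi ih =>
    rw [Finset.sum_insert hi]
    exact (hf i (Finset.mem_insert_self i s)).add
      (ih fun j hj => hf j (Finset.mem_insert_of_mem hj))

lemma AdmissiblePoly.mul {B : ParamDomain κ} {A : Set (Fin n)} {f g : Poly p κ n}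
    (hf : AdmissiblePoly B A f) (hg : AdmissiblePoly B A g) : AdmissiblePoly B A (f * g) := by
  rw [AddMonoidAlgebra.mul_def]
  refine AdmissiblePoly.sum fun J hJ => AdmissiblePoly.sum fun K hK => ?_
  exact admissiblePoly_single ((hf J (Finsupp.mem_support_iff.1 hJ)).add
    (hg K (Finsupp.mem_support_iff.1 hK))) _

/-- Differentiation kills the exponent zero, and a nonzero exponent that is required to be
nonnegative is at least one; so derivatives create no poles. -/
lemma admissible_sub_unitExpo {B : ParamDomain κ} {A : Set (Fin n)} {J : Expo κ n}
    (hJ : Admissible B A J) {i : κ ⊕ Fin n} (hi : J i ≠ 0) :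
    Admissible B A (J - unitExpo i) := by
  have key : ∀ j, 0 ≤ J j → 0 ≤ (J - unitExpo i) j := fun j hj => by
    rw [Pi.sub_apply]
    by_cases h : j = i
    · subst h; rw [unitExpo_same]; omega
    · rw [unitExpo_ne h]; omega
  exact ⟨fun k hk => key _ (hJ.1 k hk), fun i hi => key _ (hJ.2 i hi)⟩

lemma AdmissiblePoly.polyDeriv {B : ParamDomain κ} {A : Set (Fin n)} {f : Poly p κ n}
    (hf : AdmissiblePoly B A f) (i : κ ⊕ Fin n) : AdmissiblePoly B A (polyDeriv i f) := by
  unfold Dwork.polyDeriv Finsupp.sum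
  refine AdmissiblePoly.sum fun J hJ => ?_
  by_cases hi : J i = 0
  · intro K hK; simp [hi] at hK
  · exact admissiblePoly_single
      (admissible_sub_unitExpo (hf J (Finsupp.mem_support_iff.1 hJ)) hi) _

lemma deriv_mem {B : ParamDomain κ} {A : Set (Fin n)} {a : Series p κ n}
    (ha : a ∈ overconvergent p B A) (i : κ ⊕ Fin n) : deriv i a ∈ overconvergent p B A := by
  refine ⟨fun I hI => ?_, fun ρ hρ => (decays_of_mem ha hρ).deriv (B.radii_pos ρ hρ) i⟩
  rw [deriv_apply] at hI
  have h1 := left_ne_zero_of_mul hI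
  have h2 : (I + unitExpo i) i ≠ 0 := by
    intro h
    apply h1
    rw [Pi.add_apply, unitExpo_same] at h
    exact_mod_cast h
  have := admissible_sub_unitExpo (ha.1 _ (right_ne_zero_of_mul hI)) h2
  rwa [add_sub_cancel_right] at this

lemma twistedDeriv_mem {B : ParamDomain κ} {A : Set (Fin n)} {F : Poly p κ n}
    (hF : AdmissiblePoly B A F) {a : Series p κ n}
    (ha : a ∈ overconvergent p B A) (i : κ ⊕ Fin n) :
    twistedDeriv F i a ∈ overconvergent p B A :=
  add_mem (deriv_mem ha i) (mulPoly_mem (hF.polyDeriv i) ha)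

lemma mon_mem {B : ParamDomain κ} {A : Set (Fin n)} {J : Expo κ n} (hJ : Admissible B A J)
    {a : Series p κ n} (ha : a ∈ overconvergent p B A) : mon J a ∈ overconvergent p B A :=
  mulPoly_mem (admissiblePoly_single hJ 1) ha

/-! ### Products of series -/

lemma Decays.exists_common {m : ℕ} {ρ : κ → ℝ} (hρ : ∀ k, 0 < ρ k) {a : Series p κ n}
    {b : Series p κ m} (ha : Decays ρ a) (hb : Decays ρ b) :
    ∃ C r : ℝ, 0 ≤ C ∧ 0 < r ∧ r < 1 ∧ (∀ I, ‖a I‖ * weight ρ I ≤ C * r ^ size I) ∧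
      ∀ I, ‖b I‖ * weight ρ I ≤ C * r ^ size I := by
  obtain ⟨C, r, hr, hr1, h⟩ := ha
  obtain ⟨C', r', hr', hr1', h'⟩ := hb
  have hC := Decays.nonneg hρ h
  have hC' := Decays.nonneg hρ h'
  refine ⟨max C C', max r r', le_max_of_le_left hC, lt_max_of_lt_left hr, max_lt hr1 hr1',
    fun I => (h I).trans ?_, fun I => (h' I).trans ?_⟩
  · gcongr
    · exact le_max_left _ _
    · exact le_max_left _ _
  · gcongr
    · exact le_max_right _ _
    · exact le_max_right _ _

lemma norm_mul_weight_le {ρ : κ → ℝ} (hρ : ∀ k, 0 < ρ k) {a b : Series p κ n} {C r : ℝ}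
    (hC : 0 ≤ C) (hr : 0 < r) (ha : ∀ I, ‖a I‖ * weight ρ I ≤ C * r ^ size I)
    (hb : ∀ I, ‖b I‖ * weight ρ I ≤ C * r ^ size I) (I J : Expo κ n) :
    ‖a J * b (I - J)‖ * weight ρ I ≤ C * C * r ^ (size J + size (I - J)) := by
  calc ‖a J * b (I - J)‖ * weight ρ I = (‖a J‖ * weight ρ J) *
        (‖b (I - J)‖ * weight ρ (I - J)) := by
        rw [norm_mul, ← weight_sub_mul hρ I J]; ring
    _ ≤ (C * r ^ size J) * (C * r ^ size (I - J)) :=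
        mul_le_mul (ha J) (hb _) (mul_nonneg (norm_nonneg _) (weight_pos hρ _).le) (by positivity)
    _ = _ := by rw [pow_add]; ring

lemma Decays.summable {ρ : κ → ℝ} (hρ : ∀ k, 0 < ρ k) {a b : Series p κ n} (ha : Decays ρ a)
    (hb : Decays ρ b) (I : Expo κ n) : Summable fun J => a J * b (I - J) := by
  obtain ⟨C, r, hC, hr, hr1, ha, hb⟩ := ha.exists_common hρ hb
  refine summable_of_le_pow tendsto_size (C := C * C / weight ρ I) hr hr1 fun J => ?_
  rw [div_mul_eq_mul_div, le_div_iff₀ (weight_pos hρ I)]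
  refine (norm_mul_weight_le hρ hC hr ha hb I J).trans ?_
  gcongr _ * ?_
  exact pow_le_pow_of_le_one hr.le hr1.le (Nat.le_add_right _ _)

/-- By the ultrametric inequality the sum is bounded by its largest term, and `size I ≤ size J +
size (I - J)`, so the common rate `r` is preserved. -/
lemma Decays.mulSeries {ρ : κ → ℝ} (hρ : ∀ k, 0 < ρ k) {a b : Series p κ n} (ha : Decays ρ a)
    (hb : Decays ρ b) : Decays ρ (mulSeries a b) := by
  obtain ⟨C, r, hC, hr, hr1, ha, hb⟩ := ha.exists_common hρ hb
  refine ⟨C * C, r, hr, hr1, fun I => ?_⟩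
  rw [← le_div_iff₀ (weight_pos hρ I)]
  have hw := weight_pos hρ I
  refine IsUltrametricDist.norm_tsum_le_of_forall_le_of_nonneg (by positivity) fun J => ?_
  rw [le_div_iff₀ hw]
  refine (norm_mul_weight_le hρ hC hr ha hb I J).trans ?_
  gcongr _ * ?_
  refine pow_le_pow_of_le_one hr.le hr1.le ?_
  have := size_le_sub_add I J
  omega

lemma single_zero_mem (B : ParamDomain κ) (A : Set (Fin n)) :
    (Pi.single 0 1 : Series p κ n) ∈ overconvergent p B A := by
  refine ⟨fun I hI => ?_, fun ρ hρ => ⟨1, 1 / 2, by norm_num, by norm_num, fun I => ?_⟩⟩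
  · have : I = 0 := by by_contra h; exact hI (Pi.single_eq_of_ne h _)
    subst this
    exact ⟨fun _ _ => le_rfl, fun _ _ => le_rfl⟩
  · by_cases h : I = 0
    · subst h; simp [weight_zero, size_zero]
    · rw [Pi.single_eq_of_ne h, norm_zero, zero_mul]; positivity

lemma mulSeries_mem {B : ParamDomain κ} {A : Set (Fin n)} {a b : Series p κ n}
    (ha : a ∈ overconvergent p B A) (hb : b ∈ overconvergent p B A) :
    mulSeries a b ∈ overconvergent p B A := by
  refine ⟨fun I hI => ?_, fun ρ hρ =>
    (decays_of_mem ha hρ).mulSeries (B.radii_pos ρ hρ) (decays_of_mem hb hρ)⟩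
  obtain ⟨J, hJ⟩ : ∃ J, a J * b (I - J) ≠ 0 := by
    by_contra! h
    exact hI (by simp [Dwork.mulSeries, h])
  have := (admissible_of_mem ha (left_ne_zero_of_mul hJ)).add (admissible_of_mem hb (right_ne_zero_of_mul hJ))
  rwa [add_sub_cancel] at this

section
variable {ρ : κ → ℝ} (hρ : ∀ k, 0 < ρ k) {a b b' : Series p κ n}
include hρ

lemma mulSeries_add (ha : Decays ρ a) (hb : Decays ρ b) (hb' : Decays ρ b') :
    mulSeries a (b + b') = mulSeries a b + mulSeries a b' := by
  ext I
  simp only [mulSeries, Pi.add_apply, mul_add]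
  exact (ha.summable hρ hb I).tsum_add (ha.summable hρ hb' I)

end

lemma mulSeries_smul (a b : Series p κ n) (c : ℂ_[p]) :
    mulSeries a (c • b) = c • mulSeries a b := by
  ext I
  simp only [mulSeries, Pi.smul_apply, smul_eq_mul, mul_left_comm _ c]
  exact tsum_mul_left

lemma mulSeries_comm (a b : Series p κ n) : mulSeries a b = mulSeries b a := by
  ext I
  simp only [mulSeries]
  rw [← (Equiv.subLeft I).tsum_eq]
  simp [mul_comm]

@[simp] lemma mulSeries_zero (a : Series p κ n) : mulSeries a 0 = 0 := by
  ext I; simp [mulSeries]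

lemma one_mulSeries (b : Series p κ n) : mulSeries (Pi.single 0 1) b = b := by
  ext I
  simp only [mulSeries]
  rw [tsum_eq_single 0]
  · simp
  · intro J hJ; simp [hJ]

lemma mulSeries_mulPoly_single (a b : Series p κ n) (J : Expo κ n) (c : ℂ_[p]) :
    mulSeries a (mulPoly (AddMonoidAlgebra.single J c) b) =
      mulPoly (AddMonoidAlgebra.single J c) (mulSeries a b) := by
  ext I
  simp only [mulSeries, mulPoly_single_apply]
  rw [← tsum_mul_left]
  refine tsum_congr fun K => ?_
  rw [sub_right_comm]; ring

section
variable {ρ : κ → ℝ} (hρ : ∀ k, 0 < ρ k) {a b : Series p κ n}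
include hρ

lemma mulSeries_mulPoly (ha : Decays ρ a) (hb : Decays ρ b) (f : Poly p κ n) :
    mulSeries a (mulPoly f b) = mulPoly f (mulSeries a b) := by
  induction f using AddMonoidAlgebra.induction_linear with
  | zero => simp
  | add f g hf hg =>
    rw [mulPoly_add, LinearMap.add_apply, LinearMap.add_apply,
      mulSeries_add hρ ha (hb.mulPoly hρ f) (hb.mulPoly hρ g), hf, hg]
  | single J c => exact mulSeries_mulPoly_single a b J c

lemma deriv_mulSeries (ha : Decays ρ a) (hb : Decays ρ b) (i : κ ⊕ Fin n) :
    deriv i (mulSeries a b) = mulSeries (deriv i a) b + mulSeries a (deriv i b) := by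
  ext I
  have h1 := ((ha.deriv hρ i).summable hρ hb I)
  have h2 := (ha.summable hρ (hb.deriv hρ i) I)
  rw [← (Equiv.subRight (unitExpo i)).summable_iff] at h1
  change ((I i : ℂ_[p]) + 1) * (∑' J, a J * b (I + unitExpo i - J)) =
    (∑' J, deriv i a J * b (I - J)) + ∑' J, a J * deriv i b (I - J)
  rw [← (Equiv.subRight (unitExpo i)).tsum_eq fun J => deriv i a J * b (I - J)]
  refine Eq.trans ?_ (h1.tsum_add h2)
  rw [← tsum_mul_left]
  refine tsum_congr fun J => ?_
  simp only [Equiv.subRight_apply, sub_add_cancel, Function.comp, deriv_apply]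
  rw [show I - (J - unitExpo i) = I + unitExpo i - J by abel,
    show I - J + unitExpo i = I + unitExpo i - J by abel]
  push_cast [Pi.sub_apply, unitExpo_same]
  ring

end

/-! ### Pullback along coordinate projections -/

section Pullback
variable {m : ℕ} (e : Fin m ↪o Fin n)

lemma sumMap_injective : Function.Injective (Sum.map id e : κ ⊕ Fin m → κ ⊕ Fin n) :=
  Function.injective_id.sumMap e.injective

@[simp] lemma expoMap_inl (J : Expo κ m) (k : κ) : expoMap e J (Sum.inl k) = J (Sum.inl k) :=
  (sumMap_injective e).extend_apply J 0 (Sum.inl k)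

@[simp] lemma expoMap_inr (J : Expo κ m) (i : Fin m) :
    expoMap e J (Sum.inr (e i)) = J (Sum.inr i) :=
  (sumMap_injective e).extend_apply J 0 (Sum.inr i)

lemma expoMap_sumMap (J : Expo κ m) (i : κ ⊕ Fin m) : expoMap e J (Sum.map id e i) = J i :=
  (sumMap_injective e).extend_apply J 0 i

lemma expoMap_of_notMem (J : Expo κ m) {i : Fin n} (hi : i ∉ Set.range e) :
    expoMap e J (Sum.inr i) = 0 := by
  refine Function.extend_apply' _ _ _ ?_
  rintro ⟨k | j, h⟩
  · simp at h
  · exact hi ⟨j, by simpa using h⟩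

lemma expoMap_injective : Function.Injective (expoMap (κ := κ) e) := by
  intro J K h
  ext i
  rw [← expoMap_sumMap e J, h, expoMap_sumMap]

lemma expoMap_eq_iff (J : Expo κ m) (I : Expo κ n) : expoMap e J = I ↔
    (∀ k, J (Sum.inl k) = I (Sum.inl k)) ∧ (∀ i, J (Sum.inr i) = I (Sum.inr (e i))) ∧
      ∀ i, i ∉ Set.range e → I (Sum.inr i) = 0 := by
  constructor
  · rintro rfl
    exact ⟨by simp, by simp, fun i hi => expoMap_of_notMem e J hi⟩
  · rintro ⟨h1, h2, h3⟩
    ext (k | i)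
    · rw [expoMap_inl, h1]
    · by_cases hi : i ∈ Set.range e
      · obtain ⟨j, rfl⟩ := hi
        rw [expoMap_inr, h2]
      · rw [expoMap_of_notMem e J hi, h3 i hi]

lemma mem_range_expoMap {I : Expo κ n} : I ∈ Set.range (expoMap (κ := κ) e) ↔
    ∀ i, i ∉ Set.range e → I (Sum.inr i) = 0 := by
  constructor
  · rintro ⟨J, rfl⟩ i hi
    exact expoMap_of_notMem e J hi
  · intro h
    refine ⟨fun i => I (Sum.map id e i), (expoMap_eq_iff e _ _).2 ⟨fun _ => rfl, fun _ => rfl, h⟩⟩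

lemma expoMap_add (J K : Expo κ m) : expoMap e (J + K) = expoMap e J + expoMap e K := by
  rw [expoMap_eq_iff]
  exact ⟨by simp, by simp, fun i hi => by simp [expoMap_of_notMem e _ hi]⟩

lemma expoMap_sub (J K : Expo κ m) : expoMap e (J - K) = expoMap e J - expoMap e K := by
  rw [expoMap_eq_iff]
  exact ⟨by simp, by simp, fun i hi => by simp [expoMap_of_notMem e _ hi]⟩

lemma expoMap_nsmul (q : ℕ) (J : Expo κ m) : expoMap e (q • J) = q • expoMap e J := by
  rw [expoMap_eq_iff]
  exact ⟨by simp, by simp, fun i hi => by simp [expoMap_of_notMem e _ hi]⟩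

@[simp] lemma expoMap_zero : expoMap (κ := κ) e 0 = 0 := by
  rw [expoMap_eq_iff]
  exact ⟨by simp, by simp, fun i _ => rfl⟩

lemma unitExpo_apply (i j : κ ⊕ Fin n) : unitExpo i j = if j = i then 1 else 0 := by
  split_ifs with h
  · rw [h, unitExpo_same]
  · exact unitExpo_ne h

lemma expoMap_unitExpo (i : κ ⊕ Fin m) :
    expoMap e (unitExpo i) = unitExpo (Sum.map id e i) := by
  ext j
  by_cases hj : j ∈ Set.range (Sum.map id e : κ ⊕ Fin m → κ ⊕ Fin n)
  · obtain ⟨j, rfl⟩ := hj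
    rw [expoMap_sumMap, unitExpo_apply, unitExpo_apply]
    simp only [(sumMap_injective e).eq_iff]
  · rw [unitExpo_ne (fun h => hj ⟨i, h.symm⟩)]
    exact Function.extend_apply' _ _ _ hj

lemma size_expoMap (J : Expo κ m) : size (expoMap e J) = size J := by
  refine (Fintype.sum_of_injective _ (sumMap_injective e) _ _ (fun j hj => ?_) fun j => ?_).symm
  · rw [show expoMap e J j = 0 from Function.extend_apply' _ _ _ hj, Int.natAbs_zero]
  · rw [expoMap_sumMap]

lemma weight_expoMap (ρ : κ → ℝ) (J : Expo κ m) : weight ρ (expoMap e J) = weight ρ J := by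
  simp [weight]

/-- `expoMap` as a homomorphism. -/
def expoHom : Expo κ m →+ Expo κ n where
  toFun := expoMap e
  map_zero' := expoMap_zero e
  map_add' := expoMap_add e

lemma polyMap_single (J : Expo κ m) (c : ℂ_[p]) :
    polyMap e (AddMonoidAlgebra.single J c) = AddMonoidAlgebra.single (expoMap e J) c :=
  AddMonoidAlgebra.mapDomain_single

lemma polyMap_add (f g : Poly p κ m) : polyMap e (f + g) = polyMap e f + polyMap e g :=
  AddMonoidAlgebra.mapDomain_add _ _ _

lemma polyMap_mul (f g : Poly p κ m) : polyMap e (f * g) = polyMap e f * polyMap e g :=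
  AddMonoidAlgebra.mapDomain_mul (expoHom e) f g

@[simp] lemma polyMap_zero : polyMap e (0 : Poly p κ m) = 0 := AddMonoidAlgebra.mapDomain_zero _

lemma polyMap_polyMap {l : ℕ} (e' : Fin l ↪o Fin m) (f : Poly p κ l) :
    polyMap e (polyMap e' f) = polyMap (e'.trans e) f := by
  induction f using AddMonoidAlgebra.induction_linear with
  | zero => simp
  | add f g hf hg => simp only [polyMap_add, hf, hg]
  | single J c =>
    simp only [polyMap_single]
    congr 1
    rw [expoMap_eq_iff]
    refine ⟨by simp, fun i => ?_, fun i hi => ?_⟩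
    · by_cases h : i ∈ Set.range e'
      · obtain ⟨j, rfl⟩ := h
        rw [expoMap_inr]
        exact (expoMap_inr (e'.trans e) J j).symm
      · rw [expoMap_of_notMem e' J h, expoMap_of_notMem]
        rintro ⟨j, hj⟩
        exact h ⟨j, e.injective hj⟩
    · refine expoMap_of_notMem _ _ ?_
      rintro ⟨j, rfl⟩
      exact hi ⟨e' j, rfl⟩

lemma polyDeriv_polyMap (i : κ ⊕ Fin m) (f : Poly p κ m) :
    polyDeriv (Sum.map id e i) (polyMap e f) = polyMap e (polyDeriv i f) := by
  induction f using AddMonoidAlgebra.induction_linear with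
  | zero => simp
  | add f g hf hg => simp only [polyMap_add, polyDeriv_add, hf, hg]
  | single J c =>
    simp only [polyMap_single, polyDeriv_single, expoMap_sub, expoMap_unitExpo, expoMap_sumMap]

lemma polyDeriv_polyMap_of_notMem {i : Fin n} (hi : i ∉ Set.range e) (f : Poly p κ m) :
    polyDeriv (Sum.inr i) (polyMap e f) = 0 := by
  induction f using AddMonoidAlgebra.induction_linear with
  | zero => simp
  | add f g hf hg => simp only [polyMap_add, polyDeriv_add, hf, hg, add_zero]
  | single J c => simp [polyMap_single, polyDeriv_single, expoMap_of_notMem e J hi]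

@[simp] lemma seriesMap_expoMap (a : Series p κ m) (J : Expo κ m) :
    seriesMap e a (expoMap e J) = a J := (expoMap_injective e).extend_apply a 0 J

lemma seriesMap_of_notMem (a : Series p κ m) {I : Expo κ n}
    (hI : I ∉ Set.range (expoMap (κ := κ) e)) : seriesMap e a I = 0 :=
  Function.extend_apply' _ _ _ hI

lemma eq_seriesMap {a : Series p κ m} {b : Series p κ n} (h : ∀ J, b (expoMap e J) = a J)
    (h' : ∀ I, I ∉ Set.range (expoMap (κ := κ) e) → b I = 0) : b = seriesMap e a := by
  ext I
  by_cases hI : I ∈ Set.range (expoMap (κ := κ) e)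
  · obtain ⟨J, rfl⟩ := hI
    rw [h, seriesMap_expoMap]
  · rw [h' I hI, seriesMap_of_notMem e a hI]

@[simp] lemma seriesMap_zero : seriesMap e (0 : Series p κ m) = 0 :=
  (eq_seriesMap e (fun _ => rfl) fun _ _ => rfl).symm

lemma seriesMap_add (a b : Series p κ m) :
    seriesMap e (a + b) = seriesMap e a + seriesMap e b :=
  (eq_seriesMap e (fun J => by simp) fun I hI => by
    simp [seriesMap_of_notMem e _ hI]).symm

lemma seriesMap_smul (c : ℂ_[p]) (a : Series p κ m) :
    seriesMap e (c • a) = c • seriesMap e a :=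
  (eq_seriesMap e (fun J => by simp) fun I hI => by
    simp [seriesMap_of_notMem e _ hI]).symm

lemma seriesMap_neg (a : Series p κ m) : seriesMap e (-a) = -seriesMap e a :=
  (eq_seriesMap e (fun J => by simp) fun I hI => by
    simp [seriesMap_of_notMem e _ hI]).symm

lemma seriesMap_sub (a b : Series p κ m) :
    seriesMap e (a - b) = seriesMap e a - seriesMap e b := by
  rw [sub_eq_add_neg, seriesMap_add, seriesMap_neg, sub_eq_add_neg]

lemma seriesMap_injective : Function.Injective (seriesMap (p := p) (κ := κ) e) := by
  intro a b h
  ext J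
  rw [← seriesMap_expoMap e a, h, seriesMap_expoMap]

lemma seriesMap_seriesMap {l : ℕ} (e' : Fin l ↪o Fin m) (a : Series p κ l) :
    seriesMap e (seriesMap e' a) = seriesMap (e'.trans e) a := by
  have key : ∀ J : Expo κ l, expoMap e (expoMap e' J) = expoMap (e'.trans e) J := by
    intro J
    have := polyMap_polyMap (p := p) e e' (AddMonoidAlgebra.single J 1)
    simp only [polyMap_single] at this
    exact (AddMonoidAlgebra.single_left_inj one_ne_zero).1 this
  refine eq_seriesMap _ (fun J => ?_) fun I hI => ?_
  · rw [← key, seriesMap_expoMap, seriesMap_expoMap]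
  · by_cases h : I ∈ Set.range (expoMap (κ := κ) e)
    · obtain ⟨J, rfl⟩ := h
      rw [seriesMap_expoMap, seriesMap_of_notMem]
      rintro ⟨K, rfl⟩
      exact hI ⟨K, (key K).symm⟩
    · exact seriesMap_of_notMem _ _ h

lemma seriesMap_mulPoly (f : Poly p κ m) (a : Series p κ m) :
    seriesMap e (mulPoly f a) = mulPoly (polyMap e f) (seriesMap e a) := by
  induction f using AddMonoidAlgebra.induction_linear with
  | zero => simp
  | add f g hf hg =>
    simp only [polyMap_add, mulPoly_add, LinearMap.add_apply, seriesMap_add, hf, hg]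
  | single J c =>
    rw [polyMap_single]
    refine (eq_seriesMap e (fun K => ?_) fun I hI => ?_).symm
    · rw [mulPoly_single_apply, mulPoly_single_apply, ← expoMap_sub, seriesMap_expoMap]
    · rw [mulPoly_single_apply, seriesMap_of_notMem, mul_zero]
      rintro ⟨K, hK⟩
      exact hI ⟨K + J, by rw [expoMap_add, hK, sub_add_cancel]⟩

lemma deriv_seriesMap (i : κ ⊕ Fin m) (a : Series p κ m) :
    deriv (Sum.map id e i) (seriesMap e a) = seriesMap e (deriv i a) := by
  refine eq_seriesMap e (fun K => ?_) fun I hI => ?_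
  · rw [deriv_apply, ← expoMap_unitExpo, ← expoMap_add, seriesMap_expoMap, deriv_apply,
      expoMap_sumMap]
  · rw [deriv_apply, seriesMap_of_notMem, mul_zero]
    rintro ⟨K, hK⟩
    refine hI ⟨K - unitExpo i, ?_⟩
    rw [expoMap_sub, hK, expoMap_unitExpo, add_sub_cancel_right]

lemma deriv_seriesMap_of_notMem {i : Fin n} (hi : i ∉ Set.range e) (a : Series p κ m) :
    deriv (Sum.inr i) (seriesMap e a) = 0 := by
  ext I
  rw [deriv_apply]
  by_cases h : I + unitExpo (Sum.inr i) ∈ Set.range (expoMap (κ := κ) e)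
  · have := (mem_range_expoMap e).1 h i hi
    rw [Pi.add_apply, unitExpo_same] at this
    have h2 : ((I (Sum.inr i) : ℂ_[p]) + 1) = 0 := by exact_mod_cast congrArg (Int.cast (R := ℂ_[p])) this
    rw [h2, zero_mul]; rfl
  · rw [seriesMap_of_notMem e a h, mul_zero]; rfl

lemma twistedDeriv_seriesMap (F : Poly p κ m) (i : κ ⊕ Fin m) (a : Series p κ m) :
    twistedDeriv (polyMap e F) (Sum.map id e i) (seriesMap e a) =
      seriesMap e (twistedDeriv F i a) := by
  rw [twistedDeriv_apply, twistedDeriv_apply, deriv_seriesMap, polyDeriv_polyMap, seriesMap_add,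
    seriesMap_mulPoly]

lemma twistedDeriv_add_left (F G : Poly p κ n) (i : κ ⊕ Fin n) (a : Series p κ n) :
    twistedDeriv (F + G) i a = twistedDeriv F i a + mulPoly (polyDeriv i G) a := by
  rw [twistedDeriv_apply, twistedDeriv_apply, polyDeriv_add, mulPoly_add, LinearMap.add_apply,
    add_assoc]

lemma seriesMap_mem {B : ParamDomain κ} {A : Set (Fin m)} {A' : Set (Fin n)}
    (hA : ∀ i, e i ∈ A' → i ∈ A) {a : Series p κ m} (ha : a ∈ overconvergent p B A) :
    seriesMap e a ∈ overconvergent p B A' := by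
  have key : ∀ I, seriesMap e a I ≠ 0 → ∃ J, expoMap e J = I ∧ a J ≠ 0 := by
    intro I hI
    by_cases h : I ∈ Set.range (expoMap (κ := κ) e)
    · obtain ⟨J, rfl⟩ := h
      exact ⟨J, rfl, by rwa [seriesMap_expoMap] at hI⟩
    · exact absurd (seriesMap_of_notMem e a h) hI
  refine overconvergent_of_le ha (fun I hI => ?_) fun ρ hρ => ⟨ρ, hρ, 1, 1, fun I hI => ?_⟩
  · obtain ⟨J, rfl, hJ⟩ := key I hI
    refine ⟨fun k hk => ?_, fun i hi => ?_⟩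
    · rw [expoMap_inl]; exact (admissible_of_mem ha hJ).1 k hk
    · by_cases h : i ∈ Set.range e
      · obtain ⟨j, rfl⟩ := h
        rw [expoMap_inr]; exact (admissible_of_mem ha hJ).2 j (hA j hi)
      · rw [expoMap_of_notMem e J h]
  · obtain ⟨J, rfl, hJ⟩ := key I hI
    refine ⟨J, ?_, by rw [size_expoMap]; omega⟩
    rw [seriesMap_expoMap, weight_expoMap, one_mul]
    refine le_mul_of_one_le_left (mul_nonneg (norm_nonneg _)
      (weight_pos (B.radii_pos ρ hρ) J).le) ?_
    linarith [(size J).cast_nonneg (α := ℝ)]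

/-- This is how the outcome of a reduction on the threefold is recognised as a function on the curve
or on the torus. -/
lemma exists_seriesMap {B : ParamDomain κ} {A : Set (Fin m)} {A' : Set (Fin n)}
    (hA : ∀ i ∈ A, e i ∈ A') {b : Series p κ n} (hb : b ∈ overconvergent p B A')
    (h : ∀ I, b I ≠ 0 → ∀ i, i ∉ Set.range e → I (Sum.inr i) = 0) :
    ∃ a ∈ overconvergent p B A, b = seriesMap e a := by
  refine ⟨fun J => b (expoMap e J), ?_, eq_seriesMap e (fun _ => rfl) fun I hI => ?_⟩
  · refine overconvergent_of_le hb (fun J hJ => ?_) fun ρ hρ => ⟨ρ, hρ, 1, 1, fun J hJ => ?_⟩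
    · have := admissible_of_mem hb hJ
      exact ⟨fun k hk => by simpa using this.1 k hk, fun i hi => by simpa using this.2 _ (hA i hi)⟩
    · refine ⟨expoMap e J, ?_, by rw [size_expoMap]; omega⟩
      rw [weight_expoMap, one_mul]
      refine le_mul_of_one_le_left (mul_nonneg (norm_nonneg _)
        (weight_pos (B.radii_pos ρ hρ) J).le) ?_
      linarith [(size (expoMap e J)).cast_nonneg (α := ℝ)]
  · by_contra hne
    exact hI ((mem_range_expoMap e).2 (h I hne))

lemma seriesMap_mulSeries (a b : Series p κ m) :
    seriesMap e (mulSeries a b) = mulSeries (seriesMap e a) (seriesMap e b) := by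
  refine (eq_seriesMap e (fun K => ?_) fun I hI => ?_).symm
  · simp only [mulSeries]
    rw [← (expoMap_injective e).tsum_eq]
    · refine tsum_congr fun J => ?_
      rw [← expoMap_sub, seriesMap_expoMap, seriesMap_expoMap]
    · intro J hJ
      by_contra h
      exact hJ (by simp [seriesMap_of_notMem e a h])
  · simp only [mulSeries]
    refine (tsum_congr fun J => ?_).trans tsum_zero
    by_cases h : J ∈ Set.range (expoMap (κ := κ) e)
    · rw [seriesMap_of_notMem e b, mul_zero]
      rintro ⟨K, hK⟩
      obtain ⟨J, rfl⟩ := h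
      exact hI ⟨J + K, by rw [expoMap_add, hK, add_sub_cancel]⟩
    · rw [seriesMap_of_notMem e a h, zero_mul]

lemma formMap_map (ω : Form p κ m) (S : Finset (Fin m)) :
    formMap e ω (S.map e.toEmbedding) = seriesMap e (ω S) :=
  (Finset.map_injective _).extend_apply _ _ S

lemma formMap_of_notMem (ω : Form p κ m) {S : Finset (Fin n)}
    (hS : S ∉ Set.range (Finset.map e.toEmbedding)) : formMap e ω S = 0 :=
  Function.extend_apply' _ _ _ hS

lemma HasDegree.formMap {k : ℕ} {ω : Form p κ m} (h : HasDegree k ω) :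
    HasDegree k (formMap e ω) := by
  intro S hS
  by_cases h' : S ∈ Set.range (Finset.map e.toEmbedding)
  · obtain ⟨S, rfl⟩ := h'
    rw [formMap_map, h S (by simpa using hS), seriesMap_zero]
  · exact formMap_of_notMem e ω h'

lemma formMap_add (ω η : Form p κ m) : formMap e (ω + η) = formMap e ω + formMap e η := by
  ext1 S
  by_cases h' : S ∈ Set.range (Finset.map e.toEmbedding)
  · obtain ⟨S, rfl⟩ := h'
    simp only [Pi.add_apply, formMap_map, seriesMap_add]
  · simp only [Pi.add_apply, formMap_of_notMem e _ h', add_zero]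

lemma formMap_smul (c : ℂ_[p]) (ω : Form p κ m) : formMap e (c • ω) = c • formMap e ω := by
  ext1 S
  by_cases h' : S ∈ Set.range (Finset.map e.toEmbedding)
  · obtain ⟨S, rfl⟩ := h'
    simp only [Pi.smul_apply, formMap_map, seriesMap_smul]
  · simp only [Pi.smul_apply, formMap_of_notMem e _ h', smul_zero]

end Pullback

/-! ### Classes and induced maps -/

section Classes
variable {B : ParamDomain κ} {A : Set (Fin n)} {F : Poly p κ n} {k : ℕ}

/-- The coboundaries of overconvergent forms. -/
abbrev coboundaries (B : ParamDomain κ) (A : Set (Fin n)) (F : Poly p κ n) :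
    Submodule ℂ_[p] (Form p κ n) := (forms B A).map (twistedD F)

lemma exists_isClass (c : DeRham B A F k) : ∃ ω, IsClass ω c := by
  obtain ⟨⟨ω, h⟩, rfl⟩ := Submodule.Quotient.mk_surjective _ c
  exact ⟨ω, h, rfl⟩

lemma isClass_of_mem {ω : Form p κ n} (h : ω ∈ cocycles B A F k) :
    ∃ c : DeRham B A F k, IsClass ω c := ⟨_, h, rfl⟩

lemma IsClass.mem {ω : Form p κ n} {c : DeRham B A F k} (h : IsClass ω c) :
    ω ∈ cocycles B A F k := h.1

lemma IsClass.eq_iff {ω ω' : Form p κ n} {c c' : DeRham B A F k} (h : IsClass ω c)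
    (h' : IsClass ω' c') : c = c' ↔ ω - ω' ∈ coboundaries B A F := by
  obtain ⟨hω, rfl⟩ := h
  obtain ⟨hω', rfl⟩ := h'
  rw [Submodule.Quotient.eq]
  rfl

lemma IsClass.eq_zero_iff {ω : Form p κ n} {c : DeRham B A F k} (h : IsClass ω c) :
    c = 0 ↔ ω ∈ coboundaries B A F := by
  rw [h.eq_iff (c' := 0) ⟨zero_mem _, rfl⟩, sub_zero]

/-- Construction of induced maps in cohomology. -/
lemma exists_induces {m : ℕ} {A' : Set (Fin m)} {F' : Poly p κ m} {k' : ℕ}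
    (Φ : Form p κ n → Form p κ m)
    (hadd : ∀ ω ∈ cocycles B A F k, ∀ η ∈ cocycles B A F k, Φ (ω + η) = Φ ω + Φ η)
    (hsmul : ∀ (c : ℂ_[p]), ∀ ω ∈ cocycles B A F k, Φ (c • ω) = c • Φ ω)
    (hcoc : ∀ ω ∈ cocycles B A F k, Φ ω ∈ cocycles B A' F' k')
    (hcob : ∀ ω ∈ cocycles B A F k, ω ∈ coboundaries B A F → Φ ω ∈ coboundaries B A' F') :
    ∃ G : DeRham B A F k →ₗ[ℂ_[p]] DeRham B A' F' k', Induces Φ G := by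
  let Ψ : cocycles B A F k →ₗ[ℂ_[p]] cocycles B A' F' k' :=
    { toFun := fun ω => ⟨Φ ω.1, hcoc ω.1 ω.2⟩
      map_add' := fun ω η => Subtype.ext (hadd _ ω.2 _ η.2)
      map_smul' := fun c ω => Subtype.ext (hsmul c _ ω.2) }
  refine ⟨Submodule.mapQ _ _ Ψ fun ω hω => hcob ω.1 ω.2 hω, ?_⟩
  rintro ω _ ⟨h, rfl⟩
  exact ⟨hcoc ω h, rfl⟩

/-- Maps that commute with the differential induce maps in cohomology. -/
lemma exists_induces_of_commutes (Φ : Form p κ n → Form p κ n)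
    (hadd : ∀ ω ∈ forms B A, ∀ η ∈ forms B A, Φ (ω + η) = Φ ω + Φ η)
    (hsmul : ∀ (c : ℂ_[p]), ∀ ω ∈ forms B A, Φ (c • ω) = c • Φ ω)
    (hforms : ∀ ω ∈ forms B A, Φ ω ∈ forms B A)
    (hdeg : ∀ S ω, ω S = 0 → Φ ω S = 0)
    (hD : ∀ ω ∈ forms B A, twistedD F (Φ ω) = Φ (twistedD F ω)) :
    ∃ G : DeRham B A F k →ₗ[ℂ_[p]] DeRham B A F k, Induces Φ G := by
  have hf : ∀ ω ∈ cocycles B A F k, ω ∈ forms B A := fun ω h => mem_forms.2 (mem_cocycles.1 h).1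
  refine exists_induces Φ (fun ω h η h' => hadd ω (hf ω h) η (hf η h'))
    (fun c ω h => hsmul c ω (hf ω h)) (fun ω h => ?_) (fun ω h h' => ?_)
  · have h1 := mem_cocycles.1 h
    refine mem_cocycles.2 ⟨mem_forms.1 (hforms ω (hf ω h)), fun S hS => hdeg S ω (h1.2.1 S hS), ?_⟩
    rw [hD ω (hf ω h), h1.2.2]
    ext1 S
    exact hdeg S 0 rfl
  · obtain ⟨η, hη, rfl⟩ := h'
    exact ⟨Φ η, hforms η hη, hD η hη⟩

/-- The coefficients of exact forms of top degree. -/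
def exactTop (B : ParamDomain κ) (A : Set (Fin n)) (F : Poly p κ n) :
    Submodule ℂ_[p] (Series p κ n) :=
  (Submodule.pi Set.univ fun _ : Fin n => overconvergent p B A).map
    (∑ i, twistedDeriv F (Sum.inr i) ∘ₗ LinearMap.proj i)

lemma mem_exactTop {g : Series p κ n} : g ∈ exactTop B A F ↔
    ∃ a : Fin n → Series p κ n, (∀ i, a i ∈ overconvergent p B A) ∧
      g = ∑ i, twistedDeriv F (Sum.inr i) (a i) := by
  simp only [exactTop, Submodule.mem_map, Submodule.mem_pi, Set.mem_univ, true_implies,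
    LinearMap.sum_apply, LinearMap.comp_apply, LinearMap.proj_apply, eq_comm]

lemma twistedDeriv_mem_exactTop (F : Poly p κ n) (i : Fin n) {a : Series p κ n}
    (ha : a ∈ overconvergent p B A) : twistedDeriv F (Sum.inr i) a ∈ exactTop B A F := by
  refine mem_exactTop.2 ⟨Pi.single i a, fun j => ?_, ?_⟩
  · by_cases h : j = i
    · subst h; rwa [Pi.single_eq_same]
    · rw [Pi.single_eq_of_ne h]; exact zero_mem _
  · rw [Finset.sum_eq_single i]
    · rw [Pi.single_eq_same]
    · intro j _ h; rw [Pi.single_eq_of_ne h, map_zero]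
    · simp

lemma mem_cocycles_top {ω : Form p κ n} :
    ω ∈ cocycles B A F n ↔ HasDegree n ω ∧ ω Finset.univ ∈ overconvergent p B A := by
  rw [mem_cocycles]
  refine ⟨fun h => ⟨h.2.1, h.1 _⟩, fun h => ⟨fun S => ?_, h.1, ?_⟩⟩
  · by_cases hS : S = Finset.univ
    · exact hS ▸ h.2
    · rw [h.1 S fun hc => hS ((Finset.card_eq_iff_eq_univ S).1 (by rw [hc, Fintype.card_fin]))]
      exact zero_mem _
  · exact (h.1.twistedD F).eq_zero (Nat.lt_succ_self n)

/-- Only the components of degree `n - 1` contribute to the top component of a differential, and the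
signs of the exterior product are `±1`, so they can be absorbed into the primitives. The cohomology
of top degree is therefore the cokernel of the operators `D_i` on functions. -/
lemma mem_coboundaries_top {ω : Form p κ n} (hω : HasDegree n ω) :
    ω ∈ coboundaries B A F ↔ ω Finset.univ ∈ exactTop B A F := by
  have hsign : ∀ i : Fin n, ∃ s : ℂ_[p], s * s = 1 ∧
      (-1 : ℂ_[p]) ^ ((Finset.univ : Finset (Fin n)).filter (· < i)).card = s := fun i =>
    ⟨_, by rw [← mul_pow]; simp, rfl⟩
  choose s hs hs' using hsign
  have huniv : ∀ η : Form p κ n, twistedD F η Finset.univ =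
      ∑ i, twistedDeriv F (Sum.inr i) (s i • η (Finset.univ.erase i)) := fun η => by
    rw [twistedD_apply]
    refine Finset.sum_congr rfl fun i _ => ?_
    rw [if_pos (Finset.mem_univ i), hs', map_smul]
  constructor
  · rintro ⟨η, hη, rfl⟩
    rw [huniv]
    exact mem_exactTop.2 ⟨_, fun i => Submodule.smul_mem _ _ (mem_forms.1 hη _), rfl⟩
  · rw [mem_exactTop]
    rintro ⟨a, ha, hu⟩
    have hinj : ∀ i j : Fin n, (Finset.univ : Finset (Fin n)).erase i = Finset.univ.erase j ↔
        i = j := fun i j => by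
      refine ⟨fun h => ?_, fun h => by rw [h]⟩
      by_contra hne
      have := Finset.mem_erase.2 ⟨hne, Finset.mem_univ i⟩
      rw [← h] at this
      exact Finset.notMem_erase i _ this
    let η : Form p κ n := fun S => ∑ i, if S = Finset.univ.erase i then s i • a i else 0
    have hη : ∀ i, η (Finset.univ.erase i) = s i • a i := fun i => by
      simp only [η, hinj]
      simp
    refine ⟨η, mem_forms.2 fun S => Submodule.sum_mem _ fun i _ => ?_, ?_⟩
    · split_ifs
      · exact Submodule.smul_mem _ _ (ha i)
      · exact zero_mem _
    · have hdeg : HasDegree n (twistedD F η) := by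
        intro S hS
        rw [twistedD_apply]
        refine Finset.sum_eq_zero fun i _ => ?_
        split_ifs with hi
        · rw [show η (S.erase i) = 0 from Finset.sum_eq_zero fun j _ => ?_, map_zero, smul_zero]
          rw [if_neg]
          intro h
          have h1 := Finset.card_erase_add_one hi
          rw [h, Finset.card_erase_of_mem (Finset.mem_univ j), Finset.card_univ,
            Fintype.card_fin] at h1
          have := Fin.pos i
          omega
        · rfl
      refine hdeg.ext_top hω ?_
      rw [huniv, hu]
      refine Finset.sum_congr rfl fun i _ => ?_
      rw [hη, smul_smul, hs, one_smul]

/-- The form of top degree with coefficient `g`. -/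
def topForm (g : Series p κ n) : Form p κ n := Pi.single Finset.univ g

@[simp] lemma topForm_univ (g : Series p κ n) : topForm g Finset.univ = g := by simp [topForm]

lemma hasDegree_topForm (g : Series p κ n) : HasDegree n (topForm g) := fun S hS => by
  refine Pi.single_eq_of_ne (fun h => hS ?_) _
  rw [h, Finset.card_univ, Fintype.card_fin]

lemma topForm_mem {g : Series p κ n} (hg : g ∈ overconvergent p B A) :
    topForm g ∈ cocycles B A F n :=
  mem_cocycles_top.2 ⟨hasDegree_topForm g, by rwa [topForm_univ]⟩

lemma IsClass.top_eq_iff {ω ω' : Form p κ n} {c c' : DeRham B A F n} (h : IsClass ω c)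
    (h' : IsClass ω' c') :
    c = c' ↔ ω Finset.univ - ω' Finset.univ ∈ exactTop B A F := by
  rw [h.eq_iff h', mem_coboundaries_top, Pi.sub_apply]
  exact (mem_cocycles_top.1 (sub_mem h.mem h'.mem)).1

lemma IsClass.top_eq_zero_iff {ω : Form p κ n} {c : DeRham B A F n} (h : IsClass ω c) :
    c = 0 ↔ ω Finset.univ ∈ exactTop B A F := by
  rw [h.eq_zero_iff, mem_coboundaries_top (mem_cocycles_top.1 h.mem).1]

end Classes

/-! ### Valuations of integers and factorials -/

lemma norm_natCast (m : ℕ) : ‖(m : ℂ_[p])‖ = ‖(m : ℚ_[p])‖ := by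
  rw [← PadicComplex.norm_extends' p (m : ℚ_[p])]
  congr 1
  have h1 : ((m : ℚ_[p]) : PadicAlgCl p) = (m : PadicAlgCl p) :=
    map_natCast (algebraMap ℚ_[p] (PadicAlgCl p)) m
  rw [h1, PadicComplex.coe_natCast]

lemma norm_p : ‖(p : ℂ_[p])‖ = (p : ℝ)⁻¹ := by rw [norm_natCast, Padic.norm_p]

lemma norm_natCast_eq {m : ℕ} (hm : m ≠ 0) :
    ‖(m : ℂ_[p])‖ = ((p : ℝ) ^ padicValNat p m)⁻¹ := by
  rw [norm_natCast, Padic.norm_eq_zpow_neg_valuation (by exact_mod_cast hm),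
    Padic.valuation_natCast, zpow_neg, zpow_natCast]

lemma p_pos : (0 : ℝ) < p := by exact_mod_cast (Fact.out : p.Prime).pos

/-- The power of `p` dividing `m` is at most `m`. Division by nonzero integers therefore costs only
linear growth, which overconvergence tolerates. -/
lemma one_le_natCast_mul_norm {m : ℕ} (hm : m ≠ 0) : 1 ≤ (m : ℝ) * ‖(m : ℂ_[p])‖ := by
  have hp := p_pos (p := p)
  rw [norm_natCast_eq hm, ← div_eq_mul_inv, one_le_div (by positivity)]
  exact_mod_cast Nat.le_of_dvd (Nat.pos_of_ne_zero hm) pow_padicValNat_dvd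

lemma norm_intCast_inv_le (m : ℤ) : ‖(m : ℂ_[p])⁻¹‖ ≤ m.natAbs := by
  by_cases hm : m = 0
  · simp [hm]
  have h1 := one_le_natCast_mul_norm (p := p) (m := m.natAbs) (by simpa using hm)
  have h2 : ‖((m.natAbs : ℕ) : ℂ_[p])‖ = ‖(m : ℂ_[p])‖ := by
    rcases Int.natAbs_eq m with h | h
    · conv_rhs => rw [h]
      rw [Int.cast_natCast]
    · conv_rhs => rw [h]
      rw [Int.cast_neg, Int.cast_natCast, norm_neg]
  rw [h2] at h1
  have h3 : 0 < ‖(m : ℂ_[p])‖ := norm_pos_iff.2 (by exact_mod_cast hm)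
  rw [norm_inv, inv_le_iff_one_le_mul₀ h3]
  exact h1

section Pi
variable {π : ℂ_[p]} (hπ : π ^ (p - 1) = -p)
include hπ

lemma norm_pi_pow : ‖π‖ ^ (p - 1) = (p : ℝ)⁻¹ := by
  rw [← norm_pow, hπ, norm_neg, norm_p]

lemma pi_ne_zero : π ≠ 0 := by
  rintro rfl
  have hp := (Fact.out : p.Prime).two_le
  rw [zero_pow (by omega), eq_comm, neg_eq_zero] at hπ
  exact (Fact.out : p.Prime).ne_zero (by exact_mod_cast hπ)

lemma norm_pi_lt_one : ‖π‖ < 1 := by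
  have h := norm_pi_pow hπ
  by_contra! hc
  have h1 := one_le_pow₀ hc (n := p - 1)
  rw [h] at h1
  have : (1 : ℝ) < p := by exact_mod_cast (Fact.out : p.Prime).one_lt
  exact absurd h1 (not_le.2 (inv_lt_one_of_one_lt₀ this))

/-- Legendre's formula `(p - 1) v(i!) = i - s(i)`, with `s(i)` the sum of the digits in base `p`,
combined with `‖π‖ ^ (p - 1) = 1 / p`. Raising to the power `p - 1` avoids fractional exponents. -/
lemma norm_factorial_pow (i : ℕ) :
    ‖((i.factorial : ℕ) : ℂ_[p])‖ ^ (p - 1) =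
      (‖π‖ ^ i) ^ (p - 1) * (p : ℝ) ^ (p.digits i).sum := by
  have hp := p_pos (p := p)
  rw [norm_natCast_eq i.factorial_ne_zero, inv_pow, ← pow_mul, mul_comm (padicValNat _ _),
    sub_one_mul_padicValNat_factorial, ← pow_mul, mul_comm i, pow_mul, norm_pi_pow hπ, inv_pow,
    inv_mul_eq_div, eq_div_iff (by positivity), inv_mul_eq_div, div_eq_iff (by positivity),
    ← pow_add, Nat.add_sub_cancel' (Nat.digit_sum_le p i)]

lemma norm_pi_pow_le_factorial (i : ℕ) : ‖π‖ ^ i ≤ ‖((i.factorial : ℕ) : ℂ_[p])‖ := by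
  have hp := (Fact.out : p.Prime).two_le
  rw [← pow_le_pow_iff_left₀ (by positivity) (norm_nonneg _) (show p - 1 ≠ 0 by omega),
    norm_factorial_pow hπ]
  refine le_mul_of_one_le_right (by positivity) (one_le_pow₀ ?_)
  exact_mod_cast (Fact.out : p.Prime).one_le

lemma norm_pi_pow_div_factorial_le (i : ℕ) : ‖π ^ i / ((i.factorial : ℕ) : ℂ_[p])‖ ≤ 1 := by
  rw [norm_div, norm_pow]
  refine div_le_one_of_le₀ (norm_pi_pow_le_factorial hπ i) (norm_nonneg _)

/-- The digit sum is at most `p - 1` times the number of digits, and `p` to the number of digits is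
at most `p (i + 1)`. Thus `i! / π ^ i` grows at most linearly, which makes the formal inverse of
`D_x x` overconvergent. -/
lemma norm_factorial_le (i : ℕ) :
    ‖((i.factorial : ℕ) : ℂ_[p])‖ ≤ p * ((i : ℝ) + 1) * ‖π‖ ^ i := by
  have hp := (Fact.out : p.Prime).two_le
  have hp0 := p_pos (p := p)
  rw [← pow_le_pow_iff_left₀ (norm_nonneg _) (by positivity) (show p - 1 ≠ 0 by omega),
    norm_factorial_pow hπ, mul_pow, mul_comm]
  gcongr
  have h1 : (p.digits i).sum ≤ (p.digits i).length * (p - 1) := by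
    have := List.sum_le_card_nsmul (p.digits i) (p - 1) fun d hd => by
      have := Nat.digits_lt_base (by omega) hd
      omega
    simpa using this
  have h2 : p ^ (p.digits i).length ≤ p * (i + 1) := by
    rcases Nat.eq_zero_or_pos i with rfl | hi
    · simp; omega
    · have := Nat.base_pow_length_digits_le p i (by omega) hi.ne'
      nlinarith
  calc (p : ℝ) ^ (p.digits i).sum ≤ (p : ℝ) ^ ((p.digits i).length * (p - 1)) := by
        refine pow_le_pow_right₀ ?_ h1
        exact_mod_cast (Fact.out : p.Prime).one_le
    _ = ((p ^ (p.digits i).length : ℕ) : ℝ) ^ (p - 1) := by rw [pow_mul]; push_cast; rfl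
    _ ≤ ((p * (i + 1) : ℕ) : ℝ) ^ (p - 1) := by gcongr
    _ = _ := by push_cast; rfl

/-- Rising factorials divided by powers of `π`, with alternating sign. -/
def radialCoeff (π : ℂ_[p]) (m : ℤ) (l : ℕ) : ℂ_[p] :=
  ∏ j ∈ Finset.range l, (-((m : ℂ_[p]) + 2 + j) / π)

omit hπ in
lemma radialCoeff_zero (m : ℤ) : radialCoeff π m 0 = 1 := by simp [radialCoeff]

omit hπ in
-- Splitting off the factor with `j = 0`, rather than the last one, gives the recursion along `t x
-- y` that makes the series for the inverse of `D_x x` telescope.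
lemma radialCoeff_succ (m : ℤ) (l : ℕ) :
    radialCoeff π m (l + 1) = -((m : ℂ_[p]) + 2) / π * radialCoeff π (m + 1) l := by
  unfold radialCoeff
  rw [Finset.prod_range_succ', mul_comm]
  congr 1
  · simp
  · refine Finset.prod_congr rfl fun j _ => ?_
    push_cast
    ring

/-- For `m ≥ 0` the rising factorial is `l!` times the binomial coefficient of `m + 1 + l` over `l`.
The binomial coefficient is integral, and `l! / π ^ l` has at most linear growth. -/
lemma norm_radialCoeff_le {m : ℤ} (hm : 0 ≤ m) (l : ℕ) :
    ‖radialCoeff π m l‖ ≤ p * ((l : ℝ) + 1) := by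
  obtain ⟨m, rfl⟩ := Int.eq_ofNat_of_zero_le hm
  have h0 : radialCoeff π m l = (-1) ^ l * ((m + 1 + l).choose l : ℂ_[p]) *
      ((l.factorial : ℕ) : ℂ_[p]) / π ^ l := by
    have h1 : ∏ j ∈ Finset.range l, ((m : ℂ_[p]) + 2 + j) =
        (l.factorial : ℂ_[p]) * ((m + 1 + l).choose l : ℂ_[p]) := by
      rw [← Nat.cast_mul, ← Nat.ascFactorial_eq_factorial_mul_choose, Nat.ascFactorial_eq_prod_range]
      push_cast
      refine Finset.prod_congr rfl fun j _ => by ring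
    unfold radialCoeff
    rw [Finset.prod_div_distrib, Finset.prod_const, Finset.card_range, mul_assoc,
      mul_comm ((Nat.choose _ _ : ℕ) : ℂ_[p]), ← h1]
    congr 1
    rw [Int.cast_natCast, Finset.prod_neg, Finset.card_range]
  have hpi : 0 < ‖π‖ := norm_pos_iff.2 (pi_ne_zero hπ)
  rw [h0, norm_div, norm_mul, norm_mul, norm_pow, norm_pow, norm_neg, norm_one, one_pow, one_mul,
    div_le_iff₀ (by positivity)]
  have h2 : ‖((m + 1 + l).choose l : ℂ_[p])‖ ≤ 1 := by
    exact_mod_cast norm_int_le_one (p := p) ((m + 1 + l).choose l)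
  refine le_trans ?_ (norm_factorial_le hπ l)
  exact mul_le_of_le_one_left (norm_nonneg _) h2

end Pi

/-! ### The differential operators of the threefold -/

/-- The exponent of a single coordinate. -/
abbrev coord (i : Fin n) : Expo κ n := unitExpo (Sum.inr i)

lemma coord_apply (i j : Fin n) : (coord i : Expo κ n) (Sum.inr j) = if j = i then 1 else 0 := by
  refine (unitExpo_apply _ _).trans ?_; simp

lemma coord_inl (i : Fin n) (k : κ) : (coord i : Expo κ n) (Sum.inl k) = 0 := by
  refine (unitExpo_apply _ _).trans ?_; simp

lemma admissible_coord (B : ParamDomain κ) (A : Set (Fin n)) (i : Fin n) :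
    Admissible B A (coord i) :=
  ⟨fun k _ => by rw [coord_inl], fun j _ => by rw [coord_apply]; split_ifs <;> norm_num⟩

/-- The coordinates `u`, `v` among `t, u, v, x, y`. -/
abbrev uvEmb : Fin 2 ↪o Fin 5 := (Fin.succOrderEmb 2).trans (Fin.castLEOrderEmb (by norm_num))

/-- The coordinates `t`, `u`, `v` among `t, u, v, x, y`. -/
abbrev tuvEmb : Fin 3 ↪o Fin 5 := Fin.castLEOrderEmb (by norm_num)

lemma mem_range_uvEmb (i : Fin 5) : i ∈ Set.range uvEmb ↔ i = 1 ∨ i = 2 := by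
  constructor
  · rintro ⟨j, rfl⟩; fin_cases j <;> simp [uvEmb]
  · rintro (rfl | rfl)
    · exact ⟨0, rfl⟩
    · exact ⟨1, rfl⟩

lemma mem_range_tuvEmb (i : Fin 5) : i ∈ Set.range tuvEmb ↔ i ≠ 3 ∧ i ≠ 4 := by
  constructor
  · rintro ⟨j, rfl⟩; fin_cases j <;> decide
  · intro h
    fin_cases i
    · exact ⟨0, rfl⟩
    · exact ⟨1, rfl⟩
    · exact ⟨2, rfl⟩
    · exact absurd rfl h.1
    · exact absurd rfl h.2

/-- The affine coordinates of the threefold. -/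
abbrev affX : Set (Fin 5) := insert 0 (Fin.succ '' ({2, 3} : Set (Fin 4)))

/-- The affine coordinates of the curve. -/
abbrev affC : Set (Fin 3) := insert 0 (Fin.succ '' (∅ : Set (Fin 2)))

lemma mem_affX (i : Fin 5) : i ∈ affX ↔ i = 0 ∨ i = 3 ∨ i = 4 := by
  simp only [affX, Set.mem_insert_iff, Set.mem_image, Set.mem_singleton_iff, exists_eq_or_imp,
    exists_eq_left]
  constructor
  · rintro (h | h | h)
    · exact Or.inl h
    · exact Or.inr (Or.inl h.symm)
    · exact Or.inr (Or.inr h.symm)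
  · rintro (h | h | h)
    · exact Or.inl h
    · exact Or.inr (Or.inl h.symm)
    · exact Or.inr (Or.inr h.symm)

lemma mem_affC (i : Fin 3) : i ∈ affC ↔ i = 0 := by simp [affC]

/-- The exponent of `t x y`. -/
abbrev txy : Expo κ 5 := coord 0 + coord 3 + coord 4

lemma phase_eq (π : ℂ_[p]) (f : Poly p κ n) : phase π f =
    AddMonoidAlgebra.single (coord 0) π * polyMap (Fin.succOrderEmb n) f := rfl

lemma polyMap_phase (π : ℂ_[p]) (P : Poly p κ 2) : polyMap tuvEmb (phase π P) =
    AddMonoidAlgebra.single (coord 0) π * polyMap uvEmb P := by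
  rw [phase_eq, polyMap_mul, polyMap_single, polyMap_polyMap, expoMap_unitExpo]
  rfl

lemma phase_threefoldEq (π : ℂ_[p]) (P : Poly p κ 2) : phase π (threefoldEq P) =
    AddMonoidAlgebra.single txy π + polyMap tuvEmb (phase π P) := by
  rw [phase_eq, polyMap_phase, threefoldEq, polyMap_add, polyMap_single, polyMap_polyMap, mul_add,
    AddMonoidAlgebra.single_mul_single, expoMap_add, expoMap_unitExpo, expoMap_unitExpo, mul_one,
    ← add_assoc]
  rfl

section Operators
variable (π : ℂ_[p]) (P : Poly p κ 2)

lemma twistedDeriv_threefold (i : κ ⊕ Fin 5) (a : Series p κ 5) :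
    twistedDeriv (phase π (threefoldEq P)) i a =
      twistedDeriv (polyMap tuvEmb (phase π P)) i a +
        ((txy i : ℂ_[p]) * π) • mon (txy - unitExpo i) a := by
  rw [phase_threefoldEq, add_comm (AddMonoidAlgebra.single _ _), twistedDeriv_add_left,
    polyDeriv_single, mulPoly_single]
  congr 1
  rw [mon, mulPoly_single, one_smul]
  rfl

lemma twistedDeriv_threefold_of_eq_zero {i : κ ⊕ Fin 5} (hi : (txy : Expo κ 5) i = 0)
    (a : Series p κ 5) : twistedDeriv (phase π (threefoldEq P)) i a =
      twistedDeriv (polyMap tuvEmb (phase π P)) i a := by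
  rw [twistedDeriv_threefold, hi]; simp

lemma twistedDeriv_x_apply (a : Series p κ 5) (I : Expo κ 5) :
    twistedDeriv (phase π (threefoldEq P)) (Sum.inr 3) a I =
      ((I (Sum.inr 3) : ℂ_[p]) + 1) * a (I + coord 3) + π * a (I - coord 0 - coord 4) := by
  rw [twistedDeriv_threefold, twistedDeriv_apply, polyDeriv_polyMap_of_notMem _
    (by rw [mem_range_tuvEmb]; decide), mulPoly_zero, LinearMap.zero_apply, add_zero]
  rw [Pi.add_apply, Pi.smul_apply, mon_apply, deriv_apply]
  congr 1
  simp only [Pi.add_apply, coord_apply]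
  rw [show I - (coord 0 + coord 3 + coord 4 - coord 3) = I - coord 0 - coord 4 by abel]
  simp

lemma twistedDeriv_y_apply (a : Series p κ 5) (I : Expo κ 5) :
    twistedDeriv (phase π (threefoldEq P)) (Sum.inr 4) a I =
      ((I (Sum.inr 4) : ℂ_[p]) + 1) * a (I + coord 4) + π * a (I - coord 0 - coord 3) := by
  rw [twistedDeriv_threefold, twistedDeriv_apply, polyDeriv_polyMap_of_notMem _
    (by rw [mem_range_tuvEmb]; decide), mulPoly_zero, LinearMap.zero_apply, add_zero]
  rw [Pi.add_apply, Pi.smul_apply, mon_apply, deriv_apply]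
  congr 1
  simp only [Pi.add_apply, coord_apply]
  rw [show I - (coord 0 + coord 3 + coord 4 - coord 4) = I - coord 0 - coord 3 by abel]
  simp

lemma polyDeriv_t_phase : polyDeriv (Sum.inr 0) (polyMap tuvEmb (phase π P)) =
    π • polyMap uvEmb P := by
  have h : (AddMonoidAlgebra.single 0 π : Poly p κ 5) = π • 1 := by
    rw [AddMonoidAlgebra.one_def, AddMonoidAlgebra.smul_single, smul_eq_mul, mul_one]
  rw [polyMap_phase, polyDeriv_mul, polyDeriv_single, polyDeriv_polyMap_of_notMem _
    (by rw [mem_range_uvEmb]; decide), mul_zero, add_zero, sub_self,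
    show (coord 0 : Expo κ 5) (Sum.inr 0) = 1 from unitExpo_same _, Int.cast_one, one_mul, h,
    smul_mul_assoc, one_mul]

lemma twistedDeriv_t_apply (a : Series p κ 5) (I : Expo κ 5) :
    twistedDeriv (phase π (threefoldEq P)) (Sum.inr 0) a I =
      ((I (Sum.inr 0) : ℂ_[p]) + 1) * a (I + coord 0) +
        π * (a (I - coord 3 - coord 4) + mulPoly (polyMap uvEmb P) a I) := by
  rw [twistedDeriv_threefold, twistedDeriv_apply, polyDeriv_t_phase, mulPoly_smul,
    LinearMap.smul_apply]
  rw [Pi.add_apply, Pi.smul_apply, mon_apply, Pi.add_apply, deriv_apply, Pi.smul_apply]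
  simp only [Pi.add_apply, coord_apply, smul_eq_mul]
  rw [show I - (coord 0 + coord 3 + coord 4 - coord 0) = I - coord 3 - coord 4 by abel]
  simp
  ring

/-- The operator `D_x x` of the threefold. -/
lemma radial_apply (a : Series p κ 5) (I : Expo κ 5) :
    twistedDeriv (phase π (threefoldEq P)) (Sum.inr 3) (mon (coord 3) a) I =
      ((I (Sum.inr 3) : ℂ_[p]) + 1) * a I + π * a (I - txy) := by
  rw [twistedDeriv_x_apply, mon_apply, mon_apply, add_sub_cancel_right]
  rw [show I - coord 0 - coord 4 - coord 3 = I - txy by simp only [txy]; abel]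

lemma radial_apply' (a : Series p κ 5) (I : Expo κ 5) :
    twistedDeriv (phase π (threefoldEq P)) (Sum.inr 4) (mon (coord 4) a) I =
      ((I (Sum.inr 4) : ℂ_[p]) + 1) * a I + π * a (I - txy) := by
  rw [twistedDeriv_y_apply, mon_apply, mon_apply, add_sub_cancel_right]
  rw [show I - coord 0 - coord 3 - coord 4 = I - txy by simp only [txy]; abel]

end Operators

lemma AdmissiblePoly.polyMap {m : ℕ} {B : ParamDomain κ} {A : Set (Fin m)} {A' : Set (Fin n)}
    (e : Fin m ↪o Fin n) (hA : ∀ i, e i ∈ A' → i ∈ A) {f : Poly p κ m}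
    (hf : AdmissiblePoly B A f) : AdmissiblePoly B A' (polyMap e f) := by
  intro J hJ
  have hJ' : J ∈ Set.range (expoMap (κ := κ) e) := by
    by_contra h
    exact hJ (Finsupp.mapDomain_of_notMem_range _ _ h)
  obtain ⟨K, rfl⟩ := hJ'
  have : (Dwork.polyMap e f).coeff (expoMap e K) = f.coeff K :=
    Finsupp.mapDomain_apply (expoMap_injective e) _ _
  rw [this] at hJ
  refine ⟨fun k hk => by rw [expoMap_inl]; exact (hf K hJ).1 k hk, fun i hi => ?_⟩
  by_cases h : i ∈ Set.range e
  · obtain ⟨j, rfl⟩ := h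
    rw [expoMap_inr]; exact (hf K hJ).2 j (hA j hi)
  · rw [expoMap_of_notMem e K h]

lemma AdmissiblePoly.phase {B : ParamDomain κ} {A : Set (Fin n)} {f : Poly p κ n}
    (hf : AdmissiblePoly B A f) (π : ℂ_[p]) :
    AdmissiblePoly B (insert 0 (Fin.succ '' A)) (phase π f) := by
  refine (admissiblePoly_single (admissible_coord _ _ 0) π).mul (hf.polyMap _ fun i hi => ?_)
  simpa using hi

lemma AdmissiblePoly.threefoldEq {B : ParamDomain κ} {P : Poly p κ 2}
    (hP : AdmissiblePoly B ∅ P) : AdmissiblePoly B {2, 3} (threefoldEq P) := by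
  refine (admissiblePoly_single ((admissible_coord _ _ 2).add (admissible_coord _ _ 3)) 1).add
    (hP.polyMap _ fun i hi => ?_)
  fin_cases i <;> simp at hi

/-! ### Normal forms for the radial operator -/

lemma tendsto_mul_pow_add (C : ℝ) {r : ℝ} (hr : 0 < r) (hr1 : r < 1) (s : ℕ) :
    Tendsto (fun l : ℕ => C * r ^ (s + l)) atTop (𝓝 0) := by
  simp only [pow_add, ← mul_assoc]
  simpa using (tendsto_pow_atTop_nhds_zero_of_lt_one hr.le hr1).const_mul (C * r ^ s)

lemma size_add_of {I J : Expo κ n} (h : ∀ i, J i = 0 ∨ 0 ≤ I i ∧ 0 ≤ J i) :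
    size (I + J) = size I + size J := by
  unfold size
  rw [← Finset.sum_add_distrib]
  refine Finset.sum_congr rfl fun i _ => ?_
  rw [Pi.add_apply]
  rcases h i with h | h
  · simp [h]
  · omega

/-- Exponents with nonnegative exponents of the affine coordinates of the threefold. -/
def affineCone (I : Expo κ 5) : Prop := 0 ≤ I (Sum.inr 0) ∧ 0 ≤ I (Sum.inr 3) ∧ 0 ≤ I (Sum.inr 4)

lemma affineCone_of_admissible {B : ParamDomain κ} {I : Expo κ 5} (h : Admissible B affX I) :
    affineCone I :=
  ⟨h.2 0 ((mem_affX _).2 (by simp)), h.2 3 ((mem_affX _).2 (by simp)),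
    h.2 4 ((mem_affX _).2 (by simp))⟩

lemma admissible_iff_affineCone {B : ParamDomain κ} {I : Expo κ 5} :
    Admissible B affX I ↔ (∀ k ∈ B.nonneg, 0 ≤ I (Sum.inl k)) ∧ affineCone I := by
  refine ⟨fun h => ⟨h.1, affineCone_of_admissible h⟩, fun h => ⟨h.1, fun i hi => ?_⟩⟩
  rcases (mem_affX i).1 hi with rfl | rfl | rfl
  exacts [h.2.1, h.2.2.1, h.2.2.2]

lemma size_add_nsmul {I M : Expo κ 5} (hI : affineCone I) (h1 : ∀ i, 0 ≤ M i)
    (h2 : ∀ i, i ∉ affX → M (Sum.inr i) = 0) (h3 : ∀ k, M (Sum.inl k) = 0) (l : ℕ) :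
    size (I + l • M) = size I + l * size M := by
  rw [size_add_of, size_nsmul]
  rintro (k | i)
  · left; simp [h3]
  · by_cases hi : i ∈ affX
    · right
      refine ⟨?_, nsmul_nonneg (h1 _) _⟩
      rcases (mem_affX i).1 hi with rfl | rfl | rfl
      exacts [hI.1, hI.2.1, hI.2.2]
    · left; simp [h2 i hi]

lemma size_add_nsmul_txy {I : Expo κ 5} (hI : affineCone I) (l : ℕ) :
    size I + l ≤ size (I + l • (txy : Expo κ 5)) := by
  rw [size_add_nsmul hI]
  · have : 1 ≤ size (txy : Expo κ 5) := by
      refine le_trans ?_ (natAbs_le_size _ (Sum.inr 0))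
      simp [coord_apply]
    nlinarith
  · rintro (k | i)
    · simp [coord_inl]
    · simp only [Pi.add_apply, coord_apply]; split_ifs <;> norm_num
  · intro i hi
    rw [mem_affX] at hi
    push Not at hi
    simp [coord_apply, hi.1, hi.2.1, hi.2.2]
  · intro k; simp [coord_inl]

lemma weight_add_nsmul {ρ : κ → ℝ} (I M : Expo κ n) (h3 : ∀ k, M (Sum.inl k) = 0) (l : ℕ) :
    weight ρ (I + l • M) = weight ρ I := by
  unfold weight
  refine Finset.prod_congr rfl fun k _ => by simp [h3]

section Radial
variable {π : ℂ_[p]} (hπ : π ^ (p - 1) = -p) {B : ParamDomain κ} (P : Poly p κ 2)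
include hπ

/-- On the cone of nonnegative affine exponents there is no cancellation, so translation by `l •
txy` raises the size by at least `l`. The decay of `g` then beats the linear growth of the
coefficients, uniformly in `I` and `l`. -/
lemma norm_radialCoeff_mul_le {ρ : κ → ℝ} (hρ : ∀ k, 0 < ρ k) {g : Series p κ 5}
    (hg : Decays ρ g) : ∃ C r : ℝ, 0 < r ∧ r < 1 ∧ 0 ≤ C ∧ ∀ I : Expo κ 5, affineCone I →
      ∀ l : ℕ, ‖radialCoeff π (I (Sum.inr 3)) l * g (I + l • txy)‖ * weight ρ I ≤
        C * r ^ (size I + l) := by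
  obtain ⟨C, r, hr, hr1, h⟩ := hg
  have hC := Decays.nonneg hρ h
  obtain ⟨K, q, hq, hq1, hK0, hK⟩ := exists_succ_mul_pow_le hr hr1
  have hp := p_pos (p := p)
  refine ⟨p * C * K, q, hq, hq1, by positivity, fun I hI l => ?_⟩
  have h1 := h (I + l • txy)
  rw [weight_add_nsmul I txy (by simp [coord_inl])] at h1
  have h2 := norm_radialCoeff_le hπ hI.2.1 l
  rw [norm_mul, mul_assoc]
  calc _ ≤ (p * ((l : ℝ) + 1)) * (C * r ^ (size (I + l • (txy : Expo κ 5)))) :=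
        mul_le_mul h2 h1 (mul_nonneg (norm_nonneg _) (weight_pos hρ I).le) (by positivity)
    _ ≤ (p * (((size I + l : ℕ) : ℝ) + 1)) * (C * r ^ (size I + l)) := by
        have h3 := pow_le_pow_of_le_one hr.le hr1.le (size_add_nsmul_txy hI l)
        gcongr ?_ * ?_ * (_ * ?_)
        push_cast; linarith [(size I).cast_nonneg (α := ℝ)]
    _ = p * C * ((((size I + l : ℕ) : ℝ) + 1) * r ^ (size I + l)) := by ring
    _ ≤ p * C * (K * q ^ (size I + l)) := mul_le_mul_of_nonneg_left (hK _) (by positivity)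
    _ = _ := by ring

/-- Every overconvergent function is congruent modulo the image of `D_x` to one without monomials
divisible by `t x y`. -/
lemma exists_radial {g : Series p κ 5} (hg : g ∈ overconvergent p B affX) :
    ∃ G ∈ overconvergent p B affX, ∀ I : Expo κ 5, affineCone (I - txy) →
      twistedDeriv (phase π (threefoldEq P)) (Sum.inr 3) (mon (coord 3) G) I = g I := by
  have hpi := pi_ne_zero hπ
  -- The equation at the exponent `I + txy` reads `(I_x + 2) G (I + txy) + π G I = g (I + txy)`.
  -- Solving for `G I` and iterating upwards along `txy` gives this series.
  let G : Series p κ 5 := fun I => if affineCone I then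
    ∑' l : ℕ, radialCoeff π (I (Sum.inr 3)) l * g (I + txy + l • txy) / π else 0
  have hG : ∀ I, affineCone I → G I =
      ∑' l : ℕ, radialCoeff π (I (Sum.inr 3)) l * g (I + txy + l • txy) / π :=
    fun I hI => if_pos hI
  set g' : Series p κ 5 := mon (-txy) g with hg'
  have hg'a : ∀ I, g' I = g (I + txy) := fun I => by rw [hg', mon_apply, sub_neg_eq_add]
  have hterm : ∀ (I : Expo κ 5) (l : ℕ),
      radialCoeff π (I (Sum.inr 3)) l * g (I + txy + l • txy) / π =
      π⁻¹ * (radialCoeff π (I (Sum.inr 3)) l * g' (I + l • txy)) := fun I l => by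
    rw [hg'a, add_right_comm]; field_simp
  refine ⟨G, ⟨fun I hI => ?_, fun ρ hρ => ?_⟩, fun I hI => ?_⟩
  · have hI' : affineCone I := by
      by_contra h
      exact hI (if_neg h)
    refine admissible_iff_affineCone.2 ⟨?_, hI'⟩
    rw [hG I hI'] at hI
    obtain ⟨l, hl⟩ : ∃ l : ℕ, g (I + txy + l • txy) ≠ 0 := by
      by_contra! h
      exact hI (by simp only [h, mul_zero, zero_div, tsum_zero])
    have := (admissible_of_mem hg hl).1
    simpa [coord_inl] using this
  · have hρ' := B.radii_pos ρ hρ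
    obtain ⟨C, r, hr, hr1, hC, h⟩ := norm_radialCoeff_mul_le hπ hρ'
      ((decays_of_mem hg hρ).mulPoly hρ' (AddMonoidAlgebra.single (-txy) 1))
    refine ⟨‖π⁻¹‖ * C, r, hr, hr1, fun I => ?_⟩
    by_cases hI : affineCone I
    · have hw := weight_pos hρ' I
      rw [hG I hI, ← le_div_iff₀ hw]
      refine IsUltrametricDist.norm_tsum_le_of_forall_le_of_nonneg (by positivity) fun l => ?_
      rw [hterm, norm_mul, le_div_iff₀ hw, mul_assoc, mul_assoc]
      refine mul_le_mul_of_nonneg_left ((h I hI l).trans ?_) (norm_nonneg _)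
      gcongr _ * ?_
      exact pow_le_pow_of_le_one hr.le hr1.le (Nat.le_add_right _ _)
    · rw [show G I = 0 from if_neg hI, norm_zero, zero_mul]; positivity
  · rw [radial_apply]
    have hI' : affineCone I := by
      obtain ⟨h1, h2, h3⟩ := hI
      simp [coord_apply] at h1 h2 h3
      exact ⟨by omega, by omega, by omega⟩
    obtain ⟨ρ, hρ⟩ := B.radii_nonempty
    have hρ' := B.radii_pos ρ hρ
    obtain ⟨C, r, hr, hr1, hC, h⟩ := norm_radialCoeff_mul_le hπ hρ'
      ((decays_of_mem hg hρ).mulPoly hρ' (AddMonoidAlgebra.single (-txy) 1))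
    have hsum : Summable fun l : ℕ =>
        radialCoeff π ((I - txy : Expo κ 5) (Sum.inr 3)) l * g (I - txy + txy + l • txy) / π := by
      simp only [hterm]
      refine Summable.mul_left _ (summable_of_le_pow (s := id) (C := C / weight ρ (I - txy))
        (r := r) (by simpa using Nat.cofinite_eq_atTop ▸ tendsto_id) hr hr1 fun l => ?_)
      have hw := weight_pos hρ' (I - txy)
      rw [div_mul_eq_mul_div, le_div_iff₀ hw]
      refine (h _ hI l).trans ?_
      gcongr _ * ?_
      exact pow_le_pow_of_le_one hr.le hr1.le (Nat.le_add_left _ _)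
    have h3 : (I - txy : Expo κ 5) (Sum.inr 3) = I (Sum.inr 3) - 1 := by simp [coord_apply]
    -- The term `l = 0` of `π G (I - txy)` is `g I`; the other terms cancel against `(I_x + 1) G I`
    -- by `radialCoeff_succ`.
    rw [hG _ hI, hG _ hI', hsum.tsum_eq_zero_add, mul_add, ← tsum_mul_left, ← tsum_mul_left, h3,
      radialCoeff_zero, one_mul, zero_nsmul, add_zero, sub_add_cancel, mul_div_cancel₀ _ hpi,
      add_left_comm, add_eq_left, ← eq_neg_iff_add_eq_zero, ← tsum_neg]
    refine tsum_congr fun l => ?_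
    rw [radialCoeff_succ, sub_add_cancel, show I + txy + l • txy = I + (l + 1) • txy by
      rw [succ_nsmul]; abel]
    push_cast
    field_simp
    ring

/-- The operator `D_x x` is injective on the monomials divisible by `t x y`. -/
lemma radial_injective {G : Series p κ 5} (hG : G ∈ overconvergent p B affX)
    (h : ∀ I : Expo κ 5, affineCone (I - txy) →
      twistedDeriv (phase π (threefoldEq P)) (Sum.inr 3) (mon (coord 3) G) I = 0) : G = 0 := by
  have hpi := pi_ne_zero hπ
  -- The homogeneous recursion iterated `l` times. The right-hand side tends to zero as `l` grows,
  -- so no nonzero overconvergent solution exists.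
  have key : ∀ (l : ℕ) (I : Expo κ 5), affineCone I →
      G I = radialCoeff π (I (Sum.inr 3)) l * G (I + l • txy) := by
    intro l
    induction l with
    | zero => intro I _; simp [radialCoeff_zero]
    | succ l ih =>
      intro I hI
      have h1 := h (I + txy) (by rwa [add_sub_cancel_right])
      rw [radial_apply, add_sub_cancel_right] at h1
      have h3 : (I + txy : Expo κ 5) (Sum.inr 3) = I (Sum.inr 3) + 1 := by simp [coord_apply]
      have hI' : affineCone (I + txy) := by
        obtain ⟨h1, h2, h3⟩ := hI
        refine ⟨?_, ?_, ?_⟩ <;> simp [coord_apply] <;> omega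
      rw [ih _ hI', h3] at h1
      rw [radialCoeff_succ, show I + (l + 1) • txy = I + txy + l • txy by rw [succ_nsmul]; abel]
      push_cast at h1
      field_simp
      linear_combination h1
  ext I
  by_cases hI : affineCone I
  · obtain ⟨ρ, hρ⟩ := B.radii_nonempty
    have hρ' := B.radii_pos ρ hρ
    obtain ⟨C, r, hr, hr1, hC, hb⟩ := norm_radialCoeff_mul_le hπ hρ' (decays_of_mem hG hρ)
    have h1 : ∀ l : ℕ, ‖G I‖ * weight ρ I ≤ C * r ^ (size I + l) := fun l => by
      rw [key l I hI]; exact hb I hI l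
    have h3 := ge_of_tendsto' (tendsto_mul_pow_add C hr hr1 (size I)) h1
    have h4 := weight_pos hρ' I
    have h5 : ‖G I‖ ≤ 0 := by
      by_contra! h6
      exact absurd h3 (not_le.2 (mul_pos h6 h4))
    exact norm_le_zero_iff.1 h5
  · by_contra hne
    exact hI (affineCone_of_admissible (admissible_of_mem hG hne))

omit hπ in
/-- Functions without diagonal monomials are exact. -/
lemma exists_offDiagonal {s : Series p κ 5} (hs : s ∈ overconvergent p B affX)
    (h : ∀ I, I (Sum.inr 3) = I (Sum.inr 4) → s I = 0) : ∃ G ∈ overconvergent p B affX,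
      s = twistedDeriv (phase π (threefoldEq P)) (Sum.inr 3) (mon (coord 3) G) -
        twistedDeriv (phase π (threefoldEq P)) (Sum.inr 4) (mon (coord 4) G) := by
  -- The terms with `t x y` cancel in `D_x x - D_y y`, which acts on the coefficient at `I` as
  -- multiplication by `I_x - I_y`. On the diagonal the inverse takes the value zero, which is
  -- harmless because `s` vanishes there.
  refine ⟨fun I => ((I (Sum.inr 3) - I (Sum.inr 4) : ℤ) : ℂ_[p])⁻¹ * s I,
    overconvergent_of_translate hs 0 1 (fun I hI => admissible_of_mem hs (right_ne_zero_of_mul hI))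
      fun I => ?_, ?_⟩
  · rw [norm_mul, one_mul, sub_zero]
    gcongr
    refine (norm_intCast_inv_le _).trans ?_
    have h1 : (I (Sum.inr 3)).natAbs + (I (Sum.inr 4)).natAbs ≤ size I := by
      have := Finset.sum_le_univ_sum_of_nonneg (s := {Sum.inr 3, Sum.inr 4})
        (f := fun i => (I i).natAbs) fun _ => Nat.zero_le _
      rwa [Finset.sum_pair (by simp)] at this
    have h2 : (I (Sum.inr 3) - I (Sum.inr 4)).natAbs ≤ size I + 1 := by omega
    exact_mod_cast h2
  · ext I
    rw [Pi.sub_apply, radial_apply, radial_apply', add_sub_add_right_eq_sub, ← sub_mul]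
    by_cases hI : I (Sum.inr 3) = I (Sum.inr 4)
    · rw [h I hI]; simp
    · have : ((I (Sum.inr 3) - I (Sum.inr 4) : ℤ) : ℂ_[p]) ≠ 0 := by
        exact_mod_cast sub_ne_zero.2 hI
      rw [add_sub_add_right_eq_sub, ← Int.cast_sub, mul_inv_cancel_left₀ this]

end Radial

/-! ### Division by `x y + P` -/

lemma coeff_polyMap {m : ℕ} (e : Fin m ↪o Fin n) (f : Poly p κ m) {J : Expo κ n}
    (hJ : (polyMap e f).coeff J ≠ 0) : ∃ K, expoMap e K = J ∧ (polyMap e f).coeff J = f.coeff K := by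
  by_cases h : J ∈ Set.range (expoMap (κ := κ) e)
  · obtain ⟨K, rfl⟩ := h
    exact ⟨K, rfl, Finsupp.mapDomain_apply (expoMap_injective e) _ _⟩
  · exact absurd (Finsupp.mapDomain_of_notMem_range _ _ h) hJ

/-- A polynomial of Gauss norm at most one on the polycircle does not increase norms. Only the
translates that actually occur have to be bounded, so the estimate can be localised in the exponent
of `x`. -/
lemma norm_mulPoly_le {ρ : κ → ℝ} (hρ : ∀ k, 0 < ρ k) {f : Poly p κ n}
    (hf : ∀ J, ‖f.coeff J‖ * weight ρ J ≤ 1) {a : Series p κ n} {I : Expo κ n} {M : ℝ}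
    (hM : 0 ≤ M) (h : ∀ J, f.coeff J ≠ 0 → ‖a (I - J)‖ * weight ρ (I - J) ≤ M) :
    ‖mulPoly f a I‖ * weight ρ I ≤ M := by
  have hw := weight_pos hρ I
  rw [mulPoly_apply, ← le_div_iff₀ hw, Finsupp.sum]
  refine IsUltrametricDist.norm_sum_le_of_forall_le_of_nonneg (by positivity) fun J hJ => ?_
  rw [le_div_iff₀ hw, norm_mul, ← weight_sub_mul hρ I J]
  calc _ = (‖f.coeff J‖ * weight ρ J) * (‖a (I - J)‖ * weight ρ (I - J)) := by ring
    _ ≤ 1 * M := mul_le_mul (hf J) (h J (Finsupp.mem_support_iff.1 hJ))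
        (mul_nonneg (norm_nonneg _) (weight_pos hρ _).le) zero_le_one
    _ = M := one_mul M

lemma exists_size_le (f : Poly p κ n) : ∃ N : ℕ, ∀ J, f.coeff J ≠ 0 → size J ≤ N :=
  ⟨f.coeff.support.sup size, fun _ hJ => Finset.le_sup (Finsupp.mem_support_iff.2 hJ)⟩

section Division
variable {B : ParamDomain κ} {Q : Poly p κ 5} (hQ : AdmissiblePoly B affX Q)
  (hQ0 : ∀ J, Q.coeff J ≠ 0 → J (Sum.inr 0) = 0 ∧ J (Sum.inr 3) = 0 ∧ J (Sum.inr 4) = 0)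
  (hQint : ∀ ρ ∈ B.radii, ∀ J, ‖Q.coeff J‖ * weight ρ J ≤ 1)

/-- Multiplication by `-Q`. -/
def negMul (Q : Poly p κ 5) : Module.End ℂ_[p] (Series p κ 5) := -mulPoly Q

lemma negMul_pow_succ (l : ℕ) (A : Series p κ 5) :
    (negMul Q ^ (l + 1)) A = -mulPoly Q ((negMul Q ^ l) A) := by
  rw [pow_succ', Module.End.mul_apply]; rfl

include hQ in
lemma negMul_pow_mem {A : Series p κ 5} (hA : A ∈ overconvergent p B affX) (l : ℕ) :
    (negMul Q ^ l) A ∈ overconvergent p B affX := by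
  induction l with
  | zero => simpa
  | succ l ih => rw [negMul_pow_succ]; exact neg_mem (mulPoly_mem hQ ih)

/-- The exponent of `x y`. -/
abbrev xy : Expo κ 5 := coord 3 + coord 4

include hQ0 hQint in
-- Each multiplication by `Q` keeps the norm but may move exponents by up to `N`, so it spoils a
-- decay estimate by a factor `q ^ (-N)`. Since `Q` does not involve `x`, the exponent of `x` is
-- unchanged, and at `I + (l + 1) • xy` with `I` in the cone it is at least `l + 1`. Part of the
-- decay is therefore stored in this exponent to pay for `l` multiplications.
lemma norm_negMul_pow_le {ρ : κ → ℝ} (hρ : ρ ∈ B.radii) {A : Series p κ 5}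
    (hA : Decays ρ A) : ∃ C r : ℝ, 0 < r ∧ r < 1 ∧ 0 ≤ C ∧ ∀ I : Expo κ 5, affineCone I →
      ∀ l : ℕ, ‖(negMul Q ^ l) A (I + xy + l • xy)‖ * weight ρ I ≤ C * r ^ (size I + l) := by
  have hρ' := B.radii_pos ρ hρ
  obtain ⟨C, r, hr, hr1, h⟩ := hA
  have hC := Decays.nonneg hρ' h
  obtain ⟨N, hN⟩ := exists_size_le Q
  -- The exponent is `1 + (2 N + 1)`: one share of the decay is kept for the size and `2 N + 1`
  -- shares for the exponent of `x`.
  obtain ⟨q, hq, hq1, hqr⟩ : ∃ q : ℝ, 0 < q ∧ q < 1 ∧ q ^ (2 * N + 2) = r := by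
    refine ⟨r ^ (1 / ((2 * N + 2 : ℕ) : ℝ)), Real.rpow_pos_of_pos hr _,
      Real.rpow_lt_one hr.le hr1 (by positivity), ?_⟩
    rw [← Real.rpow_natCast, ← Real.rpow_mul hr.le, one_div_mul_cancel (by positivity),
      Real.rpow_one]
  have key : ∀ (l : ℕ) (I : Expo κ 5), q ^ (l * N) * (‖(negMul Q ^ l) A I‖ * weight ρ I) ≤
      C * q ^ (size I + (2 * N + 1) * (I (Sum.inr 3)).natAbs) := by
    intro l
    induction l with
    | zero =>
      intro I
      rw [zero_mul, pow_zero, pow_zero, one_mul]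
      refine (h I).trans ?_
      rw [← hqr, ← pow_mul]
      gcongr ?_ * ?_
      apply pow_le_pow_of_le_one hq.le hq1.le
      nlinarith [natAbs_le_size I (Sum.inr 3)]
    | succ l ih =>
      intro I
      rw [negMul_pow_succ, Pi.neg_apply, norm_neg, ← le_div_iff₀' (by positivity)]
      refine norm_mulPoly_le hρ' (hQint ρ hρ) (by positivity) fun J hJ => ?_
      rw [le_div_iff₀' (by positivity)]
      have h1 := ih (I - J)
      have h3 : (I - J) (Sum.inr 3) = I (Sum.inr 3) := by
        rw [Pi.sub_apply, (hQ0 J hJ).2.1, sub_zero]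
      rw [h3] at h1
      calc _ = q ^ N * (q ^ (l * N) * (‖(negMul Q ^ l) A (I - J)‖ * weight ρ (I - J))) := by
            rw [add_mul, one_mul, pow_add]; ring
        _ ≤ q ^ N * (C * q ^ (size (I - J) + (2 * N + 1) * (I (Sum.inr 3)).natAbs)) := by
            gcongr
        _ = C * q ^ (size (I - J) + N + (2 * N + 1) * (I (Sum.inr 3)).natAbs) := by
            rw [add_right_comm, pow_add _ _ N]; ring
        _ ≤ _ := by
            have h4 := size_le_sub_add I J
            have h5 := hN J hJ
            gcongr ?_ * ?_
            exact pow_le_pow_of_le_one hq.le hq1.le (by omega)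
  refine ⟨C, q, hq, hq1, hC, fun I hI l => ?_⟩
  have h1 := key l (I + xy + l • xy)
  have h2 : I + xy + l • xy = I + (l + 1) • xy := by rw [succ_nsmul]; abel
  have h3 : size I ≤ size (I + (l + 1) • (xy : Expo κ 5)) := by
    rw [size_add_nsmul hI]
    · omega
    · rintro (k | i)
      · simp [coord_inl]
      · simp only [Pi.add_apply, coord_apply]; split_ifs <;> norm_num
    · intro i hi
      rw [mem_affX] at hi
      push Not at hi
      simp [coord_apply, hi.2.1, hi.2.2]
    · intro k; simp [coord_inl]
  have h4 : l + 1 ≤ ((I + (l + 1) • xy : Expo κ 5) (Sum.inr 3)).natAbs := by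
    have := hI.2.1
    simp [coord_apply]
    omega
  rw [h2, weight_add_nsmul I xy (by simp [coord_inl])] at h1
  rw [h2]
  -- The stored exponent suffices because `(2 N + 1) (l + 1) ≥ l N + l`: it compensates the loss and
  -- leaves decay in `l`.
  have h5 : q ^ (l * N) * (‖(negMul Q ^ l) A (I + (l + 1) • xy)‖ * weight ρ I) ≤
      q ^ (l * N) * (C * q ^ (size I + l)) := by
    refine h1.trans ?_
    rw [mul_left_comm, ← pow_add]
    gcongr ?_ * ?_
    apply pow_le_pow_of_le_one hq.le hq1.le
    nlinarith
  exact le_of_mul_le_mul_left h5 (by positivity)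

/-- Exponents of powers of `x y`. -/
def onDiagonal (I : Expo κ 5) : Prop := I (Sum.inr 0) = 0 ∧ I (Sum.inr 3) = I (Sum.inr 4)

include hQ hQ0 hQint in
/-- Division with remainder by `x y + Q`. -/
lemma exists_division {A : Series p κ 5} (hA : A ∈ overconvergent p B affX)
    (hA0 : ∀ I, A I ≠ 0 → onDiagonal I) : ∃ b ∈ overconvergent p B affX,
      (∀ I, b I ≠ 0 → onDiagonal I) ∧
      ∀ I, A I - (b (I - xy) + mulPoly Q b I) ≠ 0 →
        I (Sum.inr 0) = 0 ∧ I (Sum.inr 3) = 0 ∧ I (Sum.inr 4) = 0 := by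
  -- The expansion of `A / (x y + Q)` in powers of `1 / (x y)`, namely the sum of `(-Q)^l A / (x
  -- y)^(l+1)`, truncated to nonnegative exponents.
  let b : Series p κ 5 := fun I => if onDiagonal I ∧ affineCone I then
    ∑' l : ℕ, (negMul Q ^ l) A (I + xy + l • xy) else 0
  have hb : ∀ I, onDiagonal I → affineCone I →
      b I = ∑' l : ℕ, (negMul Q ^ l) A (I + xy + l • xy) := fun I h h' => if_pos ⟨h, h'⟩
  have hb0 : ∀ I, b I ≠ 0 → onDiagonal I ∧ affineCone I := fun I hI => by
    by_contra h
    exact hI (if_neg h)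
  refine ⟨b, ⟨fun I hI => ?_, fun ρ hρ => ?_⟩, fun I hI => (hb0 I hI).1, fun I hI => ?_⟩
  · have hI' := hb0 I hI
    refine admissible_iff_affineCone.2 ⟨?_, hI'.2⟩
    rw [hb I hI'.1 hI'.2] at hI
    obtain ⟨l, hl⟩ : ∃ l : ℕ, (negMul Q ^ l) A (I + xy + l • xy) ≠ 0 := by
      by_contra! h
      exact hI (by simp only [h, tsum_zero])
    have := (admissible_of_mem (negMul_pow_mem hQ hA l) hl).1
    simpa [coord_inl] using this
  · have hρ' := B.radii_pos ρ hρ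
    obtain ⟨C, r, hr, hr1, hC, h⟩ := norm_negMul_pow_le hQ0 hQint hρ (decays_of_mem hA hρ)
    refine ⟨C, r, hr, hr1, fun I => ?_⟩
    by_cases hI : onDiagonal I ∧ affineCone I
    · have hw := weight_pos hρ' I
      rw [hb I hI.1 hI.2, ← le_div_iff₀ hw]
      refine IsUltrametricDist.norm_tsum_le_of_forall_le_of_nonneg (by positivity) fun l => ?_
      rw [le_div_iff₀ hw]
      refine (h I hI.2 l).trans ?_
      gcongr _ * ?_
      exact pow_le_pow_of_le_one hr.le hr1.le (Nat.le_add_right _ _)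
    · rw [show b I = 0 from if_neg hI, norm_zero, zero_mul]; positivity
  · have hd : onDiagonal I := by
      by_contra h
      refine hI ?_
      have h1 : A I = 0 := by by_contra hne; exact h (hA0 I hne)
      have h2 : b (I - xy) = 0 := by
        by_contra hne
        have := (hb0 _ hne).1
        simp [onDiagonal, coord_apply] at this
        exact h this
      have h3 : mulPoly Q b I = 0 := by
        by_contra hne
        obtain ⟨J, hJ, hJ'⟩ := mulPoly_ne_zero hne
        have := (hb0 _ hJ').1
        simp only [onDiagonal, Pi.sub_apply, hQ0 J hJ, sub_zero] at this
        exact h this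
      rw [h1, h2, h3]; simp
    -- At a positive power of `x y` the truncation plays no role: the term `l = 0` of `b (I - xy)`
    -- is `A I`, and the others cancel against `Q b`. So the remainder contains no positive power of
    -- `x y`.
    have h0 : ¬ 1 ≤ I (Sum.inr 3) := by
      intro h1
      refine hI ?_
      have hcone : affineCone I := ⟨hd.1.ge, by omega, by have := hd.2; omega⟩
      have hd' : onDiagonal (I - xy) := by
        have := hd.2
        simp [onDiagonal, coord_apply, hd.1, this]
      have hcone' : affineCone (I - xy) := by
        have := hd.2
        refine ⟨?_, ?_, ?_⟩ <;> simp [coord_apply, hd.1] <;> omega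
      have hsub : ∀ J, Q.coeff J ≠ 0 → onDiagonal (I - J) ∧ affineCone (I - J) := fun J hJ => by
        simpa only [onDiagonal, affineCone, Pi.sub_apply, hQ0 J hJ, sub_zero] using
          And.intro hd hcone
      obtain ⟨ρ, hρ⟩ := B.radii_nonempty
      obtain ⟨C, r, hr, hr1, hC, h⟩ := norm_negMul_pow_le hQ0 hQint hρ (decays_of_mem hA hρ)
      have hsum : ∀ K : Expo κ 5, affineCone K →
          Summable fun l : ℕ => (negMul Q ^ l) A (K + xy + l • xy) := fun K hK => by
        have hw := weight_pos (B.radii_pos ρ hρ) K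
        refine summable_of_le_pow (s := id) (C := C / weight ρ K)
          (r := r) (by simpa using Nat.cofinite_eq_atTop ▸ tendsto_id) hr hr1 fun l => ?_
        rw [div_mul_eq_mul_div, le_div_iff₀ hw]
        refine (h _ hK l).trans ?_
        gcongr _ * ?_
        exact pow_le_pow_of_le_one hr.le hr1.le (Nat.le_add_left _ _)
      have h2 : mulPoly Q b I = ∑' l : ℕ, mulPoly Q ((negMul Q ^ l) A) (I + xy + l • xy) := by
        rw [mulPoly_apply, Finsupp.sum]
        simp only [mulPoly_apply, Finsupp.sum]
        rw [Summable.tsum_finsetSum]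
        · refine Finset.sum_congr rfl fun J hJ => ?_
          have := hsub J (Finsupp.mem_support_iff.1 hJ)
          rw [hb _ this.1 this.2, ← tsum_mul_left]
          refine tsum_congr fun l => ?_
          rw [show I - J + xy + l • xy = I + xy + l • xy - J by abel]
        · intro J hJ
          have := hsub J (Finsupp.mem_support_iff.1 hJ)
          refine ((hsum _ this.2).mul_left (Q.coeff J)).congr fun l => ?_
          rw [show I - J + xy + l • xy = I + xy + l • xy - J by abel]
      have h3 := hsum _ hcone'
      rw [hb _ hd' hcone', h2, h3.tsum_eq_zero_add]
      simp only [zero_nsmul, add_zero, sub_add_cancel, pow_zero, Module.End.one_apply,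
        negMul_pow_succ, Pi.neg_apply, tsum_neg]
      have h4 : ∀ l : ℕ, I + (l + 1) • (xy : Expo κ 5) = I + xy + l • xy := fun l => by
        rw [succ_nsmul]; abel
      simp only [h4]
      ring
    have h4 : 0 ≤ I (Sum.inr 3) := by
      by_contra h1
      have h5 : ¬ affineCone I := fun h => h1 h.2.1
      refine hI ?_
      have h1 : A I = 0 := by
        by_contra hne
        exact h5 (affineCone_of_admissible (admissible_of_mem hA hne))
      have h2 : b (I - xy) = 0 := by
        by_contra hne
        have := (hb0 _ hne).2.2.1
        simp [coord_apply] at this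
        omega
      have h3 : mulPoly Q b I = 0 := by
        by_contra hne
        obtain ⟨J, hJ, hJ'⟩ := mulPoly_ne_zero hne
        have := (hb0 _ hJ').2.2.1
        simp only [Pi.sub_apply, hQ0 J hJ, sub_zero] at this
        omega
      rw [h1, h2, h3]; simp
    exact ⟨hd.1, by omega, by have := hd.2; omega⟩

include hQ0 hQint in
/-- A multiple of `x y + Q` has a nonconstant term in `x y`. -/
lemma division_injective {A : Series p κ 5} (hA : A ∈ overconvergent p B affX)
    (h : ∀ I : Expo κ 5, 1 ≤ I (Sum.inr 3) → A (I - xy) + mulPoly Q A I = 0) : A = 0 := by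
  obtain ⟨ρ, hρ⟩ := B.radii_nonempty
  have hρ' := B.radii_pos ρ hρ
  obtain ⟨C, r, hr, hr1, hb⟩ := decays_of_mem hA hρ
  have hC := Decays.nonneg hρ' hb
  -- The relation bounds `A` at a given exponent of `x` by its values at the next one, with no loss
  -- since `Q` has norm at most one. Climbing `l` steps gains the factor `r ^ l`.
  have key : ∀ (l : ℕ) (I : Expo κ 5), 0 ≤ I (Sum.inr 3) →
      ‖A I‖ * weight ρ I ≤ C * r ^ ((I (Sum.inr 3)).natAbs + l) := by
    intro l
    induction l with
    | zero =>
      intro I _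
      refine (hb I).trans ?_
      gcongr ?_ * ?_
      exact pow_le_pow_of_le_one hr.le hr1.le (natAbs_le_size I _)
    | succ l ih =>
      intro I hI
      have h3 : (I + xy : Expo κ 5) (Sum.inr 3) = I (Sum.inr 3) + 1 := by simp [coord_apply]
      have h1 := h (I + xy) (by omega)
      rw [add_sub_cancel_right] at h1
      have hw : weight ρ (I + xy) = weight ρ I := by
        simpa using weight_add_nsmul (ρ := ρ) I xy (by simp [coord_inl]) 1
      rw [eq_neg_of_add_eq_zero_left h1, norm_neg, ← hw]
      refine norm_mulPoly_le hρ' (hQint ρ hρ) (by positivity) fun J hJ => ?_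
      have h4 : (I + xy - J : Expo κ 5) (Sum.inr 3) = I (Sum.inr 3) + 1 := by
        rw [Pi.sub_apply, h3, (hQ0 J hJ).2.1, sub_zero]
      have := ih (I + xy - J) (by omega)
      rw [h4] at this
      convert this using 3
      omega
  ext I
  by_contra hne
  have hI := (affineCone_of_admissible (admissible_of_mem hA hne)).2.1
  have h3 := ge_of_tendsto' (tendsto_mul_pow_add C hr hr1 _) fun l => key l I hI
  exact absurd h3 (not_le.2 (mul_pos (norm_pos_iff.2 hne) (weight_pos hρ' I)))

end Division

/-! ### Residues -/

/-- Pullback of series, as a linear map. -/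
def seriesMapLin {m : ℕ} (e : Fin m ↪o Fin n) : Series p κ m →ₗ[ℂ_[p]] Series p κ n where
  toFun := seriesMap e
  map_add' := seriesMap_add e
  map_smul' := seriesMap_smul e

/-- The operators `D_i` of the threefold. -/
abbrev threefoldD (π : ℂ_[p]) (P : Poly p κ 2) (i : Fin 5) :
    Series p κ 5 →ₗ[ℂ_[p]] Series p κ 5 :=
  twistedDeriv (phase π (threefoldEq P)) (Sum.inr i)

/-- The operators `D_i` of the curve. -/
abbrev curveD (π : ℂ_[p]) (P : Poly p κ 2) (i : Fin 3) :
    Series p κ 3 →ₗ[ℂ_[p]] Series p κ 3 :=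
  twistedDeriv (phase π P) (Sum.inr i)

/-- The map `h ↦ t h` from functions of `t, u, v` to functions of `t, u, v, x, y`. -/
def curveLift : Series p κ 3 →ₗ[ℂ_[p]] Series p κ 5 := mon (coord 0) ∘ₗ seriesMapLin tuvEmb

lemma curveLift_apply (h : Series p κ 3) :
    curveLift h = mon (coord 0) (seriesMap tuvEmb h) := rfl

/-- The images of `D_t`, `D_x` and `D_y`. -/
def fibreExact (B : ParamDomain κ) (π : ℂ_[p]) (P : Poly p κ 2) :
    Submodule ℂ_[p] (Series p κ 5) :=
  (overconvergent p B affX).map (threefoldD π P 0) ⊔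
    ((overconvergent p B affX).map (threefoldD π P 3) ⊔
      (overconvergent p B affX).map (threefoldD π P 4))

/-- The kernel of the residue. -/
def resKernel (B : ParamDomain κ) (π : ℂ_[p]) (P : Poly p κ 2) :
    Submodule ℂ_[p] (Series p κ 5) :=
  (overconvergent p B affC).map curveLift ⊔ fibreExact B π P

lemma fibreExact_le_resKernel (B : ParamDomain κ) (π : ℂ_[p]) (P : Poly p κ 2) :
    fibreExact B π P ≤ resKernel B π P := le_sup_right

lemma fibreExact_le_exactTop (B : ParamDomain κ) (π : ℂ_[p]) (P : Poly p κ 2) :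
    fibreExact B π P ≤ exactTop B affX (phase π (threefoldEq P)) := by
  refine sup_le ?_ (sup_le ?_ ?_) <;> rintro _ ⟨a, ha, rfl⟩ <;>
    exact twistedDeriv_mem_exactTop _ _ ha

section
variable {B : ParamDomain κ} {π : ℂ_[p]} {P : Poly p κ 2} {a : Series p κ 5}

lemma t_mem_fibreExact (ha : a ∈ overconvergent p B affX) :
    threefoldD π P 0 a ∈ fibreExact B π P :=
  Submodule.mem_sup_left (Submodule.mem_map_of_mem ha)

lemma x_mem_fibreExact (ha : a ∈ overconvergent p B affX) :
    threefoldD π P 3 a ∈ fibreExact B π P :=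
  Submodule.mem_sup_right (Submodule.mem_sup_left (Submodule.mem_map_of_mem ha))

lemma y_mem_fibreExact (ha : a ∈ overconvergent p B affX) :
    threefoldD π P 4 a ∈ fibreExact B π P :=
  Submodule.mem_sup_right (Submodule.mem_sup_right (Submodule.mem_map_of_mem ha))

lemma mem_fibreExact {g : Series p κ 5} : g ∈ fibreExact B π P ↔
    ∃ a ∈ overconvergent p B affX, ∃ d ∈ overconvergent p B affX,
      ∃ e ∈ overconvergent p B affX,
        g = threefoldD π P 0 a + (threefoldD π P 3 d + threefoldD π P 4 e) := by
  constructor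
  · intro h
    obtain ⟨_, ⟨a, ha, rfl⟩, _, h2, rfl⟩ := Submodule.mem_sup.1 h
    obtain ⟨_, ⟨d, hd, rfl⟩, _, ⟨e, he, rfl⟩, rfl⟩ := Submodule.mem_sup.1 h2
    exact ⟨a, ha, d, hd, e, he, rfl⟩
  · rintro ⟨a, ha, d, hd, e, he, rfl⟩
    exact add_mem (t_mem_fibreExact ha) (add_mem (x_mem_fibreExact hd) (y_mem_fibreExact he))

end

lemma tuv_mem {B : ParamDomain κ} {h : Series p κ 3} (hh : h ∈ overconvergent p B affC) :
    seriesMap tuvEmb h ∈ overconvergent p B affX := by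
  refine seriesMap_mem _ (fun i hi => ?_) hh
  rw [mem_affX] at hi
  rw [mem_affC]
  fin_cases i <;> simp_all [tuvEmb]

lemma uv_mem {B : ParamDomain κ} {r : Series p κ 2}
    (hr : r ∈ overconvergent p B (∅ : Set (Fin 2))) :
    seriesMap uvEmb r ∈ overconvergent p B affX := by
  refine seriesMap_mem _ (fun i hi => ?_) hr
  rw [mem_affX] at hi
  fin_cases i <;> simp [uvEmb] at hi

lemma succ_mem {B : ParamDomain κ} {r : Series p κ 2}
    (hr : r ∈ overconvergent p B (∅ : Set (Fin 2))) :
    seriesMap (Fin.succOrderEmb 2) r ∈ overconvergent p B affC := by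
  refine seriesMap_mem _ (fun i hi => ?_) hr
  rw [mem_affC] at hi
  exact absurd hi (Fin.succ_ne_zero i)

lemma curveLift_mem {B : ParamDomain κ} {h : Series p κ 3} (hh : h ∈ overconvergent p B affC) :
    curveLift h ∈ overconvergent p B affX :=
  mon_mem (admissible_coord _ _ _) (tuv_mem hh)

lemma seriesMap_tuv_ne_zero {h : Series p κ 3} {I : Expo κ 5} (hI : seriesMap tuvEmb h I ≠ 0) :
    I (Sum.inr 3) = 0 ∧ I (Sum.inr 4) = 0 := by
  by_cases hI' : I ∈ Set.range (expoMap (κ := κ) tuvEmb)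
  · rw [mem_range_expoMap] at hI'
    exact ⟨hI' 3 (by rw [mem_range_tuvEmb]; decide), hI' 4 (by rw [mem_range_tuvEmb]; decide)⟩
  · exact absurd (seriesMap_of_notMem _ _ hI') hI

lemma seriesMap_uv_ne_zero {h : Series p κ 2} {I : Expo κ 5} (hI : seriesMap uvEmb h I ≠ 0) :
    I (Sum.inr 0) = 0 ∧ I (Sum.inr 3) = 0 ∧ I (Sum.inr 4) = 0 := by
  by_cases hI' : I ∈ Set.range (expoMap (κ := κ) uvEmb)
  · rw [mem_range_expoMap] at hI'
    exact ⟨hI' 0 (by rw [mem_range_uvEmb]; decide), hI' 3 (by rw [mem_range_uvEmb]; decide),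
      hI' 4 (by rw [mem_range_uvEmb]; decide)⟩
  · exact absurd (seriesMap_of_notMem _ _ hI') hI

/-- The relation between `D_t` on the threefold and on the curve. -/
lemma t_curveLift (π : ℂ_[p]) (P : Poly p κ 2) (h : Series p κ 3) :
    threefoldD π P 0 (curveLift h) =
      curveLift (curveD π P 0 h) + threefoldD π P 3 (mon (coord 3) (seriesMap tuvEmb h)) := by
  have h0 : (txy : Expo κ 5) (Sum.inr 0) = 1 := by simp [coord_apply]
  rw [curveLift_apply, curveLift_apply, threefoldD, twistedDeriv_mulPoly, twistedDeriv_threefold,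
    show (Sum.inr 0 : κ ⊕ Fin 5) = Sum.map id tuvEmb (Sum.inr 0) from rfl,
    twistedDeriv_seriesMap, map_add, add_assoc]
  congr 1
  change _ + mulPoly (polyDeriv (Sum.inr 0) _) _ = _
  change mon (coord 0) (((txy : Expo κ 5) (Sum.inr 0) * π : ℂ_[p]) •
    mon (txy - coord 0) (seriesMap tuvEmb h)) + _ = _
  rw [polyDeriv_single, map_smul, mon_mon, add_sub_cancel, h0]
  -- Besides `t` times the operator of the curve, there remains `(1 + π t x y) h`. It equals `D_x (x
  -- h)` because `h` does not depend on `x`.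
  ext I
  rw [radial_apply, Pi.add_apply, Pi.smul_apply, mon_apply, mulPoly_single_apply,
    show (coord 0 : Expo κ 5) (Sum.inr 0) = 1 from unitExpo_same _, sub_self, sub_zero]
  by_cases hI : seriesMap tuvEmb h I = 0
  · rw [hI]; simp
  · rw [(seriesMap_tuv_ne_zero hI).1]; simp; ring

/-- The other operators commute with the lift from the curve. -/
lemma twistedDeriv_curveLift (π : ℂ_[p]) (P : Poly p κ 2) {i : κ ⊕ Fin 3}
    (hi : i ≠ Sum.inr 0) (h : Series p κ 3) :
    twistedDeriv (phase π (threefoldEq P)) (Sum.map id tuvEmb i) (curveLift h) =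
      curveLift (twistedDeriv (phase π P) i h) := by
  have hne : Sum.map id tuvEmb i ≠ (Sum.inr 0 : κ ⊕ Fin 5) := fun h =>
    hi (sumMap_injective tuvEmb (h.trans rfl))
  have h0 : (coord 0 : Expo κ 5) (Sum.map id tuvEmb i) = 0 := unitExpo_ne hne
  have h1 : (txy : Expo κ 5) (Sum.map id tuvEmb i) = 0 := by
    rcases i with k | i
    · simp [coord_inl]
    · have := (mem_range_tuvEmb (tuvEmb i)).1 ⟨i, rfl⟩
      simp only [Sum.map_inr] at h0
      simp only [txy, Sum.map_inr, Pi.add_apply, h0]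
      rw [coord_apply, coord_apply, if_neg this.1, if_neg this.2]; simp
  rw [curveLift_apply, curveLift_apply, twistedDeriv_mulPoly,
    twistedDeriv_threefold_of_eq_zero _ _ h1, twistedDeriv_seriesMap, polyDeriv_single, h0]
  simp

/-- The term by which the operators on the threefold and on the torus differ. -/
lemma twistedDeriv_seriesMap_uv (π : ℂ_[p]) (P : Poly p κ 2) (i : κ ⊕ Fin 2)
    (r : Series p κ 2) :
    twistedDeriv (phase π (threefoldEq P)) (Sum.map id uvEmb i) (seriesMap uvEmb r) =
      seriesMap uvEmb (deriv i r) +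
        curveLift (seriesMap (Fin.succOrderEmb 2) (π • mulPoly (polyDeriv i P) r)) := by
  have h0 : (txy : Expo κ 5) (Sum.map id uvEmb i) = 0 := by
    rcases i with k | i
    · simp [coord_inl]
    · simp only [Sum.map_inr, Pi.add_apply, coord_apply]
      have := (mem_range_uvEmb (uvEmb i)).1 ⟨i, rfl⟩
      rcases this with h | h <;> rw [h] <;> simp
  have h1 : (coord 0 : Expo κ 5) (Sum.map id uvEmb i) = 0 := by
    rcases i with k | i
    · simp [coord_inl]
    · simp only [Sum.map_inr, coord_apply]
      have := (mem_range_uvEmb (uvEmb i)).1 ⟨i, rfl⟩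
      rcases this with h | h <;> rw [h] <;> simp
  rw [twistedDeriv_threefold_of_eq_zero _ _ h0, twistedDeriv_apply, deriv_seriesMap, polyMap_phase,
    polyDeriv_mul, polyDeriv_single, h1, polyDeriv_polyMap, curveLift_apply, seriesMap_seriesMap]
  congr 1
  have h2 : (AddMonoidAlgebra.single (coord 0) π : Poly p κ 5) =
      π • AddMonoidAlgebra.single (coord 0) 1 := by
    rw [AddMonoidAlgebra.smul_single, smul_eq_mul, mul_one]
  rw [Int.cast_zero, zero_mul, AddMonoidAlgebra.single_zero, zero_mul, zero_add, mulPoly_mul_apply,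
    h2, mulPoly_smul, LinearMap.smul_apply, seriesMap_smul, map_smul, seriesMap_mulPoly]

/-! ### Decomposition of functions modulo the fibre directions -/

section Decomposition
variable {π : ℂ_[p]} (hπ : π ^ (p - 1) = -p) {B : ParamDomain κ} {P : Poly p κ 2}
  (hP : AdmissiblePoly B ∅ P) (hPint : ∀ ρ ∈ B.radii, ∀ J, ‖P.coeff J‖ * weight ρ J ≤ 1)

include hP in
lemma admissiblePoly_uv : AdmissiblePoly B affX (polyMap uvEmb P) :=
  hP.polyMap _ fun i hi => by
    rw [mem_affX] at hi
    fin_cases i <;> simp [uvEmb] at hi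

lemma coeff_uv_ne_zero (J : Expo κ 5) (hJ : (polyMap uvEmb P).coeff J ≠ 0) :
    J (Sum.inr 0) = 0 ∧ J (Sum.inr 3) = 0 ∧ J (Sum.inr 4) = 0 := by
  obtain ⟨K, rfl, -⟩ := coeff_polyMap _ _ hJ
  exact ⟨expoMap_of_notMem _ _ (by rw [mem_range_uvEmb]; decide),
    expoMap_of_notMem _ _ (by rw [mem_range_uvEmb]; decide),
    expoMap_of_notMem _ _ (by rw [mem_range_uvEmb]; decide)⟩

include hPint in
lemma norm_coeff_uv_le : ∀ ρ ∈ B.radii, ∀ J, ‖(polyMap uvEmb P).coeff J‖ * weight ρ J ≤ 1 := by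
  intro ρ hρ J
  by_cases hJ : (polyMap uvEmb P).coeff J = 0
  · rw [hJ]; simp
  · obtain ⟨K, rfl, h⟩ := coeff_polyMap _ _ hJ
    rw [h, weight_expoMap]
    exact hPint ρ hρ K

include hπ in
/-- Reduction modulo the images of `D_x` and `D_y`. -/
lemma exists_normalForm {g : Series p κ 5} (hg : g ∈ overconvergent p B affX) :
    ∃ A ∈ overconvergent p B affX, ∃ h ∈ overconvergent p B affC,
      ∃ d ∈ overconvergent p B affX, ∃ e ∈ overconvergent p B affX,
      (∀ I, A I ≠ 0 → onDiagonal I) ∧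
      g = A + curveLift h + (threefoldD π P 3 d + threefoldD π P 4 e) := by
  obtain ⟨G, hG, hG'⟩ := exists_radial hπ P hg
  have hc : ∀ (i : Fin 5) {a : Series p κ 5}, a ∈ overconvergent p B affX →
      mon (coord i) a ∈ overconvergent p B affX := fun i _ ha => mon_mem (admissible_coord _ _ _) ha
  have hs0 : ∀ I : Expo κ 5, affineCone (I - txy) →
      (g - threefoldD π P 3 (mon (coord 3) G)) I = 0 := fun I hI => by
    rw [Pi.sub_apply, threefoldD, hG' I hI, sub_self]
  have hs : g - threefoldD π P 3 (mon (coord 3) G) ∈ overconvergent p B affX := by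
    refine sub_mem hg ?_
    have : ∀ a ∈ overconvergent p B affX,
        twistedDeriv (phase π (threefoldEq P)) (Sum.inr 3) a ∈ overconvergent p B affX := by
      intro a ha
      rw [twistedDeriv_threefold, twistedDeriv_apply, polyDeriv_polyMap_of_notMem _
        (by rw [mem_range_tuvEmb]; decide), mulPoly_zero, LinearMap.zero_apply, add_zero]
      refine add_mem (deriv_mem ha _) (Submodule.smul_mem _ _ (mon_mem ?_ ha))
      rw [show (txy - unitExpo (Sum.inr 3) : Expo κ 5) = coord 0 + coord 4 by
        simp only [txy]; abel]
      exact (admissible_coord _ _ _).add (admissible_coord _ _ _)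
    exact this _ (hc 3 hG)
  set s := g - threefoldD π P 3 (mon (coord 3) G) with hsdef
  -- What is left after removing the multiples of `t x y` is split into the off-diagonal part `s₁`,
  -- which is exact, the diagonal part `A` free of `t`, and the diagonal part `s₂` with a nonzero
  -- power of `t`.
  set s₁ : Series p κ 5 := fun I => if I (Sum.inr 3) = I (Sum.inr 4) then 0 else s I with hs₁
  set A : Series p κ 5 := fun I => if onDiagonal I then s I else 0 with hA
  set s₂ : Series p κ 5 :=
    fun I => if I (Sum.inr 3) = I (Sum.inr 4) ∧ I (Sum.inr 0) ≠ 0 then s I else 0 with hs₂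
  have hsum : s = A + s₂ + s₁ := by
    ext I
    simp only [hs₁, hs₂, hA, Pi.add_apply, onDiagonal]
    by_cases h1 : I (Sum.inr 3) = I (Sum.inr 4) <;> by_cases h2 : I (Sum.inr 0) = 0 <;>
      simp [h1, h2]
  have hs₁m : s₁ ∈ overconvergent p B affX := overconvergent_of_norm_le hs
    (fun I hI => admissible_of_mem hs fun h => hI (by simp [hs₁, h]))
    fun I => by simp only [hs₁]; split_ifs <;> simp
  have hAm : A ∈ overconvergent p B affX := overconvergent_of_norm_le hs
    (fun I hI => admissible_of_mem hs fun h => hI (by simp [hA, h]))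
    fun I => by simp only [hA]; split_ifs <;> simp
  -- A diagonal monomial that contains `t` but is not divisible by `t x y` contains neither `x` nor
  -- `y`; hence `s₂` is `t` times a function of `t, u, v`.
  have hs₂I : ∀ I, s₂ I ≠ 0 → Admissible B affX I ∧ 1 ≤ I (Sum.inr 0) ∧ I (Sum.inr 3) = 0 ∧
      I (Sum.inr 4) = 0 := by
    intro I hI
    have h1 : (I (Sum.inr 3) = I (Sum.inr 4) ∧ I (Sum.inr 0) ≠ 0) ∧ s I ≠ 0 :=
      ite_ne_right_iff.1 hI
    have h2 := admissible_of_mem hs h1.2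
    have h3 := affineCone_of_admissible h2
    have h4 : ¬ affineCone (I - txy) := fun h => h1.2 (hs0 I h)
    simp [affineCone, coord_apply] at h4
    obtain ⟨⟨h5, h6⟩, -⟩ := h1
    obtain ⟨h7, h8, h9⟩ := h3
    refine ⟨h2, by omega, ?_, ?_⟩
    · by_contra h
      exact absurd (h4 (by omega) (by omega)) (by omega)
    · by_contra h
      exact absurd (h4 (by omega) (by omega)) (by omega)
  have hs₂m : mon (-coord 0) s₂ ∈ overconvergent p B affX := by
    refine overconvergent_of_translate hs (-coord 0) 1 (fun I hI => ?_) fun I => ?_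
    · rw [mon_apply, sub_neg_eq_add] at hI
      obtain ⟨h1, h2, -, -⟩ := hs₂I _ hI
      rw [admissible_iff_affineCone] at h1 ⊢
      obtain ⟨h3, h4, h5, h6⟩ := h1
      simp [coord_apply, coord_inl] at h2 h3 h4 h5 h6
      exact ⟨h3, h2, h5, h6⟩
    · rw [mon_apply, one_mul]
      have h1 : ‖s₂ (I - -coord 0)‖ ≤ ‖s (I - -coord 0)‖ := by
        simp only [hs₂]; split_ifs <;> simp
      exact h1.trans (le_mul_of_one_le_left (norm_nonneg _)
        (le_add_of_nonneg_left (Nat.cast_nonneg _)))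
  obtain ⟨h, hh, hh'⟩ := exists_seriesMap (A := affC) tuvEmb (fun i hi => by
    rw [mem_affC] at hi; subst hi; exact (mem_affX _).2 (Or.inl rfl)) hs₂m (by
    intro I hI i hi
    rw [mon_apply, sub_neg_eq_add] at hI
    obtain ⟨-, -, h3, h4⟩ := hs₂I _ hI
    simp [coord_apply] at h3 h4
    rw [mem_range_tuvEmb] at hi
    by_cases h5 : i = 3
    · rw [h5]; exact h3
    · have : i = 4 := by by_contra h6; exact hi ⟨h5, h6⟩
      rw [this]; exact h4)
  have hlift : curveLift h = s₂ := by
    rw [curveLift_apply, ← hh', mon_mon, add_neg_cancel]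
    ext I; rw [mon_apply, sub_zero]
  obtain ⟨G', hG'm, hG''⟩ := exists_offDiagonal (π := π) P hs₁m fun I hI => by
    simp [hs₁, hI]
  refine ⟨A, hAm, h, hh, mon (coord 3) (G + G'), hc 3 (add_mem hG hG'm),
    -mon (coord 4) G', neg_mem (hc 4 hG'm), fun I hI => ?_, ?_⟩
  · by_contra hne
    exact hI (if_neg hne)
  · have h1 : g = s + threefoldD π P 3 (mon (coord 3) G) := by rw [hsdef, sub_add_cancel]
    have h2 : s₁ = threefoldD π P 3 (mon (coord 3) G') - threefoldD π P 4 (mon (coord 4) G') :=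
      hG''
    rw [h1, hsum, h2, hlift, map_add, map_add, map_neg]
    abel

include hπ hP hPint in
/-- Every function on the threefold is the sum of a function on the torus and an element of the
kernel of the residue. -/
lemma exists_sub_mem_resKernel {g : Series p κ 5} (hg : g ∈ overconvergent p B affX) :
    ∃ r ∈ overconvergent p B (∅ : Set (Fin 2)), g - seriesMap uvEmb r ∈ resKernel B π P := by
  have hpi := pi_ne_zero hπ
  obtain ⟨A, hA, h, hh, d, hd, e, he, hA0, rfl⟩ := exists_normalForm hπ (P := P) hg
  obtain ⟨b, hb, hb0, hb1⟩ := exists_division (admissiblePoly_uv hP) coeff_uv_ne_zero (norm_coeff_uv_le hPint) hA hA0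
  -- Since `b` is free of `t`, its derivative in `t` vanishes and `D_t` acts as multiplication by `π
  -- (x y + P)`. Reduction modulo `D_t` thus becomes division by `x y + P`.
  have hDb : threefoldD π P 0 (π⁻¹ • b) = fun I => b (I - xy) + mulPoly (polyMap uvEmb P) b I := by
    ext I
    rw [twistedDeriv_t_apply, map_smul]
    simp only [Pi.smul_apply, smul_eq_mul]
    rw [show I - coord 3 - coord 4 = I - xy by simp only [xy]; abel]
    have : ((I (Sum.inr 0) : ℂ_[p]) + 1) * b (I + coord 0) = 0 := by
      by_cases h : b (I + coord 0) = 0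
      · rw [h, mul_zero]
      · have := (hb0 _ h).1
        simp at this
        have h2 : ((I (Sum.inr 0) + 1 : ℤ) : ℂ_[p]) = 0 := by rw [this]; simp
        push_cast at h2
        rw [h2, zero_mul]
    rw [mul_left_comm, this]
    field_simp
    ring
  have hm : A - threefoldD π P 0 (π⁻¹ • b) ∈ overconvergent p B affX := by
    refine sub_mem hA ?_
    rw [hDb]
    exact add_mem (mon_mem ((admissible_coord B affX 3).add (admissible_coord _ _ 4)) hb |> fun h =>
      show (fun I => b (I - xy)) ∈ _ by
        convert h using 1; ext I; rw [mon_apply]) (mulPoly_mem (admissiblePoly_uv hP) hb)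
  obtain ⟨r, hr, hr'⟩ := exists_seriesMap (A := ∅) uvEmb (fun i hi => absurd hi (by simp)) hm (by
    intro I hI i hi
    rw [Pi.sub_apply, hDb] at hI
    obtain ⟨h0, h3, h4⟩ := hb1 I hI
    rw [mem_range_uvEmb] at hi
    fin_cases i
    · exact h0
    · simp at hi
    · simp at hi
    · exact h3
    · exact h4)
  refine ⟨r, hr, ?_⟩
  rw [← hr', show A + curveLift h + (threefoldD π P 3 d + threefoldD π P 4 e) -
    (A - threefoldD π P 0 (π⁻¹ • b)) = curveLift h + (threefoldD π P 0 (π⁻¹ • b) +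
      (threefoldD π P 3 d + threefoldD π P 4 e)) by abel]
  exact Submodule.add_mem_sup (Submodule.mem_map_of_mem hh)
    (mem_fibreExact.2 ⟨_, Submodule.smul_mem _ _ hb, d, hd, e, he, rfl⟩)

/-- Diagonal functions in the images of `D_x` and `D_y`. -/
lemma exists_radial_of_diagonal {L d e : Series p κ 5} (hd : d ∈ overconvergent p B affX)
    (he : e ∈ overconvergent p B affX) (hL : ∀ I, L I ≠ 0 → I (Sum.inr 3) = I (Sum.inr 4))
    (h : L = threefoldD π P 3 d + threefoldD π P 4 e) :
    ∃ G ∈ overconvergent p B affX, L = threefoldD π P 3 (mon (coord 3) G) := by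
  -- On the diagonal, `D_x d` sees only the part of `d` of the form `x G₁` with `G₁` diagonal, and
  -- `D_y e` only a part `y G₂`. On diagonal functions the operators `D_x x` and `D_y y` agree, so
  -- the two contributions merge into `D_x x (G₁ + G₂)`.
  set G₁ : Series p κ 5 := fun I => if I (Sum.inr 3) = I (Sum.inr 4) then d (I + coord 3) else 0
    with hG₁
  set G₂ : Series p κ 5 := fun I => if I (Sum.inr 3) = I (Sum.inr 4) then e (I + coord 4) else 0
    with hG₂
  have hbound : ∀ (I : Expo κ 5) (c : ℂ_[p]), ‖if I (Sum.inr 3) = I (Sum.inr 4) then c else 0‖ ≤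
      1 * (size I + 1) * ‖c‖ := fun I c => by
    rw [one_mul]
    have h1 : ‖if I (Sum.inr 3) = I (Sum.inr 4) then c else 0‖ ≤ ‖c‖ := by split_ifs <;> simp
    exact h1.trans (le_mul_of_one_le_left (norm_nonneg _)
      (le_add_of_nonneg_left (Nat.cast_nonneg _)))
  have h₁ : G₁ ∈ overconvergent p B affX := by
    refine overconvergent_of_translate hd (-coord 3) 1 (fun I hI => ?_) fun I => ?_
    · have h1 : I (Sum.inr 3) = I (Sum.inr 4) := by by_contra h; exact hI (if_neg h)
      simp only [hG₁, h1, if_true] at hI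
      have h2 := admissible_of_mem hd hI
      rw [admissible_iff_affineCone] at h2 ⊢
      obtain ⟨h3, h4, h5, h6⟩ := h2
      simp [coord_apply, coord_inl] at h3 h4 h5 h6
      exact ⟨h3, h4, by omega, h6⟩
    · rw [sub_neg_eq_add]; exact hbound I _
  have h₂ : G₂ ∈ overconvergent p B affX := by
    refine overconvergent_of_translate he (-coord 4) 1 (fun I hI => ?_) fun I => ?_
    · have h1 : I (Sum.inr 3) = I (Sum.inr 4) := by by_contra h; exact hI (if_neg h)
      simp only [hG₂, h1, if_true] at hI
      have h2 := admissible_of_mem he hI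
      rw [admissible_iff_affineCone] at h2 ⊢
      obtain ⟨h3, h4, h5, h6⟩ := h2
      simp [coord_apply, coord_inl] at h3 h4 h5 h6
      exact ⟨h3, h4, h5, by omega⟩
    · rw [sub_neg_eq_add]; exact hbound I _
  refine ⟨G₁ + G₂, add_mem h₁ h₂, ?_⟩
  ext I
  rw [radial_apply]
  have hiff : (I - txy : Expo κ 5) (Sum.inr 3) = (I - txy : Expo κ 5) (Sum.inr 4) ↔
      I (Sum.inr 3) = I (Sum.inr 4) := by simp [coord_apply]
  by_cases hI : I (Sum.inr 3) = I (Sum.inr 4)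
  · rw [h, Pi.add_apply, twistedDeriv_x_apply, twistedDeriv_y_apply]
    simp only [hG₁, hG₂, Pi.add_apply, hiff, hI, if_true]
    rw [show I - txy + coord 3 = I - coord 0 - coord 4 by simp only [txy]; abel,
      show I - txy + coord 4 = I - coord 0 - coord 3 by simp only [txy]; abel]
    ring
  · have : L I = 0 := by by_contra h; exact hI (hL I h)
    rw [this]
    simp only [hG₁, hG₂, Pi.add_apply, hiff, hI, if_false]
    simp

include hπ hP hPint in
/-- Functions on the torus and on the curve in the images of `D_t`, `D_x` and `D_y`. -/
lemma eq_zero_of_mem_fibreExact {r : Series p κ 2} {h : Series p κ 3}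
    (hh : h ∈ overconvergent p B affC)
    (hrh : seriesMap uvEmb r + curveLift h ∈ fibreExact B π P) :
    r = 0 ∧ ∃ h' ∈ overconvergent p B affC, h = curveD π P 0 h' := by
  have hpi := pi_ne_zero hπ
  have hFX := hP.threefoldEq.phase π
  obtain ⟨a, ha, d, hd, e, he, heq⟩ := mem_fibreExact.1 hrh
  obtain ⟨A, hA, a', ha', d', hd', e', he', hA0, rfl⟩ := exists_normalForm hπ (P := P) ha
  -- With `a = A + t a' + D_x d' + D_y e'`, the last two terms commute with `D_t` and join the
  -- images of `D_x` and `D_y`; by `t_curveLift` the term `t a'` only changes `h` by an exact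
  -- function of the curve. It remains to show that `A`, `r` and `h'` vanish.
  set h' := h - curveD π P 0 a' with hh'
  have key : seriesMap uvEmb r + curveLift h' - threefoldD π P 0 A =
      threefoldD π P 3 (d + mon (coord 3) (seriesMap tuvEmb a') + threefoldD π P 0 d') +
        threefoldD π P 4 (e + threefoldD π P 0 e') := by
    have h1 := t_curveLift π P a'
    have h2 : threefoldD π P 0 (threefoldD π P 3 d') = threefoldD π P 3 (threefoldD π P 0 d') :=
      twistedDeriv_comm _ _ _ _
    have h3 : threefoldD π P 0 (threefoldD π P 4 e') = threefoldD π P 4 (threefoldD π P 0 e') :=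
      twistedDeriv_comm _ _ _ _
    simp only [map_add, h1, h2, h3] at heq
    simp only [hh', map_sub, map_add]
    rw [← sub_eq_zero] at heq ⊢
    rw [← heq]
    abel
  have hDA : ∀ I, threefoldD π P 0 A I = ((I (Sum.inr 0) : ℂ_[p]) + 1) * A (I + coord 0) +
      π * (A (I - xy) + mulPoly (polyMap uvEmb P) A I) := fun I => by
    rw [twistedDeriv_t_apply, show I - coord 3 - coord 4 = I - xy by simp only [xy]; abel]
  have hA1 : ∀ I, ((I (Sum.inr 0) : ℂ_[p]) + 1) * A (I + coord 0) = 0 := fun I => by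
    by_cases h : A (I + coord 0) = 0
    · rw [h, mul_zero]
    · have := (hA0 _ h).1
      simp at this
      have h2 : ((I (Sum.inr 0) + 1 : ℤ) : ℂ_[p]) = 0 := by rw [this]; simp
      push_cast at h2
      rw [h2, zero_mul]
  have hA2 : ∀ I, A (I - xy) ≠ 0 → onDiagonal I := fun I hI => by
    have := hA0 _ hI
    simpa [onDiagonal, coord_apply] using this
  have hA3 : ∀ I, mulPoly (polyMap uvEmb P) A I ≠ 0 → onDiagonal I := fun I hI => by
    obtain ⟨J, hJ, hJ'⟩ := mulPoly_ne_zero hI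
    have := hA0 _ hJ'
    simpa only [onDiagonal, Pi.sub_apply, coeff_uv_ne_zero J hJ, sub_zero] using this
  have hDA0 : ∀ I, threefoldD π P 0 A I ≠ 0 → onDiagonal I := fun I hI => by
    rw [hDA, hA1, zero_add] at hI
    by_contra h
    have h1 : A (I - xy) = 0 := by by_contra hne; exact h (hA2 I hne)
    have h2 : mulPoly (polyMap uvEmb P) A I = 0 := by by_contra hne; exact h (hA3 I hne)
    exact hI (by rw [h1, h2]; simp)
  have hlift : ∀ I, curveLift h' I ≠ 0 → I (Sum.inr 3) = 0 ∧ I (Sum.inr 4) = 0 := fun I hI => by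
    rw [curveLift_apply, mon_apply] at hI
    have := seriesMap_tuv_ne_zero hI
    simpa [coord_apply] using this
  have hh'm : h' ∈ overconvergent p B affC := sub_mem hh (twistedDeriv_mem (hP.phase π) ha' _)
  have hlift0 : ∀ I, curveLift h' I ≠ 0 → 1 ≤ I (Sum.inr 0) := fun I hI => by
    rw [curveLift_apply, mon_apply] at hI
    have := (affineCone_of_admissible (admissible_of_mem (tuv_mem hh'm) hI)).1
    simpa [coord_apply] using this
  obtain ⟨G, hG, hLG⟩ := exists_radial_of_diagonal (L := seriesMap uvEmb r + curveLift h' -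
      threefoldD π P 0 A)
    (add_mem (add_mem hd (mon_mem (admissible_coord _ _ _) (tuv_mem ha')))
      (twistedDeriv_mem hFX hd' _)) (add_mem he (twistedDeriv_mem hFX he' _)) (fun I hI => by
        by_contra hne
        refine hI ?_
        have h1 : seriesMap uvEmb r I = 0 := by
          by_contra h; have := seriesMap_uv_ne_zero h; omega
        have h2 : curveLift h' I = 0 := by by_contra h; have := hlift I h; omega
        have h3 : threefoldD π P 0 A I = 0 := by by_contra h; exact hne (hDA0 I h).2
        rw [Pi.sub_apply, Pi.add_apply, h1, h2, h3]; simp) key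
  -- The left-hand side of `hLG` has no monomial divisible by `t x y`: `r` and the lift do not
  -- contain `x`, and `D_t A` does not contain `t`. Hence `D_x x G` vanishes on all such monomials.
  have hG0 : G = 0 := by
    refine radial_injective hπ P hG fun I hI => ?_
    rw [← threefoldD, ← hLG]
    obtain ⟨h1, h2, h3⟩ := hI
    simp [coord_apply] at h1 h2 h3
    have h4 : seriesMap uvEmb r I = 0 := by
      by_contra h; have := seriesMap_uv_ne_zero h; omega
    have h5 : curveLift h' I = 0 := by by_contra h; have := hlift I h; omega
    have h6 : threefoldD π P 0 A I = 0 := by by_contra h; have := (hDA0 I h).1; omega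
    rw [Pi.sub_apply, Pi.add_apply, h4, h5, h6]; simp
  rw [hG0, map_zero, map_zero, sub_eq_zero] at hLG
  -- Now `π (x y + P) A = r + t h'` contains no positive power of `x`, so `A` vanishes by uniqueness
  -- of the division.
  have hAz : A = 0 := by
    refine division_injective coeff_uv_ne_zero (norm_coeff_uv_le hPint) hA fun I hI => ?_
    have h1 := congrFun hLG I
    have h4 : seriesMap uvEmb r I = 0 := by
      by_contra h; have := seriesMap_uv_ne_zero h; omega
    have h5 : curveLift h' I = 0 := by by_contra h; have := hlift I h; omega
    rw [hDA, hA1, zero_add, Pi.add_apply, h4, h5, add_zero] at h1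
    exact (mul_eq_zero.1 h1.symm).resolve_left hpi
  rw [hAz, map_zero] at hLG
  -- `r` is free of `t` while every monomial of `t h'` contains `t`, so the two summands vanish
  -- separately.
  have hr : seriesMap uvEmb r = 0 := by
    ext I
    by_contra hne
    have h1 := congrFun hLG I
    have h2 : curveLift h' I = 0 := by
      by_contra h
      have := hlift0 I h
      have := seriesMap_uv_ne_zero hne
      omega
    rw [Pi.add_apply, h2, add_zero] at h1
    exact hne h1
  rw [hr, zero_add] at hLG
  refine ⟨seriesMap_injective uvEmb (by rw [hr, seriesMap_zero]), a', ha', ?_⟩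
  have h1 : seriesMap tuvEmb h' = 0 := mon_injective (coord 0) (by rw [map_zero]; exact hLG)
  have h2 : h' = 0 := seriesMap_injective tuvEmb (by rw [h1, seriesMap_zero])
  exact sub_eq_zero.1 h2

include hπ hP hPint in
lemma eq_zero_of_mem_resKernel {r : Series p κ 2} (h : seriesMap uvEmb r ∈ resKernel B π P) :
    r = 0 := by
  obtain ⟨_, ⟨h, hh, rfl⟩, g, hg, heq⟩ := Submodule.mem_sup.1 h
  refine (eq_zero_of_mem_fibreExact hπ hP hPint (h := -h) (neg_mem hh) ?_).1
  rwa [← heq, map_neg, add_comm, neg_add_cancel_left]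

include hP in
/-- The kernel of the residue is stable under the operators in the directions of the torus. -/
lemma twistedDeriv_mem_resKernel (i : κ ⊕ Fin 2) {g : Series p κ 5}
    (hg : g ∈ resKernel B π P) :
    twistedDeriv (phase π (threefoldEq P)) (Sum.map id uvEmb i) g ∈ resKernel B π P := by
  have hFX := hP.threefoldEq.phase π
  obtain ⟨l, hl, f, hf, rfl⟩ := Submodule.mem_sup.1 hg
  obtain ⟨h, hh, rfl⟩ := Submodule.mem_map.1 hl
  obtain ⟨a, ha, d, hd, e, he, rfl⟩ := mem_fibreExact.1 hf
  have hi : (Sum.map id uvEmb i : κ ⊕ Fin 5) =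
      Sum.map id tuvEmb (Sum.map id (Fin.succOrderEmb 2) i) := by rcases i with k | i <;> rfl
  have hi' : (Sum.map id (Fin.succOrderEmb 2) i : κ ⊕ Fin 3) ≠ Sum.inr 0 := by
    rcases i with k | i
    · simp
    · simp [Fin.succ_ne_zero]
  have h1 := twistedDeriv_curveLift π P hi' h
  rw [← hi] at h1
  have h2 : ∀ (j : Fin 5) (b : Series p κ 5),
      Dwork.twistedDeriv (phase π (threefoldEq P)) (Sum.map id uvEmb i) (threefoldD π P j b) =
      threefoldD π P j (Dwork.twistedDeriv (phase π (threefoldEq P)) (Sum.map id uvEmb i) b) :=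
    fun j b => twistedDeriv_comm _ _ _ _
  rw [map_add, map_add, map_add, h1, h2, h2, h2]
  exact Submodule.add_mem_sup (Submodule.mem_map_of_mem (twistedDeriv_mem (hP.phase π) hh _))
    (mem_fibreExact.2 ⟨_, twistedDeriv_mem hFX ha _, _, twistedDeriv_mem hFX hd _, _,
      twistedDeriv_mem hFX he _, rfl⟩)

/-- `r` is the residue of `g`. -/
def IsRes (B : ParamDomain κ) (π : ℂ_[p]) (P : Poly p κ 2) (g : Series p κ 5)
    (r : Series p κ 2) : Prop :=
  r ∈ overconvergent p B (∅ : Set (Fin 2)) ∧ g - seriesMap uvEmb r ∈ resKernel B π P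

lemma IsRes.add {g g' : Series p κ 5} {r r' : Series p κ 2} (h : IsRes B π P g r)
    (h' : IsRes B π P g' r') : IsRes B π P (g + g') (r + r') := by
  refine ⟨add_mem h.1 h'.1, ?_⟩
  rw [seriesMap_add, add_sub_add_comm]
  exact add_mem h.2 h'.2

lemma IsRes.smul {g : Series p κ 5} {r : Series p κ 2} (h : IsRes B π P g r) (c : ℂ_[p]) :
    IsRes B π P (c • g) (c • r) := by
  refine ⟨Submodule.smul_mem _ _ h.1, ?_⟩
  rw [seriesMap_smul, ← smul_sub]
  exact Submodule.smul_mem _ _ h.2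

lemma isRes_of_mem {g : Series p κ 5} (hg : g ∈ resKernel B π P) : IsRes B π P g 0 :=
  ⟨zero_mem _, by rwa [seriesMap_zero, sub_zero]⟩

lemma isRes_seriesMap {r : Series p κ 2} (hr : r ∈ overconvergent p B (∅ : Set (Fin 2))) :
    IsRes B π P (seriesMap uvEmb r) r := ⟨hr, by rw [sub_self]; exact zero_mem _⟩

include hπ hP hPint in
-- Two residues of one function differ by a function on the torus in `resKernel`, which must vanish.
-- The residue is thus well defined on functions, before passing to cohomology.
lemma IsRes.unique {g : Series p κ 5} {r r' : Series p κ 2} (h : IsRes B π P g r)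
    (h' : IsRes B π P g r') : r = r' := by
  rw [← sub_eq_zero]
  refine eq_zero_of_mem_resKernel hπ hP hPint ?_
  have := sub_mem h'.2 h.2
  rwa [sub_sub_sub_cancel_left, ← seriesMap_sub] at this

include hP in
lemma smul_mulPoly_succ_mem {r : Series p κ 2}
    (hr : r ∈ overconvergent p B (∅ : Set (Fin 2))) (i : κ ⊕ Fin 2) :
    seriesMap (Fin.succOrderEmb 2) (π • mulPoly (polyDeriv i P) r) ∈ overconvergent p B affC :=
  succ_mem (Submodule.smul_mem _ _ (mulPoly_mem (hP.polyDeriv i) hr))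

include hP in
/-- The residue commutes with the operators in the directions of the torus. -/
lemma IsRes.twistedDeriv {g : Series p κ 5} {r : Series p κ 2} (h : IsRes B π P g r)
    (i : κ ⊕ Fin 2) : IsRes B π P
      (twistedDeriv (phase π (threefoldEq P)) (Sum.map id uvEmb i) g) (deriv i r) := by
  refine ⟨deriv_mem h.1 i, ?_⟩
  have h1 := twistedDeriv_mem_resKernel hP i h.2
  rw [map_sub, twistedDeriv_seriesMap_uv, ← sub_sub] at h1
  have h2 : curveLift (seriesMap (Fin.succOrderEmb 2) (π • mulPoly (polyDeriv i P) r)) ∈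
      resKernel B π P := Submodule.mem_sup_left (Submodule.mem_map_of_mem
        (smul_mulPoly_succ_mem hP h.1 i))
  simpa using add_mem h1 h2

include hP in
/-- The residue of an exact form is exact. -/
lemma exists_isRes_of_mem_exactTop (hπ : π ^ (p - 1) = -p)
    (hPint : ∀ ρ ∈ B.radii, ∀ J, ‖P.coeff J‖ * weight ρ J ≤ 1) {g : Series p κ 5}
    (hg : g ∈ exactTop B affX (phase π (threefoldEq P))) :
    ∃ r ∈ exactTop B ∅ (0 : Poly p κ 2), IsRes B π P g r := by
  obtain ⟨a, ha, rfl⟩ := mem_exactTop.1 hg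
  obtain ⟨r₁, hr₁⟩ := exists_sub_mem_resKernel hπ hP hPint (ha 1)
  obtain ⟨r₂, hr₂⟩ := exists_sub_mem_resKernel hπ hP hPint (ha 2)
  refine ⟨deriv (Sum.inr 0) r₁ + deriv (Sum.inr 1) r₂, ?_, ?_⟩
  · rw [← twistedDeriv_zero, ← twistedDeriv_zero]
    exact add_mem (twistedDeriv_mem_exactTop _ _ hr₁.1) (twistedDeriv_mem_exactTop _ _ hr₂.1)
  · have h1 := IsRes.twistedDeriv hP (⟨hr₁.1, hr₁.2⟩ : IsRes B π P (a 1) r₁) (Sum.inr 0)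
    have h2 := IsRes.twistedDeriv hP (⟨hr₂.1, hr₂.2⟩ : IsRes B π P (a 2) r₂) (Sum.inr 1)
    have h3 : threefoldD π P 0 (a 0) + (threefoldD π P 3 (a 3) + threefoldD π P 4 (a 4)) ∈
        resKernel B π P :=
      fibreExact_le_resKernel _ _ _ (mem_fibreExact.2 ⟨_, ha 0, _, ha 3, _, ha 4, rfl⟩)
    have h4 := (h1.add h2).add (isRes_of_mem h3)
    rw [add_zero] at h4
    convert h4 using 1
    rw [Fin.sum_univ_five]
    change threefoldD π P 0 (a 0) + threefoldD π P 1 (a 1) + threefoldD π P 2 (a 2) +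
      threefoldD π P 3 (a 3) + threefoldD π P 4 (a 4) = threefoldD π P 1 (a 1) +
      threefoldD π P 2 (a 2) + _
    abel

end Decomposition

/-! ### The three maps on top components -/

/-- The top component, as a function of `u, v`, of the restriction of `a du + b dv`. -/
def curveBracket (π : ℂ_[p]) (P : Poly p κ 2) (a b : Series p κ 2) : Series p κ 2 :=
  π • mulPoly (polyDeriv (Sum.inr 0) P) b - π • mulPoly (polyDeriv (Sum.inr 1) P) a

lemma restrict_univ (π : ℂ_[p]) (P : Poly p κ 2) (ω : Form p κ 2) :
    restrict π P ω Finset.univ =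
      seriesMap (Fin.succOrderEmb 2) (curveBracket π P (ω {0}) (ω {1})) := by
  have h1 : formMap (Fin.succOrderEmb 2) ω {1} = seriesMap (Fin.succOrderEmb 2) (ω {0}) :=
    formMap_map (Fin.succOrderEmb 2) ω {0}
  have h2 : formMap (Fin.succOrderEmb 2) ω {2} = seriesMap (Fin.succOrderEmb 2) (ω {1}) :=
    formMap_map (Fin.succOrderEmb 2) ω {1}
  have e1 : (Finset.univ : Finset (Fin 3)).erase 0 = {1, 2} := by decide
  have e2 : ({1, 2} : Finset (Fin 3)).erase 1 = {2} := by decide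
  have e3 : ({1, 2} : Finset (Fin 3)).erase 2 = {1} := by decide
  have c1 : ((Finset.univ : Finset (Fin 3)).filter (· < 0)).card = 0 := by decide
  have c2 : (({1, 2} : Finset (Fin 3)).filter (· < 1)).card = 0 := by decide
  have c3 : (({1, 2} : Finset (Fin 3)).filter (· < 2)).card = 1 := by decide
  have d1 : polyDeriv (Sum.inr 1) (polyMap (Fin.succOrderEmb 2) P) =
    polyMap (Fin.succOrderEmb 2) (polyDeriv (Sum.inr 0) P) :=
      polyDeriv_polyMap (Fin.succOrderEmb 2) (Sum.inr 0) P
  have d2 : polyDeriv (Sum.inr 2) (polyMap (Fin.succOrderEmb 2) P) =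
    polyMap (Fin.succOrderEmb 2) (polyDeriv (Sum.inr 1) P) :=
      polyDeriv_polyMap (Fin.succOrderEmb 2) (Sum.inr 1) P
  rw [restrict, Pi.smul_apply, wedge_apply, if_pos (Finset.mem_univ _), e1, c1, wedgeD_apply,
    Fin.sum_univ_three, if_neg (by decide), if_pos (by decide), if_pos (by decide), e2, e3, c2, c3,
    h1, h2, d1, d2, ← seriesMap_mulPoly, ← seriesMap_mulPoly, curveBracket, seriesMap_sub,
    seriesMap_smul, seriesMap_smul]
  simp [sub_eq_add_neg]

lemma HasDegree.restrict {k : ℕ} {ω : Form p κ n} (h : HasDegree k ω) (π : ℂ_[p])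
    (f : Poly p κ n) : HasDegree (k + 2) (restrict π f ω) :=
  (((h.formMap _).wedgeD _).wedge 0).smul π

lemma curveToThreefold_univ (ω : Form p κ 3) :
    curveToThreefold ω Finset.univ = curveLift (ω Finset.univ) := by
  have h1 : formMap tuvEmb ω {0, 1, 2} = seriesMap tuvEmb (ω Finset.univ) := by
    rw [← formMap_map]; congr 1
  have e1 : ((Finset.univ : Finset (Fin 5)).erase 3).erase 4 = {0, 1, 2} := by decide
  have c1 : ((Finset.univ : Finset (Fin 5)).filter (· < 3)).card = 3 := by decide
  have c2 : (((Finset.univ : Finset (Fin 5)).erase 3).filter (· < 4)).card = 3 := by decide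
  rw [curveLift_apply, ← h1, curveToThreefold, LinearMap.compLeft_apply, Function.comp_apply,
    wedge_apply, if_pos (Finset.mem_univ _), wedge_apply, if_pos (by decide), e1, c1, c2, smul_smul]
  norm_num

lemma HasDegree.curveToThreefold {ω : Form p κ 3} {k : ℕ} (h : HasDegree k ω) :
    HasDegree (k + 2) (curveToThreefold ω) :=
  (((h.formMap _).wedge 4).wedge 3).compLeft _

lemma hasDegree_monomialForm (a : Fin n → ℤ) :
    HasDegree 0 (monomialForm a : Form p κ n) := fun S hS =>
  Pi.single_eq_of_ne (fun h => hS (by rw [h, Finset.card_empty])) _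

lemma torusForm_univ :
    (torusForm : Form p κ 2) Finset.univ = Pi.single (Sum.elim (0 : κ → ℤ) ![-1, -1]) 1 := by
  have e1 : ((Finset.univ : Finset (Fin 2)).erase 0).erase 1 = ∅ := by decide
  have c1 : ((Finset.univ : Finset (Fin 2)).filter (· < 0)).card = 0 := by decide
  have c2 : (((Finset.univ : Finset (Fin 2)).erase 0).filter (· < 1)).card = 0 := by decide
  rw [torusForm, wedge_apply, if_pos (Finset.mem_univ _), wedge_apply, if_pos (by decide), e1, c1,
    c2, pow_zero, one_smul, one_smul, monomialForm, Pi.single_eq_same]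

lemma hasDegree_torusForm : HasDegree 2 (torusForm : Form p κ 2) :=
  ((hasDegree_monomialForm _).wedge 1).wedge 0

lemma hasDegree_threefoldForm : HasDegree 3 (threefoldForm : Form p κ 4) :=
  (((hasDegree_monomialForm _).wedge 1).wedge 0).wedge 2

lemma threefoldForm_apply : (threefoldForm : Form p κ 4) {0, 1, 2} =
    Pi.single (Sum.elim (0 : κ → ℤ) ![-1, -1, -1, 0]) 1 := by
  have e1 : ((({0, 1, 2} : Finset (Fin 4)).erase 2).erase 0).erase 1 = ∅ := by decide
  have c1 : (({0, 1, 2} : Finset (Fin 4)).filter (· < 2)).card = 2 := by decide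
  have c2 : ((({0, 1, 2} : Finset (Fin 4)).erase 2).filter (· < 0)).card = 0 := by decide
  have c3 : (((({0, 1, 2} : Finset (Fin 4)).erase 2).erase 0).filter (· < 1)).card = 0 := by decide
  rw [threefoldForm, wedge_apply, if_pos (by decide), wedge_apply, if_pos (by decide), wedge_apply,
    if_pos (by decide), e1, c1, c2, c3, monomialForm, Pi.single_eq_same]
  simp

lemma threefoldForm_of_mem {S : Finset (Fin 4)} (hS : 3 ∈ S) :
    (threefoldForm : Form p κ 4) S = 0 := by
  by_cases h2 : 2 ∈ S <;> by_cases h0 : 0 ∈ S.erase 2 <;> by_cases h1 : 1 ∈ (S.erase 2).erase 0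
  · simp only [threefoldForm, wedge_apply, if_pos h2, if_pos h0, if_pos h1, monomialForm]
    rw [Pi.single_eq_of_ne, smul_zero, smul_zero, smul_zero]
    exact Finset.ne_empty_of_mem (a := 3) (by simp [hS])
  all_goals simp only [threefoldForm, wedge_apply, h0, h1, h2, if_false, if_true, smul_zero]

/-- Of the terms of `df` only `x dy` survives: it cancels the pole `1 / x`, and `du`, `dv`, `dx`
already occur. Moving `dy` behind the other three differentials gives the sign, hence the
normalization `-π⁻¹` of the integral. -/
lemma restrict_threefoldForm_univ (π : ℂ_[p]) (P : Poly p κ 2) :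
    restrict π (threefoldEq P) threefoldForm Finset.univ =
      seriesMap uvEmb (-π • Pi.single (Sum.elim (0 : κ → ℤ) ![-1, -1]) 1) := by
  have h0 : ∀ S : Finset (Fin 4), 3 ∈ S → formMap (Fin.succOrderEmb 4)
      (threefoldForm : Form p κ 4) (S.map (Fin.succOrderEmb 4).toEmbedding) = 0 := fun S hS => by
    rw [formMap_map, threefoldForm_of_mem hS, seriesMap_zero]
  have h1 : formMap (Fin.succOrderEmb 4) (threefoldForm : Form p κ 4) {2, 3, 4} = 0 :=
    h0 {1, 2, 3} (by decide)
  have h2 : formMap (Fin.succOrderEmb 4) (threefoldForm : Form p κ 4) {1, 3, 4} = 0 :=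
    h0 {0, 2, 3} (by decide)
  have h3 : formMap (Fin.succOrderEmb 4) (threefoldForm : Form p κ 4) {1, 2, 4} = 0 :=
    h0 {0, 1, 3} (by decide)
  have h4 : formMap (Fin.succOrderEmb 4) (threefoldForm : Form p κ 4) {1, 2, 3} =
      seriesMap (Fin.succOrderEmb 4) (Pi.single (Sum.elim 0 ![-1, -1, -1, 0]) 1) := by
    rw [← threefoldForm_apply]; exact formMap_map (Fin.succOrderEmb 4) threefoldForm {0, 1, 2}
  have e0 : (Finset.univ : Finset (Fin 5)).erase 0 = {1, 2, 3, 4} := by decide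
  have e1 : ({1, 2, 3, 4} : Finset (Fin 5)).erase 1 = {2, 3, 4} := by decide
  have e2 : ({1, 2, 3, 4} : Finset (Fin 5)).erase 2 = {1, 3, 4} := by decide
  have e3 : ({1, 2, 3, 4} : Finset (Fin 5)).erase 3 = {1, 2, 4} := by decide
  have e4 : ({1, 2, 3, 4} : Finset (Fin 5)).erase 4 = {1, 2, 3} := by decide
  have c0 : ((Finset.univ : Finset (Fin 5)).filter (· < 0)).card = 0 := by decide
  have c4 : (({1, 2, 3, 4} : Finset (Fin 5)).filter (· < 4)).card = 3 := by decide
  have d4 : polyDeriv (Sum.inr 4) (polyMap (Fin.succOrderEmb 4) (threefoldEq P)) =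
      AddMonoidAlgebra.single (coord 3) 1 := by
    rw [show (Sum.inr 4 : κ ⊕ Fin 5) = Sum.map id (Fin.succOrderEmb 4) (Sum.inr 3) from rfl,
      polyDeriv_polyMap, threefoldEq, polyDeriv_add, polyDeriv_polyMap_of_notMem, add_zero,
      polyDeriv_single, polyMap_single]
    · congr 1
      · rw [add_sub_cancel_right, expoMap_unitExpo]; rfl
      · simp [unitExpo_ne]
    · rintro ⟨i, hi⟩
      fin_cases i <;> simp [Fin.ext_iff] at hi
  rw [restrict, Pi.smul_apply, wedge_apply, if_pos (Finset.mem_univ _), e0, c0, wedgeD_apply,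
    Fin.sum_univ_five, if_neg (by decide), if_pos (by decide), if_pos (by decide),
    if_pos (by decide), if_pos (by decide), e1, e2, e3, e4, c4, h1, h2, h3, h4, d4, seriesMap_smul]
  simp only [map_zero, smul_zero, zero_add, pow_zero, one_smul]
  rw [neg_smul, smul_smul, show π * (-1) ^ 3 = -π by ring, neg_smul]
  congr 2
  have key : ∀ {m : ℕ} (e : Fin m ↪o Fin 5) (J : Expo κ m),
      seriesMap (p := p) e (Pi.single J 1) = Pi.single (expoMap e J) 1 := fun e J => by
    refine (eq_seriesMap e (fun K => ?_) fun I hI => ?_).symm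
    · simp only [Pi.single_apply, (expoMap_injective e).eq_iff]
    · exact Pi.single_eq_of_ne (fun h => hI ⟨J, h.symm⟩) _
  rw [key, key]
  ext I
  rw [mon_apply, Pi.single_apply, Pi.single_apply]
  congr 1
  rw [sub_eq_iff_eq_add, eq_iff_iff]
  have : expoMap (Fin.succOrderEmb 4) (Sum.elim 0 ![-1, -1, -1, 0]) + coord 3 =
      expoMap uvEmb (Sum.elim (0 : κ → ℤ) ![-1, -1]) := by
    set J : Expo κ 4 := Sum.elim 0 ![-1, -1, -1, 0]
    have j0 : expoMap (Fin.succOrderEmb 4) J (Sum.inr 0) = 0 := expoMap_of_notMem _ _ (by simp)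
    have j1 : expoMap (Fin.succOrderEmb 4) J (Sum.inr 1) = -1 :=
      expoMap_inr (Fin.succOrderEmb 4) J 0
    have j2 : expoMap (Fin.succOrderEmb 4) J (Sum.inr 2) = -1 :=
      expoMap_inr (Fin.succOrderEmb 4) J 1
    have j3 : expoMap (Fin.succOrderEmb 4) J (Sum.inr 3) = -1 :=
      expoMap_inr (Fin.succOrderEmb 4) J 2
    have j4 : expoMap (Fin.succOrderEmb 4) J (Sum.inr 4) = 0 :=
      expoMap_inr (Fin.succOrderEmb 4) J 3
    symm
    rw [expoMap_eq_iff]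
    refine ⟨fun k => by simp [coord_inl, J], fun i => ?_, fun i hi => ?_⟩
    · fin_cases i
      · change -1 = expoMap (Fin.succOrderEmb 4) J (Sum.inr 1) + coord 3 (Sum.inr 1)
        rw [j1]; simp [coord_apply]
      · change -1 = expoMap (Fin.succOrderEmb 4) J (Sum.inr 2) + coord 3 (Sum.inr 2)
        rw [j2]; simp [coord_apply]
    · rw [mem_range_uvEmb] at hi
      rw [Pi.add_apply]
      fin_cases i
      · change expoMap (Fin.succOrderEmb 4) J (Sum.inr 0) + coord 3 (Sum.inr 0) = 0
        rw [j0]; simp [coord_apply]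
      · simp at hi
      · simp at hi
      · change expoMap (Fin.succOrderEmb 4) J (Sum.inr 3) + coord 3 (Sum.inr 3) = 0
        rw [j3]; simp
      · change expoMap (Fin.succOrderEmb 4) J (Sum.inr 4) + coord 3 (Sum.inr 4) = 0
        rw [j4]; simp [coord_apply]
  rw [this]

/-! ### Construction of the three maps -/

section Maps
variable {π : ℂ_[p]} {B : ParamDomain κ} {P : Poly p κ 2}

lemma restrict_add (f : Poly p κ n) (ω η : Form p κ n) :
    restrict π f (ω + η) = restrict π f ω + restrict π f η := by
  simp only [restrict, formMap_add, map_add, smul_add]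

lemma restrict_smul (f : Poly p κ n) (c : ℂ_[p]) (ω : Form p κ n) :
    restrict π f (c • ω) = c • restrict π f ω := by
  simp only [restrict, formMap_smul, map_smul]
  rw [smul_comm]

lemma curveToThreefold_add (ω η : Form p κ 3) :
    curveToThreefold (ω + η) = curveToThreefold ω + curveToThreefold η := by
  simp only [curveToThreefold, formMap_add, map_add]

lemma curveToThreefold_smul (c : ℂ_[p]) (ω : Form p κ 3) :
    curveToThreefold (c • ω) = c • curveToThreefold ω := by
  simp only [curveToThreefold, formMap_smul, map_smul]

lemma curveBracket_mem (hP : AdmissiblePoly B ∅ P) {a b : Series p κ 2}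
    (ha : a ∈ overconvergent p B (∅ : Set (Fin 2)))
    (hb : b ∈ overconvergent p B (∅ : Set (Fin 2))) :
    curveBracket π P a b ∈ overconvergent p B (∅ : Set (Fin 2)) :=
  sub_mem (Submodule.smul_mem _ _ (mulPoly_mem (hP.polyDeriv _) hb))
    (Submodule.smul_mem _ _ (mulPoly_mem (hP.polyDeriv _) ha))

lemma curveD_seriesMap (i : κ ⊕ Fin 2) (a : Series p κ 2) :
    twistedDeriv (phase π P) (Sum.map id (Fin.succOrderEmb 2) i)
      (seriesMap (Fin.succOrderEmb 2) a) =
      seriesMap (Fin.succOrderEmb 2) (deriv i a) +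
        mon (coord 0) (seriesMap (Fin.succOrderEmb 2) (π • mulPoly (polyDeriv i P) a)) := by
  have h1 : (coord 0 : Expo κ 3) (Sum.map id (Fin.succOrderEmb 2) i) = 0 := by
    rcases i with k | i
    · simp [coord_inl]
    · simp [coord_apply, Fin.succ_ne_zero]
  have h2 : (AddMonoidAlgebra.single (coord 0) π : Poly p κ 3) =
      π • AddMonoidAlgebra.single (coord 0) 1 := by
    rw [AddMonoidAlgebra.smul_single, smul_eq_mul, mul_one]
  rw [phase_eq, twistedDeriv_apply, deriv_seriesMap, polyDeriv_mul, polyDeriv_single, h1,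
    polyDeriv_polyMap, Int.cast_zero, zero_mul, AddMonoidAlgebra.single_zero, zero_mul, zero_add,
    mulPoly_mul_apply, h2, mulPoly_smul, LinearMap.smul_apply, seriesMap_smul, map_smul,
    seriesMap_mulPoly]

/-- Restrictions of exact forms are exact. -/
lemma curveBracket_deriv_mem_exactTop (hP : AdmissiblePoly B ∅ P) {g : Series p κ 2}
    (hg : g ∈ overconvergent p B (∅ : Set (Fin 2))) :
    seriesMap (Fin.succOrderEmb 2)
      (curveBracket π P (deriv (Sum.inr 0) g) (deriv (Sum.inr 1) g)) ∈
        exactTop B affC (phase π P) := by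
  have hm : ∀ i, seriesMap (Fin.succOrderEmb 2) (π • mulPoly (polyDeriv i P) g) ∈
      overconvergent p B affC := fun i =>
    succ_mem (Submodule.smul_mem _ _ (mulPoly_mem (hP.polyDeriv i) hg))
  have h1 := curveD_seriesMap (π := π) (P := P) (Sum.inr 1) (π • mulPoly (polyDeriv (Sum.inr 0) P) g)
  have h2 := curveD_seriesMap (π := π) (P := P) (Sum.inr 0) (π • mulPoly (polyDeriv (Sum.inr 1) P) g)
  -- An explicit primitive. The terms with `t` cancel since the two products of first derivatives of
  -- `P` coincide, and the mixed second derivatives of `P` cancel, leaving the restriction of `dg`.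
  have h3 : seriesMap (Fin.succOrderEmb 2)
      (curveBracket π P (deriv (Sum.inr 0) g) (deriv (Sum.inr 1) g)) =
      curveD π P 2 (seriesMap (Fin.succOrderEmb 2) (π • mulPoly (polyDeriv (Sum.inr 0) P) g)) -
      curveD π P 1 (seriesMap (Fin.succOrderEmb 2) (π • mulPoly (polyDeriv (Sum.inr 1) P) g)) := by
    refine Eq.trans ?_ (congrArg₂ (· - ·) h1 h2).symm
    simp only [map_smul, mulPoly_comm (polyDeriv (Sum.inr 0) P) (polyDeriv (Sum.inr 1) P)]
    rw [add_sub_add_right_eq_sub, ← seriesMap_sub]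
    congr 1
    rw [deriv_mulPoly, deriv_mulPoly, polyDeriv_comm (Sum.inr 1) (Sum.inr 0), curveBracket]
    simp only [smul_add]
    abel
  rw [h3]
  exact sub_mem (twistedDeriv_mem_exactTop _ _ (hm _)) (twistedDeriv_mem_exactTop _ _ (hm _))

/-- The operators `D_u`, `D_v` commute with the lift, and `t D_t a = D_t (t a) - D_x (x a)` by
`t_curveLift`. The correction term in the direction `x` is what makes `α` well defined. -/
lemma curveLift_mem_exactTop {g : Series p κ 3} (hg : g ∈ exactTop B affC (phase π P)) :
    curveLift g ∈ exactTop B affX (phase π (threefoldEq P)) := by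
  obtain ⟨a, ha, rfl⟩ := mem_exactTop.1 hg
  rw [Fin.sum_univ_three, map_add, map_add]
  refine add_mem (add_mem ?_ ?_) ?_
  · have := t_curveLift π P (a 0)
    rw [← sub_eq_iff_eq_add] at this
    rw [← curveD, ← this]
    exact sub_mem (twistedDeriv_mem_exactTop _ _ (curveLift_mem (ha 0)))
      (twistedDeriv_mem_exactTop _ _ (mon_mem (admissible_coord _ _ _) (tuv_mem (ha 0))))
  · rw [← twistedDeriv_curveLift π P (by simp)]
    exact twistedDeriv_mem_exactTop _ 1 (curveLift_mem (ha 1))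
  · rw [← twistedDeriv_curveLift π P (by simp)]
    exact twistedDeriv_mem_exactTop _ 2 (curveLift_mem (ha 2))

lemma twistedD_torus_univ (ω : Form p κ 2) : twistedD 0 ω Finset.univ =
    deriv (Sum.inr 0) (ω {1}) - deriv (Sum.inr 1) (ω {0}) := by
  have e0 : (Finset.univ : Finset (Fin 2)).erase 0 = {1} := by decide
  have e1 : (Finset.univ : Finset (Fin 2)).erase 1 = {0} := by decide
  have c0 : ((Finset.univ : Finset (Fin 2)).filter (· < 0)).card = 0 := by decide
  have c1 : ((Finset.univ : Finset (Fin 2)).filter (· < 1)).card = 1 := by decide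
  rw [twistedD_apply, Fin.sum_univ_two, if_pos (Finset.mem_univ _), if_pos (Finset.mem_univ _), e0,
    e1, c0, c1, twistedDeriv_zero, twistedDeriv_zero]
  simp [sub_eq_add_neg]

lemma twistedD_torus_single (ω : Form p κ 2) (i : Fin 2) :
    twistedD 0 ω {i} = deriv (Sum.inr i) (ω ∅) := by
  rw [twistedD_apply, Finset.sum_eq_single i]
  · rw [if_pos (Finset.mem_singleton_self i), twistedDeriv_zero]
    simp [Finset.filter_singleton]
  · intro j _ hj
    rw [if_neg (by simpa using hj)]
  · simp

lemma mem_cocycles_one {ω : Form p κ 2} :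
    ω ∈ cocycles B (∅ : Set (Fin 2)) (0 : Poly p κ 2) 1 ↔ HasDegree 1 ω ∧
      ω {0} ∈ overconvergent p B (∅ : Set (Fin 2)) ∧
      ω {1} ∈ overconvergent p B (∅ : Set (Fin 2)) ∧
      deriv (Sum.inr 0) (ω {1}) = deriv (Sum.inr 1) (ω {0}) := by
  rw [mem_cocycles]
  refine ⟨fun ⟨h1, h2, h3⟩ => ⟨h2, h1 _, h1 _, ?_⟩, fun ⟨h1, h2, h3, h4⟩ => ⟨fun S => ?_, h1, ?_⟩⟩
  · rw [← sub_eq_zero, ← twistedD_torus_univ, h3]; rfl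
  · by_cases hS : S.card = 1
    · obtain ⟨i, rfl⟩ := Finset.card_eq_one.1 hS
      fin_cases i
      · exact h2
      · exact h3
    · rw [h1 S hS]; exact zero_mem _
  · refine (h1.twistedD 0).ext_top (fun _ _ => rfl) ?_
    rw [twistedD_torus_univ, h4, sub_self]; rfl

end Maps

/-! ### The exact sequence -/

section Sequence
variable {π : ℂ_[p]} {B : ParamDomain κ} {P : Poly p κ 2}

lemma exists_iStar (hP : AdmissiblePoly B ∅ P) :
    ∃ iStar : TorusCohomology p B 1 →ₗ[ℂ_[p]] CurveCohomology B π P 1,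
      Induces (restrict π P) iStar := by
  refine exists_induces _ (fun ω _ η _ => restrict_add _ _ _) (fun c ω _ => restrict_smul _ _ _)
    (fun ω hω => ?_) (fun ω hω hω' => ?_)
  · obtain ⟨h0, h1, h2, -⟩ := mem_cocycles_one.1 hω
    refine mem_cocycles_top.2 ⟨h0.restrict π P, ?_⟩
    rw [restrict_univ]
    exact succ_mem (curveBracket_mem hP h1 h2)
  · obtain ⟨η, hη, rfl⟩ := hω'
    rw [mem_coboundaries_top ((mem_cocycles_one.1 hω).1.restrict π P), restrict_univ,
      twistedD_torus_single, twistedD_torus_single]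
    exact curveBracket_deriv_mem_exactTop hP (mem_forms.1 hη _)

lemma exists_alpha : ∃ α : CurveCohomology B π P 1 →ₗ[ℂ_[p]] ThreefoldCohomology B π P 3,
      Induces curveToThreefold α := by
  refine exists_induces _ (fun ω _ η _ => curveToThreefold_add _ _)
    (fun c ω _ => curveToThreefold_smul _ _) (fun ω hω => ?_) (fun ω hω hω' => ?_)
  · have h := mem_cocycles_top.1 hω
    refine mem_cocycles_top.2 ⟨h.1.curveToThreefold, ?_⟩
    rw [curveToThreefold_univ]
    exact curveLift_mem h.2
  · have h := mem_cocycles_top.1 hω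
    have h1 := (mem_coboundaries_top h.1).1 hω'
    refine (mem_coboundaries_top h.1.curveToThreefold).2 ?_
    rw [curveToThreefold_univ]
    exact curveLift_mem_exactTop h1

/-- The map `integral` is given on top components by `-π⁻¹` times the residue. -/
def ComputesRes (integral : ThreefoldCohomology B π P 3 →ₗ[ℂ_[p]] TorusCohomology p B 2) : Prop :=
  ∀ ω c r, IsClass ω c → IsRes B π P (ω Finset.univ) r →
    IsClass (topForm (-π⁻¹ • r)) (integral c)

variable (hπ : π ^ (p - 1) = -p) (hP : AdmissiblePoly B ∅ P)
  (hPint : ∀ ρ ∈ B.radii, ∀ J, ‖P.coeff J‖ * weight ρ J ≤ 1)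

lemma topForm_add (g h : Series p κ n) : topForm (g + h) = topForm g + topForm h :=
  Pi.single_add _ _ _

lemma topForm_smul (c : ℂ_[p]) (g : Series p κ n) : topForm (c • g) = c • topForm g :=
  Pi.single_smul _ _ _

include hπ hP hPint in
-- The residue exists and is unique for every overconvergent function, hence is linear; and residues
-- of exact functions are exact because the residue turns `D_u`, `D_v` into `∂_u`, `∂_v` and kills
-- the other images.
lemma exists_integral :
    ∃ integral : ThreefoldCohomology B π P 3 →ₗ[ℂ_[p]] TorusCohomology p B 2,
      ComputesRes integral := by
  have hex : ∀ ω ∈ cocycles B affX (phase π (threefoldEq P)) 5,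
      ∃ r, IsRes B π P (ω Finset.univ) r := fun ω hω =>
    exists_sub_mem_resKernel hπ hP hPint (mem_cocycles_top.1 hω).2
  -- The value zero for functions without residue is never used on cocycles.
  let res : Series p κ 5 → Series p κ 2 := fun g =>
    if h : ∃ r, IsRes B π P g r then h.choose else 0
  have hres : ∀ g r, IsRes B π P g r → res g = r := fun g r h => by
    have h' : ∃ r, IsRes B π P g r := ⟨r, h⟩
    simp only [res, dif_pos h']
    exact IsRes.unique hπ hP hPint h'.choose_spec h
  have hcl : ∀ r ∈ overconvergent p B (∅ : Set (Fin 2)),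
      topForm (-π⁻¹ • r) ∈ cocycles B (∅ : Set (Fin 2)) (0 : Poly p κ 2) 2 := fun r hr =>
    topForm_mem (Submodule.smul_mem _ _ hr)
  obtain ⟨G, hG⟩ : ∃ G : ThreefoldCohomology B π P 3 →ₗ[ℂ_[p]] TorusCohomology p B 2,
      Induces (fun ω => topForm (-π⁻¹ • res (ω Finset.univ))) G := by
    refine exists_induces _ (fun ω hω η hη => ?_) (fun c ω hω => ?_) (fun ω hω => ?_)
      (fun ω hω hω' => ?_)
    · obtain ⟨r, hr⟩ := hex ω hω
      obtain ⟨s, hs⟩ := hex η hη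
      simp only [Pi.add_apply]
      rw [hres _ _ hr, hres _ _ hs, hres _ _ (hr.add hs), smul_add, topForm_add]
    · obtain ⟨r, hr⟩ := hex ω hω
      simp only [Pi.smul_apply]
      rw [hres _ _ hr, hres _ _ (hr.smul c), smul_comm, topForm_smul]
    · obtain ⟨r, hr⟩ := hex ω hω
      change topForm (-π⁻¹ • res (ω Finset.univ)) ∈ _
      rw [hres _ _ hr]
      exact hcl r hr.1
    · have h := (mem_coboundaries_top (mem_cocycles_top.1 hω).1).1 hω'
      obtain ⟨r, hr, hr'⟩ := exists_isRes_of_mem_exactTop hP hπ hPint h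
      refine (mem_coboundaries_top (hasDegree_topForm _)).2 ?_
      rw [topForm_univ, hres _ _ hr']
      exact Submodule.smul_mem _ _ hr
  refine ⟨G, fun ω c r hc hr => ?_⟩
  have : IsClass (topForm (-π⁻¹ • res (ω Finset.univ))) (G c) := hG ω c hc
  rwa [hres _ _ hr] at this

lemma isClass_curveToThreefold_res (ω : Form p κ 3) {c : CurveCohomology B π P 1}
    (hω : IsClass ω c) : IsRes B π P (curveToThreefold ω Finset.univ) 0 := by
  rw [curveToThreefold_univ]
  exact isRes_of_mem (Submodule.mem_sup_left (Submodule.mem_map_of_mem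
    (mem_cocycles_top.1 hω.mem).2))

lemma ComputesRes.eq_zero
    {integral : ThreefoldCohomology B π P 3 →ₗ[ℂ_[p]] TorusCohomology p B 2}
    (hi : ComputesRes integral) {ω : Form p κ 5} {c : ThreefoldCohomology B π P 3}
    (hω : IsClass ω c) (h : IsRes B π P (ω Finset.univ) 0) : integral c = 0 := by
  have h1 := hi _ _ _ hω h
  rw [h1.top_eq_zero_iff, topForm_univ, smul_zero]
  exact zero_mem _

include hπ in
-- A function on the torus is its own residue when regarded as a function on the threefold, so
-- multiplying by `-π` gives a preimage.
lemma ComputesRes.surjective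
    {integral : ThreefoldCohomology B π P 3 →ₗ[ℂ_[p]] TorusCohomology p B 2}
    (hi : ComputesRes integral) : Function.Surjective integral := by
  intro c
  obtain ⟨ω, hω⟩ := exists_isClass c
  have h := mem_cocycles_top.1 hω.mem
  have hm : -π • ω Finset.univ ∈ overconvergent p B (∅ : Set (Fin 2)) :=
    Submodule.smul_mem _ _ h.2
  obtain ⟨c', hc'⟩ := isClass_of_mem (k := 5) (F := phase π (threefoldEq P))
    (topForm_mem (uv_mem hm))
  refine ⟨c', ?_⟩
  have h1 := hi _ c' (-π • ω Finset.univ) hc' (by rw [topForm_univ]; exact isRes_seriesMap hm)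
  rw [h1.top_eq_iff hω, topForm_univ, smul_smul, neg_mul_neg, inv_mul_cancel₀ (pi_ne_zero hπ),
    one_smul, sub_self]
  exact zero_mem _

include hπ in
lemma isClass_threefoldForm
    {integral : ThreefoldCohomology B π P 3 →ₗ[ℂ_[p]] TorusCohomology p B 2}
    (hi : ComputesRes integral) :
    ∃ c, IsClass (restrict π (threefoldEq P) threefoldForm) c ∧
      IsClass torusForm (integral c) := by
  set m : Series p κ 2 := Pi.single (Sum.elim (0 : κ → ℤ) ![-1, -1]) 1 with hm
  have hmem : m ∈ overconvergent p B (∅ : Set (Fin 2)) := by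
    have h2 : m = mon (Sum.elim (0 : κ → ℤ) ![-1, -1]) (Pi.single 0 1) := by
      ext I
      simp only [mon_apply, hm, Pi.single_apply, sub_eq_zero]
    rw [h2]
    exact mon_mem ⟨fun _ _ => le_rfl, fun _ h => absurd h (Set.notMem_empty _)⟩ (single_zero_mem B ∅)
  have hmem' : -π • m ∈ overconvergent p B (∅ : Set (Fin 2)) := Submodule.smul_mem _ _ hmem
  have h1 : restrict π (threefoldEq P) threefoldForm ∈
      cocycles B affX (phase π (threefoldEq P)) 5 := by
    refine mem_cocycles_top.2 ⟨hasDegree_threefoldForm.restrict _ _, ?_⟩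
    rw [restrict_threefoldForm_univ]
    exact uv_mem hmem'
  obtain ⟨c, hc⟩ := isClass_of_mem h1
  refine ⟨c, hc, ?_⟩
  have h2 := hi _ c (-π • m) hc (by rw [restrict_threefoldForm_univ]; exact isRes_seriesMap hmem')
  have h3 : topForm (-π⁻¹ • -π • m) = (torusForm : Form p κ 2) := by
    refine (hasDegree_topForm _).ext_top hasDegree_torusForm ?_
    rw [topForm_univ, torusForm_univ, smul_smul, neg_mul_neg, inv_mul_cancel₀ (pi_ne_zero hπ),
      one_smul]
  rwa [h3] at h2

include hP in
lemma twistedDeriv_mem_fibreExact (i : Fin 5) {f : Series p κ 5} (hf : f ∈ fibreExact B π P) :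
    threefoldD π P i f ∈ fibreExact B π P := by
  obtain ⟨a, ha, d, hd, e, he, rfl⟩ := mem_fibreExact.1 hf
  have hFX := hP.threefoldEq.phase π
  have h2 : ∀ (j : Fin 5) (b : Series p κ 5), threefoldD π P i (threefoldD π P j b) =
      threefoldD π P j (threefoldD π P i b) := fun j b => twistedDeriv_comm _ _ _ _
  rw [map_add, map_add, h2, h2, h2]
  exact mem_fibreExact.2 ⟨_, twistedDeriv_mem hFX ha _, _, twistedDeriv_mem hFX hd _, _,
    twistedDeriv_mem hFX he _, rfl⟩

include hP in
/-- The boundary of functions on the torus in the threefold. -/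
lemma exists_lift_of_exact {r₁ r₂ : Series p κ 2}
    (hr₁ : r₁ ∈ overconvergent p B (∅ : Set (Fin 2)))
    (hr₂ : r₂ ∈ overconvergent p B (∅ : Set (Fin 2))) :
    seriesMap uvEmb (deriv (Sum.inr 0) r₁ + deriv (Sum.inr 1) r₂) +
      curveLift (seriesMap (Fin.succOrderEmb 2) (curveBracket π P (-r₂) r₁)) ∈
        exactTop B affX (phase π (threefoldEq P)) := by
  have h1 := twistedDeriv_seriesMap_uv π P (Sum.inr 0) r₁
  have h2 := twistedDeriv_seriesMap_uv π P (Sum.inr 1) r₂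
  have h3 := add_mem (twistedDeriv_mem_exactTop (phase π (threefoldEq P)) 1 (uv_mem hr₁))
    (twistedDeriv_mem_exactTop (phase π (threefoldEq P)) 2 (uv_mem hr₂))
  convert h3 using 1
  refine Eq.trans ?_ (congrArg₂ (· + ·) h1 h2).symm
  rw [curveBracket, seriesMap_add, seriesMap_sub]
  simp only [map_neg, smul_neg, map_sub, seriesMap_neg]
  abel

include hP in
-- If the residue is `r = ∂_u s + ∂_v s'`, then `D_u s + D_v s'` on the threefold equals `r` plus a
-- term `t k` with `k` from the curve. Subtracting this exact function leaves only a lift from the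
-- curve and an element of `fibreExact`.
lemma exact_alpha_integral {α : CurveCohomology B π P 1 →ₗ[ℂ_[p]] ThreefoldCohomology B π P 3}
    (hα : Induces curveToThreefold α)
    {integral : ThreefoldCohomology B π P 3 →ₗ[ℂ_[p]] TorusCohomology p B 2}
    (hi : ComputesRes integral) (hπ : π ^ (p - 1) = -p)
    (hPint : ∀ ρ ∈ B.radii, ∀ J, ‖P.coeff J‖ * weight ρ J ≤ 1) : Function.Exact α integral := by
  intro c
  constructor
  · intro h
    obtain ⟨ω, hω⟩ := exists_isClass c
    obtain ⟨r, hr⟩ := exists_sub_mem_resKernel hπ hP hPint (mem_cocycles_top.1 hω.mem).2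
    have h1 := hi _ _ _ hω hr
    rw [h] at h1
    obtain ⟨s, hs, hs'⟩ := mem_exactTop.1 (h1.top_eq_zero_iff.1 rfl)
    rw [topForm_univ, Fin.sum_univ_two, twistedDeriv_zero, twistedDeriv_zero] at hs'
    have hr2 : r = deriv (Sum.inr 0) (-π • s 0) + deriv (Sum.inr 1) (-π • s 1) := by
      rw [map_smul, map_smul, ← smul_add, ← hs', smul_smul, neg_mul_neg,
        mul_inv_cancel₀ (pi_ne_zero hπ), one_smul]
    have hs0 : -π • s 0 ∈ overconvergent p B (∅ : Set (Fin 2)) := Submodule.smul_mem _ _ (hs 0)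
    have hs1 : -π • s 1 ∈ overconvergent p B (∅ : Set (Fin 2)) := Submodule.smul_mem _ _ (hs 1)
    have hex := exists_lift_of_exact (π := π) hP hs0 hs1
    rw [← hr2] at hex
    obtain ⟨l, hl, f, hf, hlf⟩ := Submodule.mem_sup.1 hr.2
    obtain ⟨h, hh, rfl⟩ := Submodule.mem_map.1 hl
    set br := seriesMap (Fin.succOrderEmb 2) (curveBracket π P (-(-π • s 1)) (-π • s 0))
    have hbr : br ∈ overconvergent p B affC := succ_mem (curveBracket_mem hP (neg_mem hs1) hs0)
    obtain ⟨c', hc'⟩ := isClass_of_mem (F := phase π P) (topForm_mem (sub_mem hh hbr))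
    refine ⟨c', ?_⟩
    have h5 := hα _ _ hc'
    rw [h5.top_eq_iff hω, curveToThreefold_univ, topForm_univ, map_sub]
    rw [← neg_mem_iff]
    have : -(curveLift h - curveLift br - ω Finset.univ) = (seriesMap uvEmb r + curveLift br) + f := by
      rw [← sub_add_cancel (ω Finset.univ) (seriesMap uvEmb r), ← hlf]; abel
    rw [this]
    exact add_mem hex (fibreExact_le_exactTop _ _ _ hf)
  · rintro ⟨c', rfl⟩
    obtain ⟨ω, hω⟩ := exists_isClass c'
    exact hi.eq_zero (hα _ _ hω) (isClass_curveToThreefold_res ω hω)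

include hP in
-- Let `r₁`, `r₂` be the residues of the components in the directions `u`, `v` of a primitive of `t
-- ω`. Uniqueness of the fibre decomposition applied to this exactness relation gives two
-- conclusions: `∂_u r₁ + ∂_v r₂ = 0`, so that `r₁ dv - r₂ du` is closed on the torus, and `ω` is
-- its restriction up to an exact form of the curve.
lemma exact_iStar_alpha {iStar : TorusCohomology p B 1 →ₗ[ℂ_[p]] CurveCohomology B π P 1}
    (hs : Induces (restrict π P) iStar)
    {α : CurveCohomology B π P 1 →ₗ[ℂ_[p]] ThreefoldCohomology B π P 3}
    (hα : Induces curveToThreefold α) (hπ : π ^ (p - 1) = -p)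
    (hPint : ∀ ρ ∈ B.radii, ∀ J, ‖P.coeff J‖ * weight ρ J ≤ 1) : Function.Exact iStar α := by
  intro c
  constructor
  · intro hc
    obtain ⟨ω, hω⟩ := exists_isClass c
    have h1 := hα _ _ hω
    rw [hc] at h1
    obtain ⟨a, ha, ha'⟩ := mem_exactTop.1 (h1.top_eq_zero_iff.1 rfl)
    obtain ⟨r₁, hr₁, hr₁'⟩ := exists_sub_mem_resKernel hπ hP hPint (ha 1)
    obtain ⟨r₂, hr₂, hr₂'⟩ := exists_sub_mem_resKernel hπ hP hPint (ha 2)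
    obtain ⟨l₁, hl₁, f₁, hf₁, hlf₁⟩ := Submodule.mem_sup.1 hr₁'
    obtain ⟨l₂, hl₂, f₂, hf₂, hlf₂⟩ := Submodule.mem_sup.1 hr₂'
    obtain ⟨h₁, hh₁, rfl⟩ := Submodule.mem_map.1 hl₁
    obtain ⟨h₂, hh₂, rfl⟩ := Submodule.mem_map.1 hl₂
    rw [eq_sub_iff_add_eq] at hlf₁ hlf₂
    set br := seriesMap (Fin.succOrderEmb 2) (curveBracket π P (-r₂) r₁) with hbrdef
    have hbr : br ∈ overconvergent p B affC := succ_mem (curveBracket_mem hP (neg_mem hr₂) hr₁)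
    have hg := (mem_cocycles_top.1 hω.mem).2
    have hCm := fun {h : Series p κ 3} (hh : h ∈ overconvergent p B affC) (i : Fin 3) =>
      twistedDeriv_mem (hP.phase π) hh (Sum.inr i)
    -- The components in the directions `u`, `v` are replaced by residue plus lift plus an element
    -- of `fibreExact`, which is stable under `D_u`, `D_v`. Only a function on the torus and a lift
    -- from the curve remain outside `fibreExact`.
    have key : seriesMap uvEmb (deriv (Sum.inr 0) r₁ + deriv (Sum.inr 1) r₂) +
        curveLift (br + curveD π P 1 h₁ + curveD π P 2 h₂ - ω Finset.univ) ∈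
          fibreExact B π P := by
      have e1 : threefoldD π P 1 (seriesMap uvEmb r₁) = seriesMap uvEmb (deriv (Sum.inr 0) r₁) +
        curveLift (seriesMap (Fin.succOrderEmb 2) (π • mulPoly (polyDeriv (Sum.inr 0) P) r₁)) :=
          twistedDeriv_seriesMap_uv π P (Sum.inr 0) r₁
      have e2 : threefoldD π P 2 (seriesMap uvEmb r₂) = seriesMap uvEmb (deriv (Sum.inr 1) r₂) +
        curveLift (seriesMap (Fin.succOrderEmb 2) (π • mulPoly (polyDeriv (Sum.inr 1) P) r₂)) :=
          twistedDeriv_seriesMap_uv π P (Sum.inr 1) r₂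
      have e3 : threefoldD π P 1 (curveLift h₁) = curveLift (curveD π P 1 h₁) :=
        twistedDeriv_curveLift π P (i := Sum.inr 1) (by simp) h₁
      have e4 : threefoldD π P 2 (curveLift h₂) = curveLift (curveD π P 2 h₂) :=
        twistedDeriv_curveLift π P (i := Sum.inr 2) (by simp) h₂
      have e5 : curveLift br =
          curveLift (seriesMap (Fin.succOrderEmb 2) (π • mulPoly (polyDeriv (Sum.inr 0) P) r₁)) +
          curveLift (seriesMap (Fin.succOrderEmb 2) (π • mulPoly (polyDeriv (Sum.inr 1) P) r₂)) := by
        rw [hbrdef, curveBracket, seriesMap_sub]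
        simp only [map_neg, smul_neg, map_sub, seriesMap_neg]
        abel
      have e6 : curveLift (ω Finset.univ) = threefoldD π P 0 (a 0) + threefoldD π P 1 (a 1) +
          threefoldD π P 2 (a 2) + threefoldD π P 3 (a 3) + threefoldD π P 4 (a 4) := by
        rw [← curveToThreefold_univ, ha', Fin.sum_univ_five]
      rw [← hlf₁, ← hlf₂, map_add, map_add, map_add, map_add, e1, e2, e3, e4] at e6
      rw [map_sub, map_add, map_add, e5, e6, seriesMap_add]
      have e7 := add_mem (add_mem (twistedDeriv_mem_fibreExact hP 1 hf₁)
        (twistedDeriv_mem_fibreExact hP 2 hf₂)) (add_mem (add_mem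
          (t_mem_fibreExact (π := π) (P := P) (ha 0)) (x_mem_fibreExact (π := π) (P := P) (ha 3)))
          (y_mem_fibreExact (π := π) (P := P) (ha 4)))
      rw [← neg_mem_iff] at e7
      convert e7 using 1
      abel
    obtain ⟨hz, h', hh', heq⟩ := eq_zero_of_mem_fibreExact hπ hP hPint
      (sub_mem (add_mem (add_mem hbr (hCm hh₁ 1)) (hCm hh₂ 2)) hg) key
    set η : Form p κ 2 := Pi.single {0} (-r₂) + Pi.single {1} r₁ with hη
    have hne : ({0} : Finset (Fin 2)) ≠ {1} := by decide
    have hη0 : η {0} = -r₂ := by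
      rw [hη, Pi.add_apply, Pi.single_eq_same, Pi.single_eq_of_ne hne, add_zero]
    have hη1 : η {1} = r₁ := by
      rw [hη, Pi.add_apply, Pi.single_eq_same, Pi.single_eq_of_ne hne.symm, zero_add]
    have hηm : η ∈ cocycles B (∅ : Set (Fin 2)) (0 : Poly p κ 2) 1 := by
      refine mem_cocycles_one.2 ⟨fun S hS => ?_, ?_, ?_, ?_⟩
      · rw [hη, Pi.add_apply, Pi.single_eq_of_ne, Pi.single_eq_of_ne, add_zero] <;>
        · rintro rfl; exact hS (Finset.card_singleton _)
      · rw [hη0]; exact neg_mem hr₂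
      · rw [hη1]; exact hr₁
      · rw [hη0, hη1, map_neg, ← add_eq_zero_iff_eq_neg, hz]
    obtain ⟨c', hc'⟩ := isClass_of_mem hηm
    refine ⟨c', ?_⟩
    rw [(hs _ _ hc').top_eq_iff hω, restrict_univ, hη0, hη1]
    have : br - ω Finset.univ = curveD π P 0 h' - curveD π P 1 h₁ - curveD π P 2 h₂ := by
      rw [← heq]; abel
    rw [this]
    exact sub_mem (sub_mem (twistedDeriv_mem_exactTop _ _ hh') (twistedDeriv_mem_exactTop _ _ hh₁))
      (twistedDeriv_mem_exactTop _ _ hh₂)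
  · rintro ⟨c', rfl⟩
    obtain ⟨η, hη⟩ := exists_isClass c'
    obtain ⟨-, h1, h2, h3⟩ := mem_cocycles_one.1 hη.mem
    have h4 := hα _ _ (hs _ _ hη)
    rw [h4.top_eq_zero_iff, curveToThreefold_univ, restrict_univ]
    -- Applied to `r₁ = η_v` and `r₂ = -η_u`: closedness of `η` makes the part on the torus vanish,
    -- so the lift of the restriction is exact.
    have h5 := exists_lift_of_exact (π := π) hP h2 (neg_mem h1)
    rwa [neg_neg, map_neg, h3, add_neg_cancel, seriesMap_zero, zero_add] at h5

/-- A criterion for the three maps to commute with operators. -/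
lemma commutes_of {iStar : TorusCohomology p B 1 →ₗ[ℂ_[p]] CurveCohomology B π P 1}
    (hs : Induces (restrict π P) iStar)
    {α : CurveCohomology B π P 1 →ₗ[ℂ_[p]] ThreefoldCohomology B π P 3}
    (hα : Induces curveToThreefold α)
    {integral : ThreefoldCohomology B π P 3 →ₗ[ℂ_[p]] TorusCohomology p B 2}
    (hi : ComputesRes integral) (hex : Function.Exact α integral)
    (hπ : π ^ (p - 1) = -p) (hP : AdmissiblePoly B ∅ P)
    (hPint : ∀ ρ ∈ B.radii, ∀ J, ‖P.coeff J‖ * weight ρ J ≤ 1)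
    {ΦT : Form p κ 2 → Form p κ 2} {ΦC : Form p κ 3 → Form p κ 3} {ΦX : Form p κ 5 → Form p κ 5}
    (hT₁ : ∃ T : TorusCohomology p B 1 →ₗ[ℂ_[p]] TorusCohomology p B 1, Induces ΦT T)
    (hC₁ : ∃ C : CurveCohomology B π P 1 →ₗ[ℂ_[p]] CurveCohomology B π P 1, Induces ΦC C)
    (hX₃ : ∃ X : ThreefoldCohomology B π P 3 →ₗ[ℂ_[p]] ThreefoldCohomology B π P 3, Induces ΦX X)
    (hT₂ : ∃ T : TorusCohomology p B 2 →ₗ[ℂ_[p]] TorusCohomology p B 2, Induces ΦT T)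
    (h₁ : ∀ ω ∈ cocycles B (∅ : Set (Fin 2)) (0 : Poly p κ 2) 1,
      restrict π P (ΦT ω) Finset.univ - ΦC (restrict π P ω) Finset.univ ∈
        exactTop B affC (phase π P))
    (h₂ : ∀ ω ∈ cocycles B affC (phase π P) 3,
      curveToThreefold (ΦC ω) Finset.univ - ΦX (curveToThreefold ω) Finset.univ ∈
        exactTop B affX (phase π (threefoldEq P)))
    (h₃ : ∀ r ∈ overconvergent p B (∅ : Set (Fin 2)),
      ∃ r', IsRes B π P (ΦX (topForm (seriesMap uvEmb r)) Finset.univ) r' ∧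
        -π⁻¹ • r' - ΦT (topForm (-π⁻¹ • r)) Finset.univ ∈ exactTop B ∅ (0 : Poly p κ 2)) :
    Commutes iStar α integral ΦT ΦC ΦX := by
  obtain ⟨T₁, hT₁⟩ := hT₁
  obtain ⟨C₁, hC₁⟩ := hC₁
  obtain ⟨X₃, hX₃⟩ := hX₃
  obtain ⟨T₂, hT₂⟩ := hT₂
  have hαC : α ∘ₗ C₁ = X₃ ∘ₗ α := by
    refine LinearMap.ext fun c => ?_
    obtain ⟨ω, hω⟩ := exists_isClass c
    exact ((hα _ _ (hC₁ _ _ hω)).top_eq_iff (hX₃ _ _ (hα _ _ hω))).2 (h₂ ω hω.mem)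
  refine ⟨T₁, C₁, X₃, T₂, hT₁, hC₁, hX₃, hT₂, ?_, hαC, ?_⟩
  · refine LinearMap.ext fun c => ?_
    obtain ⟨ω, hω⟩ := exists_isClass c
    exact ((hs _ _ (hT₁ _ _ hω)).top_eq_iff (hC₁ _ _ (hs _ _ hω))).2 (h₁ ω hω.mem)
  · refine LinearMap.ext fun c => ?_
    obtain ⟨ω, hω⟩ := exists_isClass c
    obtain ⟨r, hr, hr'⟩ := exists_sub_mem_resKernel hπ hP hPint (mem_cocycles_top.1 hω.mem).2
    obtain ⟨c₀, hc₀⟩ := isClass_of_mem (k := 5) (F := phase π (threefoldEq P))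
      (topForm_mem (uv_mem hr))
    have hc₀' : IsRes B π P ((topForm (seriesMap uvEmb r)) Finset.univ) r := by
      rw [topForm_univ]; exact isRes_seriesMap hr
    -- `c₀` is the class of the residue of `c`, so `c - c₀` comes from the curve. There both
    -- composites vanish: the operators commute with `α`, and `integral` kills the image of `α`.
    -- Only `c₀` has to be examined.
    have h4 : integral (c - c₀) = 0 := by
      refine hi.eq_zero (ω := ω - topForm (seriesMap uvEmb r)) ?_ ?_
      · obtain ⟨h5, rfl⟩ := hω
        obtain ⟨h6, rfl⟩ := hc₀
        exact ⟨sub_mem h5 h6, rfl⟩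
      · rw [Pi.sub_apply, topForm_univ]; exact isRes_of_mem hr'
    obtain ⟨c₁, hc₁⟩ := (hex _).1 h4
    have h5 : integral (X₃ (c - c₀)) = T₂ (integral (c - c₀)) := by
      rw [h4, map_zero, ← hc₁]
      exact (congrArg integral (LinearMap.congr_fun hαC c₁).symm).trans
        ((hex _).2 ⟨C₁ c₁, rfl⟩)
    have h6 : integral (X₃ c₀) = T₂ (integral c₀) := by
      obtain ⟨r', hr1, hr2⟩ := h₃ r hr
      have h7 := hi _ _ _ (hX₃ _ _ hc₀) hr1
      have h8 := hT₂ _ _ (hi _ _ _ hc₀ hc₀')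
      rw [h7.top_eq_iff h8, topForm_univ]
      exact hr2
    rw [map_sub, map_sub, map_sub, map_sub, h6] at h5
    exact sub_left_injective h5

end Sequence

/-! ### Products of overconvergent functions -/

section Products
variable {B : ParamDomain κ} {A : Set (Fin n)} {a b b' : Series p κ n}

lemma mulSeries_add_of_mem (ha : a ∈ overconvergent p B A) (hb : b ∈ overconvergent p B A)
    (hb' : b' ∈ overconvergent p B A) :
    mulSeries a (b + b') = mulSeries a b + mulSeries a b' := by
  obtain ⟨ρ, hρ⟩ := B.radii_nonempty
  exact mulSeries_add (B.radii_pos ρ hρ) (decays_of_mem ha hρ) (decays_of_mem hb hρ)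
    (decays_of_mem hb' hρ)

lemma mulSeries_sub_of_mem (ha : a ∈ overconvergent p B A) (hb : b ∈ overconvergent p B A)
    (hb' : b' ∈ overconvergent p B A) :
    mulSeries a (b - b') = mulSeries a b - mulSeries a b' := by
  rw [sub_eq_add_neg, mulSeries_add_of_mem ha hb (neg_mem hb'), ← neg_one_smul ℂ_[p] b',
    mulSeries_smul, neg_one_smul, sub_eq_add_neg]

lemma add_mulSeries_of_mem (ha : a ∈ overconvergent p B A) (hb : b ∈ overconvergent p B A)
    (hb' : b' ∈ overconvergent p B A) :
    mulSeries (b + b') a = mulSeries b a + mulSeries b' a := by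
  rw [mulSeries_comm, mulSeries_add_of_mem ha hb hb', mulSeries_comm a, mulSeries_comm a]

lemma mulSeries_mulPoly_of_mem (ha : a ∈ overconvergent p B A) (hb : b ∈ overconvergent p B A)
    (f : Poly p κ n) : mulSeries a (mulPoly f b) = mulPoly f (mulSeries a b) := by
  obtain ⟨ρ, hρ⟩ := B.radii_nonempty
  exact mulSeries_mulPoly (B.radii_pos ρ hρ) (decays_of_mem ha hρ) (decays_of_mem hb hρ) f

lemma mulPoly_mulSeries_of_mem (ha : a ∈ overconvergent p B A) (hb : b ∈ overconvergent p B A)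
    (f : Poly p κ n) : mulSeries (mulPoly f a) b = mulPoly f (mulSeries a b) := by
  rw [mulSeries_comm, mulSeries_mulPoly_of_mem hb ha, mulSeries_comm]

lemma deriv_mulSeries_of_mem (ha : a ∈ overconvergent p B A) (hb : b ∈ overconvergent p B A)
    (i : κ ⊕ Fin n) : deriv i (mulSeries a b) = mulSeries (deriv i a) b + mulSeries a (deriv i b) := by
  obtain ⟨ρ, hρ⟩ := B.radii_nonempty
  exact deriv_mulSeries (B.radii_pos ρ hρ) (decays_of_mem ha hρ) (decays_of_mem hb hρ) i

end Products

/-- Operators that act on coefficients and commute with the `D_i` induce maps in cohomology. -/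
lemma exists_induces_componentwise {B : ParamDomain κ} {A : Set (Fin n)} {F : Poly p κ n} {k : ℕ}
    (hF : AdmissiblePoly B A F) (φ : Series p κ n → Series p κ n) (hφ0 : φ 0 = 0)
    (hadd : ∀ a ∈ overconvergent p B A, ∀ b ∈ overconvergent p B A, φ (a + b) = φ a + φ b)
    (hsmul : ∀ (c : ℂ_[p]), ∀ a ∈ overconvergent p B A, φ (c • a) = c • φ a)
    (hmem : ∀ a ∈ overconvergent p B A, φ a ∈ overconvergent p B A)
    (hD : ∀ i, ∀ a ∈ overconvergent p B A,
      twistedDeriv F (Sum.inr i) (φ a) = φ (twistedDeriv F (Sum.inr i) a)) :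
    ∃ G : DeRham B A F k →ₗ[ℂ_[p]] DeRham B A F k, Induces (fun ω S => φ (ω S)) G := by
  refine exists_induces_of_commutes _ (fun ω hω η hη => ?_) (fun c ω hω => ?_) (fun ω hω => ?_)
    (fun S ω h => ?_) (fun ω hω => ?_)
  · ext1 S; exact hadd _ (mem_forms.1 hω S) _ (mem_forms.1 hη S)
  · ext1 S; exact hsmul c _ (mem_forms.1 hω S)
  · exact mem_forms.2 fun S => hmem _ (mem_forms.1 hω S)
  · simp only [h, hφ0]
  · ext1 S
    rw [twistedD_apply]
    simp only [twistedD_apply]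
    have hterm : ∀ i, (if i ∈ S then (-1 : ℂ_[p]) ^ (S.filter (· < i)).card •
        twistedDeriv F (Sum.inr i) (ω (S.erase i)) else 0) ∈ overconvergent p B A := fun i => by
      split_ifs
      · exact Submodule.smul_mem _ _ (twistedDeriv_mem hF (mem_forms.1 hω _) _)
      · exact zero_mem _
    -- `φ` is additive only on overconvergent series, since it may be given by infinite sums; so
    -- finite sums are treated by hand.
    have hsum : ∀ (s : Finset (Fin n)) (g : Fin n → Series p κ n),
        (∀ i, g i ∈ overconvergent p B A) → φ (∑ i ∈ s, g i) = ∑ i ∈ s, φ (g i) := by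
      intro s g hg
      induction s using Finset.induction_on with
      | empty => simp [hφ0]
      | insert i s hi ih =>
        rw [Finset.sum_insert hi, Finset.sum_insert hi, hadd _ (hg i) _ (sum_mem fun j _ => hg j), ih]
    rw [hsum _ _ hterm]
    refine Finset.sum_congr rfl fun i _ => ?_
    split_ifs
    · rw [hsmul _ _ (twistedDeriv_mem hF (mem_forms.1 hω _) _), hD _ _ (mem_forms.1 hω _)]
    · exact hφ0.symm

/-! ### Functions of the parameters -/

section Param

/-- A function of the parameters as a function of parameters and coordinates. -/
def paramMap (b : Series p κ 0) : Series p κ n :=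
  seriesMap (Fin.castLEOrderEmb (Nat.zero_le n)) b

lemma mulParam_apply (b : Series p κ 0) (ω : Form p κ n) (S : Finset (Fin n)) :
    mulParam b ω S = mulSeries (paramMap b) (ω S) := rfl

lemma seriesMap_paramMap {m : ℕ} (e : Fin m ↪o Fin n) (b : Series p κ 0) :
    seriesMap e (paramMap b) = paramMap b := by
  rw [paramMap, paramMap, seriesMap_seriesMap]
  congr 1
  exact RelEmbedding.ext fun i => i.elim0

variable {B : ParamDomain κ} {b : Series p κ 0} (hb : b ∈ overconvergent p B (∅ : Set (Fin 0)))

include hb in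
lemma paramMap_mem (A : Set (Fin n)) : paramMap b ∈ overconvergent p B A :=
  seriesMap_mem _ (fun i => i.elim0) hb

lemma deriv_paramMap (b : Series p κ 0) (i : Fin n) : deriv (Sum.inr i) (paramMap b) = 0 :=
  deriv_seriesMap_of_notMem _ (by rintro ⟨j, -⟩; exact j.elim0) b

include hb in
lemma twistedDeriv_mulParam {A : Set (Fin n)} {a : Series p κ n} (ha : a ∈ overconvergent p B A)
    (F : Poly p κ n) (i : Fin n) : twistedDeriv F (Sum.inr i) (mulSeries (paramMap b) a) =
      mulSeries (paramMap b) (twistedDeriv F (Sum.inr i) a) := by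
  obtain ⟨ρ, hρ⟩ := B.radii_nonempty
  have h1 := decays_of_mem ha hρ
  have hpos := B.radii_pos ρ hρ
  rw [twistedDeriv_apply, twistedDeriv_apply, deriv_mulSeries_of_mem (paramMap_mem hb A) ha,
    deriv_paramMap, mulSeries_comm 0, mulSeries_zero, zero_add,
    mulSeries_add hpos (decays_of_mem (paramMap_mem hb A) hρ) (h1.deriv hpos _) (h1.mulPoly hpos _),
    mulSeries_mulPoly_of_mem (paramMap_mem hb A) ha]

include hb in
lemma exists_induces_mulParam {A : Set (Fin n)} {F : Poly p κ n} (hF : AdmissiblePoly B A F)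
    {k : ℕ} : ∃ G : DeRham B A F k →ₗ[ℂ_[p]] DeRham B A F k, Induces (mulParam b) G :=
  exists_induces_componentwise hF (mulSeries (paramMap b)) (mulSeries_zero _)
    (fun _ ha _ ha' => mulSeries_add_of_mem (paramMap_mem hb A) ha ha')
    (fun c _ _ => mulSeries_smul _ _ c) (fun _ ha => mulSeries_mem (paramMap_mem hb A) ha)
    (fun i _ ha => twistedDeriv_mulParam hb ha F i)

lemma admissiblePoly_zero (B : ParamDomain κ) (A : Set (Fin n)) :
    AdmissiblePoly B A (0 : Poly p κ n) := fun _ hJ => absurd rfl hJ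

variable {π : ℂ_[p]} {P : Poly p κ 2}

include hb in
/-- The three maps commute with multiplication by functions of the parameters. -/
lemma commutes_mulParam {iStar : TorusCohomology p B 1 →ₗ[ℂ_[p]] CurveCohomology B π P 1}
    (hs : Induces (restrict π P) iStar)
    {α : CurveCohomology B π P 1 →ₗ[ℂ_[p]] ThreefoldCohomology B π P 3}
    (hα : Induces curveToThreefold α)
    {integral : ThreefoldCohomology B π P 3 →ₗ[ℂ_[p]] TorusCohomology p B 2}
    (hi : ComputesRes integral) (hex : Function.Exact α integral)
    (hπ : π ^ (p - 1) = -p) (hP : AdmissiblePoly B ∅ P)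
    (hPint : ∀ ρ ∈ B.radii, ∀ J, ‖P.coeff J‖ * weight ρ J ≤ 1) :
    Commutes iStar α integral (mulParam b) (mulParam b) (mulParam b) := by
  refine commutes_of hs hα hi hex hπ hP hPint
    (exists_induces_mulParam hb (admissiblePoly_zero _ _))
    (exists_induces_mulParam hb (hP.phase π))
    (exists_induces_mulParam hb (hP.threefoldEq.phase π))
    (exists_induces_mulParam hb (admissiblePoly_zero _ _)) (fun ω hω => ?_) (fun ω hω => ?_)
    (fun r hr => ?_)
  · obtain ⟨-, h1, h2, -⟩ := mem_cocycles_one.1 hω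
    have hβ := paramMap_mem (n := 2) hb ∅
    have hbr : ∀ i {a : Series p κ 2}, a ∈ overconvergent p B (∅ : Set (Fin 2)) →
        π • mulPoly (polyDeriv i P) a ∈ overconvergent p B (∅ : Set (Fin 2)) := fun i _ h =>
      Submodule.smul_mem _ _ (mulPoly_mem (hP.polyDeriv i) h)
    rw [restrict_univ, mulParam_apply, mulParam_apply, mulParam_apply, restrict_univ,
      ← seriesMap_paramMap (Fin.succOrderEmb 2), ← seriesMap_mulSeries, curveBracket, curveBracket,
      mulSeries_sub_of_mem hβ (hbr _ h2) (hbr _ h1), mulSeries_smul, mulSeries_smul,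
      mulSeries_mulPoly_of_mem hβ h1, mulSeries_mulPoly_of_mem hβ h2, sub_self]
    exact zero_mem _
  · have h := (mem_cocycles_top.1 hω).2
    rw [curveToThreefold_univ, mulParam_apply, mulParam_apply, curveToThreefold_univ,
      curveLift_apply, curveLift_apply, seriesMap_mulSeries, seriesMap_paramMap,
      mulSeries_mulPoly_single, sub_self]
    exact zero_mem _
  · refine ⟨mulSeries (paramMap b) r, ?_, ?_⟩
    · rw [mulParam_apply, topForm_univ, ← seriesMap_paramMap uvEmb, ← seriesMap_mulSeries]
      exact isRes_seriesMap (mulSeries_mem (paramMap_mem hb ∅) hr)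
    · rw [mulParam_apply, topForm_univ, mulSeries_smul, sub_self]
      exact zero_mem _

/-! ### The Gauss–Manin connection -/

lemma exists_induces_gaussManin {A : Set (Fin n)} {F : Poly p κ n} (hF : AdmissiblePoly B A F)
    (k : κ) {d : ℕ} : ∃ G : DeRham B A F d →ₗ[ℂ_[p]] DeRham B A F d, Induces (gaussManin F k) G :=
  exists_induces_componentwise hF (twistedDeriv F (Sum.inl k)) (map_zero _)
    (fun _ _ _ _ => map_add _ _ _) (fun _ _ _ => map_smul _ _ _)
    (fun _ ha => twistedDeriv_mem hF ha _) (fun _ _ _ => twistedDeriv_comm _ _ _ _)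

lemma gaussManin_apply (F : Poly p κ n) (k : κ) (ω : Form p κ n) (S : Finset (Fin n)) :
    gaussManin F k ω S = twistedDeriv F (Sum.inl k) (ω S) := rfl

/-- The three maps commute with the Gauss–Manin connections. -/
lemma commutes_gaussManin {iStar : TorusCohomology p B 1 →ₗ[ℂ_[p]] CurveCohomology B π P 1}
    (hs : Induces (restrict π P) iStar)
    {α : CurveCohomology B π P 1 →ₗ[ℂ_[p]] ThreefoldCohomology B π P 3}
    (hα : Induces curveToThreefold α)
    {integral : ThreefoldCohomology B π P 3 →ₗ[ℂ_[p]] TorusCohomology p B 2}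
    (hi : ComputesRes integral) (hex : Function.Exact α integral)
    (hπ : π ^ (p - 1) = -p) (hP : AdmissiblePoly B ∅ P)
    (hPint : ∀ ρ ∈ B.radii, ∀ J, ‖P.coeff J‖ * weight ρ J ≤ 1) (k : κ) :
    Commutes iStar α integral (gaussManin 0 k) (gaussManin (phase π P) k)
      (gaussManin (phase π (threefoldEq P)) k) := by
  refine commutes_of hs hα hi hex hπ hP hPint
    (exists_induces_gaussManin (admissiblePoly_zero _ _) k)
    (exists_induces_gaussManin (hP.phase π) k)
    (exists_induces_gaussManin (hP.threefoldEq.phase π) k)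
    (exists_induces_gaussManin (admissiblePoly_zero _ _) k) (fun ω hω => ?_) (fun ω hω => ?_)
    (fun r hr => ?_)
  · obtain ⟨-, ha, hb, hab⟩ := mem_cocycles_one.1 hω
    set a := ω {0}
    set b := ω {1}
    have h1 := curveD_seriesMap (π := π) (P := P) (Sum.inl k) (curveBracket π P a b)
    have h2 : curveD π P 1 _ = _ := curveD_seriesMap (π := π) (P := P) (Sum.inr 0)
      (π • mulPoly (polyDeriv (Sum.inl k) P) b)
    have h3 : curveD π P 2 _ = _ := curveD_seriesMap (π := π) (P := P) (Sum.inr 1)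
      (π • mulPoly (polyDeriv (Sum.inl k) P) a)
    have hm : ∀ {c : Series p κ 2}, c ∈ overconvergent p B (∅ : Set (Fin 2)) →
        seriesMap (Fin.succOrderEmb 2) (π • mulPoly (polyDeriv (Sum.inl k) P) c) ∈
          overconvergent p B affC := fun hc =>
      succ_mem (Submodule.smul_mem _ _ (mulPoly_mem (hP.polyDeriv _) hc))
    -- The homotopy between restriction after `∇` and `∇` after restriction is multiplication by `π
    -- ∂_λ P`. The closedness of `a du + b dv` removes the terms containing derivatives of `a` and
    -- `b` along the torus.
    have h4 : seriesMap (Fin.succOrderEmb 2)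
        (curveBracket π P (deriv (Sum.inl k) a) (deriv (Sum.inl k) b)) -
        twistedDeriv (phase π P) (Sum.inl k) (seriesMap (Fin.succOrderEmb 2) (curveBracket π P a b))
        = curveD π P 2 (seriesMap (Fin.succOrderEmb 2) (π • mulPoly (polyDeriv (Sum.inl k) P) a)) -
          curveD π P 1
            (seriesMap (Fin.succOrderEmb 2) (π • mulPoly (polyDeriv (Sum.inl k) P) b)) := by
      rw [h2, h3]
      refine (congrArg₂ (· - ·) rfl h1).trans ?_
      rw [← sub_eq_zero]
      have h5 : π • mulPoly (polyDeriv (Sum.inl k) P) (curveBracket π P a b) =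
          π • mulPoly (polyDeriv (Sum.inr 0) P) (π • mulPoly (polyDeriv (Sum.inl k) P) b) -
          π • mulPoly (polyDeriv (Sum.inr 1) P) (π • mulPoly (polyDeriv (Sum.inl k) P) a) := by
        rw [curveBracket, map_sub, map_smul, map_smul, map_smul, map_smul, smul_sub,
          mulPoly_comm (polyDeriv (Sum.inl k) P) (polyDeriv (Sum.inr 0) P),
          mulPoly_comm (polyDeriv (Sum.inl k) P) (polyDeriv (Sum.inr 1) P)]
      have h6 : deriv (Sum.inl k) (curveBracket π P a b) =
          curveBracket π P (deriv (Sum.inl k) a) (deriv (Sum.inl k) b) +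
          (deriv (Sum.inr 0) (π • mulPoly (polyDeriv (Sum.inl k) P) b) -
          deriv (Sum.inr 1) (π • mulPoly (polyDeriv (Sum.inl k) P) a)) := by
        simp only [curveBracket, map_sub, map_smul, deriv_mulPoly, hab, smul_add,
          polyDeriv_comm (Sum.inl k)]
        abel
      rw [h5, h6, seriesMap_add, seriesMap_sub, seriesMap_sub, map_sub]
      abel
    rw [restrict_univ, gaussManin_apply, gaussManin_apply, gaussManin_apply, restrict_univ,
      twistedDeriv_zero, twistedDeriv_zero, h4]
    exact sub_mem (twistedDeriv_mem_exactTop _ _ (hm ha)) (twistedDeriv_mem_exactTop _ _ (hm hb))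
  · have h1 : twistedDeriv (phase π (threefoldEq P)) (Sum.inl k) (curveLift (ω Finset.univ)) = _ :=
      twistedDeriv_curveLift π P (i := Sum.inl k) (by simp) (ω Finset.univ)
    rw [curveToThreefold_univ, gaussManin_apply, gaussManin_apply, curveToThreefold_univ, h1,
      sub_self]
    exact zero_mem _
  · refine ⟨deriv (Sum.inl k) r, ?_, ?_⟩
    · rw [gaussManin_apply, topForm_univ]
      exact IsRes.twistedDeriv hP (isRes_seriesMap hr) (Sum.inl k)
    · rw [gaussManin_apply, topForm_univ, twistedDeriv_zero, map_smul, sub_self]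
      exact zero_mem _

end Param

/-! ### Power series with a given logarithmic derivative -/

section LogDeriv
open PowerSeries
variable {K : Type*} [Field K] [CharZero K]

/-- `f` is the power series with constant term `1` and logarithmic derivative `M`. -/
def HasLogDeriv (M f : K⟦X⟧) : Prop := constantCoeff f = 1 ∧ d⁄dX K f = M * f

lemma HasLogDeriv.coeff_succ {M f : K⟦X⟧} (h : HasLogDeriv M f) (n : ℕ) :
    coeff (n + 1) f * (n + 1) = ∑ x ∈ Finset.HasAntidiagonal.antidiagonal n, coeff x.1 M * coeff x.2 f := by
  rw [← coeff_mul, ← h.2, coeff_derivative]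

lemma HasLogDeriv.coeff_zero {M f : K⟦X⟧} (h : HasLogDeriv M f) : coeff 0 f = 1 := by
  rw [coeff_zero_eq_constantCoeff_apply, h.1]

/-- In characteristic zero the equation `f' = M f` determines the coefficients recursively. The
identities between exponentials used below thus reduce to identities between logarithmic
derivatives, with no composition of power series with `exp` or `log`. -/
lemma HasLogDeriv.unique {M f g : K⟦X⟧} (hf : HasLogDeriv M f) (hg : HasLogDeriv M g) : f = g := by
  ext n
  induction n using Nat.strong_induction_on with
  | _ n ih =>
    rcases n with _ | n
    · rw [hf.coeff_zero, hg.coeff_zero]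
    · have h : ((n : K) + 1) ≠ 0 := Nat.cast_add_one_ne_zero n
      refine mul_right_cancel₀ h ?_
      rw [hf.coeff_succ, hg.coeff_succ]
      refine Finset.sum_congr rfl fun x hx => ?_
      rw [Finset.HasAntidiagonal.mem_antidiagonal] at hx
      rw [ih x.2 (by omega)]

lemma HasLogDeriv.mul {M N f g : K⟦X⟧} (hf : HasLogDeriv M f) (hg : HasLogDeriv N g) :
    HasLogDeriv (M + N) (f * g) := by
  refine ⟨by rw [map_mul, hf.1, hg.1, mul_one], ?_⟩
  rw [Derivation.leibniz, hf.2, hg.2, smul_eq_mul, smul_eq_mul]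
  ring

lemma HasLogDeriv.pow {M f : K⟦X⟧} (hf : HasLogDeriv M f) (k : ℕ) :
    HasLogDeriv ((k : K⟦X⟧) * M) (f ^ k) := by
  induction k with
  | zero => exact ⟨by simp, by simp⟩
  | succ k ih =>
    rw [pow_succ, Nat.cast_succ, add_mul, one_mul]
    exact ih.mul hf

lemma HasLogDeriv.map {L : Type*} [Field L] [CharZero L] (φ : K →+* L) {M f : K⟦X⟧}
    (hf : HasLogDeriv M f) : HasLogDeriv (PowerSeries.map φ M) (PowerSeries.map φ f) := by
  refine ⟨by rw [← coeff_zero_eq_constantCoeff_apply, coeff_map, hf.coeff_zero, map_one], ?_⟩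
  rw [← map_mul, ← hf.2]
  ext n
  simp [coeff_derivative]

lemma HasLogDeriv.rescale {M f : K⟦X⟧} (hf : HasLogDeriv M f) (c : K) :
    HasLogDeriv (C c * PowerSeries.rescale c M) (PowerSeries.rescale c f) := by
  refine ⟨by
    rw [← coeff_zero_eq_constantCoeff_apply, coeff_rescale, pow_zero, one_mul, hf.coeff_zero], ?_⟩
  rw [mul_assoc, ← map_mul, ← hf.2]
  ext n
  simp only [coeff_derivative, coeff_rescale, coeff_C_mul]
  ring

lemma HasLogDeriv.expand {M f : K⟦X⟧} (hf : HasLogDeriv M f) {q : ℕ} (hq : q ≠ 0) :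
    HasLogDeriv ((q : K⟦X⟧) * X ^ (q - 1) * PowerSeries.expand q hq M)
      (PowerSeries.expand q hq f) := by
  refine ⟨by rw [constantCoeff_expand, hf.1], ?_⟩
  have h : PowerSeries.expand q hq (M * f) = PowerSeries.subst (X ^ q) (d⁄dX K f) := by
    rw [hf.2, expand_apply]
  rw [mul_assoc, ← map_mul, h, expand_apply, derivative_subst (HasSubst.X_pow hq),
    Derivation.leibniz_pow, derivative_X]
  simp [nsmul_eq_mul, mul_comm]

/-- The solution of `f' = M f`. -/
def logSol (M : K⟦X⟧) : ℕ → K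
  | 0 => 1
  | n + 1 => (n + 1 : K)⁻¹ * ∑ i : Fin (n + 1), coeff (n - i) M * logSol M i

lemma exists_hasLogDeriv (M : K⟦X⟧) : ∃ f, HasLogDeriv M f := by
  refine ⟨PowerSeries.mk (logSol M), ?_, ?_⟩
  · rw [← coeff_zero_eq_constantCoeff_apply, coeff_mk, logSol]
  · ext n
    rw [coeff_derivative, coeff_mk, logSol, coeff_mul, Finset.Nat.sum_antidiagonal_eq_sum_range_succ_mk,
      mul_comm, ← mul_assoc, mul_inv_cancel₀ (Nat.cast_add_one_ne_zero n), one_mul,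
      ← Finset.sum_range_reflect, Finset.sum_range]
    refine Finset.sum_congr rfl fun i _ => ?_
    rw [coeff_mk]
    congr 2
    omega

end LogDeriv

/-! ### The Artin–Hasse exponential -/

section ArtinHasse
open PowerSeries

variable (p) in
/-- The logarithmic derivative of the Artin–Hasse exponential. -/
def logArtinHasse : ℚ_[p]⟦X⟧ := PowerSeries.mk fun n => if ∃ k, n + 1 = p ^ k then 1 else 0

/-- The logarithmic derivative of `AH(X)^p = AH(X^p) exp(p X)`, where `AH` is the exponential of the
sum of the `X^(p^k) / p^k`. The logarithmic derivative of `AH` is the sum of the `X^(p^k - 1)`; its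
term `k = 0` produces the constant `p` and the terms `k + 1` the substitution `X ↦ X^p`. -/
lemma logArtinHasse_identity :
    (p : ℚ_[p]⟦X⟧) * logArtinHasse p = (p : ℚ_[p]⟦X⟧) * X ^ (p - 1) *
      PowerSeries.expand p (Fact.out : p.Prime).ne_zero (logArtinHasse p) + C (p : ℚ_[p]) := by
  have hp := (Fact.out : p.Prime).two_le
  have h1 : (p : ℚ_[p]⟦X⟧) = C (p : ℚ_[p]) := by simp
  rw [h1, mul_assoc]
  ext n
  rw [map_add, coeff_C_mul, coeff_C_mul, coeff_X_pow_mul', coeff_C, coeff_expand, logArtinHasse,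
    coeff_mk]
  rcases n with _ | n
  · rw [if_pos ⟨0, by simp⟩, if_neg (by omega), if_pos rfl]
    simp
  · rw [if_neg (Nat.succ_ne_zero n), add_zero]
    congr 1
    by_cases h : ∃ k, n + 1 + 1 = p ^ k
    · obtain ⟨k, hk⟩ := h
      rcases k with _ | k
      · simp at hk
      · rw [pow_succ'] at hk
        have h2 : 1 ≤ p ^ k := Nat.one_le_pow _ _ (by omega)
        have h3 : p ≤ p * p ^ k := Nat.le_mul_of_pos_right p h2
        have h4 : n + 1 - (p - 1) = p * (p ^ k - 1) := by
          rw [Nat.mul_sub, mul_one]; omega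
        rw [if_pos ⟨k + 1, by rw [hk, pow_succ']⟩, if_pos (by omega), h4,
          if_pos (dvd_mul_right _ _), Nat.mul_div_cancel_left _ (by omega), coeff_mk, if_pos]
        exact ⟨k, by omega⟩
    · rw [if_neg h]
      split_ifs with h2 h3
      · obtain ⟨m, hm⟩ := h3
        rw [hm, Nat.mul_div_cancel_left _ (by omega), coeff_mk, if_neg]
        rintro ⟨k, hk⟩
        refine h ⟨k + 1, ?_⟩
        rw [pow_succ', ← hk, mul_add, ← hm]
        omega
      · rfl
      · rfl

/-- For `j ≥ 1` the digit sum of `j` is positive, so `v(j!) < j` by Legendre's formula: every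
nonconstant coefficient of `exp(p X)` is divisible by `p`. -/
lemma norm_pow_div_factorial_le {j : ℕ} (hj : j ≠ 0) :
    ‖(p : ℚ_[p]) ^ j * ((j.factorial : ℕ) : ℚ_[p])⁻¹‖ ≤ ‖(p : ℚ_[p])‖ := by
  have hp := (Fact.out : p.Prime)
  have hp1 : (1 : ℝ) < p := by exact_mod_cast hp.one_lt
  have h1 : padicValNat p j.factorial < j := by
    have h2 := sub_one_mul_padicValNat_factorial (p := p) j
    have h3 : 0 < (p.digits j).sum := by
      rw [Nat.pos_iff_ne_zero]
      intro h
      have h5 := List.sum_eq_zero_iff.1 h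
      have h6 := Nat.getLast_digit_ne_zero p hj
      exact h6 (h5 _ (List.getLast_mem _))
    have h4 : padicValNat p j.factorial ≤ (p - 1) * padicValNat p j.factorial :=
      Nat.le_mul_of_pos_left _ (by have := hp.two_le; omega)
    omega
  rw [norm_mul, norm_pow, norm_inv, Padic.norm_p,
    Padic.norm_eq_zpow_neg_valuation (by exact_mod_cast j.factorial_ne_zero),
    Padic.valuation_natCast, zpow_neg, zpow_natCast, inv_inv, inv_pow, inv_mul_le_iff₀ (by positivity),
    ← div_eq_mul_inv, le_div_iff₀ (by positivity), ← pow_succ]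
  exact pow_le_pow_right₀ hp1.le h1

/-- The coefficients of the Artin–Hasse exponential are `p`-adic integers. -/
lemma norm_coeff_artinHasse_le_one {f : ℚ_[p]⟦X⟧} (hf : HasLogDeriv (logArtinHasse p) f) (n : ℕ) :
    ‖coeff n f‖ ≤ 1 := by
  have hp := (Fact.out : p.Prime)
  have hpos : 0 < ‖(p : ℚ_[p])‖ := norm_pos_iff.2 (by exact_mod_cast hp.ne_zero)
  have hE : HasLogDeriv (C (p : ℚ_[p])) (PowerSeries.rescale (p : ℚ_[p]) (PowerSeries.exp ℚ_[p])) := by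
    have h1 : HasLogDeriv (1 : ℚ_[p]⟦X⟧) (PowerSeries.exp ℚ_[p]) :=
      ⟨constantCoeff_exp, by rw [derivative_exp, one_mul]⟩
    simpa using h1.rescale (p : ℚ_[p])
  -- The functional equation behind Dwork's integrality criterion: comparison of the coefficients of
  -- degree `n` shows that `p f_n` is divisible by `p` once the lower coefficients are integral.
  have hid : f ^ p = PowerSeries.expand p hp.ne_zero f *
      PowerSeries.rescale (p : ℚ_[p]) (PowerSeries.exp ℚ_[p]) := by
    refine (hf.pow p).unique ?_
    rw [logArtinHasse_identity]
    exact (hf.expand hp.ne_zero).mul hE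
  induction n using Nat.strong_induction_on with
  | _ n ih =>
    rcases Nat.eq_zero_or_pos n with rfl | hn
    · rw [hf.coeff_zero, norm_one]
    set T : Polynomial ℚ_[p] := trunc n f with hT
    have hT0 : coeff 0 (T : ℚ_[p]⟦X⟧) = 1 := by
      rw [Polynomial.coeff_coe, hT, coeff_trunc, if_pos hn, hf.coeff_zero]
    have hTc : ∀ m < n, coeff m (T : ℚ_[p]⟦X⟧) = coeff m f := fun m hm => by
      rw [Polynomial.coeff_coe, hT, coeff_trunc, if_pos hm]
    obtain ⟨b, hb⟩ : ∃ b : Polynomial ℤ_[p], b.map (algebraMap ℤ_[p] ℚ_[p]) = T := by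
      have : T ∈ Polynomial.lifts (algebraMap ℤ_[p] ℚ_[p]) := by
        rw [Polynomial.lifts_iff_coeff_lifts]
        intro m
        by_cases hm : m < n
        · refine ⟨⟨coeff m f, ih m hm⟩, ?_⟩
          rw [hT, coeff_trunc, if_pos hm]; rfl
        · refine ⟨0, ?_⟩
          rw [hT, coeff_trunc, if_neg hm, map_zero]
      exact (Polynomial.mem_lifts _).1 this
    -- The truncation `T` lifts to a polynomial over the `p`-adic integers, and modulo `p` one has
    -- `T(X^p) = T(X)^p`.
    have hmod : ‖coeff n (PowerSeries.expand p hp.ne_zero (T : ℚ_[p]⟦X⟧)) -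
        coeff n ((T : ℚ_[p]⟦X⟧) ^ p)‖ ≤ ‖(p : ℚ_[p])‖ := by
      have h1 : (Polynomial.expand ℤ_[p] p b - b ^ p).map (PadicInt.toZMod (p := p)) = 0 := by
        rw [Polynomial.map_sub, Polynomial.map_expand, Polynomial.map_pow, ZMod.expand_card, sub_self]
      have h2 : PadicInt.toZMod ((Polynomial.expand ℤ_[p] p b - b ^ p).coeff n) = 0 := by
        rw [← Polynomial.coeff_map, h1, Polynomial.coeff_zero]
      rw [← RingHom.mem_ker, PadicInt.ker_toZMod, PadicInt.maximalIdeal_eq_span_p,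
        Ideal.mem_span_singleton] at h2
      obtain ⟨c, hc⟩ := h2
      have h3 : coeff n (PowerSeries.expand p hp.ne_zero (T : ℚ_[p]⟦X⟧)) -
          coeff n ((T : ℚ_[p]⟦X⟧) ^ p) =
          algebraMap ℤ_[p] ℚ_[p] ((Polynomial.expand ℤ_[p] p b - b ^ p).coeff n) := by
        rw [← Polynomial.coeff_map, Polynomial.map_sub, Polynomial.map_expand, Polynomial.map_pow, hb,
          Polynomial.coeff_sub, ← Polynomial.coe_pow, Polynomial.coeff_coe, coeff_expand,
          Polynomial.coeff_expand hp.pos, Polynomial.coeff_coe]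
      rw [h3, hc, map_mul, norm_mul, map_natCast]
      exact mul_le_of_le_one_right hpos.le (PadicInt.norm_le_one c)
    have hexp : ∀ m ≤ n, coeff m (PowerSeries.expand p hp.ne_zero f) =
        coeff m (PowerSeries.expand p hp.ne_zero (T : ℚ_[p]⟦X⟧)) := fun m hm => by
      rw [coeff_expand, coeff_expand]
      split_ifs with h
      · rw [hTc]
        rcases Nat.eq_zero_or_pos m with rfl | hm0
        · simpa using hn
        · exact (Nat.div_lt_self hm0 hp.one_lt).trans_le hm
      · rfl
    have hexp1 : ∀ m, m ≤ n → ‖coeff m (PowerSeries.expand p hp.ne_zero f)‖ ≤ 1 := fun m hm => by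
      rw [coeff_expand]
      split_ifs with h
      · refine ih _ ?_
        rcases Nat.eq_zero_or_pos m with rfl | hm0
        · simpa using hn
        · exact (Nat.div_lt_self hm0 hp.one_lt).trans_le hm
      · simp
    -- Write `f = T + X^n R`. In `f^p` the terms of order two and more in `X^n R` have order at
    -- least `2 n > n`, and the linear term contributes `p f_n` because `T` has constant term one.
    have hL : coeff n (f ^ p) = coeff n ((T : ℚ_[p]⟦X⟧) ^ p) + p * coeff n f := by
      obtain ⟨k, hk⟩ := Polynomial.powAddExpansion (T : ℚ_[p]⟦X⟧)
        ((PowerSeries.mk fun i ↦ coeff (i + n) f) * X ^ n) p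
      have h1 : f = (T : ℚ_[p]⟦X⟧) + (PowerSeries.mk fun i ↦ coeff (i + n) f) * X ^ n := by
        rw [add_comm]; exact eq_shift_mul_X_pow_add_trunc n f
      conv_lhs => rw [h1, hk]
      have h2 : ∀ V : ℚ_[p]⟦X⟧, coeff n (V * X ^ n) = coeff 0 V := fun V => by
        have := coeff_mul_X_pow V n 0
        rwa [zero_add] at this
      have h3 : (p : ℚ_[p]⟦X⟧) * (T : ℚ_[p]⟦X⟧) ^ (p - 1) *
          ((PowerSeries.mk fun i ↦ coeff (i + n) f) * X ^ n) =
          ((p : ℚ_[p]⟦X⟧) * (T : ℚ_[p]⟦X⟧) ^ (p - 1) * PowerSeries.mk fun i ↦ coeff (i + n) f) *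
            X ^ n := by ring
      have h4 : k * ((PowerSeries.mk fun i ↦ coeff (i + n) f) * X ^ n) ^ 2 =
          (k * (PowerSeries.mk fun i ↦ coeff (i + n) f) ^ 2 * X ^ n) * X ^ n := by ring
      have h5 : constantCoeff (T : ℚ_[p]⟦X⟧) = 1 := by
        rw [← coeff_zero_eq_constantCoeff_apply, hT0]
      rw [map_add, map_add, h3, h4, h2, h2]
      simp [h5, hn.ne']
    have hR : coeff n (f ^ p) = coeff n (PowerSeries.expand p hp.ne_zero f) +
        ∑ i ∈ Finset.range n, coeff i (PowerSeries.expand p hp.ne_zero f) *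
          ((p : ℚ_[p]) ^ (n - i) * (((n - i).factorial : ℕ) : ℚ_[p])⁻¹) := by
      rw [hid, coeff_mul, Finset.Nat.sum_antidiagonal_eq_sum_range_succ_mk, Finset.sum_range_succ,
        add_comm]
      congr 1
      · simp [coeff_rescale, coeff_exp]
      · refine Finset.sum_congr rfl fun i _ => ?_
        simp [coeff_rescale, coeff_exp]
    have hfin : (p : ℚ_[p]) * coeff n f =
        (coeff n (PowerSeries.expand p hp.ne_zero (T : ℚ_[p]⟦X⟧)) - coeff n ((T : ℚ_[p]⟦X⟧) ^ p)) +
        ∑ i ∈ Finset.range n, coeff i (PowerSeries.expand p hp.ne_zero f) *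
          ((p : ℚ_[p]) ^ (n - i) * (((n - i).factorial : ℕ) : ℚ_[p])⁻¹) := by
      rw [← hexp n le_rfl]
      have := hL.symm.trans hR
      linear_combination this
    have hbound : ‖(p : ℚ_[p]) * coeff n f‖ ≤ ‖(p : ℚ_[p])‖ := by
      rw [hfin]
      refine (IsUltrametricDist.norm_add_le_max _ _).trans (max_le hmod ?_)
      refine IsUltrametricDist.norm_sum_le_of_forall_le_of_nonneg hpos.le fun i hi => ?_
      rw [Finset.mem_range] at hi
      rw [norm_mul]
      exact (mul_le_of_le_one_left (norm_nonneg _) (hexp1 i hi.le)).trans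
        (norm_pow_div_factorial_le (by omega))
    rw [norm_mul] at hbound
    exact le_of_mul_le_mul_left (by rwa [mul_one]) hpos

end ArtinHasse

/-! ### The Dwork exponential -/

section DworkExponential
open PowerSeries

/-- Bernoulli's inequality for `1 - (1 - q') / s` with `q' = max q (1 / 2)` gives a rate below one
whose `s`-th power is at least `q`. -/
lemma exists_le_pow {q : ℝ} (hq : q < 1) {s : ℕ} (hs : s ≠ 0) :
    ∃ r, 0 < r ∧ r < 1 ∧ q ≤ r ^ s := by
  have hs1 : (1 : ℝ) ≤ s := by exact_mod_cast Nat.one_le_iff_ne_zero.2 hs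
  set q' := max q (1 / 2)
  have hq' : q' < 1 := max_lt hq (by norm_num)
  have hq0 : 1 / 2 ≤ q' := le_max_right _ _
  have h1 : (1 - q') / s ≤ 1 / 2 := by
    rw [div_le_iff₀ (by linarith)]; nlinarith
  have h0 : 0 < (1 - q') / s := div_pos (by linarith) (by linarith)
  refine ⟨1 - (1 - q') / s, by linarith, by linarith, (le_max_left q (1 / 2)).trans ?_⟩
  have h2 := one_add_mul_le_pow (a := -((1 - q') / s)) (by linarith) s
  have h3 : (s : ℝ) * -((1 - q') / s) = -(1 - q') := by field_simp
  rw [h3] at h2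
  calc q' = 1 + -(1 - q') := by ring
    _ ≤ _ := h2
    _ = _ := by ring

lemma logArtinHasse_eq : logArtinHasse p = X ^ (p - 1) *
    PowerSeries.expand p (Fact.out : p.Prime).ne_zero (logArtinHasse p) + 1 := by
  have hp : (p : ℚ_[p]⟦X⟧) ≠ 0 := by
    rw [show (p : ℚ_[p]⟦X⟧) = C (p : ℚ_[p]) by simp, Ne, map_eq_zero_iff _ C_injective]
    exact_mod_cast (Fact.out : p.Prime).ne_zero
  have h := logArtinHasse_identity (p := p)
  rw [show C (p : ℚ_[p]) = (p : ℚ_[p]⟦X⟧) by simp] at h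
  refine mul_left_cancel₀ hp ?_
  rw [h]; ring

/-- Growth of the coefficients of `AH ^ (- 1 / p ^ 2)`. -/
lemma norm_coeff_root_le {h : ℚ_[p]⟦X⟧}
    (hh : HasLogDeriv (-C ((p : ℚ_[p]) ^ 2)⁻¹ * logArtinHasse p) h) (m : ℕ) :
    ‖coeff m h‖ ≤ ‖(p : ℚ_[p]) ^ (2 * m) * (m.factorial : ℕ)‖⁻¹ := by
  have hp := (Fact.out : p.Prime)
  have hp0 : (p : ℚ_[p]) ≠ 0 := by exact_mod_cast hp.ne_zero
  have hp1 : ‖(p : ℚ_[p])‖ ≤ 1 := by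
    have := Padic.norm_int_le_one (p := p) p
    simpa using this
  have hnat : ∀ k : ℕ, ‖(k : ℚ_[p])‖ ≤ 1 := fun k => by
    have := Padic.norm_int_le_one (p := p) k
    simpa using this
  induction m using Nat.strong_induction_on with
  | _ m ih =>
    rcases m with _ | m
    · rw [hh.coeff_zero]; simp
    have hmono : ∀ j ≤ m, ‖(p : ℚ_[p]) ^ (2 * j) * (j.factorial : ℕ)‖⁻¹ ≤
        ‖(p : ℚ_[p]) ^ (2 * m) * (m.factorial : ℕ)‖⁻¹ := fun j hj => by
      have h0 : ∀ i : ℕ, 0 < ‖(p : ℚ_[p]) ^ (2 * i) * (i.factorial : ℕ)‖ := fun i =>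
        norm_pos_iff.2 (mul_ne_zero (pow_ne_zero _ hp0) (by exact_mod_cast i.factorial_ne_zero))
      refine inv_anti₀ (h0 m) ?_
      obtain ⟨c, hc⟩ := Nat.factorial_dvd_factorial hj
      rw [hc, norm_mul, norm_mul, norm_pow, norm_pow, Nat.cast_mul, norm_mul]
      refine mul_le_mul (pow_le_pow_of_le_one (norm_nonneg _) hp1 (by omega))
        (mul_le_of_le_one_right (norm_nonneg _) (hnat c)) (by positivity) (by positivity)
    have h1 := hh.coeff_succ m
    have hm0 : ((m : ℚ_[p]) + 1) ≠ 0 := Nat.cast_add_one_ne_zero m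
    -- The logarithmic derivative has coefficients of norm at most `‖p ^ 2‖⁻¹`. Each step of the
    -- recursion thus costs this factor and the division by `m + 1`, which accumulate to `p ^ (2 m)
    -- m!`.
    have h2 : ‖coeff (m + 1) h * ((m : ℚ_[p]) + 1)‖ ≤
        ‖((p : ℚ_[p]) ^ 2)‖⁻¹ * ‖(p : ℚ_[p]) ^ (2 * m) * (m.factorial : ℕ)‖⁻¹ := by
      rw [h1]
      refine IsUltrametricDist.norm_sum_le_of_forall_le_of_nonneg (by positivity) fun x hx => ?_
      rw [Finset.HasAntidiagonal.mem_antidiagonal] at hx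
      rw [norm_mul]
      refine mul_le_mul ?_ ((ih x.2 (by omega)).trans (hmono x.2 (by omega))) (norm_nonneg _)
        (by positivity)
      rw [← map_neg, coeff_C_mul, norm_mul, norm_neg, norm_inv, logArtinHasse, coeff_mk]
      refine mul_le_of_le_one_right (by positivity) ?_
      split_ifs <;> simp
    rw [norm_mul, ← le_div_iff₀ (norm_pos_iff.2 hm0)] at h2
    refine h2.trans (le_of_eq ?_)
    rw [Nat.factorial_succ, show 2 * (m + 1) = 2 * m + 2 by ring, pow_add]
    push_cast
    simp only [norm_mul, mul_inv, div_eq_mul_inv]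
    ring

variable {π : ℂ_[p]} (hp2 : p ≠ 2) (hπ : π ^ (p - 1) = -p)

lemma norm_algebraMap_padic (x : ℚ_[p]) : ‖algebraMap ℚ_[p] ℂ_[p] x‖ = ‖x‖ := norm_algebraMap' _ x

include hp2 hπ in
/-- The Dwork exponential `exp (π (X ^ p - X))` is overconvergent. -/
lemma exists_norm_coeff_dwork_le {θ : ℂ_[p]⟦X⟧}
    (hθ : HasLogDeriv (C (-π) + C (π * p) * X ^ (p - 1)) θ) :
    ∃ r : ℝ, 0 < r ∧ r < 1 ∧ ∀ n, ‖coeff n θ‖ ≤ r ^ n := by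
  have hp := (Fact.out : p.Prime)
  have hpp := hp.two_le
  have hodd : Even (p - 1) := by
    obtain ⟨k, hk⟩ := hp.odd_of_ne_two hp2
    exact ⟨k, by omega⟩
  obtain ⟨f, hf⟩ := exists_hasLogDeriv (logArtinHasse p)
  obtain ⟨h, hh⟩ := exists_hasLogDeriv (-C ((p : ℚ_[p]) ^ 2)⁻¹ * logArtinHasse p)
  set E := PowerSeries.expand (R := ℚ_[p]) p hp.ne_zero with hE
  -- With `L` the sum of the `X^(p^k) / p^k`, all terms but the first two cancel in `L(X) -
  -- L(X^(p^2)) / p^2 = X + X^p / p`. Hence `exp (X + X^p / p)` is the product of `AH(X)`, with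
  -- integral coefficients, and `AH(X^(p^2))^(-1/p^2)`, which lives in degrees divisible by `p^2`.
  have hfg : HasLogDeriv (1 + X ^ (p - 1)) (f * E (E h)) := by
    have h1 := hf.mul ((hh.expand hp.ne_zero).expand hp.ne_zero)
    convert h1 using 1
    have h2 := logArtinHasse_eq (p := p)
    have h3 := congrArg E h2
    rw [map_add, map_mul, map_pow, map_one] at h3
    rw [← hE]
    have h4 : E (C ((p : ℚ_[p]) ^ 2)⁻¹) = C ((p : ℚ_[p]) ^ 2)⁻¹ := expand_C _ _ _
    have h5 : (p : ℚ_[p]⟦X⟧) ^ 2 * C ((p : ℚ_[p]) ^ 2)⁻¹ = 1 := by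
      rw [show (p : ℚ_[p]⟦X⟧) = C (p : ℚ_[p]) by simp, ← map_pow, ← map_mul, mul_inv_cancel₀, map_one]
      exact pow_ne_zero _ (by exact_mod_cast hp.ne_zero)
    simp only [map_mul, map_neg, map_pow, map_natCast, h4]
    linear_combination X ^ (p - 1) * E X ^ (p - 1) * E (E (logArtinHasse p)) * h5 - h2 -
      X ^ (p - 1) * h3
  have hmap := (hfg.map (algebraMap ℚ_[p] ℂ_[p])).rescale (-π)
  -- The substitution `X ↦ -π X` turns `X + X^p / p` into `π (X^p - X)`; here `p` odd and `π ^ (p -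
  -- 1) = -p` are used.
  have hθeq : θ = PowerSeries.rescale (-π) (PowerSeries.map (algebraMap ℚ_[p] ℂ_[p]) (f * E (E h))) := by
    refine hθ.unique ?_
    convert hmap using 1
    rw [map_add, map_add, map_one, map_one, map_pow, map_pow, PowerSeries.map_X, rescale_X, mul_pow,
      ← map_pow, hodd.neg_pow, hπ]
    simp only [map_mul, map_neg, map_natCast]
    ring
  have hq0 : 0 < ‖π‖ := norm_pos_iff.2 (pi_ne_zero hπ)
  obtain ⟨r, hr0, hr1, hr⟩ := exists_le_pow (norm_pi_lt_one hπ) (s := p * p) (by positivity)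
  refine ⟨r, hr0, hr1, fun n => ?_⟩
  have hroot : ∀ m, ‖π‖ ^ ((2 * p - 1) * m) * ‖coeff m h‖ ≤ 1 := fun m => by
    have h1 := norm_coeff_root_le hh m
    have h2 : ‖(p : ℚ_[p])‖ = ‖π‖ ^ (p - 1) := by rw [norm_pi_pow hπ, Padic.norm_p]
    have h3 : ‖π‖ ^ m ≤ ‖((m.factorial : ℕ) : ℚ_[p])‖ := by
      rw [← norm_natCast]; exact norm_pi_pow_le_factorial hπ m
    have h4 : ‖π‖ ^ ((2 * p - 1) * m) ≤ ‖(p : ℚ_[p]) ^ (2 * m) * (m.factorial : ℕ)‖ := by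
      rw [norm_mul, norm_pow, h2, ← pow_mul,
        show (2 * p - 1) * m = (p - 1) * (2 * m) + m by
          obtain ⟨k, rfl⟩ : ∃ k, p = k + 1 := ⟨p - 1, by omega⟩
          rw [Nat.add_sub_cancel, show 2 * (k + 1) - 1 = 2 * k + 1 by omega]; ring, pow_add]
      exact mul_le_mul_of_nonneg_left h3 (by positivity)
    have h5 : 0 < ‖(p : ℚ_[p]) ^ (2 * m) * (m.factorial : ℕ)‖ := lt_of_lt_of_le (by positivity) h4
    calc _ ≤ ‖(p : ℚ_[p]) ^ (2 * m) * (m.factorial : ℕ)‖ *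
          ‖(p : ℚ_[p]) ^ (2 * m) * (m.factorial : ℕ)‖⁻¹ := by gcongr
      _ = 1 := mul_inv_cancel₀ h5.ne'
  rw [hθeq, coeff_rescale, coeff_map, norm_mul, norm_algebraMap_padic, norm_pow, norm_neg,
    mul_comm, ← le_div_iff₀ (by positivity), coeff_mul]
  refine IsUltrametricDist.norm_sum_le_of_forall_le_of_nonneg (by positivity) fun x hx => ?_
  rw [Finset.HasAntidiagonal.mem_antidiagonal] at hx
  rw [le_div_iff₀ (by positivity), norm_mul]
  have h1 := norm_coeff_artinHasse_le_one hf x.1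
  rw [hE, coeff_expand]
  split_ifs with h2
  · rw [coeff_expand]
    split_ifs with h3
    · obtain ⟨k, hk⟩ := h2
      rw [hk, Nat.mul_div_cancel_left _ hp.pos] at h3 ⊢
      obtain ⟨m, rfl⟩ := h3
      rw [Nat.mul_div_cancel_left _ hp.pos]
      have h4 : p * p * m ≤ n := by rw [← hx, hk]; nlinarith
      have h5 : 2 * p - 1 ≤ p * p := by
        have : 2 * p ≤ p * p := Nat.mul_le_mul_right p hpp
        omega
      have h6 : (2 * p - 1) * m ≤ n := (Nat.mul_le_mul_right m h5).trans h4
      obtain ⟨e, he⟩ := Nat.exists_eq_add_of_le h6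
      -- The factor of degree `p^2 m ≤ n` costs at most `‖π‖ ^ (-(2 p - 1) m)`, so the exponent of
      -- `‖π‖` left is `e = n - (2 p - 1) m`. Since `2 p - 1 < p^2`, it is at least `n / p^2`,
      -- whence the rate `r` with `‖π‖ ≤ r ^ (p * p)`.
      have h7 : n ≤ p * p * e := by
        have h8 : (2 * p - 1) + 1 ≤ p * p := by
          have : 2 * p ≤ p * p := Nat.mul_le_mul_right p hpp
          omega
        have h9 : (2 * p - 1) * (p * p * m) ≤ (2 * p - 1) * n := Nat.mul_le_mul_left _ h4
        have h10 : ((2 * p - 1) + 1) * n ≤ p * p * n := Nat.mul_le_mul_right n h8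
        have h11 : p * p * n = (2 * p - 1) * (p * p * m) + p * p * e := by
          conv_lhs => rw [he]
          ring
        nlinarith
      calc ‖coeff x.1 f‖ * ‖coeff m h‖ * ‖π‖ ^ n ≤ 1 * ‖coeff m h‖ * ‖π‖ ^ n := by gcongr
        _ = (‖π‖ ^ ((2 * p - 1) * m) * ‖coeff m h‖) * ‖π‖ ^ e := by rw [he, pow_add]; ring
        _ ≤ 1 * (r ^ (p * p)) ^ e := by
          refine mul_le_mul (hroot m) ?_ (by positivity) zero_le_one
          exact pow_le_pow_left₀ hq0.le hr e
        _ = r ^ (p * p * e) := by rw [one_mul, ← pow_mul]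
        _ ≤ r ^ n := pow_le_pow_of_le_one hr0.le hr1.le h7
    · simp; positivity
  · simp; positivity

include hp2 hπ in
/-- Overconvergence of `exp (π c (S ^ p - S))` for `c` close to a Teichmüller representative. -/
lemma exists_norm_coeff_dwork_mul_le {c : ℂ_[p]} {e : ℂ_[p]⟦X⟧}
    (he : HasLogDeriv (C (-(π * c)) + C (π * c * p) * X ^ (p - 1)) e) {w : ℝ} (hw : 0 < w)
    (h1 : ‖c‖ * w ≤ 1) (h2 : ‖c ^ p - c‖ * w ^ p < 1) :
    ∃ r : ℝ, 0 < r ∧ r < 1 ∧ ∀ n, ‖coeff n e‖ * w ^ n ≤ r ^ n := by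
  have hp := (Fact.out : p.Prime)
  obtain ⟨θ, hθ⟩ := exists_hasLogDeriv (C (-π) + C (π * p) * X ^ (p - 1))
  obtain ⟨r₁, hr₁0, hr₁1, hr₁⟩ := exists_norm_coeff_dwork_le hp2 hπ hθ
  obtain ⟨r₂, hr₂0, hr₂1, hr₂⟩ := exists_le_pow h2 (s := p) hp.ne_zero
  have hexp : HasLogDeriv (1 : ℂ_[p]⟦X⟧) (PowerSeries.exp ℂ_[p]) :=
    ⟨constantCoeff_exp, by rw [derivative_exp, one_mul]⟩
  have hprod := (hθ.rescale c).mul ((hexp.rescale (π * (c - c ^ p))).expand hp.ne_zero)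
  -- From `c (S^p - S) = ((c S)^p - c S) + (c - c^p) S^p`. The first factor `θ(c S)` overconverges
  -- since `‖c‖ w ≤ 1`; the second since `π^k / k!` is bounded and `‖c^p - c‖ w^p < 1`.
  have heq : e = PowerSeries.rescale c θ * PowerSeries.expand p hp.ne_zero
      (PowerSeries.rescale (π * (c - c ^ p)) (PowerSeries.exp ℂ_[p])) := by
    refine he.unique ?_
    convert hprod using 1
    have h3 : (C (c ^ p) : ℂ_[p]⟦X⟧) = C c * C c ^ (p - 1) := by
      rw [map_pow, ← pow_succ', Nat.sub_add_cancel hp.one_le]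
    have h4 : ∀ x : ℂ_[p], PowerSeries.rescale c (C x) = C x := fun x => by
      ext m
      rw [coeff_rescale, coeff_C]
      split_ifs with h
      · rw [h, pow_zero, one_mul]
      · rw [mul_zero]
    rw [map_one, mul_one, expand_C, (PowerSeries.rescale c).map_add,
      (PowerSeries.rescale c).map_mul, (PowerSeries.rescale c).map_pow, rescale_X, h4, h4, mul_pow]
    simp only [map_mul, map_neg, map_natCast, map_sub, h3]
    ring
  refine ⟨max r₁ r₂, lt_max_of_lt_left hr₁0, max_lt hr₁1 hr₂1, fun n => ?_⟩
  rw [heq, ← le_div_iff₀ (by positivity), coeff_mul]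
  refine IsUltrametricDist.norm_sum_le_of_forall_le_of_nonneg (by positivity) fun x hx => ?_
  rw [Finset.HasAntidiagonal.mem_antidiagonal] at hx
  rw [le_div_iff₀ (by positivity), ← hx, pow_add, norm_mul, pow_add]
  have h3 : ‖coeff x.1 (PowerSeries.rescale c θ)‖ * w ^ x.1 ≤ max r₁ r₂ ^ x.1 := by
    rw [coeff_rescale, norm_mul, norm_pow, mul_right_comm, ← mul_pow]
    calc _ ≤ 1 ^ x.1 * r₁ ^ x.1 := by
          gcongr
          exact hr₁ _
      _ = r₁ ^ x.1 := by rw [one_pow, one_mul]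
      _ ≤ _ := pow_le_pow_left₀ hr₁0.le (le_max_left _ _) _
  have h4 : ‖coeff x.2 (PowerSeries.expand p hp.ne_zero
      (PowerSeries.rescale (π * (c - c ^ p)) (PowerSeries.exp ℂ_[p])))‖ * w ^ x.2 ≤
      max r₁ r₂ ^ x.2 := by
    rw [coeff_expand]
    split_ifs with h
    · obtain ⟨k, hk⟩ := h
      rw [hk, Nat.mul_div_cancel_left _ hp.pos, coeff_rescale, coeff_exp, mul_pow]
      have h5 : (π ^ k * (c - c ^ p) ^ k * algebraMap ℚ ℂ_[p] (1 / (k.factorial : ℚ))) =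
          π ^ k / ((k.factorial : ℕ) : ℂ_[p]) * (c - c ^ p) ^ k := by
        rw [map_div₀, map_one, map_natCast]; ring
      rw [h5, norm_mul, norm_pow, norm_sub_rev]
      calc _ ≤ 1 * ‖c ^ p - c‖ ^ k * w ^ (p * k) := by
            gcongr
            exact norm_pi_pow_div_factorial_le hπ k
        _ = (‖c ^ p - c‖ * w ^ p) ^ k := by rw [one_mul, mul_pow, pow_mul]
        _ ≤ (r₂ ^ p) ^ k := by gcongr
        _ = r₂ ^ (p * k) := by rw [pow_mul]
        _ ≤ _ := pow_le_pow_left₀ hr₂0.le (le_max_right _ _) _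
    · simp; positivity
  calc _ = (‖coeff x.1 (PowerSeries.rescale c θ)‖ * w ^ x.1) * (‖coeff x.2 (PowerSeries.expand p
      hp.ne_zero (PowerSeries.rescale (π * (c - c ^ p)) (PowerSeries.exp ℂ_[p])))‖ * w ^ x.2) := by ring
    _ ≤ _ := mul_le_mul h3 h4 (by positivity) (by positivity)

end DworkExponential

/-! ### Frobenius on Laurent polynomials -/

lemma polyFrob_single (J : Expo κ n) (c : ℂ_[p]) :
    polyFrob (AddMonoidAlgebra.single J c) = AddMonoidAlgebra.single (p • J) c :=
  AddMonoidAlgebra.mapDomain_single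

lemma polyFrob_add (f g : Poly p κ n) : polyFrob (f + g) = polyFrob f + polyFrob g :=
  AddMonoidAlgebra.mapDomain_add _ _ _

lemma polyFrob_mul (f g : Poly p κ n) : polyFrob (f * g) = polyFrob f * polyFrob g :=
  AddMonoidAlgebra.mapDomain_mul (nsmulAddMonoidHom (α := Expo κ n) p) f g

@[simp] lemma polyFrob_zero : polyFrob (0 : Poly p κ n) = 0 := AddMonoidAlgebra.mapDomain_zero _

lemma polyFrob_polyMap {m : ℕ} (e : Fin m ↪o Fin n) (f : Poly p κ m) :
    polyFrob (polyMap e f) = polyMap e (polyFrob f) := by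
  induction f using AddMonoidAlgebra.induction_linear with
  | zero => simp
  | add f g hf hg => simp only [polyFrob_add, polyMap_add, hf, hg]
  | single J c => rw [polyMap_single, polyFrob_single, polyFrob_single, polyMap_single, expoMap_nsmul]

lemma nsmul_expo_injective : Function.Injective fun J : Expo κ n => p • J := by
  intro J K h
  ext i
  have := congrFun h i
  simp only [Pi.smul_apply, nsmul_eq_mul] at this
  exact mul_left_cancel₀ (by exact_mod_cast (Fact.out : p.Prime).ne_zero) this

lemma coeff_polyFrob {f : Poly p κ n} {J : Expo κ n} (hJ : (polyFrob f).coeff J ≠ 0) :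
    ∃ K, p • K = J ∧ f.coeff K ≠ 0 := by
  by_cases h : J ∈ Set.range (fun K : Expo κ n => p • K)
  · obtain ⟨K, rfl⟩ := h
    have h1 : (polyFrob f).coeff (p • K) = f.coeff K :=
      Finsupp.mapDomain_apply nsmul_expo_injective _ _
    exact ⟨K, rfl, by rwa [← h1]⟩
  · exact absurd (Finsupp.mapDomain_of_notMem_range _ _ h) hJ

lemma AdmissiblePoly.polyFrob {B : ParamDomain κ} {A : Set (Fin n)} {f : Poly p κ n}
    (hf : AdmissiblePoly B A f) : AdmissiblePoly B A (polyFrob f) := by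
  intro J hJ
  obtain ⟨K, rfl, hK⟩ := coeff_polyFrob hJ
  exact (hf K hK).nsmul p

lemma polyDeriv_polyFrob (i : κ ⊕ Fin n) (f : Poly p κ n) : polyDeriv i (polyFrob f) =
    (p : ℂ_[p]) • (AddMonoidAlgebra.single ((p - 1) • unitExpo i) 1 * polyFrob (polyDeriv i f)) := by
  induction f using AddMonoidAlgebra.induction_linear with
  | zero => simp
  | add f g hf hg => simp only [polyFrob_add, polyDeriv_add, hf, hg, mul_add, smul_add]
  | single J c =>
    rw [polyFrob_single, polyDeriv_single, polyDeriv_single, polyFrob_single,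
      AddMonoidAlgebra.single_mul_single, AddMonoidAlgebra.smul_single]
    congr 1
    · have : (p - 1) • (unitExpo i : Expo κ n) = p • unitExpo i - unitExpo i := by
        rw [eq_sub_iff_add_eq, ← succ_nsmul, Nat.sub_add_cancel (Fact.out : p.Prime).one_le]
      rw [this, smul_sub]; abel
    · simp [mul_assoc]

lemma mulPoly_sub (f g : Poly p κ n) : mulPoly (f - g) = mulPoly f - mulPoly g := by
  rw [sub_eq_add_neg, mulPoly_add, mulPoly_neg, sub_eq_add_neg]

lemma mulPoly_coeff (f g : Poly p κ n) : mulPoly f g.coeff = (f * g).coeff := by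
  induction f using AddMonoidAlgebra.induction_linear with
  | zero => ext; simp
  | add f f' hf hf' =>
    rw [mulPoly_add, LinearMap.add_apply, hf, hf', add_mul, AddMonoidAlgebra.coeff_add,
      Finsupp.coe_add]
  | single J c =>
    induction g using AddMonoidAlgebra.induction_linear with
    | zero => ext; simp
    | add g g' hg hg' =>
      rw [AddMonoidAlgebra.coeff_add, Finsupp.coe_add, map_add, hg, hg', mul_add,
        AddMonoidAlgebra.coeff_add, Finsupp.coe_add]
    | single K d =>
      ext I
      rw [mulPoly_single_apply, AddMonoidAlgebra.single_mul_single, AddMonoidAlgebra.coeff_single,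
        AddMonoidAlgebra.coeff_single, Finsupp.single_apply, Finsupp.single_apply]
      simp only [eq_sub_iff_add_eq, add_comm K J]
      split_ifs <;> simp

lemma coeff_polyDeriv (i : κ ⊕ Fin n) (f : Poly p κ n) :
    ((polyDeriv i f).coeff : Series p κ n) = deriv i f.coeff := by
  induction f using AddMonoidAlgebra.induction_linear with
  | zero => ext; simp [deriv_apply]
  | add f f' hf hf' =>
    rw [polyDeriv_add, AddMonoidAlgebra.coeff_add, Finsupp.coe_add, hf, hf',
      AddMonoidAlgebra.coeff_add, Finsupp.coe_add, map_add]
  | single J c =>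
    ext I
    rw [polyDeriv_single, deriv_apply, AddMonoidAlgebra.coeff_single, AddMonoidAlgebra.coeff_single,
      Finsupp.single_apply, Finsupp.single_apply]
    simp only [sub_eq_iff_eq_add]
    split_ifs with h
    · rw [h]; simp
    · simp

/-! ### The series `exp (F(λ^p, z^p) - F(λ, z))` -/

/-- All exponents of `f` have degree at least `d` in the first coordinate. -/
def DegreeGE (d : ℤ) (f : Poly p κ (n + 1)) : Prop := ∀ J, f.coeff J ≠ 0 → d ≤ J (Sum.inr 0)

lemma DegreeGE.mul {d d' : ℤ} {f g : Poly p κ (n + 1)} (hf : DegreeGE d f) (hg : DegreeGE d' g) :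
    DegreeGE (d + d') (f * g) := by
  intro J hJ
  rw [← mulPoly_coeff] at hJ
  obtain ⟨K, hK, hK'⟩ := mulPoly_ne_zero hJ
  have h1 := hf K hK
  have h2 := hg _ hK'
  rw [Pi.sub_apply] at h2
  omega

lemma DegreeGE.pow {f : Poly p κ (n + 1)} (hf : DegreeGE 1 f) (k : ℕ) : DegreeGE k (f ^ k) := by
  induction k with
  | zero =>
    intro J hJ
    rw [pow_zero, AddMonoidAlgebra.one_def, AddMonoidAlgebra.coeff_single, Finsupp.single_apply] at hJ
    split_ifs at hJ with h
    · rw [← h]; simp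
    · exact absurd rfl hJ
  | succ k ih => rw [pow_succ, Nat.cast_succ]; exact ih.mul hf

lemma DegreeGE.polyDeriv {d : ℤ} {f : Poly p κ (n + 1)} (hf : DegreeGE (d + 1) f) :
    DegreeGE d (polyDeriv (Sum.inr 0) f) := by
  intro J hJ
  rw [coeff_polyDeriv, deriv_apply] at hJ
  have := hf _ (right_ne_zero_of_mul hJ)
  rw [Pi.add_apply, unitExpo_same] at this
  omega

lemma DegreeGE.polyFrob {f : Poly p κ (n + 1)} (hf : DegreeGE 1 f) :
    DegreeGE 1 (polyFrob f) := by
  intro J hJ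
  obtain ⟨K, rfl, hK⟩ := coeff_polyFrob hJ
  have h1 := hf K hK
  have h2 : (1 : ℤ) ≤ p := by exact_mod_cast (Fact.out : p.Prime).one_le
  rw [Pi.smul_apply, nsmul_eq_mul]
  nlinarith

lemma DegreeGE.neg {d : ℤ} {f : Poly p κ (n + 1)} (hf : DegreeGE d f) : DegreeGE d (-f) := by
  intro J hJ
  refine hf J fun h => hJ ?_
  rw [AddMonoidAlgebra.coeff_neg, Finsupp.neg_apply, h, neg_zero]

/-- Partial sums of the exponential series. -/
def truncExp (N : ℕ) (f : Poly p κ n) : Poly p κ n :=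
  ∑ i ∈ Finset.range N, ((i.factorial : ℕ) : ℂ_[p])⁻¹ • f ^ i

lemma polyDeriv_smul (i : κ ⊕ Fin n) (c : ℂ_[p]) (f : Poly p κ n) :
    polyDeriv i (c • f) = c • polyDeriv i f := by
  apply AddMonoidAlgebra.coeff_injective
  apply DFunLike.coe_injective
  rw [coeff_polyDeriv, AddMonoidAlgebra.coeff_smul, AddMonoidAlgebra.coeff_smul, Finsupp.coe_smul,
    Finsupp.coe_smul, map_smul, coeff_polyDeriv]

lemma polyDeriv_one (i : κ ⊕ Fin n) : polyDeriv i (1 : Poly p κ n) = 0 := by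
  rw [AddMonoidAlgebra.one_def, polyDeriv_single]
  simp

lemma polyDeriv_pow (i : κ ⊕ Fin n) (f : Poly p κ n) (k : ℕ) :
    polyDeriv i (f ^ (k + 1)) = ((k : ℂ_[p]) + 1) • (f ^ k * polyDeriv i f) := by
  induction k with
  | zero => simp
  | succ k ih =>
    have h1 : f ^ k * polyDeriv i f * f = f ^ (k + 1) * polyDeriv i f := by ring
    rw [pow_succ, polyDeriv_mul, ih, smul_mul_assoc, Nat.cast_succ, h1]
    module

lemma polyDeriv_truncExp (i : κ ⊕ Fin n) (N : ℕ) (f : Poly p κ n) :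
    polyDeriv i (truncExp (N + 1) f) = polyDeriv i f * truncExp N f := by
  unfold truncExp
  induction N with
  | zero => simp [polyDeriv_one]
  | succ N ih =>
    rw [Finset.sum_range_succ, polyDeriv_add, ih, Finset.sum_range_succ (n := N), mul_add,
      polyDeriv_smul, polyDeriv_pow, smul_smul, Nat.factorial_succ, mul_smul_comm,
      mul_comm (polyDeriv i f)]
    have h : ((N : ℂ_[p]) + 1) ≠ 0 := Nat.cast_add_one_ne_zero N
    congr 2
    · push_cast
      rw [mul_inv, mul_right_comm, inv_mul_cancel₀ h, one_mul]
    · exact mul_comm _ _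

/-- As `F` has degree at least one in `t`, only finitely many pairs contribute to a given
coefficient. The two truncation orders are independent, because differentiation shortens only one of
the truncated exponentials at a time. -/
lemma frobFactor_eq_coeff {F : Poly p κ (n + 1)} (hF : DegreeGE 1 F) {N M : ℕ} {I : Expo κ (n + 1)}
    (hN : I (Sum.inr 0) < N) (hM : I (Sum.inr 0) < M) :
    frobFactor F I = (truncExp N (polyFrob F) * truncExp M (-F)).coeff I := by
  have hsupp : (Function.support fun ij : ℕ × ℕ => (polyFrob F ^ ij.1 * (-F) ^ ij.2).coeff I /
      ((ij.1.factorial : ℂ_[p]) * (ij.2.factorial : ℂ_[p]))) ⊆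
      (Finset.range N ×ˢ Finset.range M : Finset (ℕ × ℕ)) := by
    intro ij hij
    rw [Function.mem_support] at hij
    have h1 : (polyFrob F ^ ij.1 * (-F) ^ ij.2).coeff I ≠ 0 := fun h => hij (by rw [h, zero_div])
    have h2 := ((hF.polyFrob.pow ij.1).mul (hF.neg.pow ij.2)) I h1
    simp only [Finset.coe_product, Finset.coe_range, Set.mem_prod, Set.mem_Iio]
    omega
  rw [frobFactor, finsum_eq_sum_of_support_subset _ hsupp, truncExp, truncExp, Finset.sum_mul_sum,
    Finset.sum_product]
  simp only [AddMonoidAlgebra.coeff_sum, Finsupp.finsetSum_apply]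
  refine Finset.sum_congr rfl fun i _ => Finset.sum_congr rfl fun j _ => ?_
  rw [smul_mul_smul_comm, AddMonoidAlgebra.coeff_smul, Finsupp.smul_apply, smul_eq_mul, ← mul_inv,
    div_eq_mul_inv]
  exact mul_comm _ _

lemma frobFactor_of_neg {F : Poly p κ (n + 1)} (hF : DegreeGE 1 F) {I : Expo κ (n + 1)}
    (hI : I (Sum.inr 0) < 0) : frobFactor F I = 0 := by
  rw [frobFactor_eq_coeff hF (N := 0) (M := 0) (by simpa using hI) (by simpa using hI)]
  simp [truncExp]

lemma frobFactor_initial {F : Poly p κ (n + 1)} (hF : DegreeGE 1 F) {I : Expo κ (n + 1)}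
    (hI : I (Sum.inr 0) = 0) : frobFactor F I = if I = 0 then 1 else 0 := by
  rw [frobFactor_eq_coeff hF (N := 1) (M := 1) (by rw [hI]; simp) (by rw [hI]; simp)]
  simp [truncExp, AddMonoidAlgebra.one_def, AddMonoidAlgebra.coeff_single, Finsupp.single_apply,
    eq_comm]

lemma deriv_frobFactor {F : Poly p κ (n + 1)} (hF : DegreeGE 1 F) :
    deriv (Sum.inr 0) (frobFactor F) =
      mulPoly (polyDeriv (Sum.inr 0) (polyFrob F) - polyDeriv (Sum.inr 0) F) (frobFactor F) := by
  ext I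
  obtain ⟨N, hN⟩ : ∃ N : ℕ, I (Sum.inr 0) < N := ⟨(I (Sum.inr 0) + 1).toNat, by omega⟩
  have key : ∀ {g : Poly p κ (n + 1)} (_ : DegreeGE 0 g) {N M : ℕ} (_ : I (Sum.inr 0) < N)
      (_ : I (Sum.inr 0) < M), mulPoly g (frobFactor F) I =
        (g * (truncExp N (polyFrob F) * truncExp M (-F))).coeff I := by
    intro g hg N M hN hM
    rw [← mulPoly_coeff, mulPoly_apply, mulPoly_apply]
    refine Finset.sum_congr rfl fun J hJ => ?_
    have h1 := hg J (Finsupp.mem_support_iff.1 hJ)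
    dsimp only
    rw [frobFactor_eq_coeff hF (N := N) (M := M)] <;> rw [Pi.sub_apply] <;> omega
  have hneg : polyDeriv (Sum.inr 0) (-F) = -polyDeriv (Sum.inr 0) F := by
    rw [← neg_one_smul ℂ_[p] F, polyDeriv_smul, neg_one_smul]
  rw [deriv_apply, frobFactor_eq_coeff hF (N := N + 1) (M := N + 1)
    (by rw [Pi.add_apply, unitExpo_same]; push_cast; omega)
    (by rw [Pi.add_apply, unitExpo_same]; push_cast; omega), ← deriv_apply, ← coeff_polyDeriv,
    polyDeriv_mul, polyDeriv_truncExp, polyDeriv_truncExp, AddMonoidAlgebra.coeff_add,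
    Finsupp.add_apply, mul_assoc, hneg, sub_eq_add_neg, mulPoly_add,
    LinearMap.add_apply, Pi.add_apply,
    key (DegreeGE.polyDeriv (d := 0) hF.polyFrob) (N := N) (M := N + 1) hN (by push_cast; omega),
    key (g := -polyDeriv (Sum.inr 0) F) (DegreeGE.neg (DegreeGE.polyDeriv (d := 0) hF))
      (N := N + 1) (M := N) (by push_cast; omega) hN,
    mul_left_comm (truncExp (N + 1) _)]

/-- Uniqueness of solutions of `∂_t Θ = g Θ`. -/
lemma eq_of_deriv_eq {g : Poly p κ (n + 1)} (hg : DegreeGE 0 g) {a b : Series p κ (n + 1)}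
    (ha : deriv (Sum.inr 0) a = mulPoly g a) (hb : deriv (Sum.inr 0) b = mulPoly g b)
    (hab : ∀ I, I (Sum.inr 0) ≤ 0 → a I = b I) : a = b := by
  -- Since `g` has no negative powers of `t`, the equation expresses the coefficients of degree `N +
  -- 1` in `t` by those of degree at most `N`.
  have key : ∀ (N : ℕ) (I : Expo κ (n + 1)), I (Sum.inr 0) ≤ N → a I = b I := by
    intro N
    induction N with
    | zero => exact fun I hI => hab I (by simpa using hI)
    | succ N ih =>
      intro I hI
      rcases lt_or_ge (I (Sum.inr 0)) (N + 1) with h | h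
      · exact ih I (by omega)
      have hI' : I (Sum.inr 0) = N + 1 := by push_cast at hI; omega
      have h1 := congrFun ha (I - unitExpo (Sum.inr 0))
      have h2 := congrFun hb (I - unitExpo (Sum.inr 0))
      have h3 : mulPoly g a (I - unitExpo (Sum.inr 0)) = mulPoly g b (I - unitExpo (Sum.inr 0)) := by
        rw [mulPoly_apply, mulPoly_apply]
        refine Finset.sum_congr rfl fun J hJ => ?_
        have h4 := hg J (Finsupp.mem_support_iff.1 hJ)
        dsimp only
        rw [ih]
        rw [Pi.sub_apply, Pi.sub_apply, unitExpo_same]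
        omega
      rw [h3, ← h2, deriv_apply, deriv_apply, sub_add_cancel, Pi.sub_apply, unitExpo_same, hI'] at h1
      refine mul_left_cancel₀ ?_ h1
      push_cast
      rw [add_sub_cancel_right]
      exact Nat.cast_add_one_ne_zero N
  ext I
  exact key (I (Sum.inr 0)).toNat I (by omega)

/-- `Θ` is an overconvergent solution of the differential equations of
`exp (F(λ^p, z^p) - F(λ, z))`. -/
structure IsFrobExp (B : ParamDomain κ) (A : Set (Fin (n + 1))) (F : Poly p κ (n + 1))
    (Θ : Series p κ (n + 1)) : Prop where
  mem : Θ ∈ overconvergent p B A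
  deriv_eq : ∀ i : Fin (n + 1), deriv (Sum.inr i) Θ =
    mulPoly (polyDeriv (Sum.inr i) (polyFrob F) - polyDeriv (Sum.inr i) F) Θ
  initial : ∀ I, I (Sum.inr 0) = 0 → Θ I = if I = 0 then 1 else 0

/-- The formal definition of the Frobenius factor and its analytic construction as a product meet
here: both solve the same equation in `t` and agree in degrees at most zero. Overconvergence of the
formal series follows. -/
lemma IsFrobExp.eq_frobFactor {B : ParamDomain κ} {A : Set (Fin (n + 1))} (hA : 0 ∈ A)
    {F : Poly p κ (n + 1)} (hF : DegreeGE 1 F) {Θ : Series p κ (n + 1)}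
    (h : IsFrobExp B A F Θ) : Θ = frobFactor F := by
  have hg : DegreeGE 0 (polyDeriv (Sum.inr 0) (polyFrob F) - polyDeriv (Sum.inr 0) F) := by
    intro J hJ
    by_cases h1 : (polyDeriv (Sum.inr 0) F).coeff J = 0
    · refine DegreeGE.polyDeriv (d := 0) hF.polyFrob J fun h2 => hJ ?_
      rw [AddMonoidAlgebra.coeff_sub, Finsupp.sub_apply, h1, h2, sub_zero]
    · exact DegreeGE.polyDeriv (d := 0) hF J h1
  refine eq_of_deriv_eq hg (h.deriv_eq 0) (deriv_frobFactor hF) fun I hI => ?_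
  rcases hI.lt_or_eq with h1 | h1
  · rw [frobFactor_of_neg hF h1]
    by_contra h2
    exact absurd ((admissible_of_mem h.mem h2).2 0 hA) (not_le.2 h1)
  · rw [h.initial I h1, frobFactor_initial hF h1]

lemma isFrobExp_zero (B : ParamDomain κ) (A : Set (Fin (n + 1))) :
    IsFrobExp B A (0 : Poly p κ (n + 1)) (Pi.single 0 1) where
  mem := single_zero_mem B A
  deriv_eq i := by
    rw [polyFrob_zero, sub_self, mulPoly_zero, LinearMap.zero_apply]
    ext I
    rw [deriv_apply]
    by_cases h : I + unitExpo (Sum.inr i) = 0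
    · have := congrFun h (Sum.inr i)
      rw [Pi.add_apply, unitExpo_same] at this
      have h2 : ((I (Sum.inr i) : ℂ_[p]) + 1) = 0 := by exact_mod_cast this
      rw [h2, zero_mul]; rfl
    · rw [Pi.single_eq_of_ne h, mul_zero]; rfl
  initial I _ := by rw [Pi.single_apply]

lemma IsFrobExp.mulSeries {B : ParamDomain κ} {A : Set (Fin (n + 1))} (hA : 0 ∈ A)
    {F G : Poly p κ (n + 1)} {Θ Ψ : Series p κ (n + 1)}
    (h : IsFrobExp B A F Θ) (h' : IsFrobExp B A G Ψ) :
    IsFrobExp B A (F + G) (mulSeries Θ Ψ) where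
  mem := mulSeries_mem h.mem h'.mem
  deriv_eq i := by
    rw [deriv_mulSeries_of_mem h.mem h'.mem, h.deriv_eq, h'.deriv_eq,
      mulPoly_mulSeries_of_mem h.mem h'.mem, mulSeries_mulPoly_of_mem h.mem h'.mem, polyFrob_add,
      polyDeriv_add, polyDeriv_add, add_sub_add_comm, mulPoly_add, LinearMap.add_apply]
  initial I hI := by
    unfold Dwork.mulSeries
    -- In degree zero in `t` both factors must have degree zero, because neither has negative powers
    -- of `t`; there the first factor is `1`.
    rw [tsum_eq_single 0]
    · rw [h.initial 0 rfl, if_pos rfl, one_mul, sub_zero, h'.initial I hI]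
    · intro J hJ
      by_contra hne
      have h1 := (admissible_of_mem h.mem (left_ne_zero_of_mul hne)).2 0 hA
      have h2 := (admissible_of_mem h'.mem (right_ne_zero_of_mul hne)).2 0 hA
      rw [Pi.sub_apply, hI] at h2
      have h3 := h.initial J (by omega)
      rw [if_neg hJ] at h3
      exact left_ne_zero_of_mul hne h3

lemma IsFrobExp.seriesMap {m : ℕ} {B : ParamDomain κ} {A : Set (Fin (m + 1))}
    {A' : Set (Fin (n + 1))} (e : Fin (m + 1) ↪o Fin (n + 1)) (he : e 0 = 0)
    (hA : ∀ i, e i ∈ A' → i ∈ A) {F : Poly p κ (m + 1)} {Θ : Series p κ (m + 1)}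
    (h : IsFrobExp B A F Θ) : IsFrobExp B A' (polyMap e F) (seriesMap e Θ) where
  mem := seriesMap_mem e hA h.mem
  deriv_eq i := by
    rw [polyFrob_polyMap]
    by_cases hi : i ∈ Set.range e
    · obtain ⟨i, rfl⟩ := hi
      have h1 := deriv_seriesMap e (Sum.inr i) Θ
      have h2 := polyDeriv_polyMap e (Sum.inr i) (polyFrob F)
      have h3 := polyDeriv_polyMap e (Sum.inr i) F
      rw [Sum.map_inr] at h1 h2 h3
      rw [h1, h2, h3, h.deriv_eq, mulPoly_sub, mulPoly_sub, LinearMap.sub_apply, LinearMap.sub_apply,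
        seriesMap_sub, seriesMap_mulPoly, seriesMap_mulPoly]
    · rw [deriv_seriesMap_of_notMem e hi, polyDeriv_polyMap_of_notMem e hi,
        polyDeriv_polyMap_of_notMem e hi, sub_self, mulPoly_zero, LinearMap.zero_apply]
  initial I hI := by
    by_cases h1 : I ∈ Set.range (expoMap (κ := κ) e)
    · obtain ⟨J, rfl⟩ := h1
      rw [seriesMap_expoMap, h.initial]
      · have : expoMap e J = 0 ↔ J = 0 := by
          rw [← expoMap_zero (κ := κ) e, (expoMap_injective e).eq_iff]
        simp only [this]
      · rw [← hI, ← he, expoMap_inr]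
    · rw [seriesMap_of_notMem _ _ h1, if_neg]
      rintro rfl
      exact h1 ⟨0, expoMap_zero e⟩

/-- The power series with coefficients `e` in the monomial with exponent `J`. -/
def powSeries (J : Expo κ n) (e : ℕ → ℂ_[p]) : Series p κ n :=
  Function.extend (fun m : ℕ => m • J) e 0

section PowSeries
variable {J : Expo κ (n + 1)} (hJ : J (Sum.inr 0) = 1)
include hJ

lemma nsmul_left_injective : Function.Injective fun m : ℕ => m • J := by
  intro a b h
  have := congrFun h (Sum.inr 0)
  simpa [hJ] using this

lemma powSeries_nsmul (e : ℕ → ℂ_[p]) (m : ℕ) : powSeries J e (m • J) = e m :=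
  (nsmul_left_injective hJ).extend_apply _ _ m

lemma powSeries_nsmul_sub (e : ℕ → ℂ_[p]) (m q : ℕ) :
    powSeries J e (m • J - q • J) = if q ≤ m then e (m - q) else 0 := by
  split_ifs with h
  · obtain ⟨l, rfl⟩ := Nat.exists_eq_add_of_le h
    rw [add_nsmul, add_sub_cancel_left, Nat.add_sub_cancel_left, powSeries_nsmul hJ]
  · refine Function.extend_apply' _ _ _ ?_
    rintro ⟨l, hl⟩
    have := congrFun hl (Sum.inr 0)
    simp [hJ] at this
    omega

omit hJ in
lemma powSeries_of_notMem (e : ℕ → ℂ_[p]) {I : Expo κ (n + 1)}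
    (hI : ∀ m : ℕ, m • J ≠ I) : powSeries J e I = 0 :=
  Function.extend_apply' _ _ _ (by rintro ⟨m, hm⟩; exact hI m hm)

omit hJ in
lemma powSeries_sub_of_notMem (e : ℕ → ℂ_[p]) {I : Expo κ (n + 1)}
    (hI : ∀ m : ℕ, m • J ≠ I) (q : ℕ) : powSeries J e (I - q • J) = 0 :=
  powSeries_of_notMem e fun m hm => hI (m + q) (by rw [add_nsmul, hm, sub_add_cancel])

lemma powSeries_mem {B : ParamDomain κ} {A : Set (Fin (n + 1))} (hJ' : Admissible B A J)
    {e : ℕ → ℂ_[p]} (he : ∀ ρ ∈ B.radii, ∃ r : ℝ, 0 < r ∧ r < 1 ∧ ∃ C : ℝ, 0 ≤ C ∧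
      ∀ m, ‖e m‖ * weight ρ J ^ m ≤ C * r ^ m) : powSeries J e ∈ overconvergent p B A := by
  refine ⟨fun I hI => ?_, fun ρ hρ => ?_⟩
  · obtain ⟨m, rfl⟩ : ∃ m : ℕ, m • J = I := by
      by_contra! h; exact hI (powSeries_of_notMem e h)
    exact hJ'.nsmul m
  · obtain ⟨r, hr0, hr1, C, hC, hr⟩ := he ρ hρ
    have hs : size J ≠ 0 := by
      have := natAbs_le_size J (Sum.inr 0)
      rw [hJ] at this
      simp at this
      omega
    obtain ⟨r', hr0', hr1', hr'⟩ := exists_le_pow hr1 hs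
    refine ⟨C, r', hr0', hr1', fun I => ?_⟩
    by_cases h : ∃ m : ℕ, m • J = I
    · obtain ⟨m, rfl⟩ := h
      rw [powSeries_nsmul hJ, weight_nsmul (B.radii_pos ρ hρ), size_nsmul, mul_comm m, pow_mul]
      exact (hr m).trans (mul_le_mul_of_nonneg_left (pow_le_pow_left₀ hr0.le hr' m) hC)
    · push Not at h
      rw [powSeries_of_notMem e h, norm_zero, zero_mul]
      positivity

end PowSeries

lemma dwork_coeff_succ {π c : ℂ_[p]} {e : PowerSeries ℂ_[p]}
    (he : HasLogDeriv (PowerSeries.C (-(π * c)) +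
      PowerSeries.C (π * c * p) * PowerSeries.X ^ (p - 1)) e) (m : ℕ) :
    ((m : ℂ_[p]) + 1) * PowerSeries.coeff (m + 1) e = -(π * c) * PowerSeries.coeff m e +
      π * c * p * (if p ≤ m + 1 then PowerSeries.coeff (m + 1 - p) e else 0) := by
  have h := congrArg (PowerSeries.coeff m) he.2
  have hp := (Fact.out : p.Prime).two_le
  rw [PowerSeries.coeff_derivative, add_mul, map_add, PowerSeries.coeff_C_mul, mul_assoc,
    PowerSeries.coeff_C_mul, PowerSeries.coeff_X_pow_mul'] at h
  rw [mul_comm, h]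
  congr 2
  by_cases h1 : p ≤ m + 1
  · rw [if_pos h1, if_pos (by omega)]
    congr 2
    omega
  · rw [if_neg h1, if_neg (by omega)]

/-- The solution for a monomial. -/
lemma isFrobExp_single (hp2 : p ≠ 2) {π : ℂ_[p]} (hπ : π ^ (p - 1) = -p) {B : ParamDomain κ}
    {A : Set (Fin (n + 1))} {J : Expo κ (n + 1)} (hJ : J (Sum.inr 0) = 1) (hJ' : Admissible B A J)
    {c : ℂ_[p]} (h1 : ∀ ρ ∈ B.radii, ‖c‖ * weight ρ J ≤ 1)
    (h2 : ∀ ρ ∈ B.radii, ‖c ^ p - c‖ * weight ρ J ^ p < 1) {e : PowerSeries ℂ_[p]}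
    (he : HasLogDeriv (PowerSeries.C (-(π * c)) +
      PowerSeries.C (π * c * p) * PowerSeries.X ^ (p - 1)) e) :
    IsFrobExp B A (AddMonoidAlgebra.single J (π * c))
      (powSeries J fun m => PowerSeries.coeff m e) where
  mem := powSeries_mem hJ hJ' fun ρ hρ => by
    obtain ⟨r, hr0, hr1, hr⟩ := exists_norm_coeff_dwork_mul_le hp2 hπ he
      (weight_pos (B.radii_pos ρ hρ) J) (h1 ρ hρ) (h2 ρ hρ)
    exact ⟨r, hr0, hr1, 1, zero_le_one, fun m => by rw [one_mul]; exact hr m⟩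
  deriv_eq i := by
    ext I
    rw [polyFrob_single, polyDeriv_single, polyDeriv_single, mulPoly_sub, LinearMap.sub_apply,
      Pi.sub_apply, mulPoly_single_apply, mulPoly_single_apply, deriv_apply,
      show I - (p • J - unitExpo (Sum.inr i)) = I + unitExpo (Sum.inr i) - p • J by abel,
      show I - (J - unitExpo (Sum.inr i)) = I + unitExpo (Sum.inr i) - 1 • J by rw [one_smul]; abel]
    -- If `I + unitExpo i = m J`, then `I_i + 1 = m J_i`. In every direction `i` the equation is
    -- therefore `J_i` times the one-variable recursion for the Dwork exponential.
    by_cases h : ∃ m : ℕ, m • J = I + unitExpo (Sum.inr i)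
    · obtain ⟨m, hm⟩ := h
      have h3 : ((I (Sum.inr i) : ℂ_[p]) + 1) = m * J (Sum.inr i) := by
        have := congrFun hm (Sum.inr i)
        rw [Pi.add_apply, unitExpo_same, Pi.smul_apply, nsmul_eq_mul] at this
        have h4 := congrArg (Int.cast (R := ℂ_[p])) this
        push_cast at h4
        exact h4.symm
      rw [← hm, powSeries_nsmul hJ, powSeries_nsmul_sub hJ, powSeries_nsmul_sub hJ, h3]
      simp only [Pi.smul_apply, nsmul_eq_mul]
      rcases m with _ | m
      · rw [if_neg (by have := (Fact.out : p.Prime).pos; omega), if_neg (by omega)]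
        simp
      · have h4 := dwork_coeff_succ he m
        rw [if_pos (show 1 ≤ m + 1 by omega), Nat.add_sub_cancel]
        push_cast
        linear_combination (J (Sum.inr i) : ℂ_[p]) * h4
    · push Not at h
      rw [powSeries_of_notMem _ h, powSeries_sub_of_notMem _ h, powSeries_sub_of_notMem _ h]
      simp
  initial I hI := by
    by_cases h : ∃ m : ℕ, m • J = I
    · obtain ⟨m, rfl⟩ := h
      have h3 : m = 0 := by simpa [hJ] using hI
      subst h3
      rw [powSeries_nsmul hJ, he.coeff_zero, if_pos (zero_nsmul J)]
    · push Not at h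
      rw [powSeries_of_notMem _ h, if_neg]
      rintro rfl
      exact h 0 (zero_nsmul J)

/-- The factor of a sum of monomials is the product of the factors of the monomials, each of which
overconverges by Dwork's theorem. -/
lemma exists_isFrobExp_sum (hp2 : p ≠ 2) {π : ℂ_[p]} (hπ : π ^ (p - 1) = -p) {B : ParamDomain κ}
    {A : Set (Fin (n + 1))} (hA : 0 ∈ A) {ι : Type*} (s : Finset ι) (J : ι → Expo κ (n + 1))
    (c : ι → ℂ_[p]) (hJ : ∀ j ∈ s, J j (Sum.inr 0) = 1) (hJ' : ∀ j ∈ s, Admissible B A (J j))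
    (h1 : ∀ j ∈ s, ∀ ρ ∈ B.radii, ‖c j‖ * weight ρ (J j) ≤ 1)
    (h2 : ∀ j ∈ s, ∀ ρ ∈ B.radii, ‖c j ^ p - c j‖ * weight ρ (J j) ^ p < 1) :
    ∃ Θ, IsFrobExp B A (∑ j ∈ s, AddMonoidAlgebra.single (J j) (π * c j)) Θ := by
  induction s using Finset.induction_on with
  | empty => exact ⟨_, by rw [Finset.sum_empty]; exact isFrobExp_zero B A⟩
  | insert j s hj ih =>
    obtain ⟨Θ, hΘ⟩ := ih (fun i hi => hJ i (Finset.mem_insert_of_mem hi))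
      (fun i hi => hJ' i (Finset.mem_insert_of_mem hi))
      (fun i hi => h1 i (Finset.mem_insert_of_mem hi))
      (fun i hi => h2 i (Finset.mem_insert_of_mem hi))
    have hm := Finset.mem_insert_self j s
    obtain ⟨e, he⟩ := exists_hasLogDeriv (PowerSeries.C (-(π * c j)) +
      PowerSeries.C (π * c j * p) * PowerSeries.X ^ (p - 1))
    have h3 := isFrobExp_single hp2 hπ (hJ j hm) (hJ' j hm) (h1 j hm) (h2 j hm) he
    exact ⟨_, by rw [Finset.sum_insert hj]; exact h3.mulSeries hA hΘ⟩

/-! ### Frobenius on series -/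

lemma seriesFrob_nsmul (a : Series p κ n) (J : Expo κ n) : seriesFrob a (p • J) = a J :=
  nsmul_expo_injective.extend_apply _ _ J

lemma seriesFrob_of_notMem (a : Series p κ n) {I : Expo κ n} (hI : ∀ J, p • J ≠ I) :
    seriesFrob a I = 0 :=
  Function.extend_apply' _ _ _ (by rintro ⟨J, hJ⟩; exact hI J hJ)

/-- Series supported on the multiples of `p` are determined by their coefficients there. -/
lemma eq_seriesFrob {a b : Series p κ n} (h : ∀ J, b (p • J) = a J)
    (h' : ∀ I, (∀ J : Expo κ n, p • J ≠ I) → b I = 0) : b = seriesFrob a := by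
  ext I
  by_cases hI : ∃ J : Expo κ n, p • J = I
  · obtain ⟨J, rfl⟩ := hI
    rw [h, seriesFrob_nsmul]
  · push Not at hI
    rw [h' I hI, seriesFrob_of_notMem a hI]

lemma seriesFrob_add (a b : Series p κ n) : seriesFrob (a + b) = seriesFrob a + seriesFrob b :=
  (eq_seriesFrob (fun J => by simp only [Pi.add_apply, seriesFrob_nsmul]) fun I hI => by
    rw [Pi.add_apply, seriesFrob_of_notMem _ hI, seriesFrob_of_notMem _ hI, add_zero]).symm

lemma seriesFrob_smul (c : ℂ_[p]) (a : Series p κ n) : seriesFrob (c • a) = c • seriesFrob a :=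
  (eq_seriesFrob (fun J => by simp only [Pi.smul_apply, seriesFrob_nsmul]) fun I hI => by
    rw [Pi.smul_apply, seriesFrob_of_notMem _ hI, smul_zero]).symm

lemma seriesFrob_zero : seriesFrob (0 : Series p κ n) = 0 :=
  (eq_seriesFrob (fun _ => rfl) fun _ _ => rfl).symm

lemma seriesFrob_mulPoly (f : Poly p κ n) (a : Series p κ n) :
    seriesFrob (mulPoly f a) = mulPoly (polyFrob f) (seriesFrob a) := by
  induction f using AddMonoidAlgebra.induction_linear with
  | zero => simp [seriesFrob_zero]
  | add f g hf hg =>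
    rw [mulPoly_add, LinearMap.add_apply, seriesFrob_add, hf, hg, polyFrob_add, mulPoly_add,
      LinearMap.add_apply]
  | single K c =>
    refine (eq_seriesFrob (fun J => ?_) fun I hI => ?_).symm <;>
      rw [polyFrob_single, mulPoly_single_apply]
    · rw [← smul_sub, seriesFrob_nsmul, mulPoly_single_apply]
    · rw [seriesFrob_of_notMem, mul_zero]
      intro J hJ
      exact hI (J + K) (by rw [smul_add, hJ, sub_add_cancel])

lemma deriv_seriesFrob (i : κ ⊕ Fin n) (a : Series p κ n) : deriv i (seriesFrob a) =
    (p : ℂ_[p]) • mon ((p - 1) • unitExpo i) (seriesFrob (deriv i a)) := by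
  have hu : (p - 1) • (unitExpo i : Expo κ n) = p • unitExpo i - unitExpo i := by
    rw [eq_sub_iff_add_eq, ← succ_nsmul, Nat.sub_add_cancel (Fact.out : p.Prime).one_le]
  ext I
  rw [deriv_apply, Pi.smul_apply, mon_apply, hu]
  by_cases h : ∃ J : Expo κ n, p • J = I + unitExpo i
  · obtain ⟨J, hJ⟩ := h
    have h1 : I - (p • unitExpo i - unitExpo i) = p • (J - unitExpo i) := by
      rw [smul_sub, hJ]; abel
    have h2 : (I i : ℂ_[p]) + 1 = p * J i := by
      have := congrFun hJ i
      rw [Pi.add_apply, unitExpo_same, Pi.smul_apply, nsmul_eq_mul] at this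
      exact_mod_cast this.symm
    rw [h1, ← hJ, seriesFrob_nsmul, seriesFrob_nsmul, deriv_apply, sub_add_cancel, h2,
      Pi.sub_apply, unitExpo_same, smul_eq_mul]
    push_cast
    ring
  · push Not at h
    rw [seriesFrob_of_notMem _ h, seriesFrob_of_notMem, smul_zero, mul_zero]
    intro J hJ
    exact h (J + unitExpo i) (by rw [smul_add, hJ]; abel)

lemma seriesFrob_seriesMap {m : ℕ} (e : Fin m ↪o Fin n) (a : Series p κ m) :
    seriesFrob (seriesMap e a) = seriesMap e (seriesFrob a) := by
  refine (eq_seriesFrob (fun J => ?_) fun I hI => ?_).symm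
  · by_cases h : J ∈ Set.range (expoMap (κ := κ) e)
    · obtain ⟨K, rfl⟩ := h
      rw [seriesMap_expoMap, ← expoMap_nsmul, seriesMap_expoMap, seriesFrob_nsmul]
    · rw [seriesMap_of_notMem _ _ h, seriesMap_of_notMem]
      intro h'
      rw [mem_range_expoMap] at h h'
      refine h fun i hi => ?_
      have h1 := h' i hi
      rw [Pi.smul_apply, nsmul_eq_mul] at h1
      exact (mul_eq_zero.1 h1).resolve_left (by exact_mod_cast (Fact.out : p.Prime).ne_zero)
  · by_cases h : I ∈ Set.range (expoMap (κ := κ) e)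
    · obtain ⟨K, rfl⟩ := h
      rw [seriesMap_expoMap, seriesFrob_of_notMem]
      intro J hJ
      exact hI (expoMap e J) (by rw [← hJ, expoMap_nsmul])
    · rw [seriesMap_of_notMem _ _ h]

/-- The monomial `p • J` has on the polycircle `ρ` the absolute value that `J` has on `ρ^p`; this is
why the set of radii must be stable under `p`-th powers. The size grows by the factor `p` only,
which preserves exponential decay. -/
lemma seriesFrob_mem {B : ParamDomain κ} (hB : ∀ ρ ∈ B.radii, (fun k => ρ k ^ p) ∈ B.radii)
    {A : Set (Fin n)} {a : Series p κ n} (ha : a ∈ overconvergent p B A) :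
    seriesFrob a ∈ overconvergent p B A := by
  have key : ∀ I, seriesFrob a I ≠ 0 → ∃ J : Expo κ n, p • J = I ∧ a J ≠ 0 := by
    intro I hI
    by_cases h : ∃ J : Expo κ n, p • J = I
    · obtain ⟨J, rfl⟩ := h
      exact ⟨J, rfl, by rwa [seriesFrob_nsmul] at hI⟩
    · push Not at h
      exact absurd (seriesFrob_of_notMem a h) hI
  refine overconvergent_of_le ha (fun I hI => ?_) fun ρ hρ => ⟨_, hB ρ hρ, 1, p, fun I hI => ?_⟩
  · obtain ⟨J, rfl, hJ⟩ := key I hI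
    exact (admissible_of_mem ha hJ).nsmul p
  · obtain ⟨J, rfl, hJ⟩ := key I hI
    refine ⟨J, ?_, ?_⟩
    · rw [seriesFrob_nsmul, weight_nsmul', one_mul]
      have hw := (weight_pos (B.radii_pos _ (hB ρ hρ)) J).le
      refine le_mul_of_one_le_left (mul_nonneg (norm_nonneg _) hw) ?_
      linarith [(size J).cast_nonneg (α := ℝ)]
    · rw [size_nsmul]
      exact Nat.mul_le_mul_left _ (Nat.le_succ _)

/-! ### Frobenius on forms -/

/-- The exponent of the factor in `d(z_{i_1}^p) ∧ … ∧ d(z_{i_k}^p)`. -/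
def frobExpo (S : Finset (Fin n)) : Expo κ n := (p - 1) • ∑ i ∈ S, unitExpo (Sum.inr i)

variable (p) in
lemma admissible_frobExpo (B : ParamDomain κ) (A : Set (Fin n)) (S : Finset (Fin n)) :
    Admissible B A (frobExpo (p := p) S) := by
  refine Admissible.nsmul ?_ _
  induction S using Finset.induction_on with
  | empty => exact ⟨fun _ _ => le_rfl, fun _ _ => le_rfl⟩
  | insert i S hi ih => rw [Finset.sum_insert hi]; exact (admissible_coord B A i).add ih

lemma frobExpo_apply_of_notMem {S : Finset (Fin n)} {i : Fin n} (hi : i ∉ S) :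
    (frobExpo (p := p) S : Expo κ n) (Sum.inr i) = 0 := by
  rw [frobExpo, Pi.smul_apply, Finset.sum_apply, Finset.sum_eq_zero, smul_zero]
  intro j hj
  exact unitExpo_ne fun h => hi (by rw [Sum.inr_injective h]; exact hj)

/-- The Frobenius map on the component with index `S`, up to the factor `Θ`. -/
def frobComponent (S : Finset (Fin n)) (a : Series p κ n) : Series p κ n :=
  ((p : ℂ_[p]) ^ S.card) • mon (frobExpo (p := p) S) (seriesFrob a)

lemma frobenius_apply (F : Poly p κ n) (ω : Form p κ n) (S : Finset (Fin n)) :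
    frobenius F ω S = mulSeries (frobFactor F) (frobComponent S (ω S)) := by
  unfold frobenius
  congr 1
  ext I
  rw [frobComponent, Pi.smul_apply, mon_apply, smul_eq_mul]
  rfl

lemma frobComponent_add (S : Finset (Fin n)) (a b : Series p κ n) :
    frobComponent S (a + b) = frobComponent S a + frobComponent S b := by
  rw [frobComponent, seriesFrob_add, map_add, smul_add]; rfl

lemma frobComponent_smul (S : Finset (Fin n)) (c : ℂ_[p]) (a : Series p κ n) :
    frobComponent S (c • a) = c • frobComponent S a := by
  rw [frobComponent, seriesFrob_smul, map_smul, smul_comm]; rfl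

lemma frobComponent_zero (S : Finset (Fin n)) : frobComponent S (0 : Series p κ n) = 0 := by
  rw [frobComponent, seriesFrob_zero, map_zero, smul_zero]

lemma frobComponent_mem {B : ParamDomain κ} (hB : ∀ ρ ∈ B.radii, (fun k => ρ k ^ p) ∈ B.radii)
    {A : Set (Fin n)} {a : Series p κ n} (ha : a ∈ overconvergent p B A) (S : Finset (Fin n)) :
    frobComponent S a ∈ overconvergent p B A :=
  Submodule.smul_mem _ _ (mon_mem (admissible_frobExpo p B A S) (seriesFrob_mem hB ha))

lemma frobExpo_erase {S : Finset (Fin n)} {i : Fin n} (hi : i ∈ S) :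
    (frobExpo (p := p) S : Expo κ n) =
      (p - 1) • unitExpo (Sum.inr i) + frobExpo (p := p) (S.erase i) := by
  rw [frobExpo, frobExpo, ← smul_add, 
    Finset.add_sum_erase S (fun j => unitExpo (Sum.inr j)) hi]

/-- The chain rule gives the factor `p z_i^(p-1)`, which is the one that `d(z_i^p)` adds in passing
from `S.erase i` to `S`; the factor belonging to `S.erase i` does not involve `z_i`. -/
lemma deriv_frobComponent {S : Finset (Fin n)} {i : Fin n} (hi : i ∈ S) (a : Series p κ n) :
    deriv (Sum.inr i) (frobComponent (S.erase i) a) = frobComponent S (deriv (Sum.inr i) a) := by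
  rw [frobComponent, map_smul, deriv_mulPoly, polyDeriv_single,
    frobExpo_apply_of_notMem (Finset.notMem_erase i S), Int.cast_zero, zero_mul,
    AddMonoidAlgebra.single_zero, mulPoly_zero, LinearMap.zero_apply, add_zero, deriv_seriesFrob,
    map_smul, smul_smul, mon_mon, ← pow_succ, Finset.card_erase_add_one hi, add_comm,
    ← frobExpo_erase hi]
  rfl

lemma mulPoly_polyDeriv_frobComponent {S : Finset (Fin n)} {i : Fin n} (hi : i ∈ S) (F : Poly p κ n)
    (a : Series p κ n) : mulPoly (polyDeriv (Sum.inr i) (polyFrob F)) (frobComponent (S.erase i) a) =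
      frobComponent S (mulPoly (polyDeriv (Sum.inr i) F) a) := by
  rw [polyDeriv_polyFrob, mulPoly_smul, LinearMap.smul_apply, mulPoly_mul_apply, frobComponent,
    map_smul, mulPoly_comm (polyFrob _), ← seriesFrob_mulPoly, map_smul, smul_smul, mon_mon,
    ← pow_succ', Finset.card_erase_add_one hi, ← frobExpo_erase hi]
  rfl

section IsFrobExp
variable {B : ParamDomain κ} {A : Set (Fin (n + 1))} {F : Poly p κ (n + 1)}
  {Θ : Series p κ (n + 1)}

lemma IsFrobExp.twistedDeriv_mulSeries (h : IsFrobExp B A F Θ) {b : Series p κ (n + 1)}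
    (hb : b ∈ overconvergent p B A) (hF : AdmissiblePoly B A F) (i : Fin (n + 1)) :
    twistedDeriv F (Sum.inr i) (Dwork.mulSeries Θ b) =
      Dwork.mulSeries Θ (deriv (Sum.inr i) b + mulPoly (polyDeriv (Sum.inr i) (polyFrob F)) b) := by
  rw [twistedDeriv_apply, deriv_mulSeries_of_mem h.mem hb, h.deriv_eq,
    mulPoly_mulSeries_of_mem h.mem hb, mulPoly_sub, LinearMap.sub_apply,
    mulSeries_add_of_mem h.mem (deriv_mem hb _) (mulPoly_mem (hF.polyFrob.polyDeriv _) hb),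
    mulSeries_mulPoly_of_mem h.mem hb]
  abel

/-- The Frobenius map commutes with the twisted derivatives. -/
lemma IsFrobExp.twistedDeriv_frobComponent (h : IsFrobExp B A F Θ)
    (hB : ∀ ρ ∈ B.radii, (fun k => ρ k ^ p) ∈ B.radii) (hF : AdmissiblePoly B A F)
    {S : Finset (Fin (n + 1))} {i : Fin (n + 1)} (hi : i ∈ S) {a : Series p κ (n + 1)}
    (ha : a ∈ overconvergent p B A) :
    twistedDeriv F (Sum.inr i) (Dwork.mulSeries Θ (frobComponent (S.erase i) a)) =
      Dwork.mulSeries Θ (frobComponent S (twistedDeriv F (Sum.inr i) a)) := by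
  rw [h.twistedDeriv_mulSeries (frobComponent_mem hB ha _) hF, deriv_frobComponent hi,
    mulPoly_polyDeriv_frobComponent hi, ← frobComponent_add]
  rfl

lemma exists_induces_frobenius (h : IsFrobExp B A F (frobFactor F))
    (hB : ∀ ρ ∈ B.radii, (fun k => ρ k ^ p) ∈ B.radii) (hF : AdmissiblePoly B A F) {k : ℕ} :
    ∃ G : DeRham B A F k →ₗ[ℂ_[p]] DeRham B A F k, Induces (frobenius F) G := by
  have hc : ∀ {a}, a ∈ overconvergent p B A → ∀ S, frobComponent S a ∈ overconvergent p B A :=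
    fun ha S => frobComponent_mem hB ha S
  refine exists_induces_of_commutes _ (fun ω hω η hη => ?_) (fun c ω hω => ?_) (fun ω hω => ?_)
    (fun S ω h0 => ?_) (fun ω hω => ?_)
  · ext1 S
    rw [Pi.add_apply, frobenius_apply, frobenius_apply, frobenius_apply, Pi.add_apply,
      frobComponent_add, mulSeries_add_of_mem h.mem (hc (mem_forms.1 hω S) S)
        (hc (mem_forms.1 hη S) S)]
  · ext1 S
    rw [Pi.smul_apply, frobenius_apply, frobenius_apply, Pi.smul_apply, frobComponent_smul,
      mulSeries_smul]
  · refine mem_forms.2 fun S => ?_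
    rw [frobenius_apply]
    exact mulSeries_mem h.mem (hc (mem_forms.1 hω S) S)
  · rw [frobenius_apply, h0, frobComponent_zero, mulSeries_zero]
  · ext1 S
    -- Multiplication by the infinite series is additive only where the sums converge, so linearity
    -- is formulated on the submodule of overconvergent functions.
    let φ : overconvergent p B A →ₗ[ℂ_[p]] Series p κ (n + 1) :=
      { toFun := fun a => mulSeries (frobFactor F) (frobComponent S a.1)
        map_add' := fun a b => by
          rw [Submodule.coe_add, frobComponent_add,
            mulSeries_add_of_mem h.mem (hc a.2 S) (hc b.2 S)]
        map_smul' := fun c a => by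
          rw [Submodule.coe_smul, frobComponent_smul, mulSeries_smul]; rfl }
    let τ : Fin (n + 1) → overconvergent p B A := fun i => if i ∈ S then
      (-1 : ℂ_[p]) ^ (S.filter (· < i)).card •
        ⟨_, twistedDeriv_mem hF (mem_forms.1 hω (S.erase i)) (Sum.inr i)⟩ else 0
    have hτ : twistedD F ω S = (∑ i, τ i : overconvergent p B A) := by
      rw [twistedD_apply, Submodule.coe_sum]
      refine Finset.sum_congr rfl fun i _ => ?_
      simp only [τ]
      split_ifs <;> rfl
    rw [twistedD_apply, frobenius_apply, hτ]
    refine Eq.trans ?_ (map_sum φ τ Finset.univ).symm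
    refine Finset.sum_congr rfl fun i _ => ?_
    simp only [τ]
    split_ifs with hi
    · rw [map_smul, frobenius_apply,
        h.twistedDeriv_frobComponent hB hF hi (mem_forms.1 hω (S.erase i))]
      rfl
    · rw [map_zero]

end IsFrobExp

lemma Induces.smul {B : ParamDomain κ} {A : Set (Fin n)} {F : Poly p κ n} {k : ℕ}
    {Φ : Form p κ n → Form p κ n} {G : DeRham B A F k →ₗ[ℂ_[p]] DeRham B A F k}
    (h : Induces Φ G) (c : ℂ_[p]) : Induces (fun ω => c • Φ ω) (c • G) := by
  intro ω d hd
  obtain ⟨h1, h2⟩ := h ω d hd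
  exact ⟨Submodule.smul_mem _ _ h1, by rw [LinearMap.smul_apply, ← h2]; rfl⟩

/-- The domain is auxiliary: the identity is formal, and a polycircle with all coordinates affine
suffices to apply the uniqueness. -/
lemma frobFactor_zero : frobFactor (0 : Poly p κ (n + 1)) = Pi.single 0 1 :=
  ((isFrobExp_zero (ParamDomain.polycircle (fun _ => 1) fun _ => one_pos) Set.univ).eq_frobFactor
    (Set.mem_univ 0) fun _ hJ => absurd rfl hJ).symm

/-! ### The Frobenius factors of the curve and of the threefold -/

lemma phase_eq_sum (π : ℂ_[p]) (f : Poly p κ n) : phase π f = ∑ J ∈ f.coeff.support,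
    AddMonoidAlgebra.single (coord 0 + expoMap (Fin.succOrderEmb n) J) (π * f.coeff J) := by
  let φ : Poly p κ n →+ Poly p κ (n + 1) :=
    { toFun := polyMap (Fin.succOrderEmb n)
      map_zero' := AddMonoidAlgebra.mapDomain_zero _
      map_add' := polyMap_add _ }
  have h : polyMap (Fin.succOrderEmb n) f = ∑ J ∈ f.coeff.support,
      AddMonoidAlgebra.single (expoMap (Fin.succOrderEmb n) J) (f.coeff J) := by
    conv_lhs => rw [← AddMonoidAlgebra.sum_coeff_single f]
    refine (map_sum φ _ _).trans (Finset.sum_congr rfl fun J _ => ?_)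
    exact polyMap_single _ _ _
  rw [phase_eq, h, Finset.mul_sum]
  exact Finset.sum_congr rfl fun J _ => AddMonoidAlgebra.single_mul_single _ _ _ _

lemma expoMap_succ_zero (J : Expo κ n) : expoMap (Fin.succOrderEmb n) J (Sum.inr 0) = 0 :=
  expoMap_of_notMem _ _ (by rintro ⟨i, hi⟩; exact Fin.succ_ne_zero i hi)

lemma degreeGE_phase (π : ℂ_[p]) (f : Poly p κ n) : DegreeGE 1 (phase π f) := by
  intro J hJ
  rw [phase_eq, ← mulPoly_coeff, mulPoly_single_apply] at hJ
  obtain ⟨K, hK, -⟩ := coeff_polyMap _ f (right_ne_zero_of_mul hJ)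
  have := congrFun hK (Sum.inr 0)
  rw [expoMap_succ_zero, Pi.sub_apply, coord_apply] at this
  simp at this
  omega

lemma isFrobExp_phase (hp2 : p ≠ 2) {π : ℂ_[p]} (hπ : π ^ (p - 1) = -p) {B : ParamDomain κ}
    {A : Set (Fin n)} {f : Poly p κ n} (hf : AdmissiblePoly B A f)
    (h1 : ∀ ρ ∈ B.radii, ∀ J, ‖f.coeff J‖ * weight ρ J ≤ 1)
    (h2 : ∀ ρ ∈ B.radii, ∀ J, ‖f.coeff J ^ p - f.coeff J‖ * weight ρ J ^ p < 1) :
    IsFrobExp B (insert 0 (Fin.succ '' A)) (phase π f) (frobFactor (phase π f)) := by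
  have hw : ∀ (ρ : κ → ℝ) (J : Expo κ n),
      weight ρ (coord 0 + expoMap (Fin.succOrderEmb n) J) = weight ρ J := fun ρ J => by
    rw [← weight_expoMap (e := Fin.succOrderEmb n)]
    unfold weight
    refine Finset.prod_congr rfl fun k _ => ?_
    rw [Pi.add_apply, coord_inl, zero_add]
  obtain ⟨Θ, hΘ⟩ := exists_isFrobExp_sum hp2 hπ (B := B) (Set.mem_insert 0 (Fin.succ '' A))
    f.coeff.support (fun J => coord 0 + expoMap (Fin.succOrderEmb n) J) (fun J => f.coeff J)
    (fun J _ => by rw [Pi.add_apply, expoMap_succ_zero, coord_apply]; simp)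
    -- Admissibility of each exponent is read off from the phase with constant `1`, where the
    -- coefficient of the monomial is that of `f` itself.
    (fun J hJ => hf.phase (1 : ℂ_[p]) _ (by
      rw [phase_eq, ← mulPoly_coeff, mulPoly_single_apply, add_sub_cancel_left, one_mul]
      have : (polyMap (Fin.succOrderEmb n) f).coeff (expoMap (Fin.succOrderEmb n) J) = f.coeff J :=
        Finsupp.mapDomain_apply (expoMap_injective _) _ _
      rw [this]
      exact Finsupp.mem_support_iff.1 hJ))
    (fun J _ ρ hρ => by rw [hw]; exact h1 ρ hρ J) (fun J _ ρ hρ => by rw [hw]; exact h2 ρ hρ J)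
  rw [← phase_eq_sum] at hΘ
  rwa [← hΘ.eq_frobFactor (Set.mem_insert _ _) (degreeGE_phase π f)]

/-- The series `∑_m e_m (t x y)^m K`, for a function `K` of `t, u, v`. -/
def fibreSeries (e : ℕ → ℂ_[p]) (K : Series p κ 5) : Series p κ 5 := fun I =>
  if 0 ≤ I (Sum.inr 3) then e (I (Sum.inr 3)).toNat * K (I - (I (Sum.inr 3)).toNat • txy) else 0

lemma txy_zero : (txy : Expo κ 5) (Sum.inr 0) = 1 := by simp [coord_apply]
lemma txy_three : (txy : Expo κ 5) (Sum.inr 3) = 1 := by simp [coord_apply]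

lemma txy_nsmul_three (m : ℕ) : (m • txy : Expo κ 5) (Sum.inr 3) = m := by
  rw [Pi.smul_apply, txy_three, nsmul_eq_mul, mul_one]

lemma fibreSeries_of_eq (e : ℕ → ℂ_[p]) (K : Series p κ 5) {I : Expo κ 5} {m : ℕ}
    (h : I (Sum.inr 3) = m) : fibreSeries e K I = e m * K (I - m • txy) := by
  rw [fibreSeries, if_pos (by omega), show (I (Sum.inr 3)).toNat = m by omega]

lemma fibreSeries_of_neg (e : ℕ → ℂ_[p]) (K : Series p κ 5) {I : Expo κ 5}
    (h : I (Sum.inr 3) < 0) : fibreSeries e K I = 0 := by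
  rw [fibreSeries, if_neg (by omega)]

section FibreSeries
variable (e : ℕ → ℂ_[p]) (k k' : Series p κ 3)

/-- The second factor is free of `x`, so the exponent of `x` determines which power of `t x y`
contributes: each convolution has a single term. -/
lemma powSeries_mulSeries : mulSeries (powSeries txy e) (seriesMap tuvEmb k) =
    fibreSeries e (seriesMap tuvEmb k) := by
  ext I
  have key : ∀ J, powSeries txy e J * seriesMap tuvEmb k (I - J) ≠ 0 →
      ∃ m : ℕ, m • txy = J ∧ I (Sum.inr 3) = m := by
    intro J hJ
    obtain ⟨m, hm⟩ : ∃ m : ℕ, m • txy = J := by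
      by_contra! h
      exact left_ne_zero_of_mul hJ (powSeries_of_notMem e h)
    have h1 := (seriesMap_tuv_ne_zero (right_ne_zero_of_mul hJ)).1
    rw [Pi.sub_apply, ← hm, txy_nsmul_three, sub_eq_zero] at h1
    exact ⟨m, hm, h1⟩
  unfold mulSeries
  rcases lt_or_ge (I (Sum.inr 3)) 0 with h | h
  · rw [fibreSeries_of_neg _ _ h]
    refine (tsum_congr fun J => ?_).trans tsum_zero
    by_contra h1
    obtain ⟨m, -, hm⟩ := key J h1
    omega
  · obtain ⟨m, hm⟩ := Int.eq_ofNat_of_zero_le h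
    rw [fibreSeries_of_eq _ _ hm, tsum_eq_single (m • txy), powSeries_nsmul txy_zero]
    intro J hJ
    by_contra h1
    obtain ⟨l, rfl, hl⟩ := key J h1
    exact hJ (by rw [show l = m by omega])

lemma fibreSeries_mulSeries :
    mulSeries (fibreSeries e (seriesMap tuvEmb k)) (seriesMap tuvEmb k') =
      fibreSeries e (seriesMap tuvEmb (mulSeries k k')) := by
  ext I
  have key : ∀ J, fibreSeries e (seriesMap tuvEmb k) J * seriesMap tuvEmb k' (I - J) ≠ 0 →
      I (Sum.inr 3) = J (Sum.inr 3) ∧ 0 ≤ J (Sum.inr 3) := by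
    intro J hJ
    have h1 := (seriesMap_tuv_ne_zero (right_ne_zero_of_mul hJ)).1
    rw [Pi.sub_apply, sub_eq_zero] at h1
    refine ⟨h1, ?_⟩
    by_contra! h2
    exact left_ne_zero_of_mul hJ (fibreSeries_of_neg _ _ h2)
  rcases lt_or_ge (I (Sum.inr 3)) 0 with h | h
  · rw [fibreSeries_of_neg _ _ h]
    refine (tsum_congr fun J => ?_).trans tsum_zero
    by_contra h1
    have := key J h1
    omega
  · obtain ⟨m, hm⟩ := Int.eq_ofNat_of_zero_le h
    rw [fibreSeries_of_eq _ _ hm, seriesMap_mulSeries]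
    unfold mulSeries
    rw [← tsum_mul_left, ← (Equiv.addRight (m • (txy : Expo κ 5))).tsum_eq]
    refine tsum_congr fun J => ?_
    simp only [Equiv.coe_addRight]
    by_cases h1 : J (Sum.inr 3) = 0
    · rw [fibreSeries_of_eq (m := m) _ _ (by rw [Pi.add_apply, txy_nsmul_three, h1, zero_add]),
        add_sub_cancel_right, mul_assoc, sub_sub, add_comm J]
    · have h2 : seriesMap tuvEmb k J = 0 := by
        by_contra h3; exact h1 (seriesMap_tuv_ne_zero h3).1
      rw [h2, zero_mul, mul_zero]
      by_contra h3
      have := (key _ h3).1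
      rw [Pi.add_apply, txy_nsmul_three, hm] at this
      omega

/-- The Frobenius structure along the fibres of the threefold is homotopic to the identity. -/
lemma mon_fibreSeries_sub (π : ℂ_[p]) (hπ : π ≠ 0) (P : Poly p κ 2) {e : PowerSeries ℂ_[p]}
    (he : HasLogDeriv (PowerSeries.C (-(π * 1)) +
      PowerSeries.C (π * 1 * p) * PowerSeries.X ^ (p - 1)) e) :
    (p : ℂ_[p]) • mon ((p - 1) • txy)
        (fibreSeries (fun m => PowerSeries.coeff m e) (seriesMap tuvEmb k)) - seriesMap tuvEmb k =
      π⁻¹ • threefoldD π P 3 (mon (coord 3)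
        (fibreSeries (fun m => PowerSeries.coeff (m + 1) e) (seriesMap tuvEmb k))) := by
  have hp := (Fact.out : p.Prime).two_le
  -- Put `X = t x y` and `φ = (e - 1) / X`, with coefficients `e_(m+1)`. On `φ k` the operator `D_x
  -- x` gives `((X φ)' + π X φ) k`. By the differential equation of `e`, this is `(e' + π (e - 1)) k
  -- = π (p X^(p-1) e - 1) k`.
  ext I
  rw [Pi.sub_apply, Pi.smul_apply, Pi.smul_apply, mon_apply, radial_apply, smul_eq_mul, smul_eq_mul,
    eq_inv_mul_iff_mul_eq₀ hπ]
  have hI : (I - (p - 1) • txy : Expo κ 5) (Sum.inr 3) = I (Sum.inr 3) - (p - 1 : ℕ) := by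
    rw [Pi.sub_apply, txy_nsmul_three]
  have hI' : (I - txy : Expo κ 5) (Sum.inr 3) = I (Sum.inr 3) - 1 := by rw [Pi.sub_apply, txy_three]
  have hK : I (Sum.inr 3) ≠ 0 → seriesMap tuvEmb k I = 0 := fun h => by
    by_contra h1; exact h (seriesMap_tuv_ne_zero h1).1
  rcases lt_or_ge (I (Sum.inr 3)) 0 with h | h
  · rw [fibreSeries_of_neg _ _ (by omega), fibreSeries_of_neg _ _ h,
      fibreSeries_of_neg _ _ (by omega), hK (by omega)]
    simp
  obtain ⟨m, hm⟩ := Int.eq_ofNat_of_zero_le h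
  have hD := dwork_coeff_succ he m
  rw [fibreSeries_of_eq _ _ hm, hm]
  rcases m with _ | m
  · rw [fibreSeries_of_neg _ _ (by omega), fibreSeries_of_neg _ _ (by omega), zero_nsmul, sub_zero]
    rw [if_neg (by omega), he.coeff_zero] at hD
    simp only [Nat.cast_zero] at hD ⊢
    linear_combination -seriesMap tuvEmb k I * hD
  · rw [fibreSeries_of_eq (I := I - txy) (m := m) _ _ (by rw [hI', hm]; push_cast; ring),
      hK (by omega), sub_sub, show txy + m • (txy : Expo κ 5) = (m + 1) • txy by rw [succ_nsmul, add_comm]]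
    by_cases h1 : p ≤ m + 1 + 1
    · rw [if_pos h1] at hD
      rw [fibreSeries_of_eq (I := I - _) (m := m + 1 + 1 - p) _ _ (by rw [hI, hm]; omega), sub_sub, ← add_nsmul,
        show p - 1 + (m + 1 + 1 - p) = m + 1 by omega]
      simp only [Int.cast_natCast]
      linear_combination -seriesMap tuvEmb k (I - (m + 1) • txy) * hD
    · rw [if_neg h1] at hD
      rw [fibreSeries_of_neg _ _ (by rw [hI, hm]; omega)]
      simp only [Int.cast_natCast]
      linear_combination -seriesMap tuvEmb k (I - (m + 1) • txy) * hD

end FibreSeries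

/-! ### The three maps commute with Frobenius -/

lemma frobComponent_map {m : ℕ} (e : Fin m ↪o Fin n) (S : Finset (Fin m)) (a : Series p κ m) :
    frobComponent (S.map e.toEmbedding) (seriesMap e a) = seriesMap e (frobComponent S a) := by
  have h : (frobExpo (p := p) (S.map e.toEmbedding) : Expo κ n) =
      expoMap e (frobExpo (p := p) S) := by
    rw [frobExpo, frobExpo, expoMap_nsmul, Finset.sum_map]
    congr 1
    refine Eq.trans (Finset.sum_congr rfl fun i _ => ?_)
      (map_sum (expoHom e) (fun i => unitExpo (Sum.inr i)) S).symm
    exact (expoMap_unitExpo e (Sum.inr i)).symm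
  rw [frobComponent, frobComponent, seriesMap_smul, seriesMap_mulPoly, polyMap_single,
    seriesFrob_seriesMap, h, Finset.card_map]

lemma frobComponent_insert {S : Finset (Fin n)} {i : Fin n} (hi : i ∉ S) (a : Series p κ n) :
    frobComponent (insert i S) a = (p : ℂ_[p]) • mon ((p - 1) • coord i) (frobComponent S a) := by
  rw [frobComponent, frobComponent, map_smul, smul_smul, mon_mon, Finset.card_insert_of_notMem hi,
    pow_succ', frobExpo, Finset.sum_insert hi, smul_add]
  rfl

lemma frobComponent_mon (S : Finset (Fin n)) (J : Expo κ n) (a : Series p κ n) :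
    frobComponent S (mon J a) = mon (p • J) (frobComponent S a) := by
  rw [frobComponent, seriesFrob_mulPoly, polyFrob_single, mulPoly_comm, ← map_smul]
  rfl

lemma frobComponent_succ (a : Series p κ 2) :
    frobComponent Finset.univ (seriesMap (Fin.succOrderEmb 2) a) =
      (p : ℂ_[p]) • mon ((p - 1) • coord 0)
        (seriesMap (Fin.succOrderEmb 2) (frobComponent Finset.univ a)) := by
  rw [show (Finset.univ : Finset (Fin 3)) =
    insert 0 (Finset.univ.map (Fin.succOrderEmb 2).toEmbedding) by decide,
    frobComponent_insert (by decide), frobComponent_map]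

lemma frobComponent_tuv (a : Series p κ 3) :
    frobComponent Finset.univ (seriesMap tuvEmb a) =
      ((p : ℂ_[p]) ^ 2) • mon ((p - 1) • (coord 3 + coord 4))
        (seriesMap tuvEmb (frobComponent Finset.univ a)) := by
  rw [show (Finset.univ : Finset (Fin 5)) =
    insert 3 (insert 4 (Finset.univ.map tuvEmb.toEmbedding)) by decide,
    frobComponent_insert (by decide), frobComponent_insert (by decide), frobComponent_map, map_smul,
    smul_smul, mon_mon, ← smul_add, pow_two]

/-- `d(x^p) ∧ d(y^p)` contributes `p^2 (x y)^(p-1)` and `t` becomes `t^p`; together they give `p^2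
(t x y)^(p-1) t`. One factor `p` is removed by the normalization, the other enters the fibre
homotopy. -/
lemma frobComponent_curveLift (a : Series p κ 3) :
    frobComponent Finset.univ (curveLift a) = ((p : ℂ_[p]) ^ 2) • mon ((p - 1) • txy)
      (curveLift (frobComponent Finset.univ a)) := by
  rw [curveLift_apply, curveLift_apply, frobComponent_mon, frobComponent_tuv, map_smul, mon_mon,
    mon_mon]
  congr 3
  rw [← Nat.sub_add_cancel (Fact.out : p.Prime).one_le, Nat.add_sub_cancel, succ_nsmul]
  simp only [txy, smul_add]
  abel

lemma frobComponent_uv (a : Series p κ 2) :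
    frobComponent Finset.univ (seriesMap uvEmb a) = ((p : ℂ_[p]) ^ 3) • mon ((p - 1) • txy)
      (seriesMap uvEmb (frobComponent Finset.univ a)) := by
  rw [← seriesMap_seriesMap, ← seriesMap_seriesMap, frobComponent_tuv, frobComponent_succ,
    seriesMap_smul, seriesMap_mulPoly, polyMap_single, expoMap_nsmul, expoMap_unitExpo, map_smul,
    smul_smul, mon_mon, ← smul_add, pow_succ _ 2]
  congr 4
  simp only [txy]
  abel_nf
  rfl

section Commutes
variable {B : ParamDomain κ} {π : ℂ_[p]} {P : Poly p κ 2}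

/-- The monomial `t x y` has coefficient `1`, which is its own `p`-th power, so its factor is the
Dwork exponential in `t x y`; the rest is the factor `Θ` of the curve. The shifted coefficients give
the function used in the fibre homotopy. -/
lemma exists_isFrobExp_threefold (hp2 : p ≠ 2) (hπ : π ^ (p - 1) = -p) {Θ : Series p κ 3}
    (hΘ : IsFrobExp B affC (phase π P) Θ) :
    ∃ e : PowerSeries ℂ_[p], HasLogDeriv (PowerSeries.C (-(π * 1)) +
        PowerSeries.C (π * 1 * p) * PowerSeries.X ^ (p - 1)) e ∧
      (∀ k ∈ overconvergent p B affC, fibreSeries (fun m => PowerSeries.coeff (m + 1) e)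
        (seriesMap tuvEmb k) ∈ overconvergent p B affX) ∧
      IsFrobExp B affX (phase π (threefoldEq P))
        (fibreSeries (fun m => PowerSeries.coeff m e) (seriesMap tuvEmb Θ)) := by
  have hJ : Admissible B affX txy :=
    ((admissible_coord _ _ _).add (admissible_coord _ _ _)).add (admissible_coord _ _ _)
  have hw : ∀ ρ : κ → ℝ, weight ρ txy = 1 := fun ρ =>
    Finset.prod_eq_one fun k _ => by simp [coord_inl]
  have h1 : ∀ ρ ∈ B.radii, ‖(1 : ℂ_[p])‖ * weight ρ txy ≤ 1 := fun ρ _ => by rw [hw]; simp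
  have h2 : ∀ ρ ∈ B.radii, ‖(1 : ℂ_[p]) ^ p - 1‖ * weight ρ txy ^ p < 1 := fun ρ _ => by simp
  obtain ⟨e, he⟩ := exists_hasLogDeriv (PowerSeries.C (-(π * 1)) +
    PowerSeries.C (π * 1 * p) * PowerSeries.X ^ (p - 1))
  refine ⟨e, he, fun k hk => ?_, ?_⟩
  · rw [← powSeries_mulSeries]
    refine mulSeries_mem (powSeries_mem txy_zero hJ fun ρ hρ => ?_) (tuv_mem hk)
    obtain ⟨r, hr0, hr1, hr⟩ := exists_norm_coeff_dwork_mul_le hp2 hπ he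
      (weight_pos (B.radii_pos ρ hρ) txy) (h1 ρ hρ) (h2 ρ hρ)
    refine ⟨r, hr0, hr1, 1, zero_le_one, fun m => ?_⟩
    have h3 := hr (m + 1)
    rw [hw, one_pow, mul_one] at h3 ⊢
    rw [one_mul]
    exact h3.trans (pow_le_pow_of_le_one hr0.le hr1.le (Nat.le_succ m))
  · have h3 := (isFrobExp_single hp2 hπ txy_zero hJ h1 h2 he).mulSeries
      (by simp) (hΘ.seriesMap tuvEmb (A' := affX) rfl fun i hi => ?_)
    · rwa [mul_one, ← phase_threefoldEq, powSeries_mulSeries] at h3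
    · rw [mem_affX] at hi
      rw [mem_affC]
      fin_cases i <;> simp_all [tuvEmb]

/-- The initial condition says that `Θ` is `1` in degree zero in `t`. The quotient `Ω = (Θ - 1) / t`
is the homotopy between Frobenius on the torus and on the curve. -/
lemma IsFrobExp.exists_eq_add {Θ : Series p κ 3} (hΘ : IsFrobExp B affC (phase π P) Θ) :
    ∃ Ω ∈ overconvergent p B affC, Θ = Pi.single 0 1 + mon (coord 0) Ω := by
  have h0 : ∀ I, Θ I - (Pi.single 0 1 : Series p κ 3) I ≠ 0 →
      Admissible B affC I ∧ 1 ≤ I (Sum.inr 0) := by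
    intro I hI
    have h1 := admissible_of_mem (sub_mem hΘ.mem (single_zero_mem B affC)) hI
    refine ⟨h1, ?_⟩
    have h2 := h1.2 0 ((mem_affC _).2 rfl)
    by_contra h3
    refine hI ?_
    rw [hΘ.initial I (by omega), Pi.single_apply, sub_self]
  refine ⟨fun I => (Θ - Pi.single 0 1 : Series p κ 3) (I + coord 0),
    overconvergent_of_translate (sub_mem hΘ.mem (single_zero_mem B affC)) (-coord 0) 1
      (fun I hI => ?_) fun I => ?_, ?_⟩
  · obtain ⟨h1, h2⟩ := h0 _ hI
    refine ⟨fun k hk => ?_, fun i hi => ?_⟩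
    · have := h1.1 k hk
      rwa [Pi.add_apply, coord_inl, add_zero] at this
    · rw [mem_affC] at hi
      subst hi
      rw [Pi.add_apply, coord_apply, if_pos rfl] at h2
      omega
  · rw [sub_neg_eq_add]
    refine le_mul_of_one_le_left (norm_nonneg _) ?_
    linarith [(size I).cast_nonneg (α := ℝ)]
  · ext I
    rw [Pi.add_apply, mon_apply, sub_add_cancel, Pi.sub_apply]
    ring

lemma mon_fibreSeries_sub_mem (hπ : π ≠ 0) {e : PowerSeries ℂ_[p]}
    (he : HasLogDeriv (PowerSeries.C (-(π * 1)) +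
      PowerSeries.C (π * 1 * p) * PowerSeries.X ^ (p - 1)) e) {k : Series p κ 3}
    (hk : fibreSeries (fun m => PowerSeries.coeff (m + 1) e) (seriesMap tuvEmb k) ∈
      overconvergent p B affX) :
    (p : ℂ_[p]) • mon ((p - 1) • txy)
        (fibreSeries (fun m => PowerSeries.coeff m e) (seriesMap tuvEmb k)) - seriesMap tuvEmb k ∈
      fibreExact B π P := by
  rw [mon_fibreSeries_sub k π hπ P he]
  exact Submodule.smul_mem _ _ (x_mem_fibreExact (mon_mem (admissible_coord _ _ _) hk))

end Commutes

/-! ### Frobenius and the restriction to the curve -/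

section Restriction
variable {B : ParamDomain κ} {π : ℂ_[p]} {P : Poly p κ 2}

lemma frobComponent_curveBracket (a b : Series p κ 2) :
    (p : ℂ_[p]) • frobComponent Finset.univ (curveBracket π P a b) =
      curveBracket π (polyFrob P) ((p : ℂ_[p]) • frobComponent {0} a)
        ((p : ℂ_[p]) • frobComponent {1} b) := by
  have h0 := mulPoly_polyDeriv_frobComponent (Finset.mem_univ (0 : Fin 2)) P b
  have h1 := mulPoly_polyDeriv_frobComponent (Finset.mem_univ (1 : Fin 2)) P a
  rw [show (Finset.univ : Finset (Fin 2)).erase 0 = {1} by decide] at h0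
  rw [show (Finset.univ : Finset (Fin 2)).erase 1 = {0} by decide] at h1
  rw [curveBracket, curveBracket, map_smul, map_smul, h0, h1, sub_eq_add_neg, ← neg_smul,
    frobComponent_add, frobComponent_smul, frobComponent_smul, smul_add, smul_comm _ π, neg_smul,
    smul_neg, smul_comm _ π, ← sub_eq_add_neg]

lemma polyFrob_phase (π : ℂ_[p]) (f : Poly p κ n) : polyFrob (phase π f) =
    AddMonoidAlgebra.single (p • coord 0) π * polyMap (Fin.succOrderEmb n) (polyFrob f) := by
  rw [phase_eq, polyFrob_mul, polyFrob_single, polyFrob_polyMap]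

lemma mulPoly_polyDeriv_polyFrob_phase (i : Fin 2) (c : Series p κ 2) :
    mulPoly (polyDeriv (Sum.inr i.succ) (polyFrob (phase π P))) (seriesMap (Fin.succOrderEmb 2) c) =
      mon (p • coord 0) (seriesMap (Fin.succOrderEmb 2)
        (π • mulPoly (polyDeriv (Sum.inr i) (polyFrob P)) c)) := by
  have h1 : (p • coord 0 : Expo κ 3) (Sum.inr i.succ) = 0 := by
    rw [Pi.smul_apply, coord_apply, if_neg (Fin.succ_ne_zero i), smul_zero]
  have h2 : (AddMonoidAlgebra.single (p • coord 0) π : Poly p κ 3) =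
      π • AddMonoidAlgebra.single (p • coord 0) 1 := by
    rw [AddMonoidAlgebra.smul_single, smul_eq_mul, mul_one]
  have h3 : polyDeriv (Sum.inr i.succ) (polyMap (Fin.succOrderEmb 2) (polyFrob P)) =
      polyMap (Fin.succOrderEmb 2) (polyDeriv (Sum.inr i) (polyFrob P)) :=
    polyDeriv_polyMap (Fin.succOrderEmb 2) (Sum.inr i) (polyFrob P)
  rw [polyFrob_phase, polyDeriv_mul, polyDeriv_single, h1, h3, Int.cast_zero, zero_mul,
    AddMonoidAlgebra.single_zero, zero_mul, zero_add, mulPoly_mul_apply, h2, mulPoly_smul,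
    LinearMap.smul_apply, seriesMap_smul, map_smul, seriesMap_mulPoly]

variable {Θ Ω : Series p κ 3} (hΘ : IsFrobExp B affC (phase π P) Θ)
  (hΩ : Ω ∈ overconvergent p B affC) (h : Θ = Pi.single 0 1 + mon (coord 0) Ω)
include hΘ hΩ h

lemma mulSeries_eq_add {s : Series p κ 3} (hs : s ∈ overconvergent p B affC) :
    mulSeries Θ s = s + mon (coord 0) (mulSeries Ω s) := by
  rw [h, add_mulSeries_of_mem hs (single_zero_mem _ _) (mon_mem (admissible_coord _ _ _) hΩ),
    one_mulSeries, mulPoly_mulSeries_of_mem hΩ hs]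

/-- The directions `u`, `v` commute with `t`, and `t Ω = Θ - 1`. Moreover `D_i (Θ c) = Θ (∂_i c + π
t^p (∂_i P(λ^p, z^p)) c)`, while `D_i c = ∂_i c + π t (∂_i P) c`. -/
lemma mon_curveD_mulSeries (hP : AdmissiblePoly B ∅ P) (i : Fin 2) {c : Series p κ 2}
    (hc : c ∈ overconvergent p B (∅ : Set (Fin 2))) :
    mon (coord 0) (curveD π P i.succ (mulSeries Ω (seriesMap (Fin.succOrderEmb 2) c))) =
      mulSeries Θ (seriesMap (Fin.succOrderEmb 2) (deriv (Sum.inr i) c) +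
        mon (p • coord 0) (seriesMap (Fin.succOrderEmb 2)
          (π • mulPoly (polyDeriv (Sum.inr i) (polyFrob P)) c))) -
      (seriesMap (Fin.succOrderEmb 2) (deriv (Sum.inr i) c) +
        mon (coord 0) (seriesMap (Fin.succOrderEmb 2)
          (π • mulPoly (polyDeriv (Sum.inr i) P) c))) := by
  have hs := succ_mem hc
  have h1 : curveD π P i.succ (mon (coord 0) (mulSeries Ω (seriesMap (Fin.succOrderEmb 2) c))) =
      mon (coord 0) (curveD π P i.succ (mulSeries Ω (seriesMap (Fin.succOrderEmb 2) c))) := by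
    rw [curveD, twistedDeriv_mulPoly, polyDeriv_single, coord_apply,
      if_neg (Fin.succ_ne_zero i), Int.cast_zero, zero_mul, AddMonoidAlgebra.single_zero,
      mulPoly_zero, LinearMap.zero_apply, add_zero]
  have h2 : deriv (Sum.inr i.succ) (seriesMap (Fin.succOrderEmb 2) c) =
      seriesMap (Fin.succOrderEmb 2) (deriv (Sum.inr i) c) :=
    deriv_seriesMap (Fin.succOrderEmb 2) (Sum.inr i) c
  have h3 : curveD π P i.succ (seriesMap (Fin.succOrderEmb 2) c) = _ :=
    curveD_seriesMap (π := π) (P := P) (Sum.inr i) c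
  have h4 := eq_sub_of_add_eq' (mulSeries_eq_add hΘ hΩ h hs).symm
  rw [← h1, h4, map_sub, h3, curveD, hΘ.twistedDeriv_mulSeries hs (hP.phase π), h2,
    mulPoly_polyDeriv_polyFrob_phase]

/-- The restriction map commutes with Frobenius up to an exact form. -/
lemma curveBracket_sub_frobenius (hP : AdmissiblePoly B ∅ P)
    {a b : Series p κ 2} (ha : a ∈ overconvergent p B (∅ : Set (Fin 2)))
    (hb : b ∈ overconvergent p B (∅ : Set (Fin 2)))
    (hab : deriv (Sum.inr 0) b = deriv (Sum.inr 1) a) :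
    seriesMap (Fin.succOrderEmb 2) (curveBracket π P a b) - mulSeries Θ (mon ((p - 1) • coord 0)
        (seriesMap (Fin.succOrderEmb 2) (curveBracket π (polyFrob P) a b))) =
      curveD π P 2 (mulSeries Ω (seriesMap (Fin.succOrderEmb 2) a)) -
        curveD π P 1 (mulSeries Ω (seriesMap (Fin.succOrderEmb 2) b)) := by
  -- After multiplication by `t` both sides are differences of `D_i (Θ c)` and `D_i c`. The terms
  -- with `∂_i c` cancel because the form is closed, separately with and without the factor `Θ`.
  apply mon_injective (coord 0)
  have h1 := mon_curveD_mulSeries hΘ hΩ h hP 0 hb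
  have h2 := mon_curveD_mulSeries hΘ hΩ h hP 1 ha
  have hm : ∀ {c : Series p κ 2}, c ∈ overconvergent p B (∅ : Set (Fin 2)) → ∀ i,
      mon (p • coord 0) (seriesMap (Fin.succOrderEmb 2)
          (π • mulPoly (polyDeriv (Sum.inr i) (polyFrob P)) c)) ∈ overconvergent p B affC :=
    fun hc i => mon_mem ((admissible_coord _ _ _).nsmul p)
      (smul_mulPoly_succ_mem hP.polyFrob hc (Sum.inr i))
  have hd : ∀ {c : Series p κ 2}, c ∈ overconvergent p B (∅ : Set (Fin 2)) → ∀ i,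
      seriesMap (Fin.succOrderEmb 2) (deriv (Sum.inr i) c) ∈ overconvergent p B affC :=
    fun hc i => succ_mem (deriv_mem hc _)
  rw [map_sub, map_sub, show (1 : Fin 3) = Fin.succ 0 from rfl, show (2 : Fin 3) = Fin.succ 1 from rfl,
    h1, h2, ← mulSeries_mulPoly_of_mem hΘ.mem (mon_mem ((admissible_coord _ _ _).nsmul (p - 1))
      (succ_mem (curveBracket_mem hP.polyFrob ha hb))), mon_mon, ← succ_nsmul',
    Nat.sub_add_cancel (Fact.out : p.Prime).one_le, curveBracket, curveBracket, seriesMap_sub,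
    seriesMap_sub, map_sub, map_sub, mulSeries_sub_of_mem hΘ.mem (hm hb 0) (hm ha 1),
    mulSeries_add_of_mem hΘ.mem (hd hb 0) (hm hb 0),
    mulSeries_add_of_mem hΘ.mem (hd ha 1) (hm ha 1), hab]
  abel

end Restriction

section Commutes
variable {B : ParamDomain κ} {π : ℂ_[p]} {P : Poly p κ 2}

/-- The three maps commute with the Frobenius maps. -/
lemma commutes_frobenius {iStar : TorusCohomology p B 1 →ₗ[ℂ_[p]] CurveCohomology B π P 1}
    (hs : Induces (restrict π P) iStar)
    {α : CurveCohomology B π P 1 →ₗ[ℂ_[p]] ThreefoldCohomology B π P 3}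
    (hα : Induces curveToThreefold α)
    {integral : ThreefoldCohomology B π P 3 →ₗ[ℂ_[p]] TorusCohomology p B 2}
    (hi : ComputesRes integral) (hex : Function.Exact α integral)
    (hp2 : p ≠ 2) (hπ : π ^ (p - 1) = -p) (hP : AdmissiblePoly B ∅ P)
    (hPint : ∀ ρ ∈ B.radii, ∀ J, ‖P.coeff J‖ * weight ρ J ≤ 1)
    (hB : ∀ ρ ∈ B.radii, (fun k => ρ k ^ p) ∈ B.radii)
    (hPfrob : ∀ ρ ∈ B.radii, ∀ J, ‖P.coeff J ^ p - P.coeff J‖ * weight ρ J ^ p < 1) :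
    Commutes iStar α integral (fun ω => (p : ℂ_[p]) • frobenius 0 ω)
      (fun ω => (p : ℂ_[p]) • hypersurfaceFrobenius π P ω)
      (hypersurfaceFrobenius π (threefoldEq P)) := by
  have hp0 : (p : ℂ_[p]) ≠ 0 := Nat.cast_ne_zero.2 (Fact.out : p.Prime).ne_zero
  have hpi := pi_ne_zero hπ
  have hΘ := isFrobExp_phase hp2 hπ hP hPint hPfrob
  obtain ⟨e, he, hemem, hX⟩ := exists_isFrobExp_threefold hp2 hπ hΘ
  have hXe := hX.eq_frobFactor (by simp) (degreeGE_phase π _)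
  obtain ⟨Ω, hΩ, hΘΩ⟩ := hΘ.exists_eq_add
  set Θ := frobFactor (phase π P) with hΘdef
  have hT : IsFrobExp B (∅ : Set (Fin 2)) (0 : Poly p κ 2) (frobFactor 0) := by
    rw [frobFactor_zero (n := 1)]; exact isFrobExp_zero (n := 1) B ∅
  have hTω : ∀ (ω : Form p κ 2) S, ((p : ℂ_[p]) • frobenius 0 ω) S =
      (p : ℂ_[p]) • frobComponent S (ω S) := fun ω S => by
    rw [Pi.smul_apply, frobenius_apply, frobFactor_zero (n := 1), one_mulSeries]
  have hCω : ∀ (ω : Form p κ 3) S, ((p : ℂ_[p]) • hypersurfaceFrobenius π P ω) S =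
      mulSeries Θ (frobComponent S (ω S)) := fun ω S => by
    rw [hypersurfaceFrobenius, smul_smul, mul_inv_cancel₀ hp0, one_smul, frobenius_apply]
  have hXω : ∀ (ω : Form p κ 5) S, hypersurfaceFrobenius π (threefoldEq P) ω S =
      (p : ℂ_[p])⁻¹ • mulSeries (fibreSeries (fun m => PowerSeries.coeff m e) (seriesMap tuvEmb Θ))
        (frobComponent S (ω S)) := fun ω S => by
    rw [hypersurfaceFrobenius, Pi.smul_apply, frobenius_apply, hXe]
  have hTind : ∀ k, ∃ T : TorusCohomology p B k →ₗ[ℂ_[p]] TorusCohomology p B k,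
      Induces (fun ω => (p : ℂ_[p]) • frobenius 0 ω) T := fun k => by
    obtain ⟨G, hG⟩ := exists_induces_frobenius hT hB (admissiblePoly_zero B ∅) (k := k)
    exact ⟨_, hG.smul _⟩
  -- This fibre homotopy, applied to lifts from the curve and to functions on the torus, gives the
  -- compatibility with `α` and with the integral.
  have hfib : ∀ k ∈ overconvergent p B affC, (p : ℂ_[p]) • mon ((p - 1) • txy)
      (fibreSeries (fun m => PowerSeries.coeff m e) (seriesMap tuvEmb k)) - seriesMap tuvEmb k ∈
        fibreExact B π P := fun k hk => mon_fibreSeries_sub_mem hpi he (hemem k hk)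
  have hlift : ∀ k : Series p κ 3, curveLift k = seriesMap tuvEmb (mon (coord 0) k) := fun k => by
    rw [curveLift_apply, seriesMap_mulPoly, polyMap_single, expoMap_unitExpo]; rfl
  refine commutes_of hs hα hi hex hπ hP hPint (hTind 1) ?_ ?_ (hTind 2) (fun ω hω => ?_)
    (fun ω hω => ?_) (fun r hr => ?_)
  · obtain ⟨G, hG⟩ := exists_induces_frobenius hΘ hB (hP.phase π) (k := 3)
    exact ⟨_, (hG.smul (p : ℂ_[p])⁻¹).smul (p : ℂ_[p])⟩
  · obtain ⟨G, hG⟩ := exists_induces_frobenius (hXe ▸ hX) hB (hP.threefoldEq.phase π) (k := 5)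
    exact ⟨_, hG.smul (p : ℂ_[p])⁻¹⟩
  · obtain ⟨-, ha, hb, hab⟩ := mem_cocycles_one.1 hω
    have ha' : (p : ℂ_[p]) • frobComponent {0} (ω {0}) ∈ overconvergent p B (∅ : Set (Fin 2)) :=
      Submodule.smul_mem _ _ (frobComponent_mem hB ha _)
    have hb' : (p : ℂ_[p]) • frobComponent {1} (ω {1}) ∈ overconvergent p B (∅ : Set (Fin 2)) :=
      Submodule.smul_mem _ _ (frobComponent_mem hB hb _)
    have h0 := deriv_frobComponent (Finset.mem_univ (0 : Fin 2)) (ω {1})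
    have h1 := deriv_frobComponent (Finset.mem_univ (1 : Fin 2)) (ω {0})
    rw [show (Finset.univ : Finset (Fin 2)).erase 0 = {1} by decide] at h0
    rw [show (Finset.univ : Finset (Fin 2)).erase 1 = {0} by decide] at h1
    rw [restrict_univ, hTω, hTω, hCω, restrict_univ, frobComponent_succ, ← map_smul,
      ← seriesMap_smul, frobComponent_curveBracket,
      curveBracket_sub_frobenius hΘ hΩ hΘΩ hP ha' hb' (by rw [map_smul, map_smul, h0, h1, hab])]
    exact sub_mem
      (twistedDeriv_mem_exactTop _ 2 (mulSeries_mem hΩ (succ_mem ha')))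
      (twistedDeriv_mem_exactTop _ 1 (mulSeries_mem hΩ (succ_mem hb')))
  · have hω' := frobComponent_mem hB (mem_cocycles_top.1 hω).2 Finset.univ
    have hk := mon_mem (admissible_coord B affC 0) hω'
    rw [curveToThreefold_univ, hCω, hXω, curveToThreefold_univ, frobComponent_curveLift,
      mulSeries_smul, mulSeries_mulPoly_single, smul_smul, pow_two, ← mul_assoc,
      inv_mul_cancel₀ hp0, one_mul, hlift, hlift, fibreSeries_mulSeries,
      mulSeries_mulPoly_of_mem hΘ.mem hω', ← neg_mem_iff, neg_sub]
    exact fibreExact_le_exactTop B π P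
      (hfib _ (mon_mem (admissible_coord _ _ _) (mulSeries_mem hΘ.mem hω')))
  · set r' := (p : ℂ_[p]) • frobComponent Finset.univ r with hr'def
    have hr' : r' ∈ overconvergent p B (∅ : Set (Fin 2)) :=
      Submodule.smul_mem _ _ (frobComponent_mem hB hr _)
    refine ⟨r', ⟨hr', ?_⟩, ?_⟩
    · have hs' := succ_mem hr'
      have h1 := hfib _ (mulSeries_mem hΘ.mem hs')
      have h2 : hypersurfaceFrobenius π (threefoldEq P) (topForm (seriesMap uvEmb r)) Finset.univ =
          (p : ℂ_[p]) • mon ((p - 1) • txy) (fibreSeries (fun m => PowerSeries.coeff m e)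
            (seriesMap tuvEmb (mulSeries Θ (seriesMap (Fin.succOrderEmb 2) r')))) := by
        rw [hXω, topForm_univ, frobComponent_uv, mulSeries_smul, mulSeries_mulPoly_single,
          ← fibreSeries_mulSeries, seriesMap_seriesMap, hr'def, seriesMap_smul, mulSeries_smul,
          map_smul, smul_smul, smul_smul]
        congr 1
        field_simp
      -- The factor `Θ = 1 + t Ω` changes `r'` only by a multiple of `t` free of `x` and `y`, which
      -- lies in the kernel of the residue.
      have h3 : seriesMap tuvEmb (mulSeries Θ (seriesMap (Fin.succOrderEmb 2) r')) =
          seriesMap uvEmb r' + curveLift (mulSeries Ω (seriesMap (Fin.succOrderEmb 2) r')) := by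
        rw [mulSeries_eq_add hΘ hΩ hΘΩ hs', seriesMap_add, seriesMap_seriesMap, hlift]
      rw [h2]
      rw [h3, ← sub_sub] at h1
      have h4 := add_mem (fibreExact_le_resKernel B π P h1)
        (Submodule.mem_sup_left (Submodule.mem_map_of_mem (mulSeries_mem hΩ hs')) :
          curveLift (mulSeries Ω (seriesMap (Fin.succOrderEmb 2) r')) ∈ resKernel B π P)
      rw [sub_add_cancel] at h4
      rwa [← h3] at h4
    · rw [hTω, topForm_univ, frobComponent_smul, smul_comm, sub_self]
      exact zero_mem _

end Commutes

end
end Dwork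

theorem mainTheorem5 {p : ℕ} [Fact p.Prime] (hp : p ≠ 2) {π : ℂ_[p]} (hπ : π ^ (p - 1) = -p)
    {κ : Type*} [Fintype κ] (B : Dwork.ParamDomain κ) (P : Dwork.Poly p κ 2)
    (hP : ∀ J, P.coeff J ≠ 0 → ∀ k ∈ B.nonneg, 0 ≤ J (Sum.inl k))
    (hPint : ∀ ρ ∈ B.radii, ∀ J, ‖P.coeff J‖ * Dwork.weight ρ J ≤ 1) :
    ∃ (iStar : Dwork.TorusCohomology p B 1 →ₗ[ℂ_[p]] Dwork.CurveCohomology B π P 1)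
      (α : Dwork.CurveCohomology B π P 1 →ₗ[ℂ_[p]] Dwork.ThreefoldCohomology B π P 3)
      (integral : Dwork.ThreefoldCohomology B π P 3 →ₗ[ℂ_[p]] Dwork.TorusCohomology p B 2),
      Dwork.Induces (Dwork.restrict π P) iStar ∧
      Dwork.Induces Dwork.curveToThreefold α ∧
      (∃ c, Dwork.IsClass (Dwork.restrict π (Dwork.threefoldEq P) Dwork.threefoldForm) c ∧
        Dwork.IsClass Dwork.torusForm (integral c)) ∧
      Function.Exact iStar α ∧ Function.Exact α integral ∧ Function.Surjective integral ∧
      (∀ b ∈ Dwork.overconvergent (n := 0) p B ∅, Dwork.Commutes iStar α integral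
        (Dwork.mulParam b) (Dwork.mulParam b) (Dwork.mulParam b)) ∧
      (∀ k, Dwork.Commutes iStar α integral (Dwork.gaussManin 0 k)
        (Dwork.gaussManin (Dwork.phase π P) k)
        (Dwork.gaussManin (Dwork.phase π (Dwork.threefoldEq P)) k)) ∧
      ((∀ ρ ∈ B.radii, (fun k => ρ k ^ p) ∈ B.radii) →
        (∀ ρ ∈ B.radii, ∀ J, ‖P.coeff J ^ p - P.coeff J‖ * Dwork.weight ρ J ^ p < 1) →
        Dwork.Commutes iStar α integral
          (fun ω => (p : ℂ_[p]) • Dwork.frobenius 0 ω)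
          (fun ω => (p : ℂ_[p]) • Dwork.hypersurfaceFrobenius π P ω)
          (Dwork.hypersurfaceFrobenius π (Dwork.threefoldEq P))) := by
  have hP' : Dwork.AdmissiblePoly B ∅ P := fun J hJ =>
    ⟨hP J hJ, fun _ h => absurd h (Set.notMem_empty _)⟩
  obtain ⟨iStar, hs⟩ := Dwork.exists_iStar (π := π) hP'
  obtain ⟨α, hα⟩ := Dwork.exists_alpha (B := B) (π := π) (P := P)
  obtain ⟨integral, hi⟩ := Dwork.exists_integral hπ hP' hPint
  have hex := Dwork.exact_alpha_integral hP' hα hi hπ hPint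
  exact ⟨iStar, α, integral, hs, hα, Dwork.isClass_threefoldForm hπ hi,
    Dwork.exact_iStar_alpha hP' hs hα hπ hPint, hex, hi.surjective hπ,
    fun b hb => Dwork.commutes_mulParam hb hs hα hi hex hπ hP' hPint,
    fun k => Dwork.commutes_gaussManin hs hα hi hex hπ hP' hPint k,
    fun hB hPfrob => Dwork.commutes_frobenius hs hα hi hex hp hπ hP' hPint hB hPfrob⟩
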